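/- **Setting.** Functions and distributions on the torus $[0,1)^2$ are $1$-periodic in both variables $x=(x_1,x_2)$; periodic distributions form the dual of the $C^\infty$ functions on the torus, and $f(k)$, $k\in(2\pi\mathbb Z)^2$, are the Fourier coefficients. $P$ is the projection onto vanishing average in $x_1$, extended to distributions by duality; $R$ is the Hilbert transform in $x_1$, with Fourier multiplier $i\,\mathrm{sgn}(k_1)$. Let $d(x,y)=|x_1-y_1|+|x_2-y_2|^{2/3}$, for $\alpha\in(0,1]$ let $[g]_\alpha=\sup_{x\ne y\in\mathbb R^2}|g(y)-g(x)|/d(y,x)^{\alpha}$ for a periodic function $g$, and for $\beta\in(-1,-\frac12]$ and a periodic distribution $f$ let $$[f]_\beta=\inf\{|c|+[g]_{\beta+1}+[h]_{\beta+3/2}:\ f=c+\partial_1g+\partial_2h\},$$ the infimum over constants $c$ and periodic functions $g,h$ ($+\infty$ if there is no such decomposition with finite seminorms). Let $\xi$ be distributed like white noise on the torus, that is, $\xi$ is a random periodic distribution such that $\xi(\zeta)$ is, for every $C^\infty$ function $\zeta$ on the torus, a centered Gaussian of variance $\int_{[0,1)^2}\zeta^2$; denote by $\langle\cdot\rangle$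 the expectation. Let $v$ be the solution with vanishing average in $x_1$ (i.e. $Pv=v$) of $$(-\partial_1^2-|\partial_1|^{-1}\partial_2^2)v=P\xi,\qquad\text{i.e. } (k_1^2+|k_1|^{-1}k_2^2)\,v(k)=\xi(k)\ \text{ for } k_1\neq0 .$$ A kernel is a real Schwartz function $\phi$ on $\mathbb R^2$ with $\phi(-x)=\phi(x)$ and $\int\phi=1$; for $\ell>0$ put $\phi_\ell(x)=\ell^{-5/2}\phi(x_1/\ell,x_2/\ell^{3/2})$, $v_\ell=\phi_\ell*v$ and $$F^\ell:=P(v_\ell\,\partial_2Rv_\ell).$$ **Lemma 5.** (i) For every kernel $\phi$, every $1\le p<\infty$ and every $0<\varepsilon<\frac14$ there is a constant $C<\infty$, depending only on $\phi$, $p$ and $\varepsilon$, such that $$\Big\langle\sup_{0<\ell\le1}[F^\ell]^p_{-\frac34-\varepsilon}\Big\rangle\le C \quad\text{and}\quad \Big\langle\sup_{0<\ell,\ell'\le\ell_0}[F^\ell-F^{\ell'}]^p_{-\frac34-\varepsilon}\Big\rangle^{1/p}\le C\,\ell_0^{\varepsilon/2}\quad\text{for all }0<\ell_0\le1 .$$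 (ii) There is a random periodic distribution $F$ with $F=PF$ almost surely such that, for every kernel $\phi$ and every $0<\varepsilon<\frac14$, almost surely $F^\ell$ is Cauchy with respect to $[\cdot]_{-\frac34-\varepsilon}$ as $\ell\downarrow0$, $[F]_{-\frac34-\varepsilon}<\infty$ and $[F^\ell-F]_{-\frac34-\varepsilon}\to0$ as $\ell\downarrow0$. In particular, the almost sure limit $F$ does not depend on the kernel $\phi$. -/

import Mathlib

open MeasureTheory ProbabilityTheory Set Filter Topology
open scoped NNReal ENNReal SchwartzMap

noncomputable section

namespace Ripple

section Smooth

open scoped ContDiff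

/-! ### Partial derivatives and smooth functions on the torus -/

/-- The partial derivative `∂₁ f`. -/
def pd₁ (f : ℝ × ℝ → ℝ) : ℝ × ℝ → ℝ := fun x => deriv (fun t => f (t, x.2)) x.1

/-- The partial derivative `∂₂ f`. -/
def pd₂ (f : ℝ × ℝ → ℝ) : ℝ × ℝ → ℝ := fun x => deriv (fun t => f (x.1, t)) x.2

/-- `f` has period one in both variables. -/
def IsPeriodic (f : ℝ × ℝ → ℝ) : Prop :=
  ∀ x : ℝ × ℝ, f (x.1 + 1, x.2) = f x ∧ f (x.1, x.2 + 1) = f x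

/-- The space of `C^∞` functions on the torus: smooth functions on the plane with period one in
both variables. -/
def TorusTest : Submodule ℝ (ℝ × ℝ → ℝ) where
  carrier := {ζ | ContDiff ℝ ∞ ζ ∧ IsPeriodic ζ}
  add_mem' := fun {f g} hf hg => ⟨hf.1.add hg.1, fun x => by
    simp [(hf.2 x).1, (hf.2 x).2, (hg.2 x).1, (hg.2 x).2]⟩
  zero_mem' := ⟨contDiff_const, fun _ => ⟨rfl, rfl⟩⟩
  smul_mem' := fun c f hf => ⟨contDiff_const.smul hf.1, fun x => by
    simp [(hf.2 x).1, (hf.2 x).2]⟩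

/-- The unit cell `[0,1)²`. -/
def cell : Set (ℝ × ℝ) := Ico 0 1 ×ˢ Ico 0 1

/-! ### Periodic distributions -/

/-- All derivatives `∂₁^i ∂₂^j ζ` with `i, j ≤ N` are bounded by `M`. -/
def DerivBound (N : ℕ) (M : ℝ) (ζ : ℝ × ℝ → ℝ) : Prop :=
  ∀ i ≤ N, ∀ j ≤ N, ∀ x, |pd₁^[i] (pd₂^[j] ζ) x| ≤ M

theorem DerivBound.nonneg {N : ℕ} {M : ℝ} {ζ : ℝ × ℝ → ℝ} (h : DerivBound N M ζ) : 0 ≤ M :=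
  (abs_nonneg _).trans (h 0 (Nat.zero_le _) 0 (Nat.zero_le _) 0)

theorem DerivBound.mono {N N' : ℕ} {M : ℝ} {ζ : ℝ × ℝ → ℝ} (h : DerivBound N M ζ)
    (hN : N' ≤ N) : DerivBound N' M ζ :=
  fun i hi j hj x => h i (hi.trans hN) j (hj.trans hN) x

/-- Periodic distributions: the topological dual of the space of `C^∞` functions on the torus,
which carries the seminorms `sup |∂₁^i ∂₂^j ζ|`. A linear functional is continuous precisely if it
is bounded by a multiple of the maximum of finitely many of these seminorms. -/
def PeriodicDistribution : Submodule ℝ (TorusTest →ₗ[ℝ] ℝ) where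
  carrier := {f | ∃ (N : ℕ) (C : ℝ), ∀ (ζ : TorusTest) (M : ℝ),
    DerivBound N M (ζ : ℝ × ℝ → ℝ) → |f ζ| ≤ C * M}
  add_mem' := by
    rintro f g ⟨N, C, hf⟩ ⟨N', C', hg⟩
    refine ⟨max N N', C + C', fun ζ M h => ?_⟩
    have h1 := hf ζ M (h.mono (le_max_left _ _))
    have h2 := hg ζ M (h.mono (le_max_right _ _))
    calc |(f + g) ζ| ≤ |f ζ| + |g ζ| := abs_add_le _ _
      _ ≤ (C + C') * M := by linarith
  zero_mem' := ⟨0, 0, fun ζ M _ => by simp⟩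
  smul_mem' := by
    rintro c f ⟨N, C, hf⟩
    refine ⟨N, |c| * C, fun ζ M h => ?_⟩
    have h1 := hf ζ M h
    calc |(c • f) ζ| = |c| * |f ζ| := by simp [abs_mul]
      _ ≤ |c| * (C * M) := by gcongr
      _ = |c| * C * M := by ring

/-- The value `f(ζ)` of a periodic distribution at a test function. -/
def pair (f : PeriodicDistribution) (ζ : TorusTest) : ℝ := (f : TorusTest →ₗ[ℝ] ℝ) ζ

theorem bounded_cell (ζ : TorusTest) : ∃ B, ∀ x ∈ cell, ‖(ζ : ℝ × ℝ → ℝ) x‖ ≤ B := by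
  have hK : IsCompact (Icc (0 : ℝ) 1 ×ˢ Icc (0 : ℝ) 1) := isCompact_Icc.prod isCompact_Icc
  obtain ⟨B, hB⟩ := hK.exists_bound_of_continuousOn ζ.2.1.continuous.continuousOn
  exact ⟨B, fun x hx => hB x ⟨Ico_subset_Icc_self hx.1, Ico_subset_Icc_self hx.2⟩⟩

theorem measurableSet_cell : MeasurableSet cell := measurableSet_Ico.prod measurableSet_Ico

theorem integrableOn_mul_test {f : ℝ × ℝ → ℝ} (hf : IntegrableOn f cell) (ζ : TorusTest) :
    IntegrableOn (fun x => f x * (ζ : ℝ × ℝ → ℝ) x) cell := by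
  obtain ⟨B, hB⟩ := bounded_cell ζ
  refine Integrable.mul_bdd (c := B) hf ζ.2.1.continuous.aestronglyMeasurable ?_
  exact (ae_restrict_iff' measurableSet_cell).2 (ae_of_all _ hB)

open Classical in
/-- The periodic distribution `ζ ↦ ∫_{[0,1)²} f ζ` given by a periodic integrable function `f`
(and `0` if `f` is not integrable over the unit cell). -/
def ofFun (f : ℝ × ℝ → ℝ) : PeriodicDistribution :=
  if hf : IntegrableOn f cell then
    ⟨{ toFun := fun ζ => ∫ x in cell, f x * (ζ : ℝ × ℝ → ℝ) x
       map_add' := fun ζ η => by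
        rw [← integral_add (integrableOn_mul_test hf ζ) (integrableOn_mul_test hf η)]
        exact integral_congr_ae (ae_of_all _ fun x => by simp [mul_add])
       map_smul' := fun c ζ => by
        rw [RingHom.id_apply, smul_eq_mul, ← integral_const_mul]
        exact integral_congr_ae (ae_of_all _ fun x => by simp; ring) },
      0, ∫ x in cell, ‖f x‖, fun ζ M h => by
        change ‖∫ x in cell, f x * (ζ : ℝ × ℝ → ℝ) x‖ ≤ _
        rw [← integral_mul_const]
        refine (norm_integral_le_integral_norm _).trans
          (integral_mono (integrableOn_mul_test hf ζ).norm (hf.norm.mul_const M) fun x => ?_)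
        have := h 0 le_rfl 0 le_rfl x
        simp only [Function.iterate_zero, id_eq] at this
        simp only [norm_mul]
        gcongr
        exact this⟩
  else 0

/-! ### Fourier coefficients -/

/-- The test function `cos (2π n·x)`. -/
def cosTest (n : ℤ × ℤ) : TorusTest :=
  ⟨fun x => Real.cos (2 * Real.pi * (n.1 * x.1 + n.2 * x.2)), by
    refine ⟨by fun_prop, fun x => ⟨?_, ?_⟩⟩
    · refine Eq.trans ?_
        (Real.cos_add_int_mul_two_pi (2 * Real.pi * (n.1 * x.1 + n.2 * x.2)) n.1)
      dsimp only
      congr 1; ring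
    · refine Eq.trans ?_
        (Real.cos_add_int_mul_two_pi (2 * Real.pi * (n.1 * x.1 + n.2 * x.2)) n.2)
      dsimp only
      congr 1; ring⟩

/-- The test function `sin (2π n·x)`. -/
def sinTest (n : ℤ × ℤ) : TorusTest :=
  ⟨fun x => Real.sin (2 * Real.pi * (n.1 * x.1 + n.2 * x.2)), by
    refine ⟨by fun_prop, fun x => ⟨?_, ?_⟩⟩
    · refine Eq.trans ?_
        (Real.sin_add_int_mul_two_pi (2 * Real.pi * (n.1 * x.1 + n.2 * x.2)) n.1)
      dsimp only
      congr 1; ring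
    · refine Eq.trans ?_
        (Real.sin_add_int_mul_two_pi (2 * Real.pi * (n.1 * x.1 + n.2 * x.2)) n.2)
      dsimp only
      congr 1; ring⟩

/-- The Fourier coefficient `f(k) = ∫_{[0,1)²} e^{-ik·x} f` of a periodic distribution at
`k = 2πn`, `n ∈ ℤ²`. -/
def fourierCoeff (f : PeriodicDistribution) (n : ℤ × ℤ) : ℂ :=
  (pair f (cosTest n) : ℂ) - Complex.I * (pair f (sinTest n) : ℂ)

/-! ### The projection `P` onto vanishing average in `x₁` -/

/-- The average of `ζ` in `x₁`, as a function of both variables. -/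
def avg₁ (ζ : ℝ × ℝ → ℝ) : ℝ × ℝ → ℝ := fun x => ∫ s in (0 : ℝ)..1, ζ (s, x.2)

theorem contDiff_pd₂ {f : ℝ × ℝ → ℝ} (hf : ContDiff ℝ ∞ f) : ContDiff ℝ ∞ (pd₂ f) := by
  have h : pd₂ f = fun x => fderiv ℝ f x (0, 1) := by
    funext x
    have h1 : HasDerivAt (fun t : ℝ => ((x.1, t) : ℝ × ℝ)) (0, 1) x.2 :=
      (hasDerivAt_const _ _).prodMk (hasDerivAt_id _)
    have h2 : HasFDerivAt f (fderiv ℝ f x) (x.1, x.2) :=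
      (hf.differentiable (by simp) x).hasFDerivAt
    exact (h2.comp_hasDerivAt x.2 h1).deriv
  rw [h]
  exact (contDiff_infty_iff_fderiv.1 hf).2.clm_apply contDiff_const

theorem hasDerivAt_pd₂ {f : ℝ × ℝ → ℝ} (hf : ContDiff ℝ ∞ f) (s t : ℝ) :
    HasDerivAt (fun t => f (s, t)) (pd₂ f (s, t)) t := by
  have h : DifferentiableAt ℝ (fun t => f (s, t)) t :=
    ((hf.differentiable (by simp)).comp
      ((differentiable_const s).prodMk differentiable_id)).differentiableAt
  exact h.hasDerivAt

theorem hasDerivAt_avg {f : ℝ × ℝ → ℝ} (hf : ContDiff ℝ ∞ f) (t : ℝ) :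
    HasDerivAt (fun t => ∫ s in (0 : ℝ)..1, f (s, t)) (∫ s in (0 : ℝ)..1, pd₂ f (s, t)) t := by
  have hc := hf.continuous
  have hc' := (contDiff_pd₂ hf).continuous
  have hK : IsCompact (Icc (0 : ℝ) 1 ×ˢ Icc (t - 1) (t + 1)) := isCompact_Icc.prod isCompact_Icc
  obtain ⟨B, hB⟩ := hK.exists_bound_of_continuousOn hc'.continuousOn
  refine (intervalIntegral.hasDerivAt_integral_of_dominated_loc_of_deriv_le
    (F := fun t s => f (s, t)) (F' := fun t s => pd₂ f (s, t)) (bound := fun _ => B)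
    (s := Icc (t - 1) (t + 1)) (Icc_mem_nhds (by linarith) (by linarith)) ?_ ?_ ?_ ?_ ?_ ?_).2
  · exact Eventually.of_forall fun t => (by fun_prop : Continuous fun s => f (s, t)).aestronglyMeasurable
  · exact (by fun_prop : Continuous fun s => f (s, t)).intervalIntegrable _ _
  · exact (by fun_prop : Continuous fun s => pd₂ f (s, t)).aestronglyMeasurable
  · refine ae_of_all _ fun s hs x hx => hB _ ⟨?_, hx⟩
    rw [uIoc_of_le zero_le_one] at hs
    exact Ioc_subset_Icc_self hs
  · exact intervalIntegrable_const
  · exact ae_of_all _ fun s _ x _ => hasDerivAt_pd₂ hf s x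

theorem contDiff_avg₁ {f : ℝ × ℝ → ℝ} (hf : ContDiff ℝ ∞ f) : ContDiff ℝ ∞ (avg₁ f) := by
  have key : ∀ n : ℕ, ∀ f : ℝ × ℝ → ℝ, ContDiff ℝ ∞ f →
      ContDiff ℝ n (fun t => ∫ s in (0 : ℝ)..1, f (s, t)) := by
    intro n
    induction n with
    | zero =>
      intro f hf
      exact contDiff_zero.2
        (continuous_iff_continuousAt.2 fun t => (hasDerivAt_avg hf t).continuousAt)
    | succ n ih =>
      intro f hf
      push_cast
      refine contDiff_succ_iff_deriv.2 ⟨fun t => (hasDerivAt_avg hf t).differentiableAt,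
        fun h => absurd h (by simp), ?_⟩
      rw [show deriv (fun t => ∫ s in (0 : ℝ)..1, f (s, t)) =
        fun t => ∫ s in (0 : ℝ)..1, pd₂ f (s, t) from funext fun t => (hasDerivAt_avg hf t).deriv]
      exact ih _ (contDiff_pd₂ hf)
  exact (contDiff_infty.2 fun n => key n f hf).comp contDiff_snd

/-- The projection `P` on test functions: subtract the average in `x₁`. -/
def projTest : TorusTest →ₗ[ℝ] TorusTest where
  toFun ζ := ⟨fun x => (ζ : ℝ × ℝ → ℝ) x - avg₁ ζ x, ζ.2.1.sub (contDiff_avg₁ ζ.2.1), fun x => by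
    have h : ∀ s, (ζ : ℝ × ℝ → ℝ) (s, x.2 + 1) = (ζ : ℝ × ℝ → ℝ) (s, x.2) :=
      fun s => (ζ.2.2 (s, x.2)).2
    simp [(ζ.2.2 x).1, (ζ.2.2 x).2, avg₁, h]⟩
  map_add' ζ η := by
    ext x
    have hi : ∀ θ : TorusTest, IntervalIntegrable (fun s => (θ : ℝ × ℝ → ℝ) (s, x.2)) volume 0 1 :=
      fun θ => by
        have := θ.2.1.continuous
        exact (by fun_prop : Continuous fun s => (θ : ℝ × ℝ → ℝ) (s, x.2)).intervalIntegrable _ _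
    simp only [avg₁, Submodule.coe_add, Pi.add_apply]
    rw [intervalIntegral.integral_add (hi ζ) (hi η)]
    ring
  map_smul' c ζ := by
    ext x
    simp only [avg₁, Submodule.coe_smul, Pi.smul_apply, smul_eq_mul, RingHom.id_apply]
    rw [intervalIntegral.integral_const_mul]
    ring

theorem pd₂_iterate_sub_avg (j : ℕ) {f : ℝ × ℝ → ℝ} (hf : ContDiff ℝ ∞ f) :
    ContDiff ℝ ∞ (pd₂^[j] f) ∧
      pd₂^[j] (fun x => f x - avg₁ f x) = fun x => pd₂^[j] f x - avg₁ (pd₂^[j] f) x := by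
  induction j with
  | zero => exact ⟨hf, rfl⟩
  | succ j ih =>
    rw [Function.iterate_succ_apply', Function.iterate_succ_apply', ih.2]
    refine ⟨contDiff_pd₂ ih.1, ?_⟩
    funext x
    exact ((hasDerivAt_pd₂ ih.1 x.1 x.2).sub (hasDerivAt_avg ih.1 x.2)).deriv

theorem pd₁_sub_avg (f : ℝ × ℝ → ℝ) : pd₁ (fun x => f x - avg₁ f x) = pd₁ f := by
  funext x
  exact deriv_sub_const (f := fun t => f (t, x.2)) (avg₁ f x)

theorem DerivBound.projTest {N : ℕ} {M : ℝ} {ζ : TorusTest}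
    (h : DerivBound N M (ζ : ℝ × ℝ → ℝ)) :
    DerivBound N (2 * M) (Ripple.projTest ζ : ℝ × ℝ → ℝ) := by
  intro i hi j hj x
  change |pd₁^[i] (pd₂^[j] (fun x => (ζ : ℝ × ℝ → ℝ) x - avg₁ ζ x)) x| ≤ 2 * M
  rw [(pd₂_iterate_sub_avg j ζ.2.1).2]
  have hM := h.nonneg
  cases i with
  | zero =>
    have h0 := fun y => h 0 (Nat.zero_le _) j hj y
    simp only [Function.iterate_zero, id_eq] at h0 ⊢
    have h1 : |avg₁ (pd₂^[j] (ζ : ℝ × ℝ → ℝ)) x| ≤ M := by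
      have := intervalIntegral.norm_integral_le_of_norm_le_const (a := (0 : ℝ)) (b := 1)
        (f := fun s => pd₂^[j] (ζ : ℝ × ℝ → ℝ) (s, x.2)) (C := M) (fun s _ => h0 (s, x.2))
      simpa [avg₁] using this
    calc _ ≤ |pd₂^[j] (ζ : ℝ × ℝ → ℝ) x| + |avg₁ (pd₂^[j] (ζ : ℝ × ℝ → ℝ)) x| := abs_sub _ _
      _ ≤ 2 * M := by linarith [h0 x]
  | succ i =>
    rw [Function.iterate_succ_apply, pd₁_sub_avg, ← Function.iterate_succ_apply]
    linarith [h (i + 1) hi j hj x]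

/-- The projection `P` on periodic distributions, extended from functions by duality:
`(P f)(ζ) = f(P ζ)`. -/
def proj (f : PeriodicDistribution) : PeriodicDistribution :=
  ⟨(f : TorusTest →ₗ[ℝ] ℝ).comp projTest, by
    obtain ⟨N, C, hf⟩ := f.2
    refine ⟨N, C * 2, fun ζ M h => ?_⟩
    rw [mul_assoc]
    exact hf (projTest ζ) (2 * M) h.projTest⟩

/-! ### Mollification -/

/-- The periodization `∑_{z ∈ ℤ²} ψ(· + z)`. -/
def periodize {F : Type*} [NormedAddCommGroup F] (ψ : ℝ × ℝ → F) : ℝ × ℝ → F :=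
  fun y => ∑' z : ℤ × ℤ, ψ (y + ((z.1 : ℝ), (z.2 : ℝ)))

/-- The rescaled kernel `φ_ℓ(x) = ℓ^{-5/2} φ(x₁/ℓ, x₂/ℓ^{3/2})`. -/
def rescale (φ : ℝ × ℝ → ℝ) (ℓ : ℝ) : ℝ × ℝ → ℝ :=
  fun x => ℓ ^ (-(5 / 2 : ℝ)) * φ (x.1 / ℓ, x.2 / ℓ ^ (3 / 2 : ℝ))

theorem summable_lattice : Summable fun z : ℤ × ℤ => (1 + ‖z‖) ^ (-3 : ℝ) := by
  have h := (EisensteinSeries.summable_one_div_norm_rpow (k := 3) (by norm_num))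
  rw [← (finTwoArrowEquiv ℤ).symm.summable_iff] at h
  refine Summable.of_norm_bounded_eventually h ?_
  filter_upwards [(Set.finite_singleton (0 : ℤ × ℤ)).compl_mem_cofinite] with z hz
  have hz' : 0 < ‖z‖ := norm_pos_iff.2 hz
  have hn : ‖(finTwoArrowEquiv ℤ).symm z‖ = ‖z‖ := by
    rw [Prod.norm_def]
    simp [EisensteinSeries.norm_eq_max_natAbs, Int.norm_eq_abs, Nat.cast_natAbs]
  rw [Function.comp_apply, hn, Real.norm_of_nonneg (by positivity)]
  exact Real.rpow_le_rpow_of_nonpos hz' (by linarith) (by norm_num)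

theorem schwartz_lattice_bound {F : Type*} [NormedAddCommGroup F] [NormedSpace ℝ F]
    (ψ : 𝓢(ℝ × ℝ, F)) (R : ℝ) (hR : 0 ≤ R) : ∃ C, ∀ (y : ℝ × ℝ), ‖y‖ ≤ R → ∀ z : ℤ × ℤ,
      ‖ψ (y + ((z.1 : ℝ), (z.2 : ℝ)))‖ ≤ C * (1 + ‖z‖) ^ (-3 : ℝ) := by
  set S := 2 ^ 3 * ((Finset.Iic (3, 0)).sup fun m : ℕ × ℕ => SchwartzMap.seminorm ℝ m.1 m.2) ψ
  refine ⟨S * (1 + R) ^ 3, fun y hy z => ?_⟩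
  set w : ℝ × ℝ := ((z.1 : ℝ), (z.2 : ℝ)) with hw
  have hzn : ‖z‖ = ‖w‖ := by simp [Prod.norm_def, hw, Int.norm_eq_abs]
  have h1 := SchwartzMap.one_add_le_sup_seminorm_apply (𝕜 := ℝ) (m := (3, 0)) (k := 3) (n := 0)
    le_rfl le_rfl ψ (y + w)
  rw [norm_iteratedFDeriv_zero] at h1
  have h2 : 1 + ‖w‖ ≤ (1 + R) * (1 + ‖y + w‖) := by
    have : ‖w‖ ≤ ‖y + w‖ + ‖y‖ := by
      have := norm_sub_le (y + w) y
      simpa using this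
    nlinarith [norm_nonneg (y + w)]
  have h3 : (1 + ‖z‖) ^ (-3 : ℝ) = ((1 + ‖w‖) ^ 3)⁻¹ := by
    rw [hzn, Real.rpow_neg (by positivity)]
    norm_cast
  rw [h3, ← div_eq_mul_inv, le_div_iff₀ (by positivity)]
  calc ‖ψ (y + w)‖ * (1 + ‖w‖) ^ 3 ≤ ‖ψ (y + w)‖ * ((1 + R) * (1 + ‖y + w‖)) ^ 3 := by gcongr
    _ = ((1 + ‖y + w‖) ^ 3 * ‖ψ (y + w)‖) * (1 + R) ^ 3 := by ring
    _ ≤ S * (1 + R) ^ 3 := by gcongr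

theorem hasFDerivAt_periodize {F : Type*} [NormedAddCommGroup F] [NormedSpace ℝ F]
    [CompleteSpace F] (ψ : 𝓢(ℝ × ℝ, F)) (x : ℝ × ℝ) :
    HasFDerivAt (periodize ψ) (periodize (SchwartzMap.fderivCLM ℝ (ℝ × ℝ) F ψ) x) x := by
  obtain ⟨C, hC⟩ := schwartz_lattice_bound (SchwartzMap.fderivCLM ℝ (ℝ × ℝ) F ψ) (‖x‖ + 1)
    (by positivity)
  obtain ⟨C', hC'⟩ := schwartz_lattice_bound ψ ‖x‖ (norm_nonneg _)
  have hx : x ∈ Metric.ball (0 : ℝ × ℝ) (‖x‖ + 1) := by simp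
  have hs : Summable fun z : ℤ × ℤ => ψ (x + ((z.1 : ℝ), (z.2 : ℝ))) :=
    Summable.of_norm_bounded (summable_lattice.mul_left C') (hC' x le_rfl)
  have h1 : ∀ (z : ℤ × ℤ) (y : ℝ × ℝ), y ∈ Metric.ball (0 : ℝ × ℝ) (‖x‖ + 1) →
      HasFDerivAt (fun y => ψ (y + ((z.1 : ℝ), (z.2 : ℝ))))
        (SchwartzMap.fderivCLM ℝ (ℝ × ℝ) F ψ (y + ((z.1 : ℝ), (z.2 : ℝ)))) y := by
    intro z y _
    have h := ψ.hasFDerivAt (y + ((z.1 : ℝ), (z.2 : ℝ)))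
    exact (hasFDerivAt_comp_add_right _).2 h
  have h2 : ∀ (z : ℤ × ℤ) (y : ℝ × ℝ), y ∈ Metric.ball (0 : ℝ × ℝ) (‖x‖ + 1) →
      ‖SchwartzMap.fderivCLM ℝ (ℝ × ℝ) F ψ (y + ((z.1 : ℝ), (z.2 : ℝ)))‖ ≤
        C * (1 + ‖z‖) ^ (-3 : ℝ) := by
    intro z y hy
    exact hC y (by simpa using (mem_ball_zero_iff.1 hy).le) z
  exact hasFDerivAt_tsum_of_isPreconnected (summable_lattice.mul_left C) Metric.isOpen_ball
    (convex_ball (0 : ℝ × ℝ) (‖x‖ + 1)).isPreconnected h1 h2 hx hs hx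

theorem contDiff_periodize (ψ : 𝓢(ℝ × ℝ, ℝ)) : ContDiff ℝ ∞ (periodize ψ) := by
  have key : ∀ n : ℕ, ∀ (F : Type) [NormedAddCommGroup F] [NormedSpace ℝ F] [CompleteSpace F]
      (ψ : 𝓢(ℝ × ℝ, F)), ContDiff ℝ n (periodize ψ) := by
    intro n
    induction n with
    | zero =>
      intro F _ _ _ ψ
      exact contDiff_zero.2
        (continuous_iff_continuousAt.2 fun x => (hasFDerivAt_periodize ψ x).continuousAt)
    | succ n ih =>
      intro F _ _ _ ψ
      push_cast
      refine contDiff_succ_iff_fderiv.2 ⟨fun x => (hasFDerivAt_periodize ψ x).differentiableAt,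
        fun h => absurd h (by simp), ?_⟩
      rw [show fderiv ℝ (periodize ψ) = periodize (SchwartzMap.fderivCLM ℝ (ℝ × ℝ) F ψ) from
        funext fun x => (hasFDerivAt_periodize ψ x).fderiv]
      exact ih _ _
  exact contDiff_infty.2 fun n => key n ℝ ψ

theorem isPeriodic_periodize (ψ : ℝ × ℝ → ℝ) : IsPeriodic (periodize ψ) := by
  intro x
  constructor
  · refine Eq.trans ?_ ((Equiv.addRight ((1, 0) : ℤ × ℤ)).tsum_eq
      fun z : ℤ × ℤ => ψ (x + ((z.1 : ℝ), (z.2 : ℝ))))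
    refine tsum_congr fun z => congrArg ψ (Prod.ext ?_ ?_) <;> (simp; try ring)
  · refine Eq.trans ?_ ((Equiv.addRight ((0, 1) : ℤ × ℤ)).tsum_eq
      fun z : ℤ × ℤ => ψ (x + ((z.1 : ℝ), (z.2 : ℝ))))
    refine tsum_congr fun z => congrArg ψ (Prod.ext ?_ ?_) <;> (simp; try ring)

theorem periodize_rescale_mem (φ : 𝓢(ℝ × ℝ, ℝ)) {ℓ : ℝ} (hℓ : 0 < ℓ) :
    periodize (rescale φ ℓ) ∈ TorusTest := by
  have hℓ' : ℓ ^ (3 / 2 : ℝ) ≠ 0 := (Real.rpow_pos_of_pos hℓ _).ne'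
  let e : (ℝ × ℝ) ≃L[ℝ] (ℝ × ℝ) :=
    (ContinuousLinearEquiv.unitsEquivAut ℝ (Units.mk0 ℓ⁻¹ (inv_ne_zero hℓ.ne'))).prodCongr
      (ContinuousLinearEquiv.unitsEquivAut ℝ (Units.mk0 (ℓ ^ (3 / 2 : ℝ))⁻¹ (inv_ne_zero hℓ')))
  have h : rescale φ ℓ =
      ((ℓ ^ (-(5 / 2 : ℝ)) • SchwartzMap.compCLMOfContinuousLinearEquiv ℝ e φ :
        𝓢(ℝ × ℝ, ℝ)) : ℝ × ℝ → ℝ) := by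
    funext x
    simp [rescale, e, div_eq_mul_inv]
  refine ⟨?_, isPeriodic_periodize _⟩
  rw [h]
  exact contDiff_periodize _

/-- The test function `y ↦ ∑_{z ∈ ℤ²} φ_ℓ(x - y + z)`, the periodization of `φ_ℓ(x - ·)`. -/
def kernelTest (φ : 𝓢(ℝ × ℝ, ℝ)) {ℓ : ℝ} (hℓ : 0 < ℓ) (x : ℝ × ℝ) : TorusTest :=
  ⟨fun y => periodize (rescale φ ℓ) (x - y), by
    obtain ⟨h1, h2⟩ := periodize_rescale_mem φ hℓ
    refine ⟨h1.comp (contDiff_const.sub contDiff_id), fun y => ⟨?_, ?_⟩⟩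
    · refine Eq.trans ?_ ((h2 (x - (y.1 + 1, y.2))).1).symm |>.trans ?_
      · rfl
      · exact congrArg _ (Prod.ext (by simp; try ring) (by simp; try ring))
    · refine Eq.trans ?_ ((h2 (x - (y.1, y.2 + 1))).2).symm |>.trans ?_
      · rfl
      · exact congrArg _ (Prod.ext (by simp; try ring) (by simp; try ring))⟩

open Classical in
/-- The mollification `f_ℓ = φ_ℓ * f` of a periodic distribution at scale `ℓ > 0` (convolution
over the whole plane): `f_ℓ(x) = ∫_{ℝ²} φ_ℓ(x - y) f(y) dy`, the value of `f` at the periodization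
of `φ_ℓ(x - ·)`. The value for `ℓ ≤ 0` is irrelevant. -/
def mollify (φ : 𝓢(ℝ × ℝ, ℝ)) (ℓ : ℝ) (f : PeriodicDistribution) : ℝ × ℝ → ℝ :=
  fun x => if hℓ : 0 < ℓ then pair f (kernelTest φ hℓ x) else 0

end Smooth

/-- An admissible convolution kernel: symmetric with integral one. -/
structure IsKernel (φ : 𝓢(ℝ × ℝ, ℝ)) : Prop where
  symm : ∀ x, φ (-x) = φ x
  integral_eq_one : ∫ x, φ x = 1

/-! ### The Hilbert transform in `x₁` and the linearized equation -/

/-- The Fourier coefficient `∫₀¹ e^{-ik₁s} u(s, x₂) ds` in the first variable, `k₁ = 2πn`. -/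
def fourierCoeff₁ (u : ℝ × ℝ → ℝ) (n : ℤ) (x₂ : ℝ) : ℂ :=
  ∫ s in (0 : ℝ)..1, Complex.exp (-(2 * Real.pi * n * s : ℝ) * Complex.I) * (u (s, x₂) : ℂ)

/-- The Hilbert transform `R = ∂₁/|∂₁|` in `x₁` of a (smooth, periodic) function: the function with
the Fourier coefficients `i sgn(k₁) u(k₁)` in the first variable. -/
def hilbert (u : ℝ × ℝ → ℝ) : ℝ × ℝ → ℝ := fun x =>
  (∑' n : ℤ, Complex.I * ((n.sign : ℤ) : ℂ) * fourierCoeff₁ u n x.2 *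
    Complex.exp ((2 * Real.pi * n * x.1 : ℝ) * Complex.I)).re

/-- The Fourier multiplier `k₁² + |k₁|⁻¹ k₂²`, `k = 2πn`, of `𝓛 = -∂₁² - |∂₁|⁻¹ ∂₂²` (only used on
distributions with vanishing average in `x₁`, that is, for `k₁ ≠ 0`). -/
def symbolL (n : ℤ × ℤ) : ℝ :=
  (2 * Real.pi * n.1) ^ 2 + |2 * Real.pi * n.1|⁻¹ * (2 * Real.pi * n.2) ^ 2

/-- `v` is the distributional solution of `𝓛 v = P ξ` with vanishing average in `x₁`. The operator
`𝓛` acts as a Fourier multiplier. -/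
structure SolvesLinearized (v ξ : PeriodicDistribution) : Prop where
  avg_zero : proj v = v
  eqn : ∀ n : ℤ × ℤ, (symbolL n : ℂ) * fourierCoeff v n = fourierCoeff (proj ξ) n

/-- `F^ℓ = P(v_ℓ ∂₂ R v_ℓ)` with `v_ℓ = φ_ℓ * v`. -/
def offline (φ : 𝓢(ℝ × ℝ, ℝ)) (v : PeriodicDistribution) (ℓ : ℝ) : PeriodicDistribution :=
  proj (ofFun fun x => mollify φ ℓ v x * pd₂ (hilbert (mollify φ ℓ v)) x)

/-! ### Anisotropic Hölder seminorms -/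

/-- The Carnot–Carathéodory distance `d(x,y) = |x₁ - y₁| + |x₂ - y₂|^{2/3}`. -/
def ccDist (x y : ℝ × ℝ) : ℝ := |x.1 - y.1| + |x.2 - y.2| ^ (2 / 3 : ℝ)

/-- The Hölder seminorm `[f]_α = sup_{x ≠ y} |f(y) - f(x)| / d(y,x)^α` for exponents
`α ∈ (0,1]`. -/
def holderSeminorm (α : ℝ) (f : ℝ × ℝ → ℝ) : ℝ≥0∞ :=
  ⨆ (x : ℝ × ℝ) (y : ℝ × ℝ) (_ : x ≠ y), ENNReal.ofReal (|f y - f x| / ccDist y x ^ α)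

/-- `f = c + ∂₁ g + ∂₂ h` in the sense of periodic distributions. -/
def IsDecomposition (f : PeriodicDistribution) (c : ℝ) (g h : ℝ × ℝ → ℝ) : Prop :=
  ∀ ζ : TorusTest, pair f ζ = c * (∫ x in cell, (ζ : ℝ × ℝ → ℝ) x)
    - (∫ x in cell, g x * pd₁ ζ x) - ∫ x in cell, h x * pd₂ ζ x

/-- The Hölder norm of negative exponent `β`, for `β ∈ (-1,-1/2]`:
`[f]_β = inf {|c| + [g]_{β+1} + [h]_{β+3/2} : f = c + ∂₁ g + ∂₂ h}`, where `c` is a constant and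
`g`, `h` are periodic functions. It is `∞` if no such decomposition has finite seminorms. -/
def negHolder (β : ℝ) (f : PeriodicDistribution) : ℝ≥0∞ :=
  ⨅ (c : ℝ) (g : ℝ × ℝ → ℝ) (h : ℝ × ℝ → ℝ) (_ : IsPeriodic g) (_ : IsPeriodic h)
    (_ : IsDecomposition f c g h),
    ENNReal.ofReal |c| + holderSeminorm (β + 1) g + holderSeminorm (β + 3 / 2) h

/-! ### White noise and expectations -/

/-- `ξ` is a random periodic distribution distributed like white noise on the torus: every `ξ(ζ)` is
a centered Gaussian random variable of variance `∫_{[0,1)²} ζ²`. By linearity in `ζ`, the family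
`(ξ(ζ))` is then jointly Gaussian with covariance `∫ ζ η`. -/
def IsWhiteNoise {Ω : Type*} [MeasurableSpace Ω] (μ : Measure Ω)
    (ξ : Ω → PeriodicDistribution) : Prop :=
  ∀ ζ : TorusTest, HasLaw (fun ω => pair (ξ ω) ζ)
    (gaussianReal 0 (∫ x in cell, (ζ : ℝ × ℝ → ℝ) x ^ 2).toNNReal) μ

/-- The expectation of a `[0,∞]`-valued function, read as the upper integral: it is `∫⁻ f dμ` for
measurable `f` and makes sense without any discussion of the measurability of suprema over
uncountable families. -/
def expectation {Ω : Type*} [MeasurableSpace Ω] (μ : Measure Ω) (f : Ω → ℝ≥0∞) : ℝ≥0∞ :=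
  ⨅ (g : Ω → ℝ≥0∞) (_ : Measurable g) (_ : ∀ᵐ ω ∂μ, f ω ≤ g ω), ∫⁻ ω, g ω ∂μ

end Ripple

end

open MeasureTheory ProbabilityTheory Set Filter Topology
open scoped NNReal ENNReal SchwartzMap

noncomputable section

namespace Ripple

/-! ### Anisotropic weights on the lattice -/

/-! Fourier analysis turns the claim, path by path, into one about a quadratic form in the Fourier
coefficients of `ξ`. Since `v` has the coefficients `ξ(n) / symbolL n`, the product `v_ℓ ∂₂Rv_ℓ` is
a double series over pairs `(n, m)` with output frequency `n + m` and symbol `bilinSymbol n m`, of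
size `rho n ^ (-2) * rho m ^ (-1/2)`, times the mollification multipliers of `n` and `m`
(`SolvesLinearized.offline_eq`). The expectation of the product sits on the pairs with `n + m = 0`.
The projection `P` removes every output frequency with vanishing first component, hence these pairs
too, and so no renormalization is needed.

For the negative Hölder norm the form is written as `∂₁g + ∂₂h` with Fourier multipliers `potX`,
`potY` of anisotropic order `-1` and `-3/2`, supported where the first or the second frequency
component dominates. It remains to bound `g` in the Hölder class of exponent `1/4 - ε` and `h` in
that of exponent `3/4 - ε`. A Sobolev-type embedding made from Poisson kernels
(`holderSeminorm_pot_le`) trades this for `L^P` norms with large `P`. High moments of a trace-free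
Gaussian quadratic form are bounded by its Hilbert-Schmidt norm
(`IsStdGaussianFamily.lintegral_quadratic_pow_le`). That norm is a lattice sum
(`sum_norm_sq_bilin_le`), which converges because the effective dimension is `5/2` and a positive
power of `rho` remains to spare.

The spare power pays for convergence: a difference of multipliers bounded by `M * (rho n ^ δ + rho m
^ δ)` produces moments of size `M` (`IsPotential.exists_moment_diff`). For the supremum over all
scales, the increment between two scales is the integral of the scale derivative, whose multiplier
is of order `s ^ (δ - 1)`. This is integrable at `0` and yields the rate `ℓ₀ ^ δ` with `δ = ε / 2`
(`IsPotential.exists_moment_sup`).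

The limit is constructed without any kernel, from sharp frequency cutoffs at dyadic scales. The
increments of the cutoffs, the differences between cutoff `N` and mollification at scale `2 ^ (-N)`,
and the suprema over scales below `2 ^ (-N)` all have geometrically small moments, so almost surely
their Hölder seminorms are summable. Hence every kernel leads to the same limit `limitDist`, a
function of `ξ` alone. Infinite series are treated throughout by truncating to finite boxes,
estimating uniformly, and passing to the limit with lower semicontinuity of the Hölder seminorm and
Fatou's lemma. -/

/-- The anisotropic weight `1 + |n₁| + |n₂|^{2/3}` on `ℤ²`. -/
def rho (n : ℤ × ℤ) : ℝ := 1 + |(n.1 : ℝ)| + |(n.2 : ℝ)| ^ (2 / 3 : ℝ)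

theorem one_le_rho (n : ℤ × ℤ) : 1 ≤ rho n := by
  unfold rho
  have h1 := abs_nonneg (n.1 : ℝ)
  have h2 : 0 ≤ |(n.2 : ℝ)| ^ (2 / 3 : ℝ) := by positivity
  linarith

theorem rho_pos (n : ℤ × ℤ) : 0 < rho n := one_pos.trans_le (one_le_rho n)

theorem one_add_abs_fst_le_rho (n : ℤ × ℤ) : 1 + |(n.1 : ℝ)| ≤ rho n := by
  unfold rho
  have h2 : 0 ≤ |(n.2 : ℝ)| ^ (2 / 3 : ℝ) := by positivity
  linarith

theorem one_add_abs_snd_rpow_le_rho (n : ℤ × ℤ) : (1 + |(n.2 : ℝ)|) ^ (2 / 3 : ℝ) ≤ rho n := by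
  have h := Real.rpow_add_le_add_rpow (p := 2 / 3) zero_le_one (abs_nonneg (n.2 : ℝ))
    (by norm_num) (by norm_num)
  rw [Real.one_rpow] at h
  have h1 := abs_nonneg (n.1 : ℝ)
  unfold rho
  linarith

theorem abs_snd_le_rho (n : ℤ × ℤ) : |(n.2 : ℝ)| ≤ rho n ^ (3 / 2 : ℝ) := by
  have h : |(n.2 : ℝ)| ^ (2 / 3 : ℝ) ≤ rho n := by
    unfold rho
    have h1 := abs_nonneg (n.1 : ℝ)
    linarith
  calc |(n.2 : ℝ)| = (|(n.2 : ℝ)| ^ (2 / 3 : ℝ)) ^ (3 / 2 : ℝ) := by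
        rw [← Real.rpow_mul (abs_nonneg _)]; norm_num
    _ ≤ _ := Real.rpow_le_rpow (by positivity) h (by norm_num)

theorem summable_one_add_abs_int {s : ℝ} (hs : 1 < s) :
    Summable fun n : ℤ => (1 + |(n : ℝ)|) ^ (-s) := by
  refine Summable.of_norm_bounded_eventually (Real.summable_abs_int_rpow hs) ?_
  filter_upwards [(Set.finite_singleton (0 : ℤ)).compl_mem_cofinite] with n hn
  have hn' : 0 < |(n : ℝ)| := abs_pos.2 (by exact_mod_cast hn)
  rw [Real.norm_of_nonneg (by positivity)]
  exact Real.rpow_le_rpow_of_nonpos hn' (by linarith) (by linarith)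

/-- The threshold `5/2 = 1 + 3/2` is the homogeneous dimension: one power of `rho` sums the first
variable and `3/2` powers sum the second. The excess `s - 5/2 = 2t` is shared equally between the
two. -/
theorem summable_rho {s : ℝ} (hs : 5 / 2 < s) : Summable fun n : ℤ × ℤ => rho n ^ (-s) := by
  set t := (s - 5 / 2) / 2 with ht
  have h1 := (summable_one_add_abs_int (s := 1 + t) (by linarith)).mul_of_nonneg
    (summable_one_add_abs_int (s := 1 + 2 / 3 * t) (by linarith))
    (fun n => by positivity) (fun n => by positivity)
  refine Summable.of_nonneg_of_le (fun n => (Real.rpow_pos_of_pos (rho_pos n) _).le)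
    (fun n => ?_) h1
  have e : -s = -(1 + t) + -(3 / 2 * (1 + 2 / 3 * t)) := by rw [ht]; ring
  rw [e, Real.rpow_add (rho_pos n)]
  refine mul_le_mul ?_ ?_ (Real.rpow_nonneg (rho_pos n).le _) (by positivity)
  · exact Real.rpow_le_rpow_of_nonpos (by positivity) (one_add_abs_fst_le_rho n) (by linarith)
  · calc rho n ^ (-(3 / 2 * (1 + 2 / 3 * t)))
        ≤ ((1 + |(n.2 : ℝ)|) ^ (2 / 3 : ℝ)) ^ (-(3 / 2 * (1 + 2 / 3 * t))) :=
          Real.rpow_le_rpow_of_nonpos (by positivity) (one_add_abs_snd_rpow_le_rho n) (by linarith)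
      _ = _ := by
          rw [← Real.rpow_mul (by positivity)]
          congr 1; ring

/-- Translation by `k` is injective, so the shifted sum is a partial sum of the full series. The
uniformity in `k` is what matters. -/
theorem summable_rho_sq_inv_bound {s : ℝ} (hs : 5 / 2 < s) (S : Finset (ℤ × ℤ)) (k : ℤ × ℤ) :
    ∑ n ∈ S, rho (k + n) ^ (-s) ≤ ∑' n, rho n ^ (-s) := by
  have h := (summable_rho hs).sum_le_tsum (S.map (addLeftEmbedding k))
    (fun n _ => (Real.rpow_pos_of_pos (rho_pos n) _).le)
  simpa using h

/-! ### Ellipticity of the linear operator and order of the dispersive symbol -/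

theorem symbolL_fst_zero {n : ℤ × ℤ} (hn : n.1 = 0) : symbolL n = 0 := by simp [symbolL, hn]

theorem symbolL_pos {n : ℤ × ℤ} (hn : n.1 ≠ 0) : 0 < symbolL n := by
  have : (n.1 : ℝ) ≠ 0 := by exact_mod_cast hn
  unfold symbolL
  positivity

theorem symbolL_nonneg (n : ℤ × ℤ) : 0 ≤ symbolL n := by
  unfold symbolL; positivity

theorem one_le_abs_intCast {n : ℤ} (hn : n ≠ 0) : 1 ≤ |(n : ℝ)| := by
  exact_mod_cast Int.one_le_abs hn

/-- With `x = |n₁| ≥ 1` and `y = |n₂|^(2/3)` the symbol dominates `x² + y³/x`. If `y ≤ x` then `x²`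
controls `y²`, otherwise `y³/x` does. -/
theorem rho_sq_le_symbolL {n : ℤ × ℤ} (hn : n.1 ≠ 0) : rho n ^ 2 ≤ 10 * symbolL n := by
  have hx : 1 ≤ |(n.1 : ℝ)| := one_le_abs_intCast hn
  set x := |(n.1 : ℝ)| with hxd
  set y := |(n.2 : ℝ)| ^ (2 / 3 : ℝ) with hyd
  have hy : 0 ≤ y := by positivity
  have hy3 : (n.2 : ℝ) ^ 2 = y ^ 3 := by
    rw [hyd, ← Real.rpow_natCast (|(n.2 : ℝ)| ^ (2 / 3 : ℝ)), ← Real.rpow_mul (abs_nonneg _),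
      ← sq_abs]
    norm_num
  have hpi := Real.pi_gt_three
  have hx0 : 0 < x := by linarith
  have e : symbolL n = (2 * Real.pi) ^ 2 * x ^ 2 + 2 * Real.pi * (y ^ 3 / x) := by
    unfold symbolL
    rw [mul_pow _ (n.1 : ℝ), mul_pow _ (n.2 : ℝ), hy3, abs_mul,
      abs_of_pos (by positivity : 0 < 2 * Real.pi), ← hxd, ← sq_abs (n.1 : ℝ), ← hxd]
    field_simp
  have h1 : x ^ 2 + y ^ 3 / x ≤ symbolL n := by
    rw [e]
    have : 0 ≤ y ^ 3 / x := by positivity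
    have h2 : (1 : ℝ) ≤ (2 * Real.pi) ^ 2 := by nlinarith
    nlinarith [sq_nonneg x]
  have h2 : y ^ 2 ≤ x ^ 2 + y ^ 3 / x := by
    rcases le_total y x with h | h
    · have : 0 ≤ y ^ 3 / x := by positivity
      nlinarith
    · have : y ^ 2 ≤ y ^ 3 / x := by
        rw [le_div_iff₀ hx0]
        nlinarith [sq_nonneg y]
      nlinarith [sq_nonneg x]
  have h3 : 0 ≤ y ^ 3 / x := by positivity
  have : rho n = 1 + x + y := rfl
  rw [this]
  have h4 : (1 + x + y) ^ 2 ≤ (2 * x + y) ^ 2 := by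
    apply pow_le_pow_left₀ (by positivity); linarith
  nlinarith [sq_nonneg (2 * x - 2 * y), h4]

/-- On the line `n.1 = 0` the convention `0⁻¹ = 0` makes `symbolL n` and then its inverse vanish. So
the inverse symbol incorporates the projection onto vanishing average, and no case distinction is
needed later. -/
theorem symbolL_inv_le (n : ℤ × ℤ) : (symbolL n)⁻¹ ≤ 10 * rho n ^ (-2 : ℝ) := by
  have hr := rho_pos n
  have e : rho n ^ (-2 : ℝ) = (rho n ^ 2)⁻¹ := by
    rw [Real.rpow_neg hr.le]; norm_cast
  by_cases hn : n.1 = 0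
  · rw [symbolL_fst_zero hn, inv_zero]
    positivity
  · have h := rho_sq_le_symbolL hn
    have hp := symbolL_pos hn
    rw [e, ← div_eq_mul_inv, le_div_iff₀ (by positivity), inv_mul_le_iff₀ hp]
    linarith

/-- The Fourier multiplier `(i k₂)(i sgn k₁)` of `∂₂R`, `k = 2πn`. -/
def dispSymbol (n : ℤ × ℤ) : ℂ :=
  (2 * Real.pi * n.2 * Complex.I) * (Complex.I * (n.1.sign : ℂ))

theorem norm_dispSymbol_le' (n : ℤ × ℤ) : ‖dispSymbol n‖ ≤ 2 * Real.pi * |(n.2 : ℝ)| := by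
  unfold dispSymbol
  have h : ‖((n.1.sign : ℤ) : ℂ)‖ ≤ 1 := by
    rw [Complex.norm_intCast]
    rcases lt_trichotomy n.1 0 with h | h | h
    · simp [Int.sign_eq_neg_one_of_neg h]
    · simp [h]
    · simp [Int.sign_eq_one_of_pos h]
  have h2 : ‖((n.2 : ℤ) : ℂ)‖ = |(n.2 : ℝ)| := by rw [Complex.norm_intCast]
  simp only [norm_mul, Complex.norm_I, mul_one, one_mul, Complex.norm_real, h2, Complex.norm_ofNat,
    Real.norm_of_nonneg Real.pi_pos.le]
  exact mul_le_of_le_one_right (by positivity) h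

theorem norm_dispSymbol_le (n : ℤ × ℤ) : ‖dispSymbol n‖ ≤ 7 * rho n ^ (3 / 2 : ℝ) := by
  refine (norm_dispSymbol_le' n).trans ?_
  have h := abs_snd_le_rho n
  have hpi := Real.pi_lt_d2
  have := Real.pi_pos
  nlinarith [abs_nonneg (n.2 : ℝ)]

/-! ### The symbol of the quadratic form and its square sum -/

/-- The symbol of the bilinear form `(ξ, ξ) ↦ v ∂₂Rv`. -/
def bilinSymbol (n m : ℤ × ℤ) : ℂ := ((symbolL n)⁻¹ : ℝ) * (((symbolL m)⁻¹ : ℝ) * dispSymbol m)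

/-- Inverting the operator gains two orders in each factor, and `∂₂R` costs `3/2` orders in the
second one. -/
theorem norm_bilinSymbol_le (n m : ℤ × ℤ) :
    ‖bilinSymbol n m‖ ≤ 700 * (rho n ^ (-2 : ℝ) * rho m ^ (-1 / 2 : ℝ)) := by
  have h1 := symbolL_inv_le n
  have h2 := symbolL_inv_le m
  have h3 := norm_dispSymbol_le m
  have p1 := inv_nonneg.2 (symbolL_nonneg n)
  have p2 := inv_nonneg.2 (symbolL_nonneg m)
  unfold bilinSymbol
  rw [norm_mul, norm_mul, Complex.norm_real, Complex.norm_real, Real.norm_of_nonneg p1,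
    Real.norm_of_nonneg p2]
  have e : rho m ^ (-1 / 2 : ℝ) = rho m ^ (-2 : ℝ) * rho m ^ (3 / 2 : ℝ) := by
    rw [← Real.rpow_add (rho_pos m)]; norm_num
  have q1 := Real.rpow_nonneg (rho_pos n).le (-2)
  have q2 := Real.rpow_nonneg (rho_pos m).le (-2)
  calc _ ≤ (10 * rho n ^ (-2 : ℝ)) * ((10 * rho m ^ (-2 : ℝ)) * (7 * rho m ^ (3 / 2 : ℝ))) := by
        gcongr
    _ = _ := by rw [e]; ring

/-- Replacing the larger of `x` and `y` by the smaller one gathers both exponents on a single base.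
This decouples the frequencies `n + m` and `m` in the lattice sum. -/
theorem rpow_neg_mul_rpow_neg_le {x y a b : ℝ} (hx : 0 < x) (hy : 0 < y) (ha : 0 ≤ a)
    (hb : 0 ≤ b) : x ^ (-a) * y ^ (-b) ≤ x ^ (-(a + b)) + y ^ (-(a + b)) := by
  have px := Real.rpow_nonneg hx.le (-(a + b))
  have py := Real.rpow_nonneg hy.le (-(a + b))
  rcases le_total x y with h | h
  · have : y ^ (-b) ≤ x ^ (-b) := Real.rpow_le_rpow_of_nonpos hx h (by linarith)
    calc x ^ (-a) * y ^ (-b) ≤ x ^ (-a) * x ^ (-b) := by gcongr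
      _ = x ^ (-(a + b)) := by rw [← Real.rpow_add hx]; ring_nf
      _ ≤ _ := by linarith
  · have : x ^ (-a) ≤ y ^ (-a) := Real.rpow_le_rpow_of_nonpos hy h (by linarith)
    calc x ^ (-a) * y ^ (-b) ≤ y ^ (-a) * y ^ (-b) := by gcongr
      _ = y ^ (-(a + b)) := by rw [← Real.rpow_add hy]; ring_nf
      _ ≤ _ := by linarith

/-- After squaring, the summand carries the weights `rho (n+m)` to the power `-(3/2 + 2η)`, `rho m`
to the power `-(1 - 2δ)` and `rho n` to the power `-(4 - 2δ)`. The first two merge into exponent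
`-(5/2 + κ)` on one of `n + m`, `m`, so the sum over `m` is finite uniformly in `n`. The remaining
sum over `n` converges since `4 - 2δ ≥ 3 > 5/2`. -/
theorem sum_norm_sq_bilin_le {η δ K : ℝ} (hδ : 0 < δ) (hδη : δ < η) (hδ' : δ ≤ 1 / 2) :
    ∃ C : ℝ, 0 ≤ C ∧ ∀ (S : Finset (ℤ × ℤ)) (b : ℤ × ℤ → ℂ) (D : ℤ × ℤ → ℤ × ℤ → ℂ) (M : ℝ),
      0 ≤ M → (∀ n, ‖b n‖ ≤ K * rho n ^ (-(3 / 4 + η))) →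
      (∀ n m, ‖D n m‖ ≤ M * (rho n ^ δ + rho m ^ δ)) →
      ∑ n ∈ S, ∑ m ∈ S, ‖b (n + m) * D n m * bilinSymbol n m‖ ^ 2 ≤ C * M ^ 2 := by
  -- The surplus over the dimension `5/2`. It is positive exactly because `δ < η`.
  set κ := 2 * η - 2 * δ with hκ
  set Z := ∑' n, rho n ^ (-(5 / 2 + κ)) with hZ
  set Z' := ∑' n, rho n ^ (-(4 - 2 * δ)) with hZ'
  have hZ0 : 0 ≤ Z := tsum_nonneg fun n => (Real.rpow_pos_of_pos (rho_pos n) _).le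
  have hZ0' : 0 ≤ Z' := tsum_nonneg fun n => (Real.rpow_pos_of_pos (rho_pos n) _).le
  refine ⟨4 * K ^ 2 * 700 ^ 2 * (Z' * (Z + Z)), by positivity, ?_⟩
  intro S b D M hM hb hD
  have point : ∀ n m, ‖b (n + m) * D n m * bilinSymbol n m‖ ^ 2 ≤
      4 * K ^ 2 * 700 ^ 2 * M ^ 2 * (rho n ^ (-(4 - 2 * δ)) *
        (rho (n + m) ^ (-(5 / 2 + κ)) + rho (0 + m) ^ (-(5 / 2 + κ)))) := by
    intro n m
    rw [zero_add]
    have hn := rho_pos n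
    have hm := rho_pos m
    have hnm := rho_pos (n + m)
    have hD' : ‖D n m‖ ≤ 2 * M * (rho n ^ δ * rho m ^ δ) := by
      have h1 : 1 ≤ rho n ^ δ := Real.one_le_rpow (one_le_rho n) hδ.le
      have h2 : 1 ≤ rho m ^ δ := Real.one_le_rpow (one_le_rho m) hδ.le
      have h3 : rho n ^ δ + rho m ^ δ ≤ 2 * (rho n ^ δ * rho m ^ δ) := by nlinarith
      calc _ ≤ _ := hD n m
        _ ≤ M * (2 * (rho n ^ δ * rho m ^ δ)) := by gcongr
        _ = _ := by ring
    have h0 : ‖b (n + m) * D n m * bilinSymbol n m‖ ≤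
        (K * rho (n + m) ^ (-(3 / 4 + η))) * (2 * M * (rho n ^ δ * rho m ^ δ)) *
          (700 * (rho n ^ (-2 : ℝ) * rho m ^ (-1 / 2 : ℝ))) := by
      rw [norm_mul, norm_mul]
      have := norm_bilinSymbol_le n m
      have h4 := hb (n + m)
      have h5 := (norm_nonneg _).trans h4
      gcongr
    have h1 := pow_le_pow_left₀ (norm_nonneg _) h0 2
    refine h1.trans ?_
    have sq : ∀ (x s : ℝ), 0 < x → (x ^ s) ^ 2 = x ^ (2 * s) := fun x s hx => by
      rw [← Real.rpow_natCast, ← Real.rpow_mul hx.le]; congr 1; push_cast; ring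
    have e : (K * rho (n + m) ^ (-(3 / 4 + η)) * (2 * M * (rho n ^ δ * rho m ^ δ)) *
          (700 * (rho n ^ (-2 : ℝ) * rho m ^ (-1 / 2 : ℝ)))) ^ 2 =
        4 * K ^ 2 * 700 ^ 2 * M ^ 2 * (rho n ^ (-(4 - 2 * δ)) *
          (rho (n + m) ^ (-(3 / 2 + 2 * η)) * rho m ^ (-(1 - 2 * δ)))) := by
      simp only [mul_pow, sq _ _ hn, sq _ _ hm, sq _ _ hnm]
      have e1 : rho n ^ (-(4 - 2 * δ)) = rho n ^ (2 * δ) * rho n ^ (2 * (-2 : ℝ)) := by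
        rw [← Real.rpow_add hn]; ring_nf
      have e2 : rho m ^ (-(1 - 2 * δ)) = rho m ^ (2 * δ) * rho m ^ (2 * (-1 / 2 : ℝ)) := by
        rw [← Real.rpow_add hm]; ring_nf
      rw [e1, e2, show 2 * -(3 / 4 + η) = -(3 / 2 + 2 * η) by ring]
      ring
    rw [e]
    have h2 := rpow_neg_mul_rpow_neg_le hnm hm (a := 3 / 2 + 2 * η) (b := 1 - 2 * δ)
      (by linarith) (by linarith)
    rw [show 3 / 2 + 2 * η + (1 - 2 * δ) = 5 / 2 + κ by rw [hκ]; ring] at h2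
    have := Real.rpow_nonneg hn.le (-(4 - 2 * δ))
    gcongr
  calc _ ≤ ∑ n ∈ S, ∑ m ∈ S, 4 * K ^ 2 * 700 ^ 2 * M ^ 2 * (rho n ^ (-(4 - 2 * δ)) *
        (rho (n + m) ^ (-(5 / 2 + κ)) + rho (0 + m) ^ (-(5 / 2 + κ)))) :=
        Finset.sum_le_sum fun n _ => Finset.sum_le_sum fun m _ => point n m
    _ = 4 * K ^ 2 * 700 ^ 2 * M ^ 2 * ∑ n ∈ S, rho n ^ (-(4 - 2 * δ)) *
        (∑ m ∈ S, rho (n + m) ^ (-(5 / 2 + κ)) + ∑ m ∈ S, rho (0 + m) ^ (-(5 / 2 + κ))) := by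
        simp only [← Finset.mul_sum, ← Finset.sum_add_distrib]
    _ ≤ 4 * K ^ 2 * 700 ^ 2 * M ^ 2 * ∑ n ∈ S, rho n ^ (-(4 - 2 * δ)) * (Z + Z) := by
        gcongr with n hn
        · exact (Real.rpow_pos_of_pos (rho_pos n) _).le
        · exact summable_rho_sq_inv_bound (by linarith) S n
        · exact summable_rho_sq_inv_bound (by linarith) S 0
    _ ≤ 4 * K ^ 2 * 700 ^ 2 * M ^ 2 * (Z' * (Z + Z)) := by
        rw [← Finset.sum_mul]
        have := summable_rho_sq_inv_bound (s := 4 - 2 * δ) (by linarith) S 0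
        simp only [zero_add] at this
        gcongr
    _ = _ := by ring

/-! ### Multipliers for the divergence form -/

/-- The Fourier multiplier of the `∂₁`-potential: `1/(ik₁)` where `|k₁|` dominates. -/
def potX (n : ℤ × ℤ) : ℂ :=
  if n.1 ≠ 0 ∧ |(n.2 : ℝ)| ^ (2 / 3 : ℝ) ≤ |(n.1 : ℝ)| then (2 * Real.pi * n.1 * Complex.I)⁻¹ else 0

/-- The Fourier multiplier of the `∂₂`-potential: `1/(ik₂)` where `|k₂|` dominates. -/
def potY (n : ℤ × ℤ) : ℂ :=
  if n.1 ≠ 0 ∧ ¬ |(n.2 : ℝ)| ^ (2 / 3 : ℝ) ≤ |(n.1 : ℝ)| then (2 * Real.pi * n.2 * Complex.I)⁻¹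
  else 0

theorem potX_fst_zero {n : ℤ × ℤ} (hn : n.1 = 0) : potX n = 0 := by simp [potX, hn]

theorem potY_fst_zero {n : ℤ × ℤ} (hn : n.1 = 0) : potY n = 0 := by simp [potY, hn]

/-- For each frequency exactly one of the two multipliers is active. Where `potY` is active, `n.2`
is nonzero because its weight exceeds `|n.1|`. -/
theorem potX_add_potY {n : ℤ × ℤ} (hn : n.1 ≠ 0) :
    2 * Real.pi * n.1 * Complex.I * potX n + 2 * Real.pi * n.2 * Complex.I * potY n = 1 := by
  have hpi : (Real.pi : ℂ) ≠ 0 := by exact_mod_cast Real.pi_ne_zero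
  have h1 : (n.1 : ℂ) ≠ 0 := by exact_mod_cast hn
  by_cases h : |(n.2 : ℝ)| ^ (2 / 3 : ℝ) ≤ |(n.1 : ℝ)|
  · rw [potX, potY, if_pos ⟨hn, h⟩, if_neg (by simp [h])]
    rw [mul_zero, add_zero]
    exact mul_inv_cancel₀ (by simp [Complex.I_ne_zero, hpi, h1])
  · have h2 : (n.2 : ℂ) ≠ 0 := by
      intro h0
      have : n.2 = 0 := by exact_mod_cast h0
      apply h
      simp [this, Real.zero_rpow]
    rw [potX, potY, if_neg (by simp [h]), if_pos ⟨hn, h⟩, mul_zero, zero_add]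
    exact mul_inv_cancel₀ (by simp [Complex.I_ne_zero, hpi, h2])

/-- On the support, `rho n ≤ 3 |n.1|`, and the factor `3` is absorbed by `2π`. -/
theorem norm_potX_le (n : ℤ × ℤ) : ‖potX n‖ ≤ rho n ^ (-1 : ℝ) := by
  have hr := rho_pos n
  unfold potX
  split_ifs with h
  · have hx := one_le_abs_intCast h.1
    have hn : ‖(2 * Real.pi * n.1 * Complex.I : ℂ)‖ = 2 * Real.pi * |(n.1 : ℝ)| := by
      simp only [norm_mul, Complex.norm_I, mul_one, Complex.norm_real, Complex.norm_intCast,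
        Complex.norm_ofNat, Real.norm_of_nonneg Real.pi_pos.le]
    rw [norm_inv, hn, Real.rpow_neg_one]
    apply inv_anti₀ hr
    have := Real.pi_gt_three
    unfold rho
    nlinarith [h.2]
  · simpa using Real.rpow_nonneg hr.le _

theorem norm_potY_le (n : ℤ × ℤ) : ‖potY n‖ ≤ rho n ^ (-(3 / 2) : ℝ) := by
  have hr := rho_pos n
  unfold potY
  split_ifs with h
  · have hx := one_le_abs_intCast h.1
    have hy := not_le.1 h.2
    have hn : ‖(2 * Real.pi * n.2 * Complex.I : ℂ)‖ = 2 * Real.pi * |(n.2 : ℝ)| := by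
      simp only [norm_mul, Complex.norm_I, mul_one, Complex.norm_real, Complex.norm_intCast,
        Complex.norm_ofNat, Real.norm_of_nonneg Real.pi_pos.le]
    rw [norm_inv, hn, Real.rpow_neg hr.le]
    apply inv_anti₀ (by positivity)
    set y := |(n.2 : ℝ)| ^ (2 / 3 : ℝ) with hyd
    have h1 : rho n ≤ 3 * y := by unfold rho; linarith
    have hy0 : 0 ≤ y := by positivity
    have h2 : rho n ^ (3 / 2 : ℝ) ≤ 3 ^ (3 / 2 : ℝ) * |(n.2 : ℝ)| := by
      calc _ ≤ (3 * y) ^ (3 / 2 : ℝ) := Real.rpow_le_rpow hr.le h1 (by norm_num)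
        _ = _ := by
          rw [Real.mul_rpow (by norm_num) hy0, hyd, ← Real.rpow_mul (abs_nonneg _)]; norm_num
    -- The loss `3^(3/2)` from `rho n ≤ 3y` stays below `2π`, so the bound holds with constant one.
    have h3 : (3 : ℝ) ^ (3 / 2 : ℝ) ≤ 6 := by
      rw [show (3 / 2 : ℝ) = 1 + 1 / 2 by norm_num, Real.rpow_add (by norm_num), Real.rpow_one,
        ← Real.sqrt_eq_rpow]
      have : √(3 : ℝ) ≤ 2 := by rw [Real.sqrt_le_left (by norm_num)]; norm_num
      linarith
    have := Real.pi_gt_three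
    nlinarith [abs_nonneg (n.2 : ℝ)]
  · simpa using Real.rpow_nonneg hr.le _

/-! ### Moments of Gaussian quadratic forms -/

section GaussianQuadratic

variable {Ω : Type*} [MeasurableSpace Ω] {μ : Measure Ω} {ι : Type*} [Fintype ι]

/-- A finite family of independent standard Gaussians, described through its linear combinations. -/
def IsStdGaussianFamily (X : ι → Ω → ℝ) (μ : Measure Ω) : Prop :=
  ∀ t : ι → ℝ, HasLaw (fun ω => ∑ i, t i * X i ω) (gaussianReal 0 (∑ i, t i ^ 2).toNNReal) μ

/-- An orthogonal matrix acts on the coefficient vectors of linear combinations by isometries, so it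
does not change their variances. -/
theorem IsStdGaussianFamily.rotate {X : ι → Ω → ℝ} (hX : IsStdGaussianFamily X μ) [DecidableEq ι]
    {U : Matrix ι ι ℝ} (hU : U.transpose * U = 1) :
    IsStdGaussianFamily (fun i ω => ∑ j, U j i * X j ω) μ := by
  intro t
  have h := hX (U.mulVec t)
  have e1 : ∑ i, (U.mulVec t) i ^ 2 = ∑ i, t i ^ 2 := by
    have : U.mulVec t ⬝ᵥ U.mulVec t = t ⬝ᵥ t := by
      rw [Matrix.dotProduct_mulVec, Matrix.vecMul_mulVec, hU, Matrix.vecMul_one]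
    simpa [dotProduct, sq] using this
  have e2 : (fun ω => ∑ i, (U.mulVec t) i * X i ω) =
      fun ω => ∑ i, t i * ∑ j, U j i * X j ω := by
    funext ω
    simp only [Matrix.mulVec, dotProduct, Finset.sum_mul, Finset.mul_sum]
    rw [Finset.sum_comm]
    exact Finset.sum_congr rfl fun i _ => Finset.sum_congr rfl fun j _ => by ring
  rwa [e1, e2] at h

theorem IsStdGaussianFamily.hasLaw {X : ι → Ω → ℝ} (hX : IsStdGaussianFamily X μ) (i : ι) :
    HasLaw (X i) (gaussianReal 0 1) μ := by
  classical
  have h := hX (Pi.single i 1)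
  simpa [Pi.single_apply] using h

/-- A vector is jointly Gaussian once all its linear functionals are, and those are the linear
combinations in the hypothesis. -/
theorem IsStdGaussianFamily.hasGaussianLaw {X : ι → Ω → ℝ} (hX : IsStdGaussianFamily X μ) :
    HasGaussianLaw (fun ω i => X i ω) μ := by
  classical
  have hm : AEMeasurable (fun ω i => X i ω) μ :=
    aemeasurable_pi_lambda _ fun i => (hX.hasLaw i).aemeasurable
  refine ⟨isGaussian_of_map_eq_gaussianReal fun L => ?_⟩
  refine ⟨0, (∑ i, (L (Pi.single i 1)) ^ 2).toNNReal, ?_⟩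
  rw [AEMeasurable.map_map_of_aemeasurable (by fun_prop) hm, ← (hX fun i => L (Pi.single i 1)).map_eq]
  congr 1
  funext ω
  simp only [Function.comp_apply]
  conv_lhs => rw [pi_eq_sum_univ' (fun i => X i ω), map_sum]
  refine Finset.sum_congr rfl fun i _ => ?_
  have : (fun j => X i ω * if i = j then (1 : ℝ) else 0) = X i ω • Pi.single i (1 : ℝ) := by
    funext j
    simp [Pi.single_apply, eq_comm]
  rw [mul_comm, ← smul_eq_mul, ← map_smul]

/-- Jointly Gaussian and uncorrelated coordinates are independent. The covariance is read off from
`Var (X i + X j) = 2 = Var (X i) + Var (X j)`. -/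
theorem IsStdGaussianFamily.independent {X : ι → Ω → ℝ} (hX : IsStdGaussianFamily X μ) :
    iIndepFun X μ := by
  classical
  have hG := hX.hasGaussianLaw
  have := hG.isProbabilityMeasure
  refine hG.iIndepFun_of_covariance_eq_zero fun i j hij => ?_
  have h2 : ∀ k, MemLp (X k) 2 μ := fun k => (hG.eval k).memLp_two
  have hv : ∀ k, Var[X k; μ] = 1 := fun k => by
    rw [(hX.hasLaw k).variance_eq]; simp
  have hs := (hX (Pi.single i 1 + Pi.single j 1)).variance_eq
  have e : (fun ω => ∑ k, (Pi.single i 1 + Pi.single j 1 : ι → ℝ) k * X k ω) = X i + X j := by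
    funext ω
    simp [Pi.single_apply, add_mul, Finset.sum_add_distrib]
  have e2 : ∑ k, ((Pi.single i 1 + Pi.single j 1 : ι → ℝ) k) ^ 2 = 2 := by
    have : ∀ k, ((Pi.single i 1 + Pi.single j 1 : ι → ℝ) k) ^ 2 =
        (if k = i then 1 else 0) + (if k = j then 1 else 0) := by
      intro k
      simp only [Pi.add_apply, Pi.single_apply]
      split_ifs with h1 h2 <;> first | exact absurd (h1.symm.trans h2) hij | norm_num
    simp only [this, Finset.sum_add_distrib]
    simp; norm_num
  rw [e, e2, variance_add (h2 i) (h2 j), hv, hv] at hs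
  simp at hs
  linarith

theorem integral_exp_mul_sq_gaussianReal {s : ℝ} (hs : s < 1 / 2) :
    ∫⁻ x, ENNReal.ofReal (Real.exp (s * x ^ 2)) ∂(gaussianReal 0 1) =
      ENNReal.ofReal (√(1 - 2 * s))⁻¹ := by
  rw [gaussianReal_of_var_ne_zero _ one_ne_zero,
    lintegral_withDensity_eq_lintegral_mul _ (measurable_gaussianPDF 0 1) (by fun_prop)]
  have e : ∀ x, (gaussianPDF 0 1 * fun x => ENNReal.ofReal (Real.exp (s * x ^ 2))) x =
      ENNReal.ofReal ((√(2 * Real.pi))⁻¹ * Real.exp (-(1 / 2 - s) * x ^ 2)) := by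
    intro x
    simp only [Pi.mul_apply, gaussianPDF, gaussianPDFReal]
    rw [← ENNReal.ofReal_mul (by positivity), mul_assoc, ← Real.exp_add]
    simp
    ring_nf
  simp only [e]
  rw [← ofReal_integral_eq_lintegral_ofReal, integral_const_mul, integral_gaussian]
  · congr 1
    rw [← Real.sqrt_inv, ← Real.sqrt_inv, ← Real.sqrt_mul (by positivity)]
    congr 1
    have h1 : (1 : ℝ) - 2 * s ≠ 0 := by linarith
    have h2 : (1 : ℝ) / 2 - s ≠ 0 := by linarith
    have := Real.pi_pos.ne'
    rw [show (1 : ℝ) / 2 - s = (1 - 2 * s) / 2 by ring]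
    field_simp
  · exact (integrable_exp_neg_mul_sq (by linarith)).const_mul _
  · exact ae_of_all _ fun x => by positivity

/-- The logarithm is expanded to second order with the linear term kept exactly: summed over the
eigenvalues of a trace-free matrix it cancels, and only the square sum survives. -/
theorem inv_sqrt_one_sub_le {u : ℝ} (hu : |u| ≤ 1 / 4) :
    (√(1 - 2 * u))⁻¹ ≤ Real.exp (u + 4 * u ^ 2) := by
  have hu' := abs_le.1 hu
  have h1 : 0 < 1 - 2 * u := by linarith [hu'.2]
  have h2 : |2 * u| < 1 := by rw [abs_mul]; norm_num; linarith
  have h := Real.abs_log_sub_add_sum_range_le h2 1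
  simp only [Finset.range_one, Finset.sum_singleton] at h
  norm_num at h
  have h3 := (abs_le.1 h).1
  have h4 : (2 * |u|) ^ 2 / (1 - 2 * |u|) ≤ 8 * u ^ 2 := by
    rw [div_le_iff₀ (by linarith)]
    have := sq_abs u
    nlinarith [abs_nonneg u]
  have h5 : -2 * u - 8 * u ^ 2 ≤ Real.log (1 - 2 * u) := by linarith
  rw [← Real.exp_log (inv_pos.2 (Real.sqrt_pos.2 h1)), Real.log_inv, Real.log_sqrt h1.le]
  apply Real.exp_le_exp.2
  linarith

theorem exists_diagonalization [DecidableEq ι] {M : Matrix ι ι ℝ} (hM : M.IsHermitian) :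
    ∃ (U : Matrix ι ι ℝ) (d : ι → ℝ), U.transpose * U = 1 ∧
      M = U * Matrix.diagonal d * U.transpose := by
  refine ⟨hM.eigenvectorUnitary, hM.eigenvalues, ?_, ?_⟩
  · have := Unitary.coe_star_mul_self hM.eigenvectorUnitary
    simpa [Matrix.star_eq_conjTranspose] using this
  · have := hM.spectral_theorem
    rw [Unitary.conjStarAlgAut_apply] at this
    simpa [Matrix.star_eq_conjTranspose, Function.comp_def] using this

/-- In an eigenbasis the form is `∑ d i * Y i ^ 2` with independent standard Gaussians `Y i`, so the
exponential moment factorizes and is at most `exp (t ∑ d i + 4 t² ∑ d i ²)`. The first sum is the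
trace, the second the squared Hilbert-Schmidt norm, and neither depends on the number of variables.
-/
theorem IsStdGaussianFamily.lintegral_exp_quadratic_le {X : ι → Ω → ℝ}
    (hX : IsStdGaussianFamily X μ) {M : Matrix ι ι ℝ} (hM : M.IsHermitian) (htr : M.trace = 0)
    (hF : ∑ i, ∑ j, M i j ^ 2 ≤ 1) {t : ℝ} (ht : |t| ≤ 1 / 4) :
    ∫⁻ ω, ENNReal.ofReal (Real.exp (t * ∑ i, ∑ j, M i j * X i ω * X j ω)) ∂μ ≤
      ENNReal.ofReal (Real.exp 1) := by
  classical
  obtain ⟨U, d, hU, rfl⟩ := exists_diagonalization hM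
  set Y : ι → Ω → ℝ := fun i ω => ∑ j, U j i * X j ω with hY
  have hYg := hX.rotate hU
  have hd1 : ∑ i, d i = 0 := by
    rw [Matrix.trace_mul_cycle, hU, one_mul, Matrix.trace_diagonal] at htr
    exact htr
  have hd2 : ∑ i, d i ^ 2 ≤ 1 := by
    refine le_trans (le_of_eq ?_) hF
    have h1 : Matrix.trace ((U * Matrix.diagonal d * U.transpose) *
        (U * Matrix.diagonal d * U.transpose).transpose) = ∑ i, d i ^ 2 := by
      rw [Matrix.transpose_mul, Matrix.transpose_mul, Matrix.transpose_transpose,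
        Matrix.diagonal_transpose]
      have : U * Matrix.diagonal d * U.transpose * (U * (Matrix.diagonal d * U.transpose)) =
          U * (Matrix.diagonal d * Matrix.diagonal d) * U.transpose := by
        calc _ = U * Matrix.diagonal d * (U.transpose * U) * Matrix.diagonal d * U.transpose := by
              simp only [Matrix.mul_assoc]
          _ = _ := by rw [hU]; simp only [Matrix.mul_assoc, Matrix.one_mul]
      rw [this, Matrix.trace_mul_cycle, hU, one_mul, Matrix.diagonal_mul_diagonal,
        Matrix.trace_diagonal]
      exact Finset.sum_congr rfl fun i _ => (sq _).symm
    rw [← h1]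
    generalize U * Matrix.diagonal d * U.transpose = N
    simp [Matrix.trace, Matrix.mul_apply, sq]
  have hdi : ∀ i, |t * d i| ≤ 1 / 4 := by
    intro i
    have h1 : d i ^ 2 ≤ 1 := (Finset.single_le_sum (f := fun i => d i ^ 2)
      (fun i _ => sq_nonneg _) (Finset.mem_univ i)).trans hd2
    have h2 : |d i| ≤ 1 := by rw [← sq_le_one_iff_abs_le_one]; exact h1
    rw [abs_mul]
    nlinarith [abs_nonneg t, abs_nonneg (d i)]
  have hQ : ∀ ω, t * ∑ i, ∑ j, (U * Matrix.diagonal d * U.transpose) i j * X i ω * X j ω =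
      ∑ i, t * d i * Y i ω ^ 2 := by
    intro ω
    have : ∑ i, ∑ j, (U * Matrix.diagonal d * U.transpose) i j * X i ω * X j ω =
        ∑ i, d i * Y i ω ^ 2 := by
      have e : ∀ i j, (U * Matrix.diagonal d * U.transpose) i j = ∑ k, U i k * d k * U j k :=
        fun i j => by
          rw [Matrix.mul_apply]
          simp only [Matrix.mul_diagonal, Matrix.transpose_apply]
      simp only [e, hY, sq, Finset.sum_mul, Finset.mul_sum]
      conv_lhs => enter [2, i]; rw [Finset.sum_comm]
      rw [Finset.sum_comm]
      refine Finset.sum_congr rfl fun k _ => Finset.sum_congr rfl fun i _ =>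
        Finset.sum_congr rfl fun j _ => by ring
    rw [this, Finset.mul_sum]
    exact Finset.sum_congr rfl fun i _ => by ring
  have hexp : ∀ ω, ENNReal.ofReal (Real.exp (t * ∑ i, ∑ j,
      (U * Matrix.diagonal d * U.transpose) i j * X i ω * X j ω)) =
      ∏ i, ENNReal.ofReal (Real.exp (t * d i * Y i ω ^ 2)) := by
    intro ω
    rw [hQ, Real.exp_sum, ENNReal.ofReal_prod_of_nonneg fun i _ => (Real.exp_pos _).le]
  simp only [hexp]
  have hind : iIndepFun (fun i ω => ENNReal.ofReal (Real.exp (t * d i * Y i ω ^ 2))) μ :=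
    hYg.independent.comp (fun i x => ENNReal.ofReal (Real.exp (t * d i * x ^ 2)))
      fun i => by fun_prop
  have hone : ∀ i, ∫⁻ ω, ENNReal.ofReal (Real.exp (t * d i * Y i ω ^ 2)) ∂μ ≤
      ENNReal.ofReal (Real.exp (t * d i + 4 * (t * d i) ^ 2)) := by
    intro i
    have h1 := (hYg.hasLaw i).lintegral_comp
      (f := fun x => ENNReal.ofReal (Real.exp (t * d i * x ^ 2))) (by fun_prop)
    have h1' : ∫⁻ ω, ENNReal.ofReal (Real.exp (t * d i * Y i ω ^ 2)) ∂μ =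
      ∫⁻ x, ENNReal.ofReal (Real.exp (t * d i * x ^ 2)) ∂(gaussianReal 0 1) := h1
    rw [h1', integral_exp_mul_sq_gaussianReal (by linarith [(abs_le.1 (hdi i)).2])]
    exact ENNReal.ofReal_le_ofReal (inv_sqrt_one_sub_le (hdi i))
  have hmeas : ∀ i, AEMeasurable (fun ω => ENNReal.ofReal (Real.exp (t * d i * Y i ω ^ 2))) μ :=
    fun i => by
      have := (hYg.hasLaw i).aemeasurable
      fun_prop
  -- The variables are only almost everywhere measurable, so the product formula is applied to
  -- measurable modifications.
  have hmk : ∀ᵐ ω ∂μ, ∀ i, ENNReal.ofReal (Real.exp (t * d i * Y i ω ^ 2)) = (hmeas i).mk _ ω :=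
    ae_all_iff.2 fun i => (hmeas i).ae_eq_mk
  calc _ = ∫⁻ ω, ∏ i, (hmeas i).mk _ ω ∂μ := by
        refine lintegral_congr_ae ?_
        filter_upwards [hmk] with ω hω
        exact Finset.prod_congr rfl fun i _ => hω i
    _ = ∏ i, ∫⁻ ω, (hmeas i).mk _ ω ∂μ :=
        lintegral_prod_eq_prod_lintegral_of_indepFun _ _
          (hind.congr fun i => (hmeas i).ae_eq_mk) fun i => (hmeas i).measurable_mk
    _ = ∏ i, ∫⁻ ω, ENNReal.ofReal (Real.exp (t * d i * Y i ω ^ 2)) ∂μ :=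
        Finset.prod_congr rfl fun i _ => lintegral_congr_ae (hmeas i).ae_eq_mk.symm
    _ ≤ ∏ i, ENNReal.ofReal (Real.exp (t * d i + 4 * (t * d i) ^ 2)) :=
        Finset.prod_le_prod' fun i _ => hone i
    _ = ENNReal.ofReal (Real.exp (∑ i, (t * d i + 4 * (t * d i) ^ 2))) := by
        rw [Real.exp_sum, ENNReal.ofReal_prod_of_nonneg fun i _ => (Real.exp_pos _).le]
    _ ≤ _ := by
        apply ENNReal.ofReal_le_ofReal (Real.exp_le_exp.2 _)
        rw [Finset.sum_add_distrib, ← Finset.mul_sum, ← Finset.mul_sum, hd1]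
        simp only [mul_pow]
        rw [← Finset.mul_sum, ← sq_abs]
        have h0 : 0 ≤ ∑ i, d i ^ 2 := Finset.sum_nonneg fun i _ => sq_nonneg _
        nlinarith [abs_nonneg t, mul_le_mul ht ht (abs_nonneg t) (by norm_num)]

theorem abs_pow_even_le_exp (q : ℕ) (x : ℝ) :
    |x| ^ (2 * q) ≤ (2 * q).factorial * (Real.exp x + Real.exp (-x)) := by
  have h := Real.pow_div_factorial_le_exp (x := |x|) (abs_nonneg x) (2 * q)
  have h2 : Real.exp |x| ≤ Real.exp x + Real.exp (-x) := by
    rcases abs_cases x with ⟨h, _⟩ | ⟨h, _⟩ <;> rw [h] <;> linarith [Real.exp_pos x, Real.exp_pos (-x)]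
  rw [div_le_iff₀ (by positivity)] at h
  calc _ ≤ _ := h
    _ ≤ (Real.exp x + Real.exp (-x)) * (2 * q).factorial := by gcongr
    _ = _ := mul_comm _ _

/-- The even moments of a centered quadratic form in independent standard Gaussians are controlled by
its Hilbert-Schmidt norm. -/
theorem IsStdGaussianFamily.lintegral_quadratic_pow_le (q : ℕ) {X : ι → Ω → ℝ}
    (hX : IsStdGaussianFamily X μ) (M : ι → ι → ℝ) (htr : ∑ i, M i i = 0) {σ : ℝ} (hσ : 0 < σ)
    (hF : ∑ i, ∑ j, M i j ^ 2 ≤ σ ^ 2) :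
    ∫⁻ ω, ENNReal.ofReal (|∑ i, ∑ j, M i j * X i ω * X j ω| ^ (2 * q)) ∂μ ≤
      ENNReal.ofReal (4 ^ (2 * q) * (2 * q).factorial * (2 * Real.exp 1) * σ ^ (2 * q)) := by
  classical
  -- Symmetrizing leaves the form unchanged and does not increase the Hilbert-Schmidt norm. Division
  -- by `σ` normalizes that norm to at most one.
  set N : Matrix ι ι ℝ := Matrix.of fun i j => (M i j + M j i) / (2 * σ) with hN
  have hherm : N.IsHermitian := by
    ext i j
    simp [hN, add_comm]
  have hNtr : N.trace = 0 := by
    simp only [hN, Matrix.trace, Matrix.diag_apply, Matrix.of_apply, ← two_mul]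
    rw [← Finset.sum_div, ← Finset.mul_sum, htr]; simp
  have hNF : ∑ i, ∑ j, N i j ^ 2 ≤ 1 := by
    have h1 : ∀ i j, N i j ^ 2 ≤ (M i j ^ 2 + M j i ^ 2) / (2 * σ ^ 2) := by
      intro i j
      simp only [hN, Matrix.of_apply, div_pow, mul_pow]
      rw [div_le_div_iff₀ (by positivity) (by positivity)]
      have := mul_nonneg (sq_nonneg (M i j - M j i)) (sq_nonneg σ)
      nlinarith
    calc _ ≤ ∑ i, ∑ j, (M i j ^ 2 + M j i ^ 2) / (2 * σ ^ 2) :=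
          Finset.sum_le_sum fun i _ => Finset.sum_le_sum fun j _ => h1 i j
      _ = (∑ i, ∑ j, M i j ^ 2 + ∑ i, ∑ j, M j i ^ 2) / (2 * σ ^ 2) := by
          simp only [← Finset.sum_div, Finset.sum_add_distrib]
      _ = (2 * ∑ i, ∑ j, M i j ^ 2) / (2 * σ ^ 2) := by
          rw [Finset.sum_comm (f := fun i j => M j i ^ 2)]; ring
      _ ≤ 1 := by rw [div_le_one (by positivity)]; linarith
  have hQ : ∀ ω, ∑ i, ∑ j, M i j * X i ω * X j ω =
      4 * σ * (1 / 4 * ∑ i, ∑ j, N i j * X i ω * X j ω) := by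
    intro ω
    have : ∑ i, ∑ j, N i j * X i ω * X j ω = (∑ i, ∑ j, M i j * X i ω * X j ω) / σ := by
      have e : ∀ i j, N i j * X i ω * X j ω =
          (M i j * X i ω * X j ω + M j i * X j ω * X i ω) / (2 * σ) := fun i j => by
        simp only [hN, Matrix.of_apply]; ring
      simp only [e, ← Finset.sum_div, Finset.sum_add_distrib]
      rw [Finset.sum_comm (f := fun i j => M j i * X j ω * X i ω)]
      field_simp; ring
    rw [this]; field_simp
  have h1 := hX.lintegral_exp_quadratic_le hherm hNtr hNF (t := 1 / 4) (by norm_num [abs_of_pos])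
  have h2 := hX.lintegral_exp_quadratic_le hherm hNtr hNF (t := -(1 / 4))
    (by rw [abs_neg]; norm_num [abs_of_pos])
  set R : Ω → ℝ := fun ω => 1 / 4 * ∑ i, ∑ j, N i j * X i ω * X j ω with hR
  have hRm : AEMeasurable R μ := by
    have := fun i => (hX.hasLaw i).aemeasurable
    fun_prop
  have h2' : ∫⁻ ω, ENNReal.ofReal (Real.exp (-R ω)) ∂μ ≤ ENNReal.ofReal (Real.exp 1) := by
    simpa only [hR, neg_mul] using h2
  -- A power is dominated by the exponentials of both signs, at `t = ±1/4`. Undoing the factors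
  -- `1/4` and `1/σ` produces `4 ^ (2q) σ ^ (2q)`.
  calc _ ≤ ∫⁻ ω, ENNReal.ofReal (4 ^ (2 * q) * σ ^ (2 * q) * (2 * q).factorial) *
        (ENNReal.ofReal (Real.exp (R ω)) + ENNReal.ofReal (Real.exp (-R ω))) ∂μ := by
        refine lintegral_mono fun ω => ?_
        rw [← ENNReal.ofReal_add (Real.exp_pos _).le (Real.exp_pos _).le,
          ← ENNReal.ofReal_mul (by positivity)]
        apply ENNReal.ofReal_le_ofReal
        rw [hQ, abs_mul, abs_of_pos (by positivity), mul_pow, mul_pow, mul_assoc]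
        have := abs_pow_even_le_exp q (R ω)
        rw [mul_assoc, mul_assoc]
        gcongr
    _ = ENNReal.ofReal (4 ^ (2 * q) * σ ^ (2 * q) * (2 * q).factorial) *
        (∫⁻ ω, ENNReal.ofReal (Real.exp (R ω)) ∂μ +
          ∫⁻ ω, ENNReal.ofReal (Real.exp (-R ω)) ∂μ) := by
        rw [lintegral_const_mul'' _ (by fun_prop), lintegral_add_left' (by fun_prop)]
    _ ≤ ENNReal.ofReal (4 ^ (2 * q) * σ ^ (2 * q) * (2 * q).factorial) *
        (ENNReal.ofReal (Real.exp 1) + ENNReal.ofReal (Real.exp 1)) := by gcongr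
    _ = _ := by
        rw [← ENNReal.ofReal_add (Real.exp_pos _).le (Real.exp_pos _).le,
          ← ENNReal.ofReal_mul (by positivity)]
        congr 1; ring

end GaussianQuadratic

/-! ### Characters of the torus and white noise -/

/-- The character `e^{ik·x}`, `k = 2πn`. -/
def chr (n : ℤ × ℤ) (x : ℝ × ℝ) : ℂ :=
  Complex.exp ((2 * Real.pi * (n.1 * x.1 + n.2 * x.2) : ℝ) * Complex.I)

theorem chr_re (n : ℤ × ℤ) (x : ℝ × ℝ) : (chr n x).re = (cosTest n : ℝ × ℝ → ℝ) x :=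
  Complex.exp_ofReal_mul_I_re _

theorem chr_im (n : ℤ × ℤ) (x : ℝ × ℝ) : (chr n x).im = (sinTest n : ℝ × ℝ → ℝ) x :=
  Complex.exp_ofReal_mul_I_im _

@[simp] theorem norm_chr (n : ℤ × ℤ) (x : ℝ × ℝ) : ‖chr n x‖ = 1 :=
  Complex.norm_exp_ofReal_mul_I _

theorem chr_add (n m : ℤ × ℤ) (x : ℝ × ℝ) : chr (n + m) x = chr n x * chr m x := by
  unfold chr
  rw [← Complex.exp_add]
  congr 1
  push_cast [Prod.fst_add, Prod.snd_add]
  ring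

theorem chr_add_arg (n : ℤ × ℤ) (x y : ℝ × ℝ) : chr n (x + y) = chr n x * chr n y := by
  unfold chr
  rw [← Complex.exp_add]
  congr 1
  push_cast [Prod.fst_add, Prod.snd_add]
  ring

theorem chr_int (n z : ℤ × ℤ) : chr n ((z.1 : ℝ), (z.2 : ℝ)) = 1 := by
  unfold chr
  rw [Complex.exp_eq_one_iff]
  refine ⟨n.1 * z.1 + n.2 * z.2, ?_⟩
  push_cast
  ring

theorem chr_neg (n : ℤ × ℤ) (x : ℝ × ℝ) : chr (-n) x = starRingEnd ℂ (chr n x) := by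
  unfold chr
  rw [← Complex.exp_conj]
  congr 1
  rw [map_mul, Complex.conj_ofReal, Complex.conj_I]
  push_cast [Prod.fst_neg, Prod.snd_neg]
  ring

@[simp] theorem chr_zero (x : ℝ × ℝ) : chr 0 x = 1 := by simp [chr]

@[fun_prop] theorem continuous_chr (n : ℤ × ℤ) : Continuous (chr n) := by
  unfold chr; fun_prop

theorem chr_add_one_fst (n : ℤ × ℤ) (x : ℝ × ℝ) : chr n (x.1 + 1, x.2) = chr n x := by
  have h := chr_add_arg n x (((1 : ℤ) : ℝ), ((0 : ℤ) : ℝ))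
  rw [chr_int n (1, 0), mul_one] at h
  rw [← h]
  congr 1
  ext <;> simp

theorem chr_add_one_snd (n : ℤ × ℤ) (x : ℝ × ℝ) : chr n (x.1, x.2 + 1) = chr n x := by
  have h := chr_add_arg n x (((0 : ℤ) : ℝ), ((1 : ℤ) : ℝ))
  rw [chr_int n (0, 1), mul_one] at h
  rw [← h]
  congr 1
  ext <;> simp

theorem integral_exp_int (n : ℤ) :
    ∫ t in Ico (0 : ℝ) 1, Complex.exp ((2 * Real.pi * n * t : ℝ) * Complex.I) =
      if n = 0 then 1 else 0 := by
  rw [integral_Ico_eq_integral_Ioc, ← intervalIntegral.integral_of_le zero_le_one]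
  split_ifs with h
  · simp [h]
  · have hc : (2 * Real.pi * n * Complex.I : ℂ) ≠ 0 := by
      have : (n : ℂ) ≠ 0 := by exact_mod_cast h
      have : (Real.pi : ℂ) ≠ 0 := by exact_mod_cast Real.pi_ne_zero
      simp_all
    have := integral_exp_mul_complex (a := 0) (b := 1) hc
    calc _ = ∫ t in (0 : ℝ)..1, Complex.exp (2 * Real.pi * n * Complex.I * t) := by
          congr 1; funext t; congr 1; push_cast; ring
      _ = _ := by
          rw [this]
          have e : Complex.exp (2 * Real.pi * n * Complex.I * ((1 : ℝ) : ℂ)) = 1 := by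
            rw [Complex.exp_eq_one_iff]
            exact ⟨n, by push_cast; ring⟩
          rw [e]; simp

theorem volume_cell : volume cell = 1 := by
  rw [cell, Measure.volume_eq_prod, Measure.prod_prod]; simp

instance : IsProbabilityMeasure (volume.restrict cell) :=
  ⟨by rw [Measure.restrict_apply_univ, volume_cell]⟩

theorem chr_eq_mul (n : ℤ × ℤ) (x : ℝ × ℝ) :
    chr n x = Complex.exp ((2 * Real.pi * n.1 * x.1 : ℝ) * Complex.I) *
      Complex.exp ((2 * Real.pi * n.2 * x.2 : ℝ) * Complex.I) := by
  unfold chr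
  rw [← Complex.exp_add]; congr 1; push_cast; ring

theorem integral_chr (n : ℤ × ℤ) : ∫ x in cell, chr n x = if n = 0 then 1 else 0 := by
  have h := setIntegral_prod_mul (μ := (volume : Measure ℝ)) (ν := (volume : Measure ℝ))
    (fun t : ℝ => Complex.exp ((2 * Real.pi * n.1 * t : ℝ) * Complex.I))
    (fun t : ℝ => Complex.exp ((2 * Real.pi * n.2 * t : ℝ) * Complex.I)) (Ico 0 1) (Ico 0 1)
  rw [← Measure.volume_eq_prod] at h
  simp only [chr_eq_mul]
  unfold cell
  rw [h, integral_exp_int, integral_exp_int]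
  by_cases h1 : n.1 = 0 <;> by_cases h2 : n.2 = 0 <;> simp [h1, h2, Prod.ext_iff]

theorem isCompact_square : IsCompact (Icc (0 : ℝ) 1 ×ˢ Icc (0 : ℝ) 1) := isCompact_Icc.prod isCompact_Icc

theorem cell_subset_square : cell ⊆ Icc (0 : ℝ) 1 ×ˢ Icc (0 : ℝ) 1 :=
  prod_mono Ico_subset_Icc_self Ico_subset_Icc_self

theorem integrableOn_cell {F : Type*} [NormedAddCommGroup F] {f : ℝ × ℝ → F} (hf : Continuous f) :
    IntegrableOn f cell :=
  (hf.continuousOn.integrableOn_compact isCompact_square).mono_set cell_subset_square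

/-! ### White noise in the Hartley basis -/

/-- The real Hartley character `cos (2πn·x) + sin (2πn·x)`. -/
def casTest (n : ℤ × ℤ) : TorusTest := cosTest n + sinTest n

theorem casTest_mul (n m : ℤ × ℤ) (x : ℝ × ℝ) :
    (casTest n : ℝ × ℝ → ℝ) x * (casTest m : ℝ × ℝ → ℝ) x = (chr (n - m) x).re + (chr (n + m) x).im := by
  have h1 := chr_add n (-m) x
  rw [← sub_eq_add_neg, chr_neg] at h1
  rw [h1, chr_add]
  change ((cosTest n : ℝ × ℝ → ℝ) x + (sinTest n : ℝ × ℝ → ℝ) x) *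
    ((cosTest m : ℝ × ℝ → ℝ) x + (sinTest m : ℝ × ℝ → ℝ) x) = _
  rw [← chr_re, ← chr_im, ← chr_re, ← chr_im]
  simp
  ring

/-- The Hartley functions form a real orthonormal system indexed by all of `ℤ²`, so no half-lattice
of frequencies has to be chosen. The sine part of the product always integrates to zero. -/
theorem integral_casTest_mul (n m : ℤ × ℤ) :
    ∫ x in cell, (casTest n : ℝ × ℝ → ℝ) x * (casTest m : ℝ × ℝ → ℝ) x = if n = m then 1 else 0 := by
  simp only [casTest_mul]
  have i1 := integrableOn_cell (continuous_chr (n - m))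
  have i2 := integrableOn_cell (continuous_chr (n + m))
  have e0 := integral_add i1.re i2.im
  have e1 := integral_re i1
  have e2 := integral_im i2
  simp only [RCLike.re_to_complex, RCLike.im_to_complex] at e0 e1 e2
  rw [e0, e1, e2, integral_chr, integral_chr]
  by_cases h : n = m
  · subst h
    by_cases h2 : n + n = 0 <;> simp [h2]
  · by_cases h2 : n + m = 0 <;> simp [h, h2, sub_eq_zero]

theorem pair_add (f : PeriodicDistribution) (ζ η : TorusTest) :
    pair f (ζ + η) = pair f ζ + pair f η := map_add (f : TorusTest →ₗ[ℝ] ℝ) ζ η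

theorem pair_smul (f : PeriodicDistribution) (c : ℝ) (ζ : TorusTest) :
    pair f (c • ζ) = c * pair f ζ := map_smul (f : TorusTest →ₗ[ℝ] ℝ) c ζ

theorem pair_sum {ι : Type*} (s : Finset ι) (f : PeriodicDistribution) (ζ : ι → TorusTest) :
    pair f (∑ i ∈ s, ζ i) = ∑ i ∈ s, pair f (ζ i) := map_sum (f : TorusTest →ₗ[ℝ] ℝ) ζ s

theorem pair_neg (f : PeriodicDistribution) (ζ : TorusTest) :
    pair f (-ζ) = -pair f ζ := map_neg (f : TorusTest →ₗ[ℝ] ℝ) ζ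

theorem cosTest_neg (n : ℤ × ℤ) : cosTest (-n) = cosTest n := by
  apply Subtype.ext; funext x
  rw [← chr_re, ← chr_re, chr_neg, Complex.conj_re]

theorem sinTest_neg (n : ℤ × ℤ) : sinTest (-n) = -sinTest n := by
  apply Subtype.ext; funext x
  change _ = -((sinTest n : ℝ × ℝ → ℝ) x)
  rw [← chr_im, ← chr_im, chr_neg, Complex.conj_im]

/-- Complex coefficients become combinations of two real Hartley coefficients, which for white noise
are independent standard Gaussians. -/
theorem fourierCoeff_eq_casTest (f : PeriodicDistribution) (n : ℤ × ℤ) :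
    fourierCoeff f n = (1 - Complex.I) / 2 * pair f (casTest n) +
      (1 + Complex.I) / 2 * pair f (casTest (-n)) := by
  unfold fourierCoeff casTest
  rw [pair_add, pair_add, cosTest_neg, sinTest_neg, pair_neg]
  push_cast
  ring

theorem fourierCoeff_neg (f : PeriodicDistribution) (n : ℤ × ℤ) :
    fourierCoeff f (-n) = starRingEnd ℂ (fourierCoeff f n) := by
  unfold fourierCoeff
  rw [cosTest_neg, sinTest_neg, pair_neg]
  simp

/-- By linearity a combination of the coefficients is `ξ` tested against one function, and
orthonormality evaluates the square integral of that function. -/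
theorem IsWhiteNoise.isStdGaussianFamily {Ω : Type*} [MeasurableSpace Ω] {μ : Measure Ω}
    {ξ : Ω → PeriodicDistribution} (hξ : IsWhiteNoise μ ξ) (S : Finset (ℤ × ℤ)) :
    IsStdGaussianFamily (fun (n : S) ω => pair (ξ ω) (casTest n)) μ := by
  intro t
  have h := hξ (∑ n : S, t n • casTest n)
  have e1 : (fun ω => pair (ξ ω) (∑ n : S, t n • casTest n)) =
      fun ω => ∑ n : S, t n * pair (ξ ω) (casTest n) := by
    funext ω
    rw [pair_sum]
    exact Finset.sum_congr rfl fun i _ => pair_smul _ _ _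
  have e2 : ∫ x in cell, ((∑ n : S, t n • casTest n : TorusTest) : ℝ × ℝ → ℝ) x ^ 2 =
      ∑ n, t n ^ 2 := by
    have e3 : ∀ x, ((∑ n : S, t n • casTest n : TorusTest) : ℝ × ℝ → ℝ) x ^ 2 =
        ∑ n : S, ∑ m : S, t n * t m *
          ((casTest n : ℝ × ℝ → ℝ) x * (casTest m : ℝ × ℝ → ℝ) x) := by
      intro x
      have : ((∑ n : S, t n • casTest n : TorusTest) : ℝ × ℝ → ℝ) x =
          ∑ n : S, t n * (casTest n : ℝ × ℝ → ℝ) x := by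
        simp
      rw [this, sq, Finset.sum_mul_sum]
      exact Finset.sum_congr rfl fun n _ => Finset.sum_congr rfl fun m _ => by ring
    have hi : ∀ n m : S, IntegrableOn (fun x => t n * t m *
          ((casTest n : ℝ × ℝ → ℝ) x * (casTest m : ℝ × ℝ → ℝ) x)) cell := fun n m =>
      integrableOn_cell (continuous_const.mul
        ((casTest n).2.1.continuous.mul (casTest m).2.1.continuous))
    simp only [e3]
    rw [integral_finsetSum _ fun n _ => integrable_finsetSum _ fun m _ => hi n m]
    refine Finset.sum_congr rfl fun n _ => ?_
    rw [integral_finsetSum _ fun m _ => hi n m]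
    simp only [integral_const_mul, integral_casTest_mul, Subtype.coe_inj]
    simp [sq]
  rwa [e1, e2] at h

theorem IsWhiteNoise.aemeasurable_fourierCoeff {Ω : Type*} [MeasurableSpace Ω] {μ : Measure Ω}
    {ξ : Ω → PeriodicDistribution} (hξ : IsWhiteNoise μ ξ) (n : ℤ × ℤ) :
    AEMeasurable (fun ω => fourierCoeff (ξ ω) n) μ := by
  have h1 := (hξ (cosTest n)).aemeasurable
  have h2 := (hξ (sinTest n)).aemeasurable
  unfold fourierCoeff
  fun_prop

/-- The constant in the moment bound for quadratic forms of white noise. -/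
def chaosConst (q : ℕ) : ℝ :=
  2 ^ (2 * q) * 2 * (4 ^ (2 * q) * (2 * q).factorial * (2 * Real.exp 1)) * 2 ^ (2 * q)

theorem chaosConst_pos (q : ℕ) : 0 < chaosConst q := by unfold chaosConst; positivity

theorem norm_sq_four_le (a b c d : ℂ) : ‖a + b + c + d‖ ^ 2 ≤
    4 * (‖a‖ ^ 2 + ‖b‖ ^ 2 + ‖c‖ ^ 2 + ‖d‖ ^ 2) := by
  have h : ‖a + b + c + d‖ ≤ ‖a‖ + ‖b‖ + ‖c‖ + ‖d‖ :=
    (norm_add_le _ _).trans (by gcongr; exact norm_add₃_le)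
  have h2 := pow_le_pow_left₀ (norm_nonneg _) h 2
  nlinarith [sq_nonneg (‖a‖ - ‖b‖), sq_nonneg (‖a‖ - ‖c‖), sq_nonneg (‖a‖ - ‖d‖),
    sq_nonneg (‖b‖ - ‖c‖), sq_nonneg (‖b‖ - ‖d‖), sq_nonneg (‖c‖ - ‖d‖)]

theorem sum_neg_eq {S : Finset (ℤ × ℤ)} (hS : ∀ n ∈ S, -n ∈ S) {E : Type*} [AddCommMonoid E]
    (f : ℤ × ℤ → E) : ∑ n ∈ S, f (-n) = ∑ n ∈ S, f n :=
  Finset.sum_nbij' (fun n => -n) (fun n => -n) hS hS (by simp) (by simp) (by simp)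

/-- The even moments of an off-diagonal quadratic form in the Fourier coefficients of white noise. -/
theorem IsWhiteNoise.lintegral_quadratic_pow_le {Ω : Type*} [MeasurableSpace Ω] {μ : Measure Ω}
    {ξ : Ω → PeriodicDistribution} (hξ : IsWhiteNoise μ ξ) (q : ℕ) {S : Finset (ℤ × ℤ)}
    (hS : ∀ n ∈ S, -n ∈ S) (B : ℤ × ℤ → ℤ × ℤ → ℂ) (hB : ∀ n, B n (-n) = 0)
    {σ : ℝ} (hσ : 0 < σ) (hF : ∑ n ∈ S, ∑ m ∈ S, ‖B n m‖ ^ 2 ≤ σ ^ 2) :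
    ∫⁻ ω, ‖∑ n ∈ S, ∑ m ∈ S, B n m * fourierCoeff (ξ ω) n * fourierCoeff (ξ ω) m‖ₑ ^ (2 * q) ∂μ ≤
      ENNReal.ofReal (chaosConst q * σ ^ (2 * q)) := by
  set X : ℤ × ℤ → Ω → ℝ := fun n ω => pair (ξ ω) (casTest n) with hX
  set wp : ℂ := (1 - Complex.I) / 2 with hwp
  set wm : ℂ := (1 + Complex.I) / 2 with hwm
  have hI : Complex.I ^ 2 = -1 := Complex.I_sq
  -- This identity removes the diagonal entries `B n n` from the trace below.
  have hwpwm : wp * wp + wm * wm = 0 := by rw [hwp, hwm]; linear_combination (1 / 2 : ℂ) * hI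
  have hwp2 : ‖wp‖ ^ 2 = 1 / 2 := by
    rw [← Complex.normSq_eq_norm_sq, hwp]; simp [Complex.normSq_apply]; norm_num
  have hwm2 : ‖wm‖ ^ 2 = 1 / 2 := by
    rw [← Complex.normSq_eq_norm_sq, hwm]; simp [Complex.normSq_apply]; norm_num
  -- The coefficient matrix in the real Gaussians, obtained by inserting the Hartley expansion and
  -- reflecting frequencies. The symmetry of `S` permits the reflections.
  set A : ℤ × ℤ → ℤ × ℤ → ℂ := fun n m => wp * wp * B n m + wp * wm * B n (-m) +
    wm * wp * B (-n) m + wm * wm * B (-n) (-m) with hA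
  have hQ : ∀ ω, ∑ n ∈ S, ∑ m ∈ S, B n m * fourierCoeff (ξ ω) n * fourierCoeff (ξ ω) m =
      ∑ n ∈ S, ∑ m ∈ S, A n m * X n ω * X m ω := by
    intro ω
    have s1 : ∀ f : ℤ × ℤ → ℤ × ℤ → ℂ, ∑ n ∈ S, ∑ m ∈ S, f n (-m) = ∑ n ∈ S, ∑ m ∈ S, f n m :=
      fun f => Finset.sum_congr rfl fun n _ => sum_neg_eq hS (f n)
    have s2 : ∀ f : ℤ × ℤ → ℤ × ℤ → ℂ, ∑ n ∈ S, ∑ m ∈ S, f (-n) m = ∑ n ∈ S, ∑ m ∈ S, f n m :=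
      fun f => sum_neg_eq hS fun n => ∑ m ∈ S, f n m
    have e1 : ∀ n m, B n m * fourierCoeff (ξ ω) n * fourierCoeff (ξ ω) m =
        wp * wp * B n m * X n ω * X m ω + wp * wm * B n m * X n ω * X (-m) ω +
        wm * wp * B n m * X (-n) ω * X m ω + wm * wm * B n m * X (-n) ω * X (-m) ω := by
      intro n m
      rw [fourierCoeff_eq_casTest, fourierCoeff_eq_casTest]
      ring
    have e2 : ∀ n m, A n m * X n ω * X m ω = wp * wp * B n m * X n ω * X m ω +
        wp * wm * B n (-m) * X n ω * X m ω + wm * wp * B (-n) m * X n ω * X m ω +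
        wm * wm * B (-n) (-m) * X n ω * X m ω := by
      intro n m
      simp only [hA]; ring
    simp only [e1, e2, Finset.sum_add_distrib]
    congr 1
    · congr 1
      · congr 1
        rw [← s1 fun n m => wp * wm * B n m * X n ω * X (-m) ω]
        simp only [neg_neg]
      · rw [← s2 fun n m => wm * wp * B n m * X (-n) ω * X m ω]
        simp only [neg_neg]
    · rw [← s1 fun n m => wm * wm * B n m * X (-n) ω * X (-m) ω,
        ← s2 fun n m => wm * wm * B n (-m) * X (-n) ω * X (- -m) ω]
      simp only [neg_neg]
  -- The mixed terms vanish by `hB`. The other two have equal sums over the symmetric set `S`, with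
  -- weights adding up to zero.
  have htr : ∑ n ∈ S, A n n = 0 := by
    have : ∀ n, A n n = wp * wp * B n n + wm * wm * B (-n) (-n) := by
      intro n
      have h := hB (-n)
      rw [neg_neg] at h
      simp only [hA, hB, h]; ring
    simp only [this, Finset.sum_add_distrib]
    rw [sum_neg_eq hS fun n => wm * wm * B n n, ← Finset.mul_sum, ← Finset.mul_sum, ← add_mul,
      hwpwm, zero_mul]
  -- Each product of two weights has squared modulus `1/4`, which cancels the factor of the
  -- four-term square inequality. The reflected sums then coincide with the original one.
  have hAF : ∑ n ∈ S, ∑ m ∈ S, ‖A n m‖ ^ 2 ≤ (2 * σ) ^ 2 := by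
    have h1 : ∀ n m, ‖A n m‖ ^ 2 ≤ ‖B n m‖ ^ 2 + ‖B n (-m)‖ ^ 2 + ‖B (-n) m‖ ^ 2 +
        ‖B (-n) (-m)‖ ^ 2 := by
      intro n m
      refine (norm_sq_four_le _ _ _ _).trans (le_of_eq ?_)
      simp only [norm_mul, mul_pow, hwp2, hwm2]
      ring
    calc _ ≤ ∑ n ∈ S, ∑ m ∈ S, (‖B n m‖ ^ 2 + ‖B n (-m)‖ ^ 2 + ‖B (-n) m‖ ^ 2 +
        ‖B (-n) (-m)‖ ^ 2) := Finset.sum_le_sum fun n _ => Finset.sum_le_sum fun m _ => h1 n m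
      _ = 4 * ∑ n ∈ S, ∑ m ∈ S, ‖B n m‖ ^ 2 := by
        simp only [Finset.sum_add_distrib]
        rw [sum_neg_eq hS fun n => ∑ m ∈ S, ‖B n m‖ ^ 2,
          sum_neg_eq hS fun n => ∑ m ∈ S, ‖B n (-m)‖ ^ 2,
          Finset.sum_congr rfl fun n _ => sum_neg_eq hS fun m => ‖B n m‖ ^ 2]
        ring
      _ ≤ _ := by nlinarith
  have hfam := hξ.isStdGaussianFamily S
  -- The moment bound concerns real forms. It is applied to the real and the imaginary part, which
  -- preserve the trace condition and decrease the norm.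
  have key : ∀ f : ℂ →ₗ[ℝ] ℝ, (∀ z, |f z| ≤ ‖z‖) →
      ∫⁻ ω, ENNReal.ofReal (|f (∑ n ∈ S, ∑ m ∈ S, A n m * X n ω * X m ω)| ^ (2 * q)) ∂μ ≤
      ENNReal.ofReal (4 ^ (2 * q) * (2 * q).factorial * (2 * Real.exp 1) * (2 * σ) ^ (2 * q)) := by
    intro f hf
    have e : ∀ ω, f (∑ n ∈ S, ∑ m ∈ S, A n m * X n ω * X m ω) =
        ∑ n : S, ∑ m : S, f (A n m) * X n ω * X m ω := by
      intro ω
      have e1 : ∀ n m, f (A n m * X n ω * X m ω) = f (A n m) * X n ω * X m ω := by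
        intro n m
        have : A n m * X n ω * X m ω = (X n ω * X m ω) • A n m := by
          rw [Complex.real_smul]; push_cast; ring
        rw [this, map_smul, smul_eq_mul]; ring
      rw [← Finset.sum_coe_sort S, map_sum]
      refine Finset.sum_congr rfl fun n _ => ?_
      rw [← Finset.sum_coe_sort S, map_sum]
      exact Finset.sum_congr rfl fun m _ => e1 n m
    simp only [e]
    refine hfam.lintegral_quadratic_pow_le q (fun n m => f (A n m)) ?_ (by positivity) ?_
    · rw [Finset.sum_coe_sort S fun n => f (A n n), ← map_sum, htr, map_zero]
    · rw [Finset.sum_coe_sort S fun n => ∑ m : S, f (A n m) ^ 2]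
      refine le_trans (Finset.sum_le_sum fun n _ => ?_) hAF
      rw [Finset.sum_coe_sort S fun m => f (A n m) ^ 2]
      refine Finset.sum_le_sum fun m _ => ?_
      rw [← sq_abs]
      exact pow_le_pow_left₀ (abs_nonneg _) (hf _) 2
  have hre := key Complex.reLm Complex.abs_re_le_norm
  have him := key Complex.imLm Complex.abs_im_le_norm
  simp only [hQ]
  have hm : ∀ n, AEMeasurable (X n) μ := fun n => (hξ (casTest n)).aemeasurable
  calc _ ≤ ∫⁻ ω, ENNReal.ofReal (2 ^ (2 * q)) *
        (ENNReal.ofReal (|Complex.reLm (∑ n ∈ S, ∑ m ∈ S, A n m * X n ω * X m ω)| ^ (2 * q)) +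
        ENNReal.ofReal (|Complex.imLm (∑ n ∈ S, ∑ m ∈ S, A n m * X n ω * X m ω)| ^ (2 * q))) ∂μ := by
        refine lintegral_mono fun ω => ?_
        generalize (∑ n ∈ S, ∑ m ∈ S, A n m * X n ω * X m ω) = z
        rw [← ENNReal.ofReal_add (by positivity) (by positivity),
          ← ENNReal.ofReal_mul (by positivity), ← ofReal_norm,
          ← ENNReal.ofReal_pow (norm_nonneg _)]
        apply ENNReal.ofReal_le_ofReal
        have h1 := pow_le_pow_left₀ (norm_nonneg _) (Complex.norm_le_abs_re_add_abs_im z) (2 * q)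
        have h2 := add_pow_le (abs_nonneg z.re) (abs_nonneg z.im) (2 * q)
        have h3 : (2 : ℝ) ^ (2 * q - 1) ≤ 2 ^ (2 * q) :=
          pow_le_pow_right₀ (by norm_num) (Nat.sub_le _ _)
        calc _ ≤ _ := h1
          _ ≤ _ := h2
          _ ≤ _ := by
            simp only [Complex.reLm_coe, Complex.imLm_coe]
            gcongr
    _ = ENNReal.ofReal (2 ^ (2 * q)) *
        (∫⁻ ω, ENNReal.ofReal (|Complex.reLm (∑ n ∈ S, ∑ m ∈ S, A n m * X n ω * X m ω)| ^ (2 * q)) ∂μ +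
        ∫⁻ ω, ENNReal.ofReal (|Complex.imLm (∑ n ∈ S, ∑ m ∈ S, A n m * X n ω * X m ω)| ^ (2 * q)) ∂μ) := by
        have m1 : AEMeasurable (fun ω => ENNReal.ofReal
            (|Complex.reLm (∑ n ∈ S, ∑ m ∈ S, A n m * X n ω * X m ω)| ^ (2 * q))) μ := by
          simp only [Complex.reLm_coe]; fun_prop
        have m2 : AEMeasurable (fun ω => ENNReal.ofReal
            (|Complex.imLm (∑ n ∈ S, ∑ m ∈ S, A n m * X n ω * X m ω)| ^ (2 * q))) μ := by
          simp only [Complex.imLm_coe]; fun_prop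
        rw [lintegral_const_mul'' (f := fun ω => _ + _) _ (m1.add m2), lintegral_add_left' m1]
    _ ≤ _ := by
        refine (mul_le_mul_right (add_le_add hre him) _).trans (le_of_eq ?_)
        rw [← ENNReal.ofReal_add (by positivity) (by positivity),
          ← ENNReal.ofReal_mul (by positivity)]
        congr 1
        unfold chaosConst
        rw [mul_pow]
        ring

/-! ### Poisson kernels -/

theorem lintegral_rpow_le_measure {X : Type*} [MeasurableSpace X] (ν : Measure X) {p : ℝ}
    (hp : 1 ≤ p) {f : X → ℝ≥0∞} (hf : AEMeasurable f ν) :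
    (∫⁻ x, f x ∂ν) ^ p ≤ ν univ ^ (p - 1) * ∫⁻ x, f x ^ p ∂ν := by
  rcases hp.eq_or_lt with rfl | hp
  · simp
  have hpq := Real.HolderConjugate.conjExponent hp
  have hp0 : 0 < p := by linarith
  have h := ENNReal.lintegral_mul_le_Lp_mul_Lq ν hpq hf (g := 1) aemeasurable_const
  simp only [Pi.mul_apply, Pi.one_apply, mul_one, ENNReal.one_rpow, lintegral_const, one_mul] at h
  have h2 := ENNReal.rpow_le_rpow h hp0.le
  rw [ENNReal.mul_rpow_of_nonneg _ _ hp0.le, ← ENNReal.rpow_mul, ← ENNReal.rpow_mul,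
    one_div, inv_mul_cancel₀ hp0.ne', ENNReal.rpow_one, mul_comm] at h2
  have e : 1 / p.conjExponent * p = p - 1 := by
    unfold Real.conjExponent
    have : p - 1 ≠ 0 := by linarith
    field_simp
  rwa [e] at h2

/-- Jensen's inequality for the measure with density `k`, not normalized to mass one. -/
theorem lintegral_mul_rpow_le {X : Type*} [MeasurableSpace X] (ν : Measure X) {p : ℝ}
    (hp : 1 ≤ p) {k f : X → ℝ≥0∞} (hk : AEMeasurable k ν) (hf : AEMeasurable f ν) :
    (∫⁻ x, k x * f x ∂ν) ^ p ≤ (∫⁻ x, k x ∂ν) ^ (p - 1) * ∫⁻ x, k x * f x ^ p ∂ν := by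
  have hac := withDensity_absolutelyContinuous ν k
  have h := lintegral_rpow_le_measure (ν.withDensity k) hp (hf.mono_ac hac)
  rw [lintegral_withDensity_eq_lintegral_mul₀ hk hf,
    lintegral_withDensity_eq_lintegral_mul₀ hk (hf.pow_const p),
    withDensity_apply _ MeasurableSet.univ, Measure.restrict_univ] at h
  exact h

/-- The Poisson kernel of the circle of length one. -/
def poisson (r t : ℝ) : ℝ := (1 - r ^ 2) / (1 - 2 * r * Real.cos (2 * Real.pi * t) + r ^ 2)

theorem poisson_denom_ge {r : ℝ} (h0 : 0 < r) (t : ℝ) : (1 - r) ^ 2 ≤ 1 - 2 * r * Real.cos (2 * Real.pi * t) + r ^ 2 := by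
  nlinarith [Real.cos_le_one (2 * Real.pi * t)]

theorem poisson_nonneg {r : ℝ} (h0 : 0 < r) (h1 : r < 1) (t : ℝ) : 0 ≤ poisson r t := by
  have := poisson_denom_ge h0 t
  exact div_nonneg (by nlinarith) (le_trans (by positivity) this)

theorem poisson_le {r : ℝ} (h0 : 0 < r) (h1 : r < 1) (t : ℝ) : poisson r t ≤ 2 / (1 - r) := by
  have h := poisson_denom_ge h0 t
  have h2 : 0 < 1 - r := by linarith
  unfold poisson
  rw [div_le_div_iff₀ (lt_of_lt_of_le (by positivity) h) h2]
  nlinarith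

/-- The increment is bounded by the kernel itself, so later estimates use only positivity and unit
mass. The denominator is `|1 - r e^{2πit}|²`. Its root is Lipschitz with constant `2π` and at least
`1 - r`, which gives a relative bound. -/
theorem abs_poisson_sub_le {r : ℝ} (h0 : 0 < r) (h1 : r < 1) (s t : ℝ) : |poisson r s - poisson r t| ≤
    2 * Real.pi * |s - t| / (1 - r) * (poisson r s + poisson r t) := by
  have hs := poisson_denom_ge h0 s
  have ht := poisson_denom_ge h0 t
  have h2 : 0 < 1 - r := by linarith
  have hs0 : 0 < 1 - 2 * r * Real.cos (2 * Real.pi * s) + r ^ 2 := lt_of_lt_of_le (by positivity) hs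
  have ht0 : 0 < 1 - 2 * r * Real.cos (2 * Real.pi * t) + r ^ 2 := lt_of_lt_of_le (by positivity) ht
  have hdist : |1 - 2 * r * Real.cos (2 * Real.pi * t) + r ^ 2 -
      (1 - 2 * r * Real.cos (2 * Real.pi * s) + r ^ 2)| ≤ 2 * Real.pi * |s - t| / (1 - r) *
      (1 - 2 * r * Real.cos (2 * Real.pi * s) + r ^ 2 +
        (1 - 2 * r * Real.cos (2 * Real.pi * t) + r ^ 2)) := by
    set z : ℝ → ℂ := fun u => 1 - r * Complex.exp ((2 * Real.pi * u : ℝ) * Complex.I) with hz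
    have hn : ∀ u, ‖z u‖ ^ 2 = 1 - 2 * r * Real.cos (2 * Real.pi * u) + r ^ 2 := by
      intro u
      rw [← Complex.normSq_eq_norm_sq, Complex.normSq_apply]
      simp only [hz, Complex.sub_re, Complex.sub_im, Complex.one_re, Complex.one_im,
        Complex.re_ofReal_mul, Complex.im_ofReal_mul, Complex.exp_ofReal_mul_I_re,
        Complex.exp_ofReal_mul_I_im]
      nlinarith [Real.sin_sq_add_cos_sq (2 * Real.pi * u)]
    have hlow : ∀ u, 1 - r ≤ ‖z u‖ := by
      intro u
      rw [← abs_of_pos h2, ← abs_of_nonneg (norm_nonneg (z u)), ← sq_le_sq, hn]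
      exact poisson_denom_ge h0 u
    have hd : ‖z t - z s‖ ≤ 2 * Real.pi * |s - t| := by
      have e : z t - z s = r * (Complex.exp ((2 * Real.pi * s : ℝ) * Complex.I) -
          Complex.exp ((2 * Real.pi * t : ℝ) * Complex.I)) := by simp only [hz]; ring
      have h3 : ‖Complex.exp ((2 * Real.pi * s : ℝ) * Complex.I) -
          Complex.exp ((2 * Real.pi * t : ℝ) * Complex.I)‖ ≤ 2 * Real.pi * |s - t| := by
        have e2 : Complex.exp ((2 * Real.pi * s : ℝ) * Complex.I) -
          Complex.exp ((2 * Real.pi * t : ℝ) * Complex.I) =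
          Complex.exp ((2 * Real.pi * t : ℝ) * Complex.I) *
          (Complex.exp (Complex.I * (2 * Real.pi * (s - t) : ℝ)) - 1) := by
          rw [mul_sub, ← Complex.exp_add, mul_one]
          congr 2; push_cast; ring
        rw [e2, norm_mul, Complex.norm_exp_ofReal_mul_I, one_mul]
        refine (Real.norm_exp_I_mul_ofReal_sub_one_le).trans (le_of_eq ?_)
        rw [Real.norm_eq_abs, abs_mul, abs_of_pos (by positivity)]
      rw [e, norm_mul, Complex.norm_real, Real.norm_of_nonneg h0.le]
      have : 0 ≤ 2 * Real.pi * |s - t| := by positivity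
      nlinarith [norm_nonneg (Complex.exp ((2 * Real.pi * s : ℝ) * Complex.I) -
          Complex.exp ((2 * Real.pi * t : ℝ) * Complex.I))]
    rw [← hn, ← hn]
    have h4 : |‖z t‖ - ‖z s‖| ≤ 2 * Real.pi * |s - t| := (abs_norm_sub_norm_le _ _).trans hd
    rw [sq_sub_sq, abs_mul, abs_of_nonneg (by positivity), div_mul_eq_mul_div, le_div_iff₀ h2]
    have h5 : (‖z t‖ + ‖z s‖) * (1 - r) ≤ ‖z s‖ ^ 2 + ‖z t‖ ^ 2 := by
      nlinarith [hlow t, hlow s, norm_nonneg (z t), norm_nonneg (z s)]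
    calc _ = ((‖z t‖ + ‖z s‖) * (1 - r)) * |‖z t‖ - ‖z s‖| := by ring
      _ ≤ (‖z s‖ ^ 2 + ‖z t‖ ^ 2) * (2 * Real.pi * |s - t|) := by gcongr
      _ = _ := by ring
  unfold poisson
  generalize 2 * Real.pi * |s - t| / (1 - r) = L at *
  generalize 1 - 2 * r * Real.cos (2 * Real.pi * s) + r ^ 2 = a at *
  generalize 1 - 2 * r * Real.cos (2 * Real.pi * t) + r ^ 2 = b at *
  have hr2 : 0 < 1 - r ^ 2 := by nlinarith
  have e1 : (1 - r ^ 2) / a - (1 - r ^ 2) / b = (1 - r ^ 2) / (a * b) * (b - a) := by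
    field_simp
  have e2 : L * ((1 - r ^ 2) / a + (1 - r ^ 2) / b) = (1 - r ^ 2) / (a * b) * (L * (a + b)) := by
    field_simp; ring
  rw [e1, e2, abs_mul, abs_of_pos (by positivity)]
  gcongr

theorem continuous_poisson {r : ℝ} (h0 : 0 < r) (h1 : r < 1) : Continuous (poisson r) := by
  unfold poisson
  refine continuous_const.div (by fun_prop) fun t => ?_
  have := poisson_denom_ge h0 t
  have h2 : 0 < 1 - r := by linarith
  exact (lt_of_lt_of_le (by positivity) this).ne'

/-- Nonnegative and negative frequencies form two geometric series, in `r e^{2πit}` and `r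
e^{-2πit}`. -/
theorem hasSum_poisson {r : ℝ} (h0 : 0 < r) (h1 : r < 1) (t : ℝ) : HasSum (fun n : ℤ => ((r ^ n.natAbs : ℝ) : ℂ) *
    Complex.exp ((2 * Real.pi * n * t : ℝ) * Complex.I)) (poisson r t : ℂ) := by
  obtain ⟨e, he⟩ : ∃ e : ℂ, e = Complex.exp ((2 * Real.pi * t : ℝ) * Complex.I) := ⟨_, rfl⟩
  have hne : ‖e‖ = 1 := he ▸ Complex.norm_exp_ofReal_mul_I _
  obtain ⟨e', he'⟩ : ∃ e : ℂ, e = Complex.exp (-((2 * Real.pi * t : ℝ) * Complex.I)) := ⟨_, rfl⟩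
  have hee : e * e' = 1 := by rw [he, he', ← Complex.exp_add]; simp
  have hne' : ‖e'‖ = 1 := by
    have := congrArg norm hee
    rwa [norm_mul, hne, one_mul, norm_one] at this
  have hr : ‖(r : ℂ)‖ = r := by rw [Complex.norm_real, Real.norm_of_nonneg h0.le]
  have g1 : HasSum (fun n : ℕ => (r * e) ^ n) (1 - r * e)⁻¹ :=
    hasSum_geometric_of_norm_lt_one (by rw [norm_mul, hr, hne, mul_one]; exact h1)
  have g2 : HasSum (fun n : ℕ => (r * e') * (r * e') ^ n) ((r * e') * (1 - r * e')⁻¹) :=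
    HasSum.mul_left (r * e' : ℂ) (f := fun n => (r * e') ^ n) (hasSum_geometric_of_norm_lt_one (by
      rw [norm_mul, hr, hne', mul_one]; exact h1))
  have hne1 : ∀ w : ℂ, ‖w‖ = 1 → 1 - r * w ≠ 0 := by
    intro w hw h
    have : (1 : ℂ) = r * w := by linear_combination h
    have := congrArg norm this
    rw [norm_one, norm_mul, hr, hw, mul_one] at this
    linarith
  have hcos : e + e' = 2 * Real.cos (2 * Real.pi * t) := by
    rw [he, he', ← neg_mul, Complex.ofReal_cos, Complex.cos]
    ring
  have hval : (1 - r * e)⁻¹ + (r * e') * (1 - r * e')⁻¹ = (poisson r t : ℂ) := by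
    have a1 := hne1 e hne
    have a2 := hne1 e' hne'
    have hd : (1 - r * e) * (1 - r * e') =
        ((1 - 2 * r * Real.cos (2 * Real.pi * t) + r ^ 2 : ℝ) : ℂ) := by
      push_cast
      rw [Complex.ofReal_cos] at hcos
      push_cast at hcos
      linear_combination (r : ℂ) ^ 2 * hee - r * hcos
    unfold poisson
    rw [Complex.ofReal_div, ← hd]
    rw [eq_div_iff (mul_ne_zero a1 a2), add_mul]
    have b1 : (1 - r * e)⁻¹ * ((1 - r * e) * (1 - r * e')) = 1 - r * e' := by
      rw [← mul_assoc, inv_mul_cancel₀ a1, one_mul]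
    have b2 : r * e' * (1 - r * e')⁻¹ * ((1 - r * e) * (1 - r * e')) = r * e' * (1 - r * e) := by
      rw [mul_comm (1 - r * e) (1 - r * e'), ← mul_assoc, mul_assoc (r * e'), inv_mul_cancel₀ a2,
        mul_one]
    rw [b1, b2]
    push_cast
    linear_combination (-(r : ℂ) ^ 2) * hee
  rw [← hval]
  refine HasSum.of_nat_of_neg_add_one ?_ ?_
  · have : (fun n : ℕ => ((r ^ (n : ℤ).natAbs : ℝ) : ℂ) *
        Complex.exp ((2 * Real.pi * (n : ℤ) * t : ℝ) * Complex.I)) = fun n => (r * e) ^ n := by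
      funext n
      rw [mul_pow, he, ← Complex.exp_nat_mul, Int.natAbs_natCast, Complex.ofReal_pow]
      congr 2
      push_cast; ring
    rw [this]
    exact g1
  · have : (fun n : ℕ => ((r ^ (-((n : ℤ) + 1)).natAbs : ℝ) : ℂ) *
        Complex.exp ((2 * Real.pi * (-((n : ℤ) + 1) : ℤ) * t : ℝ) * Complex.I)) =
        fun n => (r * e') * (r * e') ^ n := by
      funext n
      have hn : (-((n : ℤ) + 1)).natAbs = n + 1 := by omega
      rw [← pow_succ', mul_pow, he', ← Complex.exp_nat_mul, hn, Complex.ofReal_pow]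
      congr 2
      push_cast; ring
    rw [this]
    exact g2

theorem integral_poisson_mul_exp {r : ℝ} (h0 : 0 < r) (h1 : r < 1) (n : ℤ) (x : ℝ) :
    ∫ y in Ico (0 : ℝ) 1, (poisson r (x - y) : ℂ) *
      Complex.exp ((2 * Real.pi * n * y : ℝ) * Complex.I) =
      ((r ^ n.natAbs : ℝ) : ℂ) * Complex.exp ((2 * Real.pi * n * x : ℝ) * Complex.I) := by
  set F : ℤ → ℝ → ℂ := fun m y => ((r ^ m.natAbs : ℝ) : ℂ) *
    Complex.exp ((2 * Real.pi * m * (x - y) : ℝ) * Complex.I) *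
      Complex.exp ((2 * Real.pi * n * y : ℝ) * Complex.I) with hF
  have hFn : ∀ m y, ‖F m y‖ = r ^ m.natAbs := by
    intro m y
    simp only [hF, norm_mul, Complex.norm_exp_ofReal_mul_I, mul_one, Complex.norm_real]
    exact Real.norm_of_nonneg (by positivity)
  have hsum : Summable fun m : ℤ => r ^ m.natAbs := by
    have := (hasSum_poisson h0 h1 0).summable.norm
    refine this.congr fun m => ?_
    rw [norm_mul, Complex.norm_exp_ofReal_mul_I, mul_one, Complex.norm_real,
      Real.norm_of_nonneg (by positivity)]
  have hint : ∀ m, Integrable (F m) (volume.restrict (Ico (0 : ℝ) 1)) := by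
    intro m
    have : Continuous (F m) := by simp only [hF]; fun_prop
    exact (this.continuousOn.integrableOn_compact isCompact_Icc).mono_set Ico_subset_Icc_self
  have h := hasSum_integral_of_summable_integral_norm hint (by
    refine hsum.congr fun m => ?_
    simp [hFn])
  have e1 : ∀ y, ∑' m, F m y = (poisson r (x - y) : ℂ) *
      Complex.exp ((2 * Real.pi * n * y : ℝ) * Complex.I) := fun y =>
    ((hasSum_poisson h0 h1 (x - y)).mul_right _).tsum_eq
  have e2 : ∀ m, ∫ y in Ico (0 : ℝ) 1, F m y = if m = n then
      ((r ^ n.natAbs : ℝ) : ℂ) * Complex.exp ((2 * Real.pi * n * x : ℝ) * Complex.I) else 0 := by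
    intro m
    have e3 : ∀ y, F m y = ((r ^ m.natAbs : ℝ) : ℂ) *
        Complex.exp ((2 * Real.pi * m * x : ℝ) * Complex.I) *
        Complex.exp ((2 * Real.pi * (n - m : ℤ) * y : ℝ) * Complex.I) := by
      intro y
      simp only [hF]
      rw [mul_assoc _ (Complex.exp _), mul_assoc _ (Complex.exp _), ← Complex.exp_add,
        ← Complex.exp_add]
      congr 2; push_cast; ring
    simp only [e3]
    rw [integral_const_mul, integral_exp_int]
    by_cases hmn : m = n
    · simp [hmn]
    · have : ¬ (n - m = 0) := by omega
      simp [hmn, this]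
  simp only [e1, e2] at h
  exact h.unique (hasSum_ite_eq n _)

/-! ### An anisotropic Hölder estimate for potentials -/

/-- The anisotropic Poisson kernel at the dyadic scale `4^{-j}`. -/
def scaleKernel (j : ℕ) (x : ℝ × ℝ) : ℝ :=
  poisson (1 - (1 / 4) ^ j / 2) x.1 * poisson (1 - (1 / 8) ^ j / 2) x.2

/-- The Fourier multiplier of `scaleKernel j`. -/
def scaleMult (j : ℕ) (n : ℤ × ℤ) : ℝ :=
  (1 - (1 / 4 : ℝ) ^ j / 2) ^ n.1.natAbs * (1 - (1 / 8 : ℝ) ^ j / 2) ^ n.2.natAbs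

theorem scale_radius {a : ℝ} (ha : 0 < a) (ha' : a ≤ 1) (j : ℕ) :
    0 < 1 - a ^ j / 2 ∧ 1 - a ^ j / 2 < 1 := by
  have h1 : 0 < a ^ j := by positivity
  have h2 : a ^ j ≤ 1 := pow_le_one₀ ha.le ha'
  constructor <;> linarith

theorem scaleMult_nonneg (j : ℕ) (n : ℤ × ℤ) : 0 ≤ scaleMult j n := by
  have h1 := scale_radius (a := 1 / 4) (by norm_num) (by norm_num) j
  have h2 := scale_radius (a := 1 / 8) (by norm_num) (by norm_num) j
  exact mul_nonneg (pow_nonneg h1.1.le _) (pow_nonneg h2.1.le _)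

theorem scaleMult_le_one (j : ℕ) (n : ℤ × ℤ) : scaleMult j n ≤ 1 := by
  have h1 := scale_radius (a := 1 / 4) (by norm_num) (by norm_num) j
  have h2 := scale_radius (a := 1 / 8) (by norm_num) (by norm_num) j
  exact mul_le_one₀ (pow_le_one₀ h1.1.le h1.2.le) (pow_nonneg h2.1.le _)
    (pow_le_one₀ h2.1.le h2.2.le)

theorem continuous_scaleKernel (j : ℕ) : Continuous (scaleKernel j) := by
  have h1 := scale_radius (a := 1 / 4) (by norm_num) (by norm_num) j
  have h2 := scale_radius (a := 1 / 8) (by norm_num) (by norm_num) j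
  exact ((continuous_poisson h1.1 h1.2).comp continuous_fst).mul
    ((continuous_poisson h2.1 h2.2).comp continuous_snd)

theorem scaleKernel_nonneg (j : ℕ) (x : ℝ × ℝ) : 0 ≤ scaleKernel j x := by
  have h1 := scale_radius (a := 1 / 4) (by norm_num) (by norm_num) j
  have h2 := scale_radius (a := 1 / 8) (by norm_num) (by norm_num) j
  exact mul_nonneg (poisson_nonneg h1.1 h1.2 _) (poisson_nonneg h2.1 h2.2 _)

/-- Convolution with the kernel acts on characters as the multiplier `scaleMult j`. This is what
turns superpositions of these kernels into the potentials `potMult`. -/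
theorem integral_scaleKernel_mul_chr (j : ℕ) (n : ℤ × ℤ) (x : ℝ × ℝ) :
    ∫ y in cell, (scaleKernel j (x - y) : ℂ) * chr n y = scaleMult j n * chr n x := by
  have h1 := scale_radius (a := 1 / 4) (by norm_num) (by norm_num) j
  have h2 := scale_radius (a := 1 / 8) (by norm_num) (by norm_num) j
  have h := setIntegral_prod_mul (μ := (volume : Measure ℝ)) (ν := (volume : Measure ℝ))
    (fun y : ℝ => (poisson (1 - (1 / 4) ^ j / 2) (x.1 - y) : ℂ) *
      Complex.exp ((2 * Real.pi * n.1 * y : ℝ) * Complex.I))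
    (fun y : ℝ => (poisson (1 - (1 / 8) ^ j / 2) (x.2 - y) : ℂ) *
      Complex.exp ((2 * Real.pi * n.2 * y : ℝ) * Complex.I)) (Ico 0 1) (Ico 0 1)
  rw [← Measure.volume_eq_prod, integral_poisson_mul_exp h1.1 h1.2,
    integral_poisson_mul_exp h2.1 h2.2] at h
  calc _ = _ := ?_
    _ = _ := h
    _ = _ := ?_
  · refine integral_congr_ae (ae_of_all _ fun y => ?_)
    simp only [scaleKernel, chr_eq_mul, Prod.fst_sub, Prod.snd_sub]
    push_cast; ring
  · rw [chr_eq_mul, scaleMult]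
    push_cast; ring

theorem lintegral_scaleKernel (j : ℕ) (x : ℝ × ℝ) :
    ∫⁻ y in cell, ENNReal.ofReal (scaleKernel j (x - y)) = 1 := by
  have h := integral_scaleKernel_mul_chr j 0 x
  have hc : Continuous fun y => scaleKernel j (x - y) :=
    (continuous_scaleKernel j).comp (continuous_const.sub continuous_id)
  simp only [chr_zero, mul_one] at h
  rw [integral_complex_ofReal] at h
  have e : scaleMult j 0 = 1 := by simp [scaleMult]
  rw [← ofReal_integral_eq_lintegral_ofReal (integrableOn_cell hc)
    (ae_of_all _ fun y => scaleKernel_nonneg _ _)]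
  rw [e] at h
  have : ∫ y in cell, scaleKernel j (x - y) = 1 := by exact_mod_cast h
  rw [this, ENNReal.ofReal_one]

/-- The two factors are at most `4 * 4 ^ j` and `4 * 8 ^ j`. With `8 = 4^(3/2)` the scaling is
anisotropic, and `32 = 4^(5/2)` is the inverse volume of a cell at scale `4^(-j)`. -/
theorem scaleKernel_le (j : ℕ) (x : ℝ × ℝ) : scaleKernel j x ≤ 16 * (32 : ℝ) ^ j := by
  have h1 := scale_radius (a := 1 / 4) (by norm_num) (by norm_num) j
  have h2 := scale_radius (a := 1 / 8) (by norm_num) (by norm_num) j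
  have a1 := poisson_le h1.1 h1.2 x.1
  have a2 := poisson_le h2.1 h2.2 x.2
  have b1 := poisson_nonneg h1.1 h1.2 x.1
  have b2 := poisson_nonneg h2.1 h2.2 x.2
  calc _ ≤ (2 / (1 - (1 - (1 / 4) ^ j / 2))) * (2 / (1 - (1 - (1 / 8 : ℝ) ^ j / 2))) :=
        mul_le_mul a1 a2 b2 (b1.trans a1)
    _ = _ := by
      have : (32 : ℝ) ^ j = 4 ^ j * 8 ^ j := by rw [← mul_pow]; norm_num
      rw [this]
      simp only [one_div, inv_pow]
      field_simp
      ring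

theorem min_one_le_rpow {a α : ℝ} (ha : 0 ≤ a) (hα : 0 ≤ α) (hα1 : α ≤ 1) : min 1 a ≤ a ^ α := by
  rcases le_total 1 a with h | h
  · rw [min_eq_left h]; exact Real.one_le_rpow h hα
  · rw [min_eq_right h]
    rcases ha.eq_or_lt with rfl | h0
    · positivity
    · calc a = a ^ (1 : ℝ) := (Real.rpow_one a).symm
        _ ≤ a ^ α := Real.rpow_le_rpow_of_exponent_ge h0 h hα1

/-- Interpolation between the Lipschitz bound and the trivial bound by the sum of the two values. -/
theorem abs_poisson_sub_le_rpow {r : ℝ} (h0 : 0 < r) (h1 : r < 1) (s t : ℝ) {α : ℝ} (hα : 0 ≤ α)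
    (hα1 : α ≤ 1) : |poisson r s - poisson r t| ≤
      (2 * Real.pi * |s - t| / (1 - r)) ^ α * (poisson r s + poisson r t) := by
  have hs := poisson_nonneg h0 h1 s
  have ht := poisson_nonneg h0 h1 t
  have h2 : 0 < 1 - r := by linarith
  have h3 : 0 ≤ 2 * Real.pi * |s - t| / (1 - r) := by positivity
  refine le_trans ?_ (mul_le_mul_of_nonneg_right (min_one_le_rpow h3 hα hα1) (by positivity))
  rw [min_mul_of_nonneg _ _ (by positivity)]
  refine le_min ?_ (abs_poisson_sub_le h0 h1 s t)
  rw [one_mul]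
  exact (abs_sub _ _).trans (by rw [abs_of_nonneg hs, abs_of_nonneg ht])

theorem ccDist_nonneg (x y : ℝ × ℝ) : 0 ≤ ccDist x y := by unfold ccDist; positivity

/-- One coordinate is moved at a time, through the intermediate point `(x.1, y.2)`. Exponent `α` in
the first variable and `2α/3` in the second fit the two parts of `ccDist`, and both lose the factor
`4 ^ (α j)`. -/
theorem abs_scaleKernel_sub_le (j : ℕ) {α : ℝ} (hα : 0 ≤ α) (hα1 : α ≤ 1) (x y z : ℝ × ℝ) :
    |scaleKernel j (y - z) - scaleKernel j (x - z)| ≤ 16 * ((4 : ℝ) ^ α) ^ j * ccDist y x ^ α *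
      (scaleKernel j (y - z) + scaleKernel j ((x.1, y.2) - z) +
        (scaleKernel j ((x.1, y.2) - z) + scaleKernel j (x - z))) := by
  have h1 := scale_radius (a := 1 / 4) (by norm_num) (by norm_num) j
  have h2 := scale_radius (a := 1 / 8) (by norm_num) (by norm_num) j
  set r := 1 - (1 / 4 : ℝ) ^ j / 2 with hr
  set s := 1 - (1 / 8 : ℝ) ^ j / 2 with hs
  have ex : ∀ w : ℝ × ℝ, scaleKernel j w = poisson r w.1 * poisson s w.2 := fun w => rfl
  have p1 := poisson_nonneg h1.1 h1.2
  have p2 := poisson_nonneg h2.1 h2.2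
  have hpi : 4 * Real.pi ≤ 16 := by linarith [Real.pi_le_four]
  have hpi1 : 1 ≤ 4 * Real.pi := by linarith [Real.pi_gt_three]
  have c1 : ∀ β : ℝ, 0 ≤ β → β ≤ 1 → (4 * Real.pi) ^ β ≤ 16 := fun β hβ hβ1 => by
    calc (4 * Real.pi) ^ β ≤ (4 * Real.pi) ^ (1 : ℝ) := Real.rpow_le_rpow_of_exponent_le hpi1 hβ1
      _ ≤ 16 := by rw [Real.rpow_one]; exact hpi
  have d1 : |y.1 - x.1| ≤ ccDist y x := by
    unfold ccDist
    have : 0 ≤ |y.2 - x.2| ^ (2 / 3 : ℝ) := by positivity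
    linarith
  have d2 : |y.2 - x.2| ^ (2 / 3 : ℝ) ≤ ccDist y x := by
    unfold ccDist
    have := abs_nonneg (y.1 - x.1)
    linarith
  have hd := ccDist_nonneg y x
  have A : |poisson r (y.1 - z.1) - poisson r (x.1 - z.1)| ≤ 16 * ((4 : ℝ) ^ α) ^ j *
      ccDist y x ^ α * (poisson r (y.1 - z.1) + poisson r (x.1 - z.1)) := by
    refine (abs_poisson_sub_le_rpow h1.1 h1.2 _ _ hα hα1).trans
      (mul_le_mul_of_nonneg_right ?_ (add_nonneg (p1 _) (p1 _)))
    have e : 2 * Real.pi * |y.1 - z.1 - (x.1 - z.1)| / (1 - r) =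
        4 * Real.pi * 4 ^ j * |y.1 - x.1| := by
      rw [hr, show y.1 - z.1 - (x.1 - z.1) = y.1 - x.1 by ring]
      simp only [one_div, inv_pow]
      field_simp
      ring
    rw [e, Real.mul_rpow (by positivity) (abs_nonneg _), Real.mul_rpow (by positivity) (by positivity),
      ← Real.rpow_natCast, ← Real.rpow_natCast, ← Real.rpow_mul (by norm_num),
      ← Real.rpow_mul (by norm_num), mul_comm (j : ℝ) α]
    have := c1 α hα hα1
    gcongr
  have B : |poisson s (y.2 - z.2) - poisson s (x.2 - z.2)| ≤ 16 * ((4 : ℝ) ^ α) ^ j *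
      ccDist y x ^ α * (poisson s (y.2 - z.2) + poisson s (x.2 - z.2)) := by
    refine (abs_poisson_sub_le_rpow h2.1 h2.2 _ _ (α := 2 / 3 * α) (by positivity)
      (by linarith)).trans (mul_le_mul_of_nonneg_right ?_ (add_nonneg (p2 _) (p2 _)))
    have e : 2 * Real.pi * |y.2 - z.2 - (x.2 - z.2)| / (1 - s) =
        4 * Real.pi * 8 ^ j * |y.2 - x.2| := by
      rw [hs, show y.2 - z.2 - (x.2 - z.2) = y.2 - x.2 by ring]
      simp only [one_div, inv_pow]
      field_simp
      ring
    have e8 : ((8 : ℝ) ^ j) ^ (2 / 3 * α) = ((4 : ℝ) ^ α) ^ j := by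
      rw [← Real.rpow_natCast, ← Real.rpow_natCast, ← Real.rpow_mul (by norm_num),
        ← Real.rpow_mul (by norm_num), show (8 : ℝ) = 4 ^ (3 / 2 : ℝ) by
          rw [show (4 : ℝ) = 2 ^ (2 : ℝ) by norm_num, ← Real.rpow_mul (by norm_num)]; norm_num,
        ← Real.rpow_mul (by norm_num)]
      congr 1; ring
    rw [e, Real.mul_rpow (by positivity) (abs_nonneg _), Real.mul_rpow (by positivity) (by positivity),
      e8, Real.rpow_mul (abs_nonneg _)]
    have := c1 (2 / 3 * α) (by positivity) (by linarith)
    gcongr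
  set L := 16 * ((4 : ℝ) ^ α) ^ j * ccDist y x ^ α with hL
  simp only [ex, Prod.fst_sub, Prod.snd_sub]
  have e : poisson r (y.1 - z.1) * poisson s (y.2 - z.2) - poisson r (x.1 - z.1) *
      poisson s (x.2 - z.2) =
      (poisson r (y.1 - z.1) - poisson r (x.1 - z.1)) * poisson s (y.2 - z.2) +
      poisson r (x.1 - z.1) * (poisson s (y.2 - z.2) - poisson s (x.2 - z.2)) := by ring
  rw [e]
  refine (abs_add_le _ _).trans ?_
  rw [abs_mul, abs_mul, abs_of_nonneg (p2 _), abs_of_nonneg (p1 (x.1 - z.1))]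
  calc _ ≤ L * (poisson r (y.1 - z.1) + poisson r (x.1 - z.1)) * poisson s (y.2 - z.2) +
        poisson r (x.1 - z.1) * (L * (poisson s (y.2 - z.2) + poisson s (x.2 - z.2))) :=
        add_le_add (mul_le_mul_of_nonneg_right A (p2 _)) (mul_le_mul_of_nonneg_left B (p1 _))
    _ = _ := by ring

/-- Jensen for the probability kernel, followed by its supremum bound: an `L^p` function loses the
`p`-th root of the inverse cell volume. -/
theorem lintegral_scaleKernel_mul_le (j : ℕ) {p : ℝ} (hp : 1 ≤ p) {w : ℝ × ℝ → ℂ} (hw : Continuous w)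
    (x : ℝ × ℝ) : ∫⁻ y in cell, ENNReal.ofReal (scaleKernel j (x - y)) * ‖w y‖ₑ ≤
      ENNReal.ofReal (16 * ((32 : ℝ) ^ (1 / p)) ^ j) * (∫⁻ y in cell, ‖w y‖ₑ ^ p) ^ (1 / p) := by
  have hp0 : 0 < p := by linarith
  have hc : Continuous fun y => scaleKernel j (x - y) :=
    (continuous_scaleKernel j).comp (continuous_const.sub continuous_id)
  have h := lintegral_mul_rpow_le (volume.restrict cell) hp
    (k := fun y => ENNReal.ofReal (scaleKernel j (x - y))) (f := fun y => ‖w y‖ₑ)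
    hc.measurable.ennreal_ofReal.aemeasurable hw.measurable.enorm.aemeasurable
  rw [lintegral_scaleKernel, ENNReal.one_rpow, one_mul] at h
  have h2 : ∫⁻ y in cell, ENNReal.ofReal (scaleKernel j (x - y)) * ‖w y‖ₑ ^ p ≤
      ENNReal.ofReal (16 * (32 : ℝ) ^ j) * ∫⁻ y in cell, ‖w y‖ₑ ^ p := by
    rw [← lintegral_const_mul' _ _ ENNReal.ofReal_ne_top]
    exact lintegral_mono fun y => mul_le_mul_left (ENNReal.ofReal_le_ofReal (scaleKernel_le _ _)) _
  have h3 := ENNReal.rpow_le_rpow (h.trans h2) (z := 1 / p) (by positivity)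
  rw [← ENNReal.rpow_mul, mul_one_div_cancel hp0.ne', ENNReal.rpow_one,
    ENNReal.mul_rpow_of_nonneg _ _ (by positivity)] at h3
  refine h3.trans (mul_le_mul_left ?_ _)
  rw [ENNReal.ofReal_rpow_of_nonneg (by positivity) (by positivity)]
  apply ENNReal.ofReal_le_ofReal
  rw [Real.mul_rpow (by norm_num) (by positivity)]
  have e : ((32 : ℝ) ^ j) ^ (1 / p) = ((32 : ℝ) ^ (1 / p)) ^ j := by
    rw [← Real.rpow_natCast, ← Real.rpow_natCast, ← Real.rpow_mul (by norm_num),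
      ← Real.rpow_mul (by norm_num), mul_comm]
  rw [e]
  gcongr
  calc (16 : ℝ) ^ (1 / p) ≤ 16 ^ (1 : ℝ) :=
        Real.rpow_le_rpow_of_exponent_le (by norm_num) (by rw [div_le_one hp0]; exact hp)
    _ = 16 := Real.rpow_one _

theorem enorm_sub_mul_le {L a b c : ℝ} (hL0 : 0 ≤ L) (n1 : 0 ≤ a) (n2 : 0 ≤ b) (n3 : 0 ≤ c)
    (h : |a - c| ≤ L * (a + b + (b + c))) (v : ℂ) : ‖(a : ℂ) * v - (c : ℂ) * v‖ₑ ≤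
      ENNReal.ofReal L * (ENNReal.ofReal a * ‖v‖ₑ + ENNReal.ofReal b * ‖v‖ₑ +
        (ENNReal.ofReal b * ‖v‖ₑ + ENNReal.ofReal c * ‖v‖ₑ)) := by
  have e : ENNReal.ofReal L * (ENNReal.ofReal a * ‖v‖ₑ + ENNReal.ofReal b * ‖v‖ₑ +
      (ENNReal.ofReal b * ‖v‖ₑ + ENNReal.ofReal c * ‖v‖ₑ)) =
      ENNReal.ofReal (L * (a + b + (b + c))) * ‖v‖ₑ := by
    rw [ENNReal.ofReal_mul hL0, ENNReal.ofReal_add (by positivity) (by positivity),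
      ENNReal.ofReal_add n1 n2, ENNReal.ofReal_add n2 n3]
    ring
  have e2 : (a : ℂ) * v - (c : ℂ) * v = ((a - c : ℝ) : ℂ) * v := by push_cast; ring
  rw [e, e2, enorm_mul, ← ofReal_norm (((a - c : ℝ)) : ℂ), Complex.norm_real, Real.norm_eq_abs]
  exact mul_le_mul_left (ENNReal.ofReal_le_ofReal h) _

theorem enorm_scale_sub_le (j : ℕ) {p α : ℝ} (hp : 1 ≤ p) (hα : 0 ≤ α) (hα1 : α ≤ 1)
    {w : ℝ × ℝ → ℂ} (hw : Continuous w) (x y : ℝ × ℝ) :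
    ‖(∫ z in cell, (scaleKernel j (y - z) : ℂ) * w z) - ∫ z in cell, (scaleKernel j (x - z) : ℂ) * w z‖ₑ ≤
      ENNReal.ofReal (1024 * ((4 : ℝ) ^ α * (32 : ℝ) ^ (1 / p)) ^ j) * ENNReal.ofReal (ccDist y x ^ α) *
        (∫⁻ z in cell, ‖w z‖ₑ ^ p) ^ (1 / p) := by
  have hc : ∀ x, Continuous fun z => scaleKernel j (x - z) := fun x =>
    (continuous_scaleKernel j).comp (continuous_const.sub continuous_id)
  have hi : ∀ x, IntegrableOn (fun z => (scaleKernel j (x - z) : ℂ) * w z) cell := fun x =>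
    integrableOn_cell ((Complex.continuous_ofReal.comp (hc x)).mul hw)
  have hd := ccDist_nonneg y x
  rw [← integral_sub (hi y) (hi x)]
  obtain ⟨L, hL⟩ : ∃ L : ℝ, L = 16 * ((4 : ℝ) ^ α) ^ j * ccDist y x ^ α := ⟨_, rfl⟩
  have hL0 : 0 ≤ L := by rw [hL]; positivity
  obtain ⟨K, hK⟩ : ∃ K : ℝ × ℝ → ℝ × ℝ → ℝ≥0∞,
    K = fun x z => ENNReal.ofReal (scaleKernel j (x - z)) * ‖w z‖ₑ := ⟨_, rfl⟩
  have hKm : ∀ x, Measurable (K x) := fun x => by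
    rw [hK]
    exact (hc x).measurable.ennreal_ofReal.mul hw.measurable.enorm
  have s1 : ∀ z, ‖(scaleKernel j (y - z) : ℂ) * w z - (scaleKernel j (x - z) : ℂ) * w z‖ₑ ≤
      ENNReal.ofReal L * (K y z + K (x.1, y.2) z + (K (x.1, y.2) z + K x z)) := by
    intro z
    simp only [hK]
    have h := abs_scaleKernel_sub_le j hα hα1 x y z
    rw [← hL] at h
    exact enorm_sub_mul_le hL0 (scaleKernel_nonneg _ _) (scaleKernel_nonneg _ _)
      (scaleKernel_nonneg _ _) h _
  have s2 : ∫⁻ z in cell, ENNReal.ofReal L * (K y z + K (x.1, y.2) z + (K (x.1, y.2) z + K x z)) =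
      ENNReal.ofReal L * ((∫⁻ z in cell, K y z) + (∫⁻ z in cell, K (x.1, y.2) z) +
        ((∫⁻ z in cell, K (x.1, y.2) z) + ∫⁻ z in cell, K x z)) := by
    rw [lintegral_const_mul' _ _ ENNReal.ofReal_ne_top,
      lintegral_add_left (f := fun a => K y a + K (x.1, y.2) a) ((hKm _).add (hKm _)), lintegral_add_left (hKm _),
      lintegral_add_left (hKm _)]
  refine (enorm_integral_le_lintegral_enorm _).trans ((lintegral_mono s1).trans (s2.le.trans ?_))
  obtain ⟨N, hN⟩ : ∃ N : ℝ≥0∞, N = (∫⁻ z in cell, ‖w z‖ₑ ^ p) ^ (1 / p) := ⟨_, rfl⟩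
  obtain ⟨Q, hQ⟩ : ∃ Q : ℝ, Q = 16 * ((32 : ℝ) ^ (1 / p)) ^ j := ⟨_, rfl⟩
  have b : ∀ x, ∫⁻ z in cell, K x z ≤ ENNReal.ofReal Q * N := fun x => by
    rw [hK, hN, hQ]
    exact lintegral_scaleKernel_mul_le j hp hw x
  -- `1024` is four kernel terms times `16` from the increment bound times `16` from the kernel
  -- bound.
  have e : 1024 * ((4 : ℝ) ^ α * (32 : ℝ) ^ (1 / p)) ^ j * ccDist y x ^ α = 4 * (L * Q) := by
    rw [hL, hQ, mul_pow]; ring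
  refine (mul_le_mul_right (add_le_add (add_le_add (b _) (b _)) (add_le_add (b _) (b _))) _).trans
    (le_of_eq ?_)
  rw [← hN, ← ENNReal.ofReal_mul (by positivity), e, ENNReal.ofReal_mul (by norm_num),
    ENNReal.ofReal_mul hL0, ENNReal.ofReal_ofNat]
  ring

/-- The Fourier multiplier of an anisotropic smoothing operator of order `γ`. -/
def potMult (γ : ℝ) (n : ℤ × ℤ) : ℝ := ∑' j : ℕ, ((4 : ℝ) ^ (-γ)) ^ j * scaleMult j n

theorem summable_potMult {γ : ℝ} (hγ : 0 < γ) (n : ℤ × ℤ) :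
    Summable fun j : ℕ => ((4 : ℝ) ^ (-γ)) ^ j * scaleMult j n := by
  have h1 : (4 : ℝ) ^ (-γ) < 1 := Real.rpow_lt_one_of_one_lt_of_neg (by norm_num) (by linarith)
  refine Summable.of_nonneg_of_le (fun j => mul_nonneg (by positivity) (scaleMult_nonneg j n))
    (fun j => ?_) (summable_geometric_of_lt_one (by positivity) h1)
  exact mul_le_of_le_one_right (by positivity) (scaleMult_le_one j n)

theorem holderSeminorm_le {α : ℝ} {f : ℝ × ℝ → ℝ} {B : ℝ≥0∞}
    (h : ∀ x y, ‖f y - f x‖ₑ ≤ ENNReal.ofReal (ccDist y x ^ α) * B) : holderSeminorm α f ≤ B := by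
  refine iSup_le fun x => iSup_le fun y => iSup_le fun hxy => ?_
  have hd : 0 < ccDist y x := by
    unfold ccDist
    rcases eq_or_ne y.1 x.1 with h1 | h1
    · have h2 : y.2 ≠ x.2 := fun h2 => hxy (Prod.ext h1 h2).symm
      have := abs_pos.2 (sub_ne_zero.2 h2)
      positivity
    · have := abs_pos.2 (sub_ne_zero.2 h1)
      positivity
  have hd' : 0 < ccDist y x ^ α := by positivity
  rw [ENNReal.ofReal_div_of_pos hd']
  refine ENNReal.div_le_of_le_mul ?_
  rw [mul_comm]
  refine le_trans (le_of_eq ?_) (h x y)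
  rw [← ofReal_norm, Real.norm_eq_abs]

theorem enorm_sub_le_holderSeminorm {α : ℝ} (f : ℝ × ℝ → ℝ) (x y : ℝ × ℝ) :
    ‖f y - f x‖ₑ ≤ ENNReal.ofReal (ccDist y x ^ α) * holderSeminorm α f := by
  rcases eq_or_ne x y with rfl | hxy
  · simp
  have h : ENNReal.ofReal (|f y - f x| / ccDist y x ^ α) ≤ holderSeminorm α f :=
    le_iSup_of_le x (le_iSup_of_le y (le_iSup_of_le hxy le_rfl))
  have hd : 0 < ccDist y x := by
    unfold ccDist
    rcases eq_or_ne y.1 x.1 with h1 | h1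
    · have h2 : y.2 ≠ x.2 := fun h2 => hxy (Prod.ext h1 h2).symm
      have := abs_pos.2 (sub_ne_zero.2 h2)
      positivity
    · have := abs_pos.2 (sub_ne_zero.2 h1)
      positivity
  have hd' : 0 < ccDist y x ^ α := by positivity
  refine le_trans (le_of_eq ?_) (mul_le_mul_right h _)
  rw [← ENNReal.ofReal_mul hd'.le, mul_div_cancel₀ _ hd'.ne', ← ofReal_norm, Real.norm_eq_abs]

/-- A potential of order `γ` of an `L^p` function is Hölder continuous with exponent
`α < γ - 5/(2p)`. -/
theorem holderSeminorm_pot_le {γ p α : ℝ} (hp : 1 ≤ p) (hα : 0 < α) (hα1 : α ≤ 1)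
    (h : α + 5 / (2 * p) < γ) : ∃ C : ℝ, 0 < C ∧ ∀ (ι : Type) (s : Finset ι) (c : ι → ℂ)
      (n : ι → ℤ × ℤ),
      holderSeminorm α (fun x => (∑ i ∈ s, potMult γ (n i) * c i * chr (n i) x).re) ≤
        ENNReal.ofReal C * (∫⁻ x in cell, ‖∑ i ∈ s, c i * chr (n i) x‖ₑ ^ p) ^ (1 / p) := by
  have hp0 : 0 < p := by linarith
  have hγ : 0 < γ := by
    have : 0 < 5 / (2 * p) := by positivity
    linarith
  -- The ratio of the geometric series over scales: gain `4^(-γ)`, loss `4^α` from the Hölder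
  -- increment and `4^(5/(2p))` from `L^p` to `L^∞`. The hypothesis says precisely that `θ < 1`.
  set θ : ℝ := (4 : ℝ) ^ (-γ) * ((4 : ℝ) ^ α * (32 : ℝ) ^ (1 / p)) with hθ
  have hθ0 : 0 < θ := by positivity
  have hθ1 : θ < 1 := by
    have e : θ = (4 : ℝ) ^ (-γ + α + 5 / (2 * p)) := by
      rw [Real.rpow_add (by norm_num), Real.rpow_add (by norm_num), hθ,
        show (32 : ℝ) = 4 ^ (5 / 2 : ℝ) by
          rw [show (4 : ℝ) = 2 ^ (2 : ℝ) by norm_num, ← Real.rpow_mul (by norm_num)]; norm_num,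
        ← Real.rpow_mul (by norm_num), show 5 / 2 * (1 / p) = 5 / (2 * p) by field_simp]
      ring
    rw [e]
    exact Real.rpow_lt_one_of_one_lt_of_neg (by norm_num) (by linarith)
  have hθ2 : 0 < 1 - θ := by linarith
  refine ⟨1024 * (1 - θ)⁻¹, by positivity, ?_⟩
  intro ι s c n
  set w : ℝ × ℝ → ℂ := fun x => ∑ i ∈ s, c i * chr (n i) x with hw
  have hwc : Continuous w := by simp only [hw]; fun_prop
  set N := (∫⁻ x in cell, ‖w x‖ₑ ^ p) ^ (1 / p) with hN
  set u : ℕ → ℝ × ℝ → ℂ := fun j x => ∑ i ∈ s, scaleMult j (n i) * c i * chr (n i) x with hu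
  have hu' : ∀ j x, u j x = ∫ z in cell, (scaleKernel j (x - z) : ℂ) * w z := by
    intro j x
    simp only [hu, hw, Finset.mul_sum]
    have hc : Continuous fun z => (scaleKernel j (x - z) : ℂ) :=
      Complex.continuous_ofReal.comp
        ((continuous_scaleKernel j).comp (continuous_const.sub continuous_id))
    rw [integral_finsetSum _ fun i _ => integrableOn_cell (by fun_prop)]
    refine Finset.sum_congr rfl fun i _ => ?_
    have e : ∀ z, (scaleKernel j (x - z) : ℂ) * (c i * chr (n i) z) =
      c i * ((scaleKernel j (x - z) : ℂ) * chr (n i) z) := fun z => by ring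
    simp only [e]
    rw [integral_const_mul, integral_scaleKernel_mul_chr]
    ring
  -- By definition of `potMult` the potential is the weighted sum over `j` of the convolutions `u
  -- j`.
  have hpot : ∀ x, HasSum (fun j => (((4 : ℝ) ^ (-γ)) ^ j : ℝ) * u j x)
      (∑ i ∈ s, potMult γ (n i) * c i * chr (n i) x) := by
    intro x
    simp only [hu, Finset.mul_sum]
    refine hasSum_sum fun i _ => ?_
    have h1 : HasSum (fun j : ℕ => ((((4 : ℝ) ^ (-γ)) ^ j * scaleMult j (n i) : ℝ) : ℂ))
        (potMult γ (n i) : ℂ) := Complex.hasSum_ofReal.2 (summable_potMult hγ (n i)).hasSum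
    have h2 := (h1.mul_right (c i)).mul_right (chr (n i) x)
    refine h2.congr_fun fun j => ?_
    push_cast; ring
  refine holderSeminorm_le fun x y => ?_
  rw [← Complex.sub_re]
  have hre : ∀ z : ℂ, ‖z.re‖ₑ ≤ ‖z‖ₑ := fun z => by
    rw [← ofReal_norm, ← ofReal_norm]
    exact ENNReal.ofReal_le_ofReal (Complex.abs_re_le_norm z)
  refine (hre _).trans ?_
  rw [← ((hpot y).sub (hpot x)).tsum_eq]
  refine enorm_tsum_le_tsum_enorm.trans ?_
  have hterm : ∀ j, ‖((((4 : ℝ) ^ (-γ)) ^ j : ℝ) : ℂ) * u j y - ((((4 : ℝ) ^ (-γ)) ^ j : ℝ) : ℂ) * u j x‖ₑ ≤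
      ENNReal.ofReal (1024 * θ ^ j) * (ENNReal.ofReal (ccDist y x ^ α) * N) := by
    intro j
    rw [← mul_sub, enorm_mul, hu', hu']
    refine (mul_le_mul_right (enorm_scale_sub_le j hp hα.le hα1 hwc x y) _).trans (le_of_eq ?_)
    rw [← ofReal_norm, Complex.norm_real, Real.norm_of_nonneg (by positivity), ← hN, ← mul_assoc,
      ← mul_assoc, ← ENNReal.ofReal_mul (by positivity), mul_assoc]
    congr 2
    rw [hθ, mul_pow ((4 : ℝ) ^ (-γ))]
    ring
  refine (ENNReal.tsum_le_tsum hterm).trans (le_of_eq ?_)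
  rw [ENNReal.tsum_mul_right, ← ENNReal.ofReal_tsum_of_nonneg (fun j => by positivity)
    ((summable_geometric_of_lt_one hθ0.le hθ1).mul_left _), tsum_mul_left,
    tsum_geometric_of_lt_one hθ0.le hθ1]
  ring

/-- All terms are nonnegative, so one suffices: the first scale with `4 ^ (j+1) > rho n`. There
Bernoulli's inequality keeps each Poisson factor above `1/2`. -/
theorem potMult_ge {γ : ℝ} (hγ : 0 < γ) (n : ℤ × ℤ) :
    (4 : ℝ) ^ (-γ) / 4 * rho n ^ (-γ) ≤ potMult γ n := by
  obtain ⟨j, hj1, hj2⟩ := exists_nat_pow_near (one_le_rho n) (by norm_num : (1 : ℝ) < 4)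
  have hr := rho_pos n
  have hle : ((4 : ℝ) ^ (-γ)) ^ (j + 1) * scaleMult (j + 1) n ≤ potMult γ n :=
    (summable_potMult hγ n).le_tsum (j + 1) fun i _ =>
      mul_nonneg (by positivity) (scaleMult_nonneg i n)
  refine le_trans ?_ hle
  have h1 := scale_radius (a := 1 / 4) (by norm_num) (by norm_num) (j + 1)
  have h2 := scale_radius (a := 1 / 8) (by norm_num) (by norm_num) (j + 1)
  have bern : ∀ (a : ℝ) (k : ℕ), 0 < a → a ≤ 1 → k * a ≤ 1 → 1 / 2 ≤ (1 - a / 2) ^ k := by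
    intro a k ha ha1 hka
    have := one_add_mul_le_pow (a := -(a / 2)) (by linarith) k
    calc (1 / 2 : ℝ) ≤ 1 + k * -(a / 2) := by linarith
      _ ≤ _ := this
      _ = _ := by ring
  have hn1 : ((n.1.natAbs : ℕ) : ℝ) = |(n.1 : ℝ)| := by
    rw [Nat.cast_natAbs]; simp
  have hn2 : ((n.2.natAbs : ℕ) : ℝ) = |(n.2 : ℝ)| := by
    rw [Nat.cast_natAbs]; simp
  have a1 : 1 / 2 ≤ (1 - (1 / 4 : ℝ) ^ (j + 1) / 2) ^ n.1.natAbs := by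
    refine bern _ _ (by positivity) (pow_le_one₀ (by norm_num) (by norm_num)) ?_
    rw [hn1, one_div, inv_pow, ← div_eq_mul_inv, div_le_one (by positivity)]
    linarith [one_add_abs_fst_le_rho n]
  have a2 : 1 / 2 ≤ (1 - (1 / 8 : ℝ) ^ (j + 1) / 2) ^ n.2.natAbs := by
    refine bern _ _ (by positivity) (pow_le_one₀ (by norm_num) (by norm_num)) ?_
    rw [hn2, one_div, inv_pow, ← div_eq_mul_inv, div_le_one (by positivity)]
    refine (abs_snd_le_rho n).trans ((Real.rpow_le_rpow hr.le hj2.le (by norm_num)).trans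
      (le_of_eq ?_))
    rw [← Real.rpow_natCast, ← Real.rpow_natCast, ← Real.rpow_mul (by norm_num), mul_comm,
      Real.rpow_mul (by norm_num)]
    congr 1
    rw [show (4 : ℝ) = 2 ^ (2 : ℝ) by norm_num, ← Real.rpow_mul (by norm_num)]; norm_num
  have a3 : 1 / 4 ≤ scaleMult (j + 1) n := by
    unfold scaleMult
    calc (1 / 4 : ℝ) = 1 / 2 * (1 / 2) := by norm_num
      _ ≤ _ := mul_le_mul a1 a2 (by norm_num) (by linarith)
  have a4 : (4 : ℝ) ^ (-γ) * rho n ^ (-γ) ≤ ((4 : ℝ) ^ (-γ)) ^ (j + 1) := by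
    rw [pow_succ, mul_comm]
    gcongr
    have : ((4 : ℝ) ^ (-γ)) ^ j = ((4 : ℝ) ^ j) ^ (-γ) := by
      rw [← Real.rpow_natCast, ← Real.rpow_natCast, ← Real.rpow_mul (by norm_num),
        ← Real.rpow_mul (by norm_num), mul_comm]
    rw [this]
    exact Real.rpow_le_rpow_of_nonpos (by positivity) hj1 (by linarith)
  have hrg : 0 ≤ rho n ^ (-γ) := by positivity
  calc _ = (4 : ℝ) ^ (-γ) * rho n ^ (-γ) * (1 / 4) := by ring
    _ ≤ _ := by gcongr

theorem potMult_pos {γ : ℝ} (hγ : 0 < γ) (n : ℤ × ℤ) : 0 < potMult γ n := by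
  have := rho_pos n
  exact lt_of_lt_of_le (by positivity) (potMult_ge hγ n)

theorem potMult_inv_le {γ : ℝ} (hγ : 0 < γ) (n : ℤ × ℤ) :
    (potMult γ n)⁻¹ ≤ 4 * (4 : ℝ) ^ γ * rho n ^ γ := by
  have hr := rho_pos n
  have h := inv_anti₀ (by positivity) (potMult_ge hγ n)
  refine h.trans (le_of_eq ?_)
  rw [Real.rpow_neg hr.le, Real.rpow_neg (by norm_num)]
  field_simp

/-! ### Fourier series with rapidly decaying coefficients -/

/-- Rapidly decaying sequences on `ℤ²`. -/
def RapidDecay (z : ℤ × ℤ → ℂ) : Prop :=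
  ∀ k : ℕ, Summable fun n : ℤ × ℤ => (1 + ‖n‖) ^ k * ‖z n‖

/-- The Fourier series with coefficients `z`. -/
def fser (z : ℤ × ℤ → ℂ) (x : ℝ × ℝ) : ℂ := ∑' n, z n * chr n x

theorem abs_fst_le_norm (n : ℤ × ℤ) : |(n.1 : ℝ)| ≤ ‖n‖ := by
  rw [← Int.norm_eq_abs]; exact norm_fst_le n

theorem abs_snd_le_norm (n : ℤ × ℤ) : |(n.2 : ℝ)| ≤ ‖n‖ := by
  rw [← Int.norm_eq_abs]; exact norm_snd_le n

theorem RapidDecay.summable_norm {z : ℤ × ℤ → ℂ} (hz : RapidDecay z) : Summable fun n => ‖z n‖ := by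
  simpa using hz 0

theorem RapidDecay.of_le {z w : ℤ × ℤ → ℂ} (hz : RapidDecay z) (C : ℝ) (k : ℕ)
    (h : ∀ n, ‖w n‖ ≤ C * (1 + ‖n‖) ^ k * ‖z n‖) : RapidDecay w := by
  intro l
  refine Summable.of_nonneg_of_le (fun n => by positivity) (fun n => ?_) ((hz (l + k)).mul_left C)
  calc _ ≤ (1 + ‖n‖) ^ l * (C * (1 + ‖n‖) ^ k * ‖z n‖) := by gcongr; exact h n
    _ = _ := by rw [pow_add]; ring

theorem RapidDecay.mul {z w : ℤ × ℤ → ℂ} (hz : RapidDecay z) {C : ℝ} {k : ℕ}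
    (h : ∀ n, ‖w n‖ ≤ C * (1 + ‖n‖) ^ k) : RapidDecay fun n => z n * w n := by
  refine hz.of_le C k fun n => ?_
  rw [norm_mul, mul_comm]
  gcongr
  exact h n

theorem rapidDecay_of_finite {z : ℤ × ℤ → ℂ} (hz : z.support.Finite) : RapidDecay z := by
  intro k
  refine summable_of_hasFiniteSupport ?_
  refine hz.subset fun n hn => ?_
  rw [Function.mem_support] at hn ⊢
  intro h
  simp [h] at hn

theorem RapidDecay.summable_chr {z : ℤ × ℤ → ℂ} (hz : RapidDecay z) (x : ℝ × ℝ) :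
    Summable fun n => z n * chr n x := by
  refine Summable.of_norm ?_
  simpa [norm_mul] using hz.summable_norm

theorem norm_fser_le {z : ℤ × ℤ → ℂ} (hz : RapidDecay z) (x : ℝ × ℝ) : ‖fser z x‖ ≤ ∑' n, ‖z n‖ :=
  tsum_of_norm_bounded hz.summable_norm.hasSum fun n => by simp

/-- The coefficients of the first derivative. -/
def dX (z : ℤ × ℤ → ℂ) (n : ℤ × ℤ) : ℂ := 2 * Real.pi * n.1 * Complex.I * z n

/-- The coefficients of the second derivative. -/
def dY (z : ℤ × ℤ → ℂ) (n : ℤ × ℤ) : ℂ := 2 * Real.pi * n.2 * Complex.I * z n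

theorem norm_two_pi_mul (k : ℤ) : ‖(2 * Real.pi * k * Complex.I : ℂ)‖ = 2 * Real.pi * |(k : ℝ)| := by
  simp only [norm_mul, Complex.norm_I, mul_one, Complex.norm_real, Complex.norm_intCast,
    Complex.norm_ofNat, Real.norm_of_nonneg Real.pi_pos.le]

theorem norm_dX_le (z : ℤ × ℤ → ℂ) (n : ℤ × ℤ) :
    ‖dX z n‖ ≤ 2 * Real.pi * (1 + ‖n‖) * ‖z n‖ := by
  unfold dX
  rw [norm_mul, norm_two_pi_mul]
  gcongr
  linarith [abs_fst_le_norm n]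

theorem norm_dY_le (z : ℤ × ℤ → ℂ) (n : ℤ × ℤ) :
    ‖dY z n‖ ≤ 2 * Real.pi * (1 + ‖n‖) * ‖z n‖ := by
  unfold dY
  rw [norm_mul, norm_two_pi_mul]
  gcongr
  linarith [abs_snd_le_norm n]

theorem RapidDecay.dX {z : ℤ × ℤ → ℂ} (hz : RapidDecay z) : RapidDecay (dX z) :=
  hz.of_le (2 * Real.pi) 1 fun n => by simpa using norm_dX_le z n

theorem RapidDecay.dY {z : ℤ × ℤ → ℂ} (hz : RapidDecay z) : RapidDecay (dY z) :=
  hz.of_le (2 * Real.pi) 1 fun n => by simpa using norm_dY_le z n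

theorem hasDerivAt_chr_fst (n : ℤ × ℤ) (s t : ℝ) :
    HasDerivAt (fun s => chr n (s, t)) (2 * Real.pi * n.1 * Complex.I * chr n (s, t)) s := by
  have h : HasDerivAt (fun s : ℝ => ((2 * Real.pi * (n.1 * s + n.2 * t) : ℝ) : ℂ) * Complex.I)
      ((2 * Real.pi * (n.1 * 1) : ℝ) * Complex.I) s :=
    ((((hasDerivAt_id s).const_mul (n.1 : ℝ)).add_const (n.2 * t)).const_mul
      (2 * Real.pi)).ofReal_comp.mul_const _
  have h2 := h.cexp
  refine h2.congr_deriv ?_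
  unfold chr
  push_cast
  ring

theorem hasDerivAt_chr_snd (n : ℤ × ℤ) (s t : ℝ) :
    HasDerivAt (fun t => chr n (s, t)) (2 * Real.pi * n.2 * Complex.I * chr n (s, t)) t := by
  have h : HasDerivAt (fun t : ℝ => ((2 * Real.pi * (n.1 * s + n.2 * t) : ℝ) : ℂ) * Complex.I)
      ((2 * Real.pi * (n.2 * 1) : ℝ) * Complex.I) t :=
    ((((hasDerivAt_id t).const_mul (n.2 : ℝ)).const_add (n.1 * s)).const_mul
      (2 * Real.pi)).ofReal_comp.mul_const _
  have h2 := h.cexp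
  refine h2.congr_deriv ?_
  unfold chr
  push_cast
  ring

theorem hasDerivAt_fser_fst {z : ℤ × ℤ → ℂ} (hz : RapidDecay z) (s t : ℝ) :
    HasDerivAt (fun s => fser z (s, t)) (fser (dX z) (s, t)) s :=
  hasDerivAt_tsum (g' := fun n s => dX z n * chr n (s, t)) hz.dX.summable_norm
    (fun n s => ((hasDerivAt_chr_fst n s t).const_mul (z n)).congr_deriv (by unfold dX; ring))
    (fun n s => by simp) (hz.summable_chr (0, t)) s

theorem hasDerivAt_fser_snd {z : ℤ × ℤ → ℂ} (hz : RapidDecay z) (s t : ℝ) :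
    HasDerivAt (fun t => fser z (s, t)) (fser (dY z) (s, t)) t :=
  hasDerivAt_tsum (g' := fun n t => dY z n * chr n (s, t)) hz.dY.summable_norm
    (fun n t => ((hasDerivAt_chr_snd n s t).const_mul (z n)).congr_deriv (by unfold dY; ring))
    (fun n s => by simp) (hz.summable_chr (s, 0)) t

theorem hasDerivAt_re {f : ℝ → ℂ} {f' : ℂ} {t : ℝ} (h : HasDerivAt f f' t) :
    HasDerivAt (fun t => (f t).re) f'.re t :=
  Complex.reCLM.hasFDerivAt.comp_hasDerivAt t h

theorem pd₁_re_fser {z : ℤ × ℤ → ℂ} (hz : RapidDecay z) :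
    pd₁ (fun x => (fser z x).re) = fun x => (fser (dX z) x).re :=
  funext fun x => (hasDerivAt_re (hasDerivAt_fser_fst hz x.1 x.2)).deriv

theorem pd₂_re_fser {z : ℤ × ℤ → ℂ} (hz : RapidDecay z) :
    pd₂ (fun x => (fser z x).re) = fun x => (fser (dY z) x).re :=
  funext fun x => (hasDerivAt_re (hasDerivAt_fser_snd hz x.1 x.2)).deriv

theorem iterate_pd_re_fser {z : ℤ × ℤ → ℂ} (hz : RapidDecay z) (i j : ℕ) :
    (pd₁^[i] (pd₂^[j] fun x => (fser z x).re) = fun x => (fser (dX^[i] (dY^[j] z)) x).re) ∧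
      RapidDecay (dX^[i] (dY^[j] z)) ∧
      ∀ n, ‖(dX^[i] (dY^[j] z)) n‖ ≤ (2 * Real.pi * (1 + ‖n‖)) ^ (i + j) * ‖z n‖ := by
  have h1 : ∀ j : ℕ, (pd₂^[j] fun x => (fser z x).re) = (fun x => (fser (dY^[j] z) x).re) ∧
      RapidDecay (dY^[j] z) ∧ ∀ n, ‖(dY^[j] z) n‖ ≤ (2 * Real.pi * (1 + ‖n‖)) ^ j * ‖z n‖ := by
    intro j
    induction j with
    | zero => exact ⟨rfl, hz, by simp⟩
    | succ j ih =>
      simp only [Function.iterate_succ_apply']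
      refine ⟨by rw [ih.1, pd₂_re_fser ih.2.1], ih.2.1.dY, fun n => (norm_dY_le _ n).trans ?_⟩
      rw [pow_succ', mul_assoc _ _ ‖z n‖]
      exact mul_le_mul_of_nonneg_left (ih.2.2 n) (by positivity)
  induction i with
  | zero =>
    rw [zero_add]
    exact h1 j
  | succ i ih =>
    simp only [Function.iterate_succ_apply']
    refine ⟨by rw [ih.1, pd₁_re_fser ih.2.1], ih.2.1.dX, fun n => (norm_dX_le _ n).trans ?_⟩
    rw [show i + 1 + j = (i + j) + 1 by ring, pow_succ', mul_assoc _ _ ‖z n‖]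
    exact mul_le_mul_of_nonneg_left (ih.2.2 n) (by positivity)

theorem one_le_two_pi_mul (n : ℤ × ℤ) : 1 ≤ 2 * Real.pi * (1 + ‖n‖) := by
  nlinarith [Real.pi_gt_three, norm_nonneg n]

theorem RapidDecay.summable_two_pi {z : ℤ × ℤ → ℂ} (hz : RapidDecay z) (k : ℕ) :
    Summable fun n => (2 * Real.pi * (1 + ‖n‖)) ^ k * ‖z n‖ := by
  refine ((hz k).mul_left ((2 * Real.pi) ^ k)).congr fun n => ?_
  rw [mul_pow (2 * Real.pi) (1 + ‖n‖)]; ring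

/-- Controls the test function seminorms by weighted `ℓ¹` norms of the coefficients, so that
distributions can be applied to Fourier series term by term. -/
theorem derivBound_re_fser {z : ℤ × ℤ → ℂ} (hz : RapidDecay z) (N : ℕ) :
    DerivBound N (∑' n, (2 * Real.pi * (1 + ‖n‖)) ^ (2 * N) * ‖z n‖) fun x => (fser z x).re := by
  intro i hi j hj x
  obtain ⟨h1, h2, h3⟩ := iterate_pd_re_fser hz i j
  rw [h1]
  refine (Complex.abs_re_le_norm _).trans ((norm_fser_le h2 x).trans ?_)
  refine h2.summable_norm.tsum_le_tsum (fun n => (h3 n).trans ?_) (hz.summable_two_pi _)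
  gcongr
  · exact one_le_two_pi_mul n
  · omega

theorem pair_sub (f : PeriodicDistribution) (ζ η : TorusTest) :
    pair f (ζ - η) = pair f ζ - pair f η := map_sub (f : TorusTest →ₗ[ℝ] ℝ) ζ η

/-- The trigonometric test function `Re (z e^{ik·x})`. -/
def trigTest (z : ℂ) (n : ℤ × ℤ) : TorusTest := z.re • cosTest n - z.im • sinTest n

theorem trigTest_apply (z : ℂ) (n : ℤ × ℤ) (x : ℝ × ℝ) :
    (trigTest z n : ℝ × ℝ → ℝ) x = (z * chr n x).re := by
  rw [Complex.mul_re, chr_re, chr_im]; rfl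

theorem pair_trigTest (f : PeriodicDistribution) (z : ℂ) (n : ℤ × ℤ) :
    pair f (trigTest z n) = (z * fourierCoeff f (-n)).re := by
  unfold trigTest fourierCoeff
  rw [pair_sub, pair_smul, pair_smul, cosTest_neg, sinTest_neg, pair_neg]
  simp

/-- A periodic distribution acts on smooth functions through the Fourier coefficients. -/
theorem hasSum_pair_of_fser (f : PeriodicDistribution) (ζ : TorusTest) {z : ℤ × ℤ → ℂ}
    (hz : RapidDecay z) (hζ : ∀ x, (ζ : ℝ × ℝ → ℝ) x = (fser z x).re) :
    HasSum (fun n => (z n * fourierCoeff f (-n)).re) (pair f ζ) := by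
  obtain ⟨N, C, hf⟩ := f.2
  set g : ℤ × ℤ → ℝ := fun n => (2 * Real.pi * (1 + ‖n‖)) ^ (2 * N) * ‖z n‖ with hg
  have hgs : Summable g := hz.summable_two_pi _
  have key : ∀ S : Finset (ℤ × ℤ), |∑ n ∈ S, (z n * fourierCoeff f (-n)).re - pair f ζ| ≤
      C * (∑' n, g n - ∑ n ∈ S, g n) := by
    intro S
    -- The coefficients of the remainder. Continuity of `f` bounds its value there by the tail of a
    -- convergent series.
    set w : ℤ × ℤ → ℂ := fun n => if n ∈ S then 0 else z n with hw
    have hwd : RapidDecay w := by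
      refine hz.of_le 1 0 fun n => ?_
      simp only [hw]
      split_ifs <;> simp
    have hrest : ∀ x, ((ζ - ∑ n ∈ S, trigTest (z n) n : TorusTest) : ℝ × ℝ → ℝ) x = (fser w x).re := by
      intro x
      have h1 : ((ζ - ∑ n ∈ S, trigTest (z n) n : TorusTest) : ℝ × ℝ → ℝ) x =
          (fser z x).re - (∑ n ∈ S, z n * chr n x).re := by
        rw [← hζ, Complex.re_sum]
        simp [trigTest_apply]
      rw [h1, ← Complex.sub_re]
      congr 1
      have h2 : HasSum (fun n => if n ∈ S then z n * chr n x else 0) (∑ n ∈ S, z n * chr n x) := by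
        have : HasSum (fun n => if n ∈ S then z n * chr n x else 0)
            (∑ n ∈ S, if n ∈ S then z n * chr n x else 0) :=
          hasSum_sum_of_ne_finset_zero (fun n hn => by simp [hn])
        rwa [Finset.sum_congr rfl fun n hn => if_pos hn] at this
      have h3 := ((hz.summable_chr x).hasSum.sub h2).tsum_eq
      rw [fser, fser, ← h3]
      refine tsum_congr fun n => ?_
      simp only [hw]
      split_ifs <;> simp
    have hb := derivBound_re_fser hwd N
    rw [← funext hrest] at hb
    have h4 := hf _ _ hb
    have h5 : pair f (ζ - ∑ n ∈ S, trigTest (z n) n) =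
        pair f ζ - ∑ n ∈ S, (z n * fourierCoeff f (-n)).re := by
      rw [pair_sub, pair_sum]
      simp only [pair_trigTest]
    have h6 : ∑' n, (2 * Real.pi * (1 + ‖n‖)) ^ (2 * N) * ‖w n‖ = ∑' n, g n - ∑ n ∈ S, g n := by
      have h2 : HasSum (fun n => if n ∈ S then g n else 0) (∑ n ∈ S, g n) := by
        have : HasSum (fun n => if n ∈ S then g n else 0) (∑ n ∈ S, if n ∈ S then g n else 0) :=
          hasSum_sum_of_ne_finset_zero (fun n hn => by simp [hn])
        rwa [Finset.sum_congr rfl fun n hn => if_pos hn] at this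
      rw [← (hgs.hasSum.sub h2).tsum_eq]
      refine tsum_congr fun n => ?_
      simp only [hw, hg]
      split_ifs <;> simp
    rw [h6] at h4
    change |pair f _| ≤ _ at h4
    rwa [h5, abs_sub_comm] at h4
  rw [HasSum, SummationFilter.unconditional_filter, tendsto_iff_norm_sub_tendsto_zero]
  refine squeeze_zero (fun S => norm_nonneg _) key ?_
  have h7 : Tendsto (fun S : Finset (ℤ × ℤ) => ∑ n ∈ S, g n) atTop (𝓝 (∑' n, g n)) := hgs.hasSum
  have h8 := (h7.const_sub (∑' n, g n)).const_mul C
  simpa using h8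

/-- A single character has seminorms that grow polynomially in its frequency, and `f` is bounded by
finitely many seminorms. -/
theorem exists_fourierCoeff_bound (f : PeriodicDistribution) :
    ∃ (C : ℝ) (k : ℕ), 0 ≤ C ∧ ∀ n, ‖fourierCoeff f n‖ ≤ C * (1 + ‖n‖) ^ k := by
  obtain ⟨N, C, hf⟩ := f.2
  have key : ∀ (c : ℂ) (n : ℤ × ℤ), ‖c‖ = 1 →
      |pair f (trigTest c n)| ≤ |C| * (2 * Real.pi) ^ (2 * N) * (1 + ‖n‖) ^ (2 * N) := by
    intro c n hc
    have hd : RapidDecay (Pi.single n c) := rapidDecay_of_finite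
      ((Set.finite_singleton n).subset (Pi.support_single_subset))
    have hb := derivBound_re_fser hd N
    have e1 : (fun x => (fser (Pi.single n c) x).re) = (trigTest c n : ℝ × ℝ → ℝ) := by
      funext x
      rw [trigTest_apply, fser, tsum_eq_single n]
      · simp
      · intro m hm; simp [hm]
    have e2 : ∑' m, (2 * Real.pi * (1 + ‖m‖)) ^ (2 * N) * ‖(Pi.single n c : ℤ × ℤ → ℂ) m‖ =
        (2 * Real.pi * (1 + ‖n‖)) ^ (2 * N) := by
      rw [tsum_eq_single n]
      · simp [hc]
      · intro m hm; simp [hm]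
    rw [e1, e2] at hb
    have h := hf _ _ hb
    change |pair f _| ≤ _ at h
    refine h.trans ((mul_le_mul_of_nonneg_right (le_abs_self C) (by positivity)).trans
      (le_of_eq ?_))
    rw [mul_pow (2 * Real.pi) (1 + ‖n‖)]; ring
  refine ⟨2 * (|C| * (2 * Real.pi) ^ (2 * N)), 2 * N, by positivity, fun n => ?_⟩
  have h1 := key 1 n (by simp)
  have h2 := key Complex.I n (by simp)
  have e1 : trigTest 1 n = cosTest n := by simp [trigTest]
  have e2 : trigTest Complex.I n = -sinTest n := by simp [trigTest]
  rw [e1] at h1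
  rw [e2, pair_neg, abs_neg] at h2
  unfold fourierCoeff
  refine (norm_sub_le _ _).trans ?_
  rw [norm_mul, Complex.norm_I, one_mul, Complex.norm_real, Complex.norm_real, Real.norm_eq_abs,
    Real.norm_eq_abs]
  linarith

/-! ### Integrals of characters against test functions -/

theorem integral_cell_eq {E : Type*} [NormedAddCommGroup E] [NormedSpace ℝ E] {f : ℝ × ℝ → E}
    (hf : Continuous f) : ∫ x in cell, f x = ∫ t in (0 : ℝ)..1, ∫ s in (0 : ℝ)..1, f (s, t) := by
  have hi := integrableOn_cell hf
  rw [cell, Measure.volume_eq_prod, IntegrableOn, ← Measure.prod_restrict] at hi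
  rw [cell, Measure.volume_eq_prod, ← Measure.prod_restrict, integral_prod_symm _ hi]
  simp only [intervalIntegral.integral_of_le zero_le_one, ← integral_Ico_eq_integral_Ioc]

theorem integral_cell_eq' {E : Type*} [NormedAddCommGroup E] [NormedSpace ℝ E] {f : ℝ × ℝ → E}
    (hf : Continuous f) : ∫ x in cell, f x = ∫ s in (0 : ℝ)..1, ∫ t in (0 : ℝ)..1, f (s, t) := by
  have hi := integrableOn_cell hf
  rw [cell, Measure.volume_eq_prod, IntegrableOn, ← Measure.prod_restrict] at hi
  rw [cell, Measure.volume_eq_prod, ← Measure.prod_restrict, integral_prod _ hi]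
  simp only [intervalIntegral.integral_of_le zero_le_one, ← integral_Ico_eq_integral_Ioc]

theorem continuous_pd₂_test (ζ : TorusTest) : Continuous (pd₂ ζ) := (contDiff_pd₂ ζ.2.1).continuous

theorem hasDerivAt_pd₁ (ζ : TorusTest) (s t : ℝ) :
    HasDerivAt (fun s => (ζ : ℝ × ℝ → ℝ) (s, t)) (pd₁ ζ (s, t)) s := by
  have h : DifferentiableAt ℝ (fun s => (ζ : ℝ × ℝ → ℝ) (s, t)) s :=
    ((ζ.2.1.differentiable (by simp)).comp
      (differentiable_id.prodMk (differentiable_const t))).differentiableAt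
  exact h.hasDerivAt

theorem continuous_pd₁_test (ζ : TorusTest) : Continuous (pd₁ ζ) := by
  have h : pd₁ ζ = fun x => fderiv ℝ (ζ : ℝ × ℝ → ℝ) x (1, 0) := by
    funext x
    have h1 : HasDerivAt (fun t : ℝ => ((t, x.2) : ℝ × ℝ)) (1, 0) x.1 :=
      (hasDerivAt_id _).prodMk (hasDerivAt_const _ _)
    have h2 : HasFDerivAt (ζ : ℝ × ℝ → ℝ) (fderiv ℝ (ζ : ℝ × ℝ → ℝ) x) (x.1, x.2) :=
      (ζ.2.1.differentiable (by simp) x).hasFDerivAt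
    exact (h2.comp_hasDerivAt x.1 h1).deriv
  rw [h]
  exact ((contDiff_infty_iff_fderiv.1 ζ.2.1).2.clm_apply contDiff_const).continuous

theorem integral_chr_mul_pd₁ (ζ : TorusTest) (k : ℤ × ℤ) :
    ∫ x in cell, chr k x * (pd₁ ζ x : ℂ) =
      -(2 * Real.pi * k.1 * Complex.I) * ∫ x in cell, chr k x * ((ζ : ℝ × ℝ → ℝ) x : ℂ) := by
  have c1 := continuous_pd₁_test ζ
  have c2 := ζ.2.1.continuous
  have c3 := continuous_chr k
  rw [integral_cell_eq (by fun_prop), integral_cell_eq (by fun_prop),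
    ← intervalIntegral.integral_const_mul]
  refine intervalIntegral.integral_congr fun t _ => ?_
  have h := intervalIntegral.integral_mul_deriv_eq_deriv_mul (a := 0) (b := 1)
    (u := fun s => chr k (s, t)) (v := fun s => ((ζ : ℝ × ℝ → ℝ) (s, t) : ℂ))
    (u' := fun s => 2 * Real.pi * k.1 * Complex.I * chr k (s, t))
    (v' := fun s => (pd₁ ζ (s, t) : ℂ))
    (fun s _ => hasDerivAt_chr_fst k s t) (fun s _ => (hasDerivAt_pd₁ ζ s t).ofReal_comp)
    (Continuous.intervalIntegrable (by fun_prop) _ _) (Continuous.intervalIntegrable (by fun_prop) _ _)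
  have e1 : chr k (1, t) = chr k (0, t) := by simpa using chr_add_one_fst k (0, t)
  have e2 : (ζ : ℝ × ℝ → ℝ) (1, t) = (ζ : ℝ × ℝ → ℝ) (0, t) := by simpa using (ζ.2.2 (0, t)).1
  rw [h, e1, e2, sub_self, zero_sub, ← intervalIntegral.integral_neg,
    ← intervalIntegral.integral_const_mul]
  refine intervalIntegral.integral_congr fun s _ => ?_
  ring

theorem integral_chr_mul_pd₂ (ζ : TorusTest) (k : ℤ × ℤ) :
    ∫ x in cell, chr k x * (pd₂ ζ x : ℂ) =
      -(2 * Real.pi * k.2 * Complex.I) * ∫ x in cell, chr k x * ((ζ : ℝ × ℝ → ℝ) x : ℂ) := by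
  have c1 := continuous_pd₂_test ζ
  have c2 := ζ.2.1.continuous
  have c3 := continuous_chr k
  rw [integral_cell_eq' (by fun_prop), integral_cell_eq' (by fun_prop),
    ← intervalIntegral.integral_const_mul]
  refine intervalIntegral.integral_congr fun s _ => ?_
  have h := intervalIntegral.integral_mul_deriv_eq_deriv_mul (a := 0) (b := 1)
    (u := fun t => chr k (s, t)) (v := fun t => ((ζ : ℝ × ℝ → ℝ) (s, t) : ℂ))
    (u' := fun t => 2 * Real.pi * k.2 * Complex.I * chr k (s, t))
    (v' := fun t => (pd₂ ζ (s, t) : ℂ))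
    (fun t _ => hasDerivAt_chr_snd k s t) (fun t _ => (hasDerivAt_pd₂ ζ.2.1 s t).ofReal_comp)
    (Continuous.intervalIntegrable (by fun_prop) _ _) (Continuous.intervalIntegrable (by fun_prop) _ _)
  have e1 : chr k (s, 1) = chr k (s, 0) := by simpa using chr_add_one_snd k (s, 0)
  have e2 : (ζ : ℝ × ℝ → ℝ) (s, 1) = (ζ : ℝ × ℝ → ℝ) (s, 0) := by simpa using (ζ.2.2 (s, 0)).2
  rw [h, e1, e2, sub_self, zero_sub, ← intervalIntegral.integral_neg,
    ← intervalIntegral.integral_const_mul]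
  refine intervalIntegral.integral_congr fun t _ => ?_
  ring

theorem interval_integral_exp_int (n : ℤ) :
    ∫ t in (0 : ℝ)..1, Complex.exp ((2 * Real.pi * n * t : ℝ) * Complex.I) =
      if n = 0 then 1 else 0 := by
  rw [intervalIntegral.integral_of_le zero_le_one, ← integral_Ico_eq_integral_Ioc]
  exact integral_exp_int n

theorem projTest_apply (ζ : TorusTest) (x : ℝ × ℝ) :
    (projTest ζ : ℝ × ℝ → ℝ) x = (ζ : ℝ × ℝ → ℝ) x - avg₁ ζ x := rfl

theorem continuous_avg₁ (ζ : TorusTest) : Continuous (avg₁ ζ) := (contDiff_avg₁ ζ.2.1).continuous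

/-- The average in the first variable keeps exactly the frequencies with vanishing first component.
-/
theorem integral_chr_mul_avg₁ (ζ : TorusTest) (k : ℤ × ℤ) :
    ∫ x in cell, chr k x * (avg₁ ζ x : ℂ) =
      if k.1 = 0 then ∫ x in cell, chr k x * ((ζ : ℝ × ℝ → ℝ) x : ℂ) else 0 := by
  have c1 := continuous_avg₁ ζ
  have c2 := ζ.2.1.continuous
  have c3 := continuous_chr k
  have hk : ∀ s t, chr k (s, t) * (avg₁ ζ (s, t) : ℂ) =
      Complex.exp ((2 * Real.pi * k.1 * s : ℝ) * Complex.I) *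
      (Complex.exp ((2 * Real.pi * k.2 * t : ℝ) * Complex.I) * (avg₁ ζ (0, t) : ℂ)) := by
    intro s t
    rw [chr_eq_mul, mul_assoc]
    rfl
  rw [integral_cell_eq (by fun_prop), integral_cell_eq (by fun_prop)]
  simp only [hk, intervalIntegral.integral_mul_const, interval_integral_exp_int]
  split_ifs with h
  · refine intervalIntegral.integral_congr fun t _ => ?_
    simp only [chr_eq_mul, h, avg₁, one_mul]
    simp only [Int.cast_zero, mul_zero, zero_mul, Complex.ofReal_zero, Complex.exp_zero, one_mul]
    rw [intervalIntegral.integral_const_mul, intervalIntegral.integral_ofReal]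
  · simp

theorem integral_chr_mul_projTest (ζ : TorusTest) (k : ℤ × ℤ) :
    ∫ x in cell, chr k x * ((projTest ζ : ℝ × ℝ → ℝ) x : ℂ) =
      if k.1 = 0 then 0 else ∫ x in cell, chr k x * ((ζ : ℝ × ℝ → ℝ) x : ℂ) := by
  have c1 := continuous_avg₁ ζ
  have c2 := ζ.2.1.continuous
  have c3 := continuous_chr k
  have h : ∫ x in cell, chr k x * ((projTest ζ : ℝ × ℝ → ℝ) x : ℂ) =
      (∫ x in cell, chr k x * ((ζ : ℝ × ℝ → ℝ) x : ℂ)) - ∫ x in cell, chr k x * (avg₁ ζ x : ℂ) := by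
    rw [← integral_sub (integrableOn_cell (by fun_prop)) (integrableOn_cell (by fun_prop))]
    refine integral_congr_ae (ae_of_all _ fun x => ?_)
    simp only [projTest_apply, Complex.ofReal_sub, mul_sub]
  rw [h, integral_chr_mul_avg₁]
  split_ifs <;> simp

/-! ### Absolutely convergent trigonometric series -/

/-- The trigonometric series `∑ c_i e^{ik_i·x}`. -/
def tser {ι : Type*} (c : ι → ℂ) (n : ι → ℤ × ℤ) (x : ℝ × ℝ) : ℂ := ∑' i, c i * chr (n i) x

section Tser

theorem summable_tser {ι : Type*} {c : ι → ℂ} (hc : Summable fun i => ‖c i‖) (n : ι → ℤ × ℤ)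
    (x : ℝ × ℝ) : Summable fun i => c i * chr (n i) x :=
  Summable.of_norm (by simpa [norm_mul] using hc)

theorem continuous_tser {ι : Type*} {c : ι → ℂ} (hc : Summable fun i => ‖c i‖) (n : ι → ℤ × ℤ) :
    Continuous (tser c n) :=
  continuous_tsum (fun i => continuous_const.mul (continuous_chr _)) hc fun i x => by simp

theorem isPeriodic_re_tser {ι : Type*} (c : ι → ℂ) (n : ι → ℤ × ℤ) :
    IsPeriodic fun x => (tser c n x).re := by
  intro x
  simp only [tser, chr_add_one_fst, chr_add_one_snd, and_self]

theorem hasSum_integral_tser_mul {ι : Type*} [Countable ι] {c : ι → ℂ} (hc : Summable fun i => ‖c i‖)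
    (n : ι → ℤ × ℤ) {ζ : ℝ × ℝ → ℝ} (hζ : Continuous ζ) :
    HasSum (fun i => (c i * ∫ x in cell, chr (n i) x * (ζ x : ℂ)).re)
      (∫ x in cell, (tser c n x).re * ζ x) := by
  obtain ⟨B, hB⟩ := isCompact_square.exists_bound_of_continuousOn hζ.continuousOn
  have hcont : ∀ i, Continuous fun x => c i * (chr (n i) x * (ζ x : ℂ)) := fun i => by
    have := continuous_chr (n i)
    fun_prop
  have hbd : ∀ i, ∫ x in cell, ‖c i * (chr (n i) x * (ζ x : ℂ))‖ ≤ ‖c i‖ * B := by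
    intro i
    have h1 : ∫ x in cell, ‖c i * (chr (n i) x * (ζ x : ℂ))‖ ≤ ∫ x in cell, ‖c i‖ * B := by
      refine setIntegral_mono_on (integrableOn_cell (hcont i).norm) (integrableOn_cell continuous_const)
        measurableSet_cell fun x hx => ?_
      rw [norm_mul, norm_mul, norm_chr, one_mul, Complex.norm_real]
      exact mul_le_mul_of_nonneg_left (hB x (cell_subset_square hx)) (norm_nonneg _)
    simpa using h1
  have h := hasSum_integral_of_summable_integral_norm (μ := volume.restrict cell)
    (F := fun i x => c i * (chr (n i) x * (ζ x : ℂ))) (fun i => integrableOn_cell (hcont i))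
    (Summable.of_nonneg_of_le (fun i => integral_nonneg fun x => norm_nonneg _) hbd
      (hc.mul_right B))
  have h2 := Complex.hasSum_re h
  simp only [integral_const_mul] at h2
  have hi : Integrable (fun x => tser c n x * (ζ x : ℂ)) (volume.restrict cell) :=
    integrableOn_cell ((continuous_tser hc n).mul (by fun_prop))
  have e : ∀ x, ∑' i, c i * (chr (n i) x * (ζ x : ℂ)) = tser c n x * (ζ x : ℂ) := fun x => by
    rw [tser, ← tsum_mul_right]
    simp only [mul_assoc]
  simp only [e] at h2
  have h3 := Complex.reCLM.integral_comp_comm hi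
  simp only [Complex.reCLM_apply, Complex.re_mul_ofReal] at h3
  rwa [h3]

/-- The average-free part of a trigonometric series in divergence form. -/
theorem isDecomposition_tser {ι : Type*} [Countable ι] {c : ι → ℂ} (hc : Summable fun i => ‖c i‖)
    (n : ι → ℤ × ℤ) :
    IsDecomposition (proj (ofFun fun x => (tser c n x).re)) 0
      (fun x => (tser (fun i => potX (n i) * c i) n x).re)
      (fun x => (tser (fun i => potY (n i) * c i) n x).re) := by
  intro ζ
  have hX : Summable fun i => ‖potX (n i) * c i‖ := by
    refine Summable.of_nonneg_of_le (fun i => norm_nonneg _) (fun i => ?_) hc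
    rw [norm_mul]
    refine mul_le_of_le_one_left (norm_nonneg _) ((norm_potX_le _).trans ?_)
    exact Real.rpow_le_one_of_one_le_of_nonpos (one_le_rho _) (by norm_num)
  have hY : Summable fun i => ‖potY (n i) * c i‖ := by
    refine Summable.of_nonneg_of_le (fun i => norm_nonneg _) (fun i => ?_) hc
    rw [norm_mul]
    refine mul_le_of_le_one_left (norm_nonneg _) ((norm_potY_le _).trans ?_)
    exact Real.rpow_le_one_of_one_le_of_nonpos (one_le_rho _) (by norm_num)
  have h0 := hasSum_integral_tser_mul hc n (projTest ζ).2.1.continuous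
  have h1 := hasSum_integral_tser_mul hX n (continuous_pd₁_test ζ)
  have h2 := hasSum_integral_tser_mul hY n (continuous_pd₂_test ζ)
  have e0 : pair (proj (ofFun fun x => (tser c n x).re)) ζ =
      ∫ x in cell, (tser c n x).re * (projTest ζ : ℝ × ℝ → ℝ) x := by
    have hi : IntegrableOn (fun x => (tser c n x).re) cell :=
      integrableOn_cell (Complex.continuous_re.comp (continuous_tser hc n))
    change (ofFun fun x => (tser c n x).re : TorusTest →ₗ[ℝ] ℝ) (projTest ζ) = _
    rw [ofFun, dif_pos hi]
    rfl
  rw [e0, zero_mul, zero_sub, ← neg_add']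
  refine h0.unique ?_
  have h3 := (h1.add h2).neg
  -- The identity is checked frequency by frequency. If the first component vanishes, both sides are
  -- zero; otherwise integration by parts reduces it to `potX_add_potY`.
  suffices e : ∀ i, (c i * ∫ x in cell, chr (n i) x * ((projTest ζ : ℝ × ℝ → ℝ) x : ℂ)).re =
      -((potX (n i) * c i * ∫ x in cell, chr (n i) x * (pd₁ ζ x : ℂ)).re +
        (potY (n i) * c i * ∫ x in cell, chr (n i) x * (pd₂ ζ x : ℂ)).re) by
    simp only [e]
    exact h3
  intro i
  rw [integral_chr_mul_projTest, integral_chr_mul_pd₁, integral_chr_mul_pd₂]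
  split_ifs with hk
  · simp [potX_fst_zero hk, potY_fst_zero hk]
  · rw [← Complex.add_re, ← Complex.neg_re]
    congr 1
    linear_combination (- c i * ∫ x in cell, chr (n i) x * ((ζ : ℝ × ℝ → ℝ) x : ℂ)) *
      potX_add_potY hk

end Tser

/-! ### The Hilbert transform of a Fourier series -/

/-- The coefficients of real Fourier series. -/
def IsHermitian (z : ℤ × ℤ → ℂ) : Prop := ∀ n, z (-n) = starRingEnd ℂ (z n)

theorem IsHermitian.fser_eq {z : ℤ × ℤ → ℂ} (hz : IsHermitian z) (x : ℝ × ℝ) :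
    fser z x = ((fser z x).re : ℂ) := by
  refine (Complex.conj_eq_iff_re.1 ?_).symm
  rw [fser, Complex.conj_tsum, ← (Equiv.neg (ℤ × ℤ)).tsum_eq]
  refine tsum_congr fun n => ?_
  rw [Equiv.neg_apply, map_mul, hz n, chr_neg]
  simp

/-- Integrating the absolutely convergent series term by term leaves only the column of frequencies
with first component `k`. Hermitian symmetry allows dropping the real part. -/
theorem fourierCoeff₁_re_fser {z : ℤ × ℤ → ℂ} (hz : RapidDecay z) (hz' : IsHermitian z) (k : ℤ)
    (t : ℝ) : fourierCoeff₁ (fun x => (fser z x).re) k t =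
      ∑' m : ℤ, z (k, m) * Complex.exp ((2 * Real.pi * m * t : ℝ) * Complex.I) := by
  have hc : ∀ m : ℤ × ℤ, Continuous fun s : ℝ =>
      Complex.exp (-(2 * Real.pi * k * s : ℝ) * Complex.I) * (z m * chr m (s, t)) := fun m => by
    have := continuous_chr m
    fun_prop
  have hn : ∀ (m : ℤ × ℤ) (s : ℝ),
      ‖Complex.exp (-(2 * Real.pi * k * s : ℝ) * Complex.I) * (z m * chr m (s, t))‖ = ‖z m‖ := by
    intro m s
    rw [← Complex.ofReal_neg, norm_mul, Complex.norm_exp_ofReal_mul_I, norm_mul, norm_chr, one_mul,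
      mul_one]
  have h := hasSum_integral_of_summable_integral_norm (μ := volume.restrict (Ioc (0 : ℝ) 1))
    (F := fun (m : ℤ × ℤ) (s : ℝ) =>
      Complex.exp (-(2 * Real.pi * k * s : ℝ) * Complex.I) * (z m * chr m (s, t)))
    (fun m => (hc m).integrableOn_Ioc) (by
      simp only [hn]
      simpa using hz.summable_norm)
  have e1 : fourierCoeff₁ (fun x => (fser z x).re) k t =
      ∫ s in Ioc (0 : ℝ) 1, ∑' m, Complex.exp (-(2 * Real.pi * k * s : ℝ) * Complex.I) *
        (z m * chr m (s, t)) := by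
    rw [fourierCoeff₁, intervalIntegral.integral_of_le zero_le_one]
    refine integral_congr_ae (ae_of_all _ fun s => ?_)
    dsimp only
    rw [← hz'.fser_eq, fser, tsum_mul_left]
  have e2 : ∀ m : ℤ × ℤ, ∫ s in Ioc (0 : ℝ) 1,
      Complex.exp (-(2 * Real.pi * k * s : ℝ) * Complex.I) * (z m * chr m (s, t)) =
      if m.1 = k then z m * Complex.exp ((2 * Real.pi * m.2 * t : ℝ) * Complex.I) else 0 := by
    intro m
    have e3 : ∀ s : ℝ, Complex.exp (-(2 * Real.pi * k * s : ℝ) * Complex.I) * (z m * chr m (s, t)) =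
        Complex.exp ((2 * Real.pi * (m.1 - k : ℤ) * s : ℝ) * Complex.I) *
          (z m * Complex.exp ((2 * Real.pi * m.2 * t : ℝ) * Complex.I)) := by
      intro s
      rw [chr_eq_mul, show Complex.exp ((2 * Real.pi * (m.1 - k : ℤ) * s : ℝ) * Complex.I) =
        Complex.exp (-(2 * Real.pi * k * s : ℝ) * Complex.I) *
        Complex.exp ((2 * Real.pi * m.1 * s : ℝ) * Complex.I) by
          rw [← Complex.exp_add]; congr 1; push_cast; ring]
      ring
    simp only [e3]
    rw [integral_mul_const, ← intervalIntegral.integral_of_le zero_le_one,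
      interval_integral_exp_int]
    simp only [sub_eq_zero]
    split_ifs <;> simp
  simp only [e2] at h
  rw [e1, ← h.tsum_eq, h.summable.tsum_prod, tsum_eq_single k]
  · simp
  · intro j hj
    simp [hj]

theorem RapidDecay.sign_mul {z : ℤ × ℤ → ℂ} (hz : RapidDecay z) :
    RapidDecay fun n => Complex.I * (n.1.sign : ℂ) * z n := by
  refine hz.of_le 1 0 fun n => ?_
  rw [norm_mul, norm_mul, Complex.norm_I, Complex.norm_intCast, pow_zero]
  gcongr
  rcases lt_trichotomy n.1 0 with h | h | h
  · simp [Int.sign_eq_neg_one_of_neg h]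
  · simp [h]
  · simp [Int.sign_eq_one_of_pos h]

theorem hilbert_re_fser {z : ℤ × ℤ → ℂ} (hz : RapidDecay z) (hz' : IsHermitian z) :
    hilbert (fun x => (fser z x).re) =
      fun x => (fser (fun n => Complex.I * (n.1.sign : ℂ) * z n) x).re := by
  funext x
  rw [hilbert, fser]
  congr 1
  have hd := hz.sign_mul
  rw [(hd.summable_chr x).tsum_prod]
  refine tsum_congr fun k => ?_
  rw [fourierCoeff₁_re_fser hz hz', mul_assoc, ← tsum_mul_right, ← tsum_mul_left]
  refine tsum_congr fun m => ?_
  rw [chr_eq_mul]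
  ring

theorem pd₂_hilbert_re_fser {z : ℤ × ℤ → ℂ} (hz : RapidDecay z) (hz' : IsHermitian z) :
    pd₂ (hilbert fun x => (fser z x).re) = fun x => (fser (fun n => dispSymbol n * z n) x).re := by
  have hd := hz.sign_mul
  rw [hilbert_re_fser hz hz', pd₂_re_fser hd]
  have : dY (fun n => Complex.I * (n.1.sign : ℂ) * z n) = fun n => dispSymbol n * z n := by
    funext n
    rw [dY, dispSymbol]
    ring
  rw [this]

/-! ### Products of real Fourier series -/

theorem RapidDecay.summable_mul {z w : ℤ × ℤ → ℂ} (hz : RapidDecay z) (hw : RapidDecay w) :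
    Summable fun i : (ℤ × ℤ) × (ℤ × ℤ) => ‖z i.1 * w i.2‖ := by
  simp only [norm_mul]
  exact hz.summable_norm.mul_of_nonneg hw.summable_norm (fun n => norm_nonneg _) fun n => norm_nonneg _

/-- It is enough that one factor is real: then the product of the real parts is the real part of the
product. -/
theorem re_fser_mul {z w : ℤ × ℤ → ℂ} (hz : RapidDecay z) (hw : RapidDecay w) (hz' : IsHermitian z)
    (x : ℝ × ℝ) : (fser z x).re * (fser w x).re =
      (tser (fun i : (ℤ × ℤ) × (ℤ × ℤ) => z i.1 * w i.2) (fun i => i.1 + i.2) x).re := by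
  have h : fser z x * fser w x =
      tser (fun i : (ℤ × ℤ) × (ℤ × ℤ) => z i.1 * w i.2) (fun i => i.1 + i.2) x := by
    have hz1 : Summable fun n => ‖z n * chr n x‖ := by simpa using hz.summable_norm
    have hw1 : Summable fun n => ‖w n * chr n x‖ := by simpa using hw.summable_norm
    rw [fser, fser, tsum_mul_tsum_of_summable_norm hz1 hw1, tser]
    refine tsum_congr fun i => ?_
    rw [chr_add]
    ring
  rw [← h, hz'.fser_eq x, Complex.re_ofReal_mul, Complex.ofReal_re]

/-! ### Inversion of periodic functions and periodizations -/

theorem mFourier_eq_chr (n : Fin 2 → ℤ) (x : Fin 2 → ℝ) :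
    UnitAddTorus.mFourier n (fun i => (x i : UnitAddCircle)) = chr (n 0, n 1) (x 0, x 1) := by
  simp only [UnitAddTorus.mFourier, ContinuousMap.coe_mk, Fin.prod_univ_two, fourier_coe_apply]
  rw [← Complex.exp_add, chr]
  congr 1
  push_cast
  ring

theorem periodic_add_int {E : Type*} {F : ℝ × ℝ → E}
    (hp : ∀ x : ℝ × ℝ, F (x.1 + 1, x.2) = F x ∧ F (x.1, x.2 + 1) = F x) (x : ℝ × ℝ) (a b : ℤ) :
    F (x.1 + a, x.2 + b) = F x := by
  have h1 : Function.Periodic (fun s => F (s, x.2)) 1 := fun s => (hp (s, x.2)).1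
  have h2 : Function.Periodic (fun t => F (x.1 + a, t)) 1 := fun t => (hp (x.1 + a, t)).2
  have e1 := h1.int_mul a x.1
  have e2 := h2.int_mul b x.2
  simp only [mul_one] at e1 e2
  rw [e2, e1]

/-- The function descends to the torus `UnitAddTorus (Fin 2)`, continuously because the projection
from the plane is an open quotient map. There a continuous function with summable coefficients
equals its Fourier series. -/
theorem hasSum_fourier_of_periodic {F : ℝ × ℝ → ℂ} (hF : Continuous F)
    (hp : ∀ x : ℝ × ℝ, F (x.1 + 1, x.2) = F x ∧ F (x.1, x.2 + 1) = F x) {Z : ℤ × ℤ → ℂ}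
    (hZ : ∀ n, ∫ x in cell, F x * chr (-n) x = Z n) (hs : Summable Z) (x : ℝ × ℝ) :
    HasSum (fun n => Z n * chr n x) (F x) := by
  let q : (Fin 2 → ℝ) → UnitAddTorus (Fin 2) := Pi.map fun _ => ((↑) : ℝ → UnitAddCircle)
  have hq : IsOpenQuotientMap q :=
    IsOpenQuotientMap.piMap fun _ => QuotientAddGroup.isOpenQuotientMap_mk
  let G₀ : UnitAddTorus (Fin 2) → ℂ := fun θ => F (Function.surjInv hq.surjective θ 0,
    Function.surjInv hq.surjective θ 1)
  have hG₀ : ∀ y : Fin 2 → ℝ, G₀ (q y) = F (y 0, y 1) := by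
    intro y
    have h := Function.surjInv_eq hq.surjective (q y)
    have h' : ∀ i, ∃ a : ℤ, Function.surjInv hq.surjective (q y) i = y i + a := by
      intro i
      have hi : ((Function.surjInv hq.surjective (q y) i : ℝ) : UnitAddCircle) = (y i : ℝ) :=
        congrFun h i
      have h0 : ((Function.surjInv hq.surjective (q y) i - y i : ℝ) : UnitAddCircle) = 0 := by
        rw [AddCircle.coe_sub, hi, sub_self]
      obtain ⟨a, ha⟩ := (AddCircle.coe_eq_zero_iff 1).1 h0
      refine ⟨a, ?_⟩
      rw [zsmul_eq_mul, mul_one] at ha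
      linarith
    obtain ⟨a, ha⟩ := h' 0
    obtain ⟨b, hb⟩ := h' 1
    change F (_, _) = _
    rw [ha, hb]
    exact periodic_add_int hp (y 0, y 1) a b
  have hG₀c : Continuous G₀ := by
    refine hq.isQuotientMap.continuous_iff.2 ?_
    have : G₀ ∘ q = fun y => F (y 0, y 1) := funext hG₀
    rw [this]
    fun_prop
  let G : C(UnitAddTorus (Fin 2), ℂ) := ⟨G₀, hG₀c⟩
  have hcoef : ∀ n : Fin 2 → ℤ, UnitAddTorus.mFourierCoeff G n = Z (n 0, n 1) := by
    intro n
    rw [UnitAddTorus.mFourierCoeff_eq_integral G n 0, ← hZ]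
    have e1 : {y : Fin 2 → ℝ | ∀ i, y i ∈ Ioc ((0 : Fin 2 → ℝ) i) ((0 : Fin 2 → ℝ) i + 1)} =
        MeasurableEquiv.finTwoArrow ⁻¹' (Ioc (0 : ℝ) 1 ×ˢ Ioc (0 : ℝ) 1) := by
      ext y
      simp [Fin.forall_fin_two]
    have e2 : cell =ᵐ[volume] (Ioc (0 : ℝ) 1 ×ˢ Ioc (0 : ℝ) 1 : Set (ℝ × ℝ)) := by
      rw [cell, Measure.volume_eq_prod]
      exact Measure.set_prod_ae_eq Ico_ae_eq_Ioc Ico_ae_eq_Ioc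
    rw [setIntegral_congr_set e2, e1,
      ← (volume_preserving_finTwoArrow ℝ).setIntegral_preimage_emb
        (MeasurableEquiv.measurableEmbedding _)]
    refine setIntegral_congr_fun ((MeasurableEquiv.measurable _)
      (measurableSet_Ioc.prod measurableSet_Ioc)) fun y _ => ?_
    have e3 : UnitAddTorus.mFourier (-n) (fun i => (y i : UnitAddCircle)) =
        chr (-(n 0, n 1)) (y 0, y 1) := mFourier_eq_chr (-n) y
    have e4 : G (fun i => (y i : UnitAddCircle)) = F (y 0, y 1) := hG₀ y
    rw [e3, e4, smul_eq_mul, mul_comm]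
    rfl
  have hsum : Summable (UnitAddTorus.mFourierCoeff G) := by
    rw [← (finTwoArrowEquiv ℤ).symm.summable_iff]
    refine hs.congr fun n => ?_
    rw [Function.comp_apply, hcoef]
    rfl
  have h := UnitAddTorus.hasSum_mFourier_series_apply_of_summable hsum (q ![x.1, x.2])
  rw [← (finTwoArrowEquiv ℤ).symm.hasSum_iff] at h
  have e5 : G (q ![x.1, x.2]) = F x := hG₀ _
  rw [e5] at h
  have e6 : ∀ n : ℤ × ℤ, Z n * chr n x = ((fun i => UnitAddTorus.mFourierCoeff G i •
      UnitAddTorus.mFourier i (q ![x.1, x.2])) ∘ (finTwoArrowEquiv ℤ).symm) n := by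
    intro n
    have e7 := mFourier_eq_chr ((finTwoArrowEquiv ℤ).symm n) ![x.1, x.2]
    rw [Function.comp_apply, hcoef, smul_eq_mul]
    change _ = Z n * UnitAddTorus.mFourier _ fun i => ((![x.1, x.2] i : ℝ) : UnitAddCircle)
    rw [e7]
    rfl
  simp only [e6]
  exact h

/-! ### Periodization, Fourier transform of the kernel, and mollification as a multiplier -/

theorem schwartz_decay {F : Type*} [NormedAddCommGroup F] [NormedSpace ℝ F] (ψ : 𝓢(ℝ × ℝ, F))
    (k : ℕ) : ∃ C, 0 ≤ C ∧ ∀ x, (1 + ‖x‖) ^ k * ‖ψ x‖ ≤ C := by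
  refine ⟨2 ^ k * ((Finset.Iic (k, 0)).sup fun m : ℕ × ℕ => SchwartzMap.seminorm ℝ m.1 m.2) ψ,
    by positivity, fun x => ?_⟩
  have h1 := SchwartzMap.one_add_le_sup_seminorm_apply (𝕜 := ℝ) (m := (k, 0)) (k := k) (n := 0)
    le_rfl le_rfl ψ x
  rwa [norm_iteratedFDeriv_zero] at h1

/-- Unfolding: the translates of the unit cell tile the plane, and characters are invariant under
integer translations. -/
theorem integral_periodize_mul_chr (ψ : 𝓢(ℝ × ℝ, ℝ)) (n : ℤ × ℤ) :
    ∫ x in cell, ((periodize ψ x : ℝ) : ℂ) * chr n x = ∫ x, (ψ x : ℂ) * chr n x := by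
  have hint : Integrable fun x => (ψ x : ℂ) * chr n x :=
    (ψ.integrable.ofReal).mul_bdd (c := 1) (continuous_chr n).aestronglyMeasurable
      (ae_of_all _ fun x => by simp)
  have hU : (⋃ z : ℤ × ℤ, Ico (z.1 : ℝ) (z.1 + 1) ×ˢ Ico (z.2 : ℝ) (z.2 + 1)) = univ := by
    refine eq_univ_of_forall fun x => mem_iUnion.2 ⟨(⌊x.1⌋, ⌊x.2⌋), ?_⟩
    exact ⟨⟨Int.floor_le _, Int.lt_floor_add_one _⟩, ⟨Int.floor_le _, Int.lt_floor_add_one _⟩⟩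
  have hD : Pairwise (Function.onFun Disjoint
      fun z : ℤ × ℤ => (Ico (z.1 : ℝ) (z.1 + 1) ×ˢ Ico (z.2 : ℝ) (z.2 + 1) : Set (ℝ × ℝ))) := by
    intro z w hzw
    refine Set.disjoint_left.2 fun x hx hy => hzw ?_
    have a1 := Int.floor_eq_iff.2 hx.1
    have a2 := Int.floor_eq_iff.2 hx.2
    have b1 := Int.floor_eq_iff.2 hy.1
    have b2 := Int.floor_eq_iff.2 hy.2
    exact Prod.ext (a1.symm.trans b1) (a2.symm.trans b2)
  have h1 := hasSum_integral_iUnion (μ := volume) (f := fun x => (ψ x : ℂ) * chr n x)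
    (fun z : ℤ × ℤ => measurableSet_Ico.prod measurableSet_Ico) hD (hU ▸ hint.integrableOn)
  rw [hU, setIntegral_univ] at h1
  have h2 : ∀ z : ℤ × ℤ, ∫ x in Ico (z.1 : ℝ) (z.1 + 1) ×ˢ Ico (z.2 : ℝ) (z.2 + 1),
      (ψ x : ℂ) * chr n x = ∫ x in cell, (ψ (x + ((z.1 : ℝ), (z.2 : ℝ))) : ℂ) * chr n x := by
    intro z
    have hmp := measurePreserving_add_right (volume : Measure (ℝ × ℝ)) ((z.1 : ℝ), (z.2 : ℝ))
    have hpre : (fun x : ℝ × ℝ => x + ((z.1 : ℝ), (z.2 : ℝ))) ⁻¹'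
        (Ico (z.1 : ℝ) (z.1 + 1) ×ˢ Ico (z.2 : ℝ) (z.2 + 1)) = cell := by
      ext x
      simp only [mem_preimage, mem_prod, cell, mem_Ico, Prod.fst_add, Prod.snd_add]
      constructor <;> rintro ⟨⟨_, _⟩, _, _⟩ <;> refine ⟨⟨?_, ?_⟩, ?_, ?_⟩ <;> linarith
    rw [← hmp.setIntegral_preimage_emb (measurableEmbedding_addRight _), hpre]
    refine integral_congr_ae (ae_of_all _ fun x => ?_)
    dsimp only
    rw [chr_add_arg, chr_int, mul_one]
  simp only [h2] at h1
  obtain ⟨C, hC⟩ := schwartz_lattice_bound ψ 1 zero_le_one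
  have hx1 : ∀ x ∈ cell, ‖x‖ ≤ 1 := by
    intro x hx
    rw [Prod.norm_def, max_le_iff, Real.norm_of_nonneg hx.1.1, Real.norm_of_nonneg hx.2.1]
    exact ⟨hx.1.2.le, hx.2.2.le⟩
  have hcont : ∀ z : ℤ × ℤ, Continuous fun x : ℝ × ℝ =>
      (ψ (x + ((z.1 : ℝ), (z.2 : ℝ))) : ℂ) * chr n x := fun z => by
    have c1 := ψ.continuous
    have c2 := continuous_chr n
    fun_prop
  have hbd : ∀ z : ℤ × ℤ, ∫ x in cell, ‖(ψ (x + ((z.1 : ℝ), (z.2 : ℝ))) : ℂ) * chr n x‖ ≤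
      C * (1 + ‖z‖) ^ (-3 : ℝ) := by
    intro z
    have h3 : ∫ x in cell, ‖(ψ (x + ((z.1 : ℝ), (z.2 : ℝ))) : ℂ) * chr n x‖ ≤
        ∫ x in cell, C * (1 + ‖z‖) ^ (-3 : ℝ) := by
      refine setIntegral_mono_on (integrableOn_cell (hcont z).norm)
        (integrableOn_cell continuous_const) measurableSet_cell fun x hx => ?_
      rw [norm_mul, norm_chr, mul_one, Complex.norm_real]
      exact hC x (hx1 x hx) z
    simpa using h3
  have h4 := hasSum_integral_of_summable_integral_norm (μ := volume.restrict cell)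
    (F := fun (z : ℤ × ℤ) x => (ψ (x + ((z.1 : ℝ), (z.2 : ℝ))) : ℂ) * chr n x)
    (fun z => integrableOn_cell (hcont z))
    (Summable.of_nonneg_of_le (fun i => integral_nonneg fun x => norm_nonneg _) hbd
      (summable_lattice.mul_left C))
  rw [← h4.unique h1]
  refine integral_congr_ae (ae_of_all _ fun x => ?_)
  dsimp only
  rw [periodize, Complex.ofReal_tsum, tsum_mul_right]

/-- The Fourier transform of a real Schwartz function on the plane. -/
theorem exists_fourier (ψ : 𝓢(ℝ × ℝ, ℝ)) : ∃ Ψ : 𝓢(ℝ × ℝ, ℂ), ∀ k : ℝ × ℝ,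
    Ψ k = ∫ x : ℝ × ℝ, (ψ x : ℂ) *
      Complex.exp ((-(2 * Real.pi * (k.1 * x.1 + k.2 * x.2)) : ℝ) * Complex.I) := by
  -- The product carries the supremum norm, whereas the Fourier transform requires an inner product,
  -- so the function is transported to the Euclidean plane and back.
  let e := WithLp.prodContinuousLinearEquiv 2 ℝ ℝ ℝ
  let ψc : 𝓢(ℝ × ℝ, ℂ) := SchwartzMap.postcompCLM Complex.ofRealCLM ψ
  let ψe : 𝓢(WithLp 2 (ℝ × ℝ), ℂ) := SchwartzMap.compCLMOfContinuousLinearEquiv ℝ e ψc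
  refine ⟨SchwartzMap.compCLMOfContinuousLinearEquiv ℝ e.symm (FourierTransform.fourier ψe), fun k => ?_⟩
  have h1 : SchwartzMap.compCLMOfContinuousLinearEquiv ℝ e.symm (FourierTransform.fourier ψe) k =
    FourierTransform.fourier (ψe : WithLp 2 (ℝ × ℝ) → ℂ) (e.symm k) := by
    rw [← SchwartzMap.fourier_coe]; rfl
  rw [h1, Real.fourier_eq']
  have hmp : MeasurePreserving (WithLp.ofLp : WithLp 2 (ℝ × ℝ) → ℝ × ℝ) volume volume :=
    WithLp.volume_preserving_ofLp _ _
  rw [← hmp.integral_comp (MeasurableEquiv.toLp 2 (ℝ × ℝ)).symm.measurableEmbedding]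
  refine integral_congr_ae (ae_of_all _ fun y => ?_)
  have e1 : ψe y = (ψ (WithLp.ofLp y) : ℂ) := rfl
  have e2 : inner ℝ y (e.symm k) = k.1 * (WithLp.ofLp y).1 + k.2 * (WithLp.ofLp y).2 := by
    rw [WithLp.prod_inner_apply]
    simp [e]
  dsimp only
  rw [e1, e2, smul_eq_mul, mul_comm]
  congr 3
  push_cast
  ring

theorem SchwartzMap_rapidDecay (Ψ : 𝓢(ℝ × ℝ, ℂ)) {a b : ℝ} (ha : 0 < a) (hb : 0 < b) :
    RapidDecay fun n => Ψ (a * n.1, b * n.2) := by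
  intro k
  obtain ⟨C, hC0, hC⟩ := schwartz_decay Ψ (k + 3)
  set κ := min a b with hκ
  have hκ0 : 0 < κ := lt_min ha hb
  refine Summable.of_nonneg_of_le (fun n => by positivity) (fun n => ?_)
    (summable_lattice.mul_left (C * (1 + κ⁻¹) ^ (k + 3)))
  have h1 := hC (a * n.1, b * n.2)
  set y := ‖((a * n.1, b * n.2) : ℝ × ℝ)‖ with hy
  have hy0 : 0 ≤ y := norm_nonneg _
  have h2 : κ * ‖n‖ ≤ y := by
    rw [Prod.norm_def n, mul_max_of_nonneg _ _ hκ0.le]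
    refine max_le ?_ ?_
    · refine le_trans ?_ (norm_fst_le ((a * n.1, b * n.2) : ℝ × ℝ))
      rw [Real.norm_eq_abs, abs_mul, abs_of_pos ha, Int.norm_eq_abs]
      exact mul_le_mul_of_nonneg_right (min_le_left _ _) (abs_nonneg _)
    · refine le_trans ?_ (norm_snd_le ((a * n.1, b * n.2) : ℝ × ℝ))
      rw [Real.norm_eq_abs, abs_mul, abs_of_pos hb, Int.norm_eq_abs]
      exact mul_le_mul_of_nonneg_right (min_le_right _ _) (abs_nonneg _)
  have h3 : 1 + ‖n‖ ≤ (1 + κ⁻¹) * (1 + y) := by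
    have : ‖n‖ ≤ κ⁻¹ * y := by
      rw [inv_mul_eq_div, le_div_iff₀ hκ0]; linarith
    have := inv_pos.2 hκ0
    nlinarith
  have h4 : (1 + ‖n‖) ^ (-3 : ℝ) = ((1 + ‖n‖) ^ 3)⁻¹ := by
    rw [Real.rpow_neg (by positivity)]
    norm_cast
  rw [h4, ← div_eq_mul_inv, le_div_iff₀ (by positivity)]
  calc (1 + ‖n‖) ^ k * ‖Ψ (a * n.1, b * n.2)‖ * (1 + ‖n‖) ^ 3
      = (1 + ‖n‖) ^ (k + 3) * ‖Ψ (a * n.1, b * n.2)‖ := by ring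
    _ ≤ ((1 + κ⁻¹) * (1 + y)) ^ (k + 3) * ‖Ψ (a * n.1, b * n.2)‖ := by gcongr
    _ = ((1 + y) ^ (k + 3) * ‖Ψ (a * n.1, b * n.2)‖) * (1 + κ⁻¹) ^ (k + 3) := by rw [mul_pow]; ring
    _ ≤ _ := by gcongr

/-- The Fourier transform of a kernel. -/
def kernelFourier (φ : 𝓢(ℝ × ℝ, ℝ)) : 𝓢(ℝ × ℝ, ℂ) := (exists_fourier φ).choose

theorem kernelFourier_apply (φ : 𝓢(ℝ × ℝ, ℝ)) (k : ℝ × ℝ) :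
    kernelFourier φ k = ∫ x : ℝ × ℝ, (φ x : ℂ) *
      Complex.exp ((-(2 * Real.pi * (k.1 * x.1 + k.2 * x.2)) : ℝ) * Complex.I) :=
  (exists_fourier φ).choose_spec k

theorem IsKernel.fourier_neg {φ : 𝓢(ℝ × ℝ, ℝ)} (hφ : IsKernel φ) (k : ℝ × ℝ) :
    kernelFourier φ (-k) = kernelFourier φ k := by
  rw [kernelFourier_apply, kernelFourier_apply, ← integral_neg_eq_self]
  refine integral_congr_ae (ae_of_all _ fun x => ?_)
  simp [hφ.symm x]

theorem IsKernel.fourier_zero {φ : 𝓢(ℝ × ℝ, ℝ)} (hφ : IsKernel φ) : kernelFourier φ 0 = 1 := by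
  rw [kernelFourier_apply]
  simp only [Prod.fst_zero, Prod.snd_zero, zero_mul, add_zero, mul_zero, neg_zero,
    Complex.ofReal_zero, Complex.exp_zero, mul_one]
  have h : ∫ x, ((φ x : ℝ) : ℂ) = ((∫ x, φ x : ℝ) : ℂ) := integral_ofReal
  rw [h, hφ.integral_eq_one, Complex.ofReal_one]

theorem conj_kernelFourier (φ : 𝓢(ℝ × ℝ, ℝ)) (k : ℝ × ℝ) :
    starRingEnd ℂ (kernelFourier φ k) = kernelFourier φ (-k) := by
  rw [kernelFourier_apply, kernelFourier_apply, ← integral_conj]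
  refine integral_congr_ae (ae_of_all _ fun x => ?_)
  simp only [map_mul, Complex.conj_ofReal, ← Complex.exp_conj, Complex.conj_I, Prod.fst_neg,
    Prod.snd_neg]
  congr 2
  push_cast
  ring

/-- A real symmetric kernel has a real transform. Hence the multiplier `mollMult`, defined as a real
part, loses nothing. -/
theorem IsKernel.fourier_eq_re {φ : 𝓢(ℝ × ℝ, ℝ)} (hφ : IsKernel φ) (k : ℝ × ℝ) :
    (((kernelFourier φ k).re : ℝ) : ℂ) = kernelFourier φ k :=
  Complex.conj_eq_iff_re.1 ((conj_kernelFourier φ k).trans (hφ.fourier_neg k))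

/-- The Fourier multiplier of the mollification at scale `ℓ`. -/
def mollMult (φ : 𝓢(ℝ × ℝ, ℝ)) (ℓ : ℝ) (n : ℤ × ℤ) : ℝ :=
  (kernelFourier φ (ℓ * n.1, ℓ ^ (3 / 2 : ℝ) * n.2)).re

theorem IsKernel.mollMult_neg {φ : 𝓢(ℝ × ℝ, ℝ)} (hφ : IsKernel φ) (ℓ : ℝ) (n : ℤ × ℤ) :
    mollMult φ ℓ (-n) = mollMult φ ℓ n := by
  rw [mollMult, mollMult, ← hφ.fourier_neg]
  congr 2
  simp

theorem rapidDecay_mollMult (φ : 𝓢(ℝ × ℝ, ℝ)) {ℓ : ℝ} (hℓ : 0 < ℓ) :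
    RapidDecay fun n => (mollMult φ ℓ n : ℂ) := by
  refine (SchwartzMap_rapidDecay (kernelFourier φ) hℓ (Real.rpow_pos_of_pos hℓ (3 / 2))).of_le 1 0
    fun n => ?_
  rw [Complex.norm_real, pow_zero, one_mul, one_mul]
  exact Complex.abs_re_le_norm _

theorem exists_schwartz_eq_rescale (φ : 𝓢(ℝ × ℝ, ℝ)) {ℓ : ℝ} (hℓ : 0 < ℓ) :
    ∃ ψ : 𝓢(ℝ × ℝ, ℝ), (ψ : ℝ × ℝ → ℝ) = rescale φ ℓ := by
  have hℓ' : ℓ ^ (3 / 2 : ℝ) ≠ 0 := (Real.rpow_pos_of_pos hℓ _).ne'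
  let e : (ℝ × ℝ) ≃L[ℝ] (ℝ × ℝ) :=
    (ContinuousLinearEquiv.unitsEquivAut ℝ (Units.mk0 ℓ⁻¹ (inv_ne_zero hℓ.ne'))).prodCongr
      (ContinuousLinearEquiv.unitsEquivAut ℝ (Units.mk0 (ℓ ^ (3 / 2 : ℝ))⁻¹ (inv_ne_zero hℓ')))
  refine ⟨ℓ ^ (-(5 / 2 : ℝ)) • SchwartzMap.compCLMOfContinuousLinearEquiv ℝ e φ, ?_⟩
  funext x
  simp [rescale, e, div_eq_mul_inv]

/-- The Jacobian `ℓ * ℓ^(3/2)` of the anisotropic change of variables cancels the prefactor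
`ℓ^(-5/2)`. -/
theorem integral_rescale_mul_chr (φ : 𝓢(ℝ × ℝ, ℝ)) {ℓ : ℝ} (hℓ : 0 < ℓ) (n : ℤ × ℤ) :
    ∫ x, (rescale φ ℓ x : ℂ) * chr (-n) x =
      kernelFourier φ (ℓ * n.1, ℓ ^ (3 / 2 : ℝ) * n.2) := by
  set b := ℓ ^ (3 / 2 : ℝ) with hb
  have hb0 : 0 < b := Real.rpow_pos_of_pos hℓ _
  set G : ℝ × ℝ → ℂ := fun x => (φ x : ℂ) *
      Complex.exp ((-(2 * Real.pi * (ℓ * n.1 * x.1 + b * n.2 * x.2)) : ℝ) * Complex.I) with hG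
  have hGi : Integrable G := (φ.integrable.ofReal).mul_bdd (c := 1)
    (by fun_prop : Continuous fun x : ℝ × ℝ => Complex.exp
      ((-(2 * Real.pi * (ℓ * n.1 * x.1 + b * n.2 * x.2)) : ℝ) * Complex.I)).aestronglyMeasurable
      (ae_of_all _ fun x => (Complex.norm_exp_ofReal_mul_I _).le)
  have e1 : ∀ x : ℝ × ℝ, (rescale φ ℓ x : ℂ) * chr (-n) x =
      (ℓ ^ (-(5 / 2 : ℝ)) : ℝ) * G (x.1 / ℓ, x.2 / b) := by
    intro x
    simp only [hG, rescale, ← hb, chr]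
    have a1 : ℓ * n.1 * (x.1 / ℓ) = n.1 * x.1 := by field_simp
    have a2 : b * n.2 * (x.2 / b) = n.2 * x.2 := by field_simp
    rw [a1, a2, Complex.ofReal_mul, mul_assoc]
    congr 4
    push_cast [Prod.fst_neg, Prod.snd_neg]
    ring
  have e2 : ∫ x : ℝ × ℝ, G (x.1 / ℓ, x.2 / b) = (ℓ * b : ℝ) * ∫ x, G x := by
    have hGi' : Integrable fun x : ℝ × ℝ => G (x.1 / ℓ, x.2 / b) := by
      obtain ⟨ψ, hψ⟩ := exists_schwartz_eq_rescale φ hℓ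
      have hi : Integrable fun x => (rescale φ ℓ x : ℂ) * chr (-n) x := by
        rw [← hψ]
        exact ψ.integrable.ofReal.mul_bdd (c := 1) (continuous_chr _).aestronglyMeasurable
          (ae_of_all _ fun x => by simp)
      simp only [e1] at hi
      have hne : ((ℓ ^ (-(5 / 2 : ℝ)) : ℝ) : ℂ) ≠ 0 := by
        exact_mod_cast (Real.rpow_pos_of_pos hℓ _).ne'
      exact (integrable_const_mul_iff hne.isUnit _).1 hi
    rw [Measure.volume_eq_prod] at hGi hGi' ⊢
    rw [integral_prod _ hGi', integral_prod _ hGi]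
    have a1 : ∀ s : ℝ, ∫ t : ℝ, G (s / ℓ, t / b) = b • ∫ t : ℝ, G (s / ℓ, t) := fun s => by
      rw [Measure.integral_comp_div (fun t => G (s / ℓ, t)) b, abs_of_pos hb0]
    simp only [a1]
    rw [integral_smul, Measure.integral_comp_div (fun s => ∫ t, G (s, t)) ℓ, abs_of_pos hℓ,
      smul_smul, mul_comm b, Complex.real_smul]
  simp only [e1]
  rw [integral_const_mul, e2, ← mul_assoc, ← Complex.ofReal_mul, kernelFourier_apply]
  have e3 : ℓ ^ (-(5 / 2 : ℝ)) * (ℓ * b) = 1 := by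
    rw [hb, ← Real.rpow_one_add' hℓ.le (by norm_num), ← Real.rpow_add hℓ]
    norm_num
  rw [e3, Complex.ofReal_one, one_mul]

/-- Poisson summation: the coefficients of a periodization are values of the Fourier transform on
the lattice. -/
theorem IsKernel.periodize_rescale_eq {φ : 𝓢(ℝ × ℝ, ℝ)} (hφ : IsKernel φ) {ℓ : ℝ} (hℓ : 0 < ℓ)
    (x : ℝ × ℝ) : periodize (rescale φ ℓ) x = (fser (fun n => (mollMult φ ℓ n : ℂ)) x).re := by
  have hp := periodize_rescale_mem φ hℓ
  obtain ⟨ψ, hψ⟩ : ∃ ψ : 𝓢(ℝ × ℝ, ℝ), (ψ : ℝ × ℝ → ℝ) = rescale φ ℓ :=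
    exists_schwartz_eq_rescale φ hℓ
  have hZ : ∀ n, ∫ x in cell, ((periodize (rescale φ ℓ) x : ℝ) : ℂ) * chr (-n) x =
      (mollMult φ ℓ n : ℂ) := by
    intro n
    rw [← hψ, integral_periodize_mul_chr, hψ, integral_rescale_mul_chr φ hℓ, mollMult,
      hφ.fourier_eq_re]
  have hs := (rapidDecay_mollMult φ hℓ).summable_norm.of_norm
  have h := hasSum_fourier_of_periodic
    (F := fun x => ((periodize (rescale φ ℓ) x : ℝ) : ℂ))
    (Complex.continuous_ofReal.comp hp.1.continuous)
    (fun x => ⟨by rw [(hp.2 x).1], by rw [(hp.2 x).2]⟩) hZ hs x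
  rw [fser, h.tsum_eq, Complex.ofReal_re]

theorem RapidDecay.hasSum_fser {z : ℤ × ℤ → ℂ} (hz : RapidDecay z) (x : ℝ × ℝ) :
    HasSum (fun n => z n * chr n x) (fser z x) := (hz.summable_chr x).hasSum

theorem RapidDecay.comp_neg {z : ℤ × ℤ → ℂ} (hz : RapidDecay z) : RapidDecay fun n => z (-n) := by
  intro k
  have h := (hz k)
  rw [← (Equiv.neg (ℤ × ℤ)).summable_iff] at h
  refine h.congr fun n => ?_
  simp

theorem IsKernel.mollify_eq {φ : 𝓢(ℝ × ℝ, ℝ)} (hφ : IsKernel φ) {ℓ : ℝ} (hℓ : 0 < ℓ)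
    (f : PeriodicDistribution) :
    mollify φ ℓ f = fun x => (fser (fun n => mollMult φ ℓ n * fourierCoeff f n) x).re := by
  funext x
  have hd := rapidDecay_mollMult φ hℓ
  obtain ⟨C, k, -, hC⟩ := exists_fourierCoeff_bound f
  have hz : RapidDecay fun m => (mollMult φ ℓ (-m) : ℂ) * chr (-m) x := by
    refine hd.comp_neg.of_le 1 0 fun n => ?_
    simp
  have h1 := hasSum_pair_of_fser f (kernelTest φ hℓ x) hz (fun y => by
    change periodize (rescale φ ℓ) (x - y) = _
    rw [hφ.periodize_rescale_eq hℓ, fser, ← (Equiv.neg (ℤ × ℤ)).tsum_eq, fser]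
    congr 1
    refine tsum_congr fun n => ?_
    rw [Equiv.neg_apply, mul_assoc, sub_eq_add_neg, chr_add_arg]
    congr 2
    unfold chr
    congr 2
    push_cast [Prod.fst_neg, Prod.snd_neg]
    ring)
  rw [mollify, dif_pos hℓ, ← h1.tsum_eq]
  have h2 := Complex.hasSum_re ((hd.mul hC).hasSum_fser x)
  rw [← h2.tsum_eq, ← (Equiv.neg (ℤ × ℤ)).tsum_eq]
  refine tsum_congr fun n => ?_
  rw [Equiv.neg_apply]
  congr 1
  rw [neg_neg]
  ring

/-! ### The linearized solution and its quadratic functional -/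

theorem integral_chr_fst (n : ℤ × ℤ) (t : ℝ) :
    ∫ s in (0 : ℝ)..1, chr n (s, t) = if n.1 = 0 then chr n (0, t) else 0 := by
  simp only [chr_eq_mul]
  rw [intervalIntegral.integral_mul_const, interval_integral_exp_int]
  split_ifs with h
  · simp
  · simp

theorem avg₁_cosTest (n : ℤ × ℤ) :
    avg₁ (cosTest n) = fun x => if n.1 = 0 then (cosTest n : ℝ × ℝ → ℝ) x else 0 := by
  funext x
  have hc := continuous_chr n
  have h := Complex.reCLM.intervalIntegral_comp_comm (a := 0) (b := 1) (μ := volume)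
    ((by fun_prop : Continuous fun s : ℝ => chr n (s, x.2)).intervalIntegrable 0 1)
  rw [integral_chr_fst] at h
  simp only [Complex.reCLM_apply, chr_re] at h
  rw [avg₁, h]
  split_ifs with hn
  · rw [chr_re]
    simp [cosTest, hn]
  · rfl

theorem avg₁_sinTest (n : ℤ × ℤ) :
    avg₁ (sinTest n) = fun x => if n.1 = 0 then (sinTest n : ℝ × ℝ → ℝ) x else 0 := by
  funext x
  have hc := continuous_chr n
  have h := Complex.imCLM.intervalIntegral_comp_comm (a := 0) (b := 1) (μ := volume)
    ((by fun_prop : Continuous fun s : ℝ => chr n (s, x.2)).intervalIntegrable 0 1)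
  rw [integral_chr_fst] at h
  simp only [Complex.imCLM_apply, chr_im] at h
  rw [avg₁, h]
  split_ifs with hn
  · rw [chr_im]
    simp [sinTest, hn]
  · rfl

theorem pair_proj (f : PeriodicDistribution) (ζ : TorusTest) : pair (proj f) ζ = pair f (projTest ζ) :=
  rfl

theorem fourierCoeff_proj (f : PeriodicDistribution) (n : ℤ × ℤ) :
    fourierCoeff (proj f) n = if n.1 = 0 then 0 else fourierCoeff f n := by
  have h0 : pair f 0 = 0 := map_zero (f : TorusTest →ₗ[ℝ] ℝ)
  have hc : projTest (cosTest n) = if n.1 = 0 then 0 else cosTest n := by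
    apply Subtype.ext
    funext x
    rw [projTest_apply, avg₁_cosTest]
    split_ifs <;> simp
  have hs : projTest (sinTest n) = if n.1 = 0 then 0 else sinTest n := by
    apply Subtype.ext
    funext x
    rw [projTest_apply, avg₁_sinTest]
    split_ifs <;> simp
  rw [fourierCoeff, pair_proj, pair_proj, hc, hs]
  split_ifs
  · simp [h0]
  · rfl

/-- For `n.1 = 0` the left side vanishes because `v` has zero average in the first variable, the
right side because the inverse of the vanishing symbol is zero. -/
theorem SolvesLinearized.fourierCoeff_eq {v ξ : PeriodicDistribution} (h : SolvesLinearized v ξ)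
    (n : ℤ × ℤ) : fourierCoeff v n = ((symbolL n)⁻¹ : ℝ) * fourierCoeff ξ n := by
  by_cases hn : n.1 = 0
  · have h1 := fourierCoeff_proj v n
    rw [h.avg_zero, if_pos hn] at h1
    rw [h1, symbolL_fst_zero hn]
    simp
  · have h1 := h.eqn n
    rw [fourierCoeff_proj, if_neg hn] at h1
    have hs : (symbolL n : ℂ) ≠ 0 := by exact_mod_cast (symbolL_pos hn).ne'
    rw [← h1, Complex.ofReal_inv, inv_mul_cancel_left₀ hs]

/-- The coefficients of the quadratic functional `v_c ∂₂ R v_c`, where `v_c` has the Fourier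
coefficients `c(n) a(n) / symbolL n`. -/
def chaosCoeff (c : ℤ × ℤ → ℝ) (a : ℤ × ℤ → ℂ) (i : (ℤ × ℤ) × (ℤ × ℤ)) : ℂ :=
  ((c i.1 * c i.2 : ℝ) : ℂ) * bilinSymbol i.1 i.2 * a i.1 * a i.2

/-- The potential `b(∂) (v_c ∂₂ R v_c)`. -/
def chaosPot (b : ℤ × ℤ → ℂ) (c : ℤ × ℤ → ℝ) (a : ℤ × ℤ → ℂ) (x : ℝ × ℝ) : ℝ :=
  (tser (fun i => b (i.1 + i.2) * chaosCoeff c a i) (fun i => i.1 + i.2) x).re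

/-- Sequences of polynomial growth. -/
def PolyGrowth (a : ℤ × ℤ → ℂ) : Prop := ∃ (C : ℝ) (k : ℕ), 0 ≤ C ∧ ∀ n, ‖a n‖ ≤ C * (1 + ‖n‖) ^ k

theorem norm_dispSymbol_le_norm (n : ℤ × ℤ) : ‖dispSymbol n‖ ≤ 2 * Real.pi * (1 + ‖n‖) := by
  refine (norm_dispSymbol_le' n).trans ?_
  have := abs_snd_le_norm n
  gcongr
  linarith

theorem symbolL_inv_le_ten (n : ℤ × ℤ) : (symbolL n)⁻¹ ≤ 10 := by
  refine (symbolL_inv_le n).trans ?_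
  have := Real.rpow_le_one_of_one_le_of_nonpos (one_le_rho n) (by norm_num : (-2 : ℝ) ≤ 0)
  linarith

theorem rapidDecay_solution {c : ℤ × ℤ → ℝ} (hc : RapidDecay fun n => (c n : ℂ)) {a : ℤ × ℤ → ℂ}
    (ha : PolyGrowth a) : RapidDecay fun n => (c n : ℂ) * (((symbolL n)⁻¹ : ℝ) * a n) := by
  obtain ⟨C, k, hC0, hC⟩ := ha
  refine hc.mul (C := 10 * C) (k := k) fun n => ?_
  rw [norm_mul, Complex.norm_real, Real.norm_of_nonneg (inv_nonneg.2 (symbolL_nonneg n)), mul_assoc]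
  exact mul_le_mul (symbolL_inv_le_ten n) (hC n) (norm_nonneg _) (by norm_num)

theorem summable_chaosCoeff {c : ℤ × ℤ → ℝ} (hc : RapidDecay fun n => (c n : ℂ)) {a : ℤ × ℤ → ℂ}
    (ha : PolyGrowth a) : Summable fun i => ‖chaosCoeff c a i‖ := by
  have hv := rapidDecay_solution hc ha
  have hw : RapidDecay fun n => dispSymbol n * ((c n : ℂ) * (((symbolL n)⁻¹ : ℝ) * a n)) := by
    refine hv.of_le (2 * Real.pi) 1 fun n => ?_
    rw [norm_mul, pow_one]
    gcongr
    exact norm_dispSymbol_le_norm n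
  refine (hv.summable_mul hw).congr fun i => ?_
  rw [chaosCoeff, bilinSymbol]
  congr 1
  push_cast
  ring

theorem isDecomposition_chaosPot {c : ℤ × ℤ → ℝ} (hc : RapidDecay fun n => (c n : ℂ)) {a : ℤ × ℤ → ℂ}
    (ha : PolyGrowth a) :
    IsDecomposition (proj (ofFun fun x => (tser (chaosCoeff c a) (fun i => i.1 + i.2) x).re)) 0
      (chaosPot potX c a) (chaosPot potY c a) :=
  isDecomposition_tser (summable_chaosCoeff hc ha) _

theorem isHermitian_solution {c : ℤ × ℤ → ℝ} (hc : ∀ n, c (-n) = c n) {a : ℤ × ℤ → ℂ}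
    (ha : IsHermitian a) : IsHermitian fun n => (c n : ℂ) * (((symbolL n)⁻¹ : ℝ) * a n) := by
  intro n
  have hs : symbolL (-n) = symbolL n := by simp [symbolL]
  simp only [hc n, hs, ha n, map_mul, Complex.conj_ofReal]

theorem solution_mul_eq_tser {c : ℤ × ℤ → ℝ} (hc : RapidDecay fun n => (c n : ℂ))
    (hc' : ∀ n, c (-n) = c n) {a : ℤ × ℤ → ℂ} (ha : PolyGrowth a) (ha' : IsHermitian a) (x : ℝ × ℝ) :
    (fser (fun n => (c n : ℂ) * (((symbolL n)⁻¹ : ℝ) * a n)) x).re *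
      pd₂ (hilbert fun x => (fser (fun n => (c n : ℂ) * (((symbolL n)⁻¹ : ℝ) * a n)) x).re) x =
    (tser (chaosCoeff c a) (fun i => i.1 + i.2) x).re := by
  have hv := rapidDecay_solution hc ha
  have hv' := isHermitian_solution hc' ha'
  have hw : RapidDecay fun n => dispSymbol n * ((c n : ℂ) * (((symbolL n)⁻¹ : ℝ) * a n)) := by
    refine hv.of_le (2 * Real.pi) 1 fun n => ?_
    rw [norm_mul, pow_one]
    gcongr
    exact norm_dispSymbol_le_norm n
  rw [pd₂_hilbert_re_fser hv hv']
  dsimp only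
  rw [re_fser_mul hv hw hv']
  congr 2
  funext i
  rw [chaosCoeff, bilinSymbol]
  push_cast
  ring

theorem polyGrowth_fourierCoeff (f : PeriodicDistribution) : PolyGrowth (fourierCoeff f) :=
  exists_fourierCoeff_bound f

/-- The bridge from the problem to the analysis: for each realization the nonlinearity is an
explicit double series in the coefficients of `ξ`, and `v` no longer appears. -/
theorem SolvesLinearized.offline_eq {v ξ : PeriodicDistribution} (h : SolvesLinearized v ξ)
    {φ : 𝓢(ℝ × ℝ, ℝ)} (hφ : IsKernel φ) {ℓ : ℝ} (hℓ : 0 < ℓ) : offline φ v ℓ =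
      proj (ofFun fun x => (tser (chaosCoeff (mollMult φ ℓ) (fourierCoeff ξ))
        (fun i => i.1 + i.2) x).re) := by
  rw [offline, hφ.mollify_eq hℓ]
  simp only [h.fourierCoeff_eq]
  congr 2
  funext x
  exact solution_mul_eq_tser (rapidDecay_mollMult φ hℓ) (hφ.mollMult_neg ℓ)
    (polyGrowth_fourierCoeff ξ) (fourierCoeff_neg ξ) x

theorem SolvesLinearized.isDecomposition_offline {v ξ : PeriodicDistribution}
    (h : SolvesLinearized v ξ) {φ : 𝓢(ℝ × ℝ, ℝ)} (hφ : IsKernel φ) {ℓ : ℝ} (hℓ : 0 < ℓ) :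
    IsDecomposition (offline φ v ℓ) 0 (chaosPot potX (mollMult φ ℓ) (fourierCoeff ξ))
      (chaosPot potY (mollMult φ ℓ) (fourierCoeff ξ)) := by
  rw [h.offline_eq hφ hℓ]
  exact isDecomposition_chaosPot (rapidDecay_mollMult φ hℓ) (polyGrowth_fourierCoeff ξ)

/-! ### Lower semicontinuity of Hölder seminorms and truncated series -/

/-- Each increment of the limit is bounded along a subsequence realizing a level above the lower
limit. The bound has the form required by Fatou's lemma for passing from truncated to full series.
-/
theorem holderSeminorm_rpow_le_liminf {α P : ℝ} (hP : 0 < P) {f : ℕ → ℝ × ℝ → ℝ} {g : ℝ × ℝ → ℝ}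
    (hf : ∀ x, Tendsto (fun N => f N x) atTop (𝓝 (g x))) {L : ℕ → ℝ≥0∞}
    (hL : ∀ N, holderSeminorm α (f N) ^ P ≤ L N) :
    holderSeminorm α g ^ P ≤ liminf L atTop := by
  refine le_of_forall_gt_imp_ge_of_dense fun L' hL' => ?_
  have hfr : ∃ᶠ N in atTop, L N < L' := frequently_lt_of_liminf_lt (by isBoundedDefault) hL'
  rw [← ENNReal.le_rpow_inv_iff hP]
  refine holderSeminorm_le fun x y => ?_
  have ht : Tendsto (fun N => ‖f N y - f N x‖ₑ) atTop (𝓝 ‖g y - g x‖ₑ) :=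
    ((continuous_enorm.tendsto _).comp ((hf y).sub (hf x)))
  refine le_of_tendsto_of_frequently ht (hfr.mono fun N hN => ?_)
  refine (enorm_sub_le_holderSeminorm (α := α) (f N) x y).trans (mul_le_mul_right ?_ _)
  rw [ENNReal.le_rpow_inv_iff hP]
  exact (hL N).trans hN.le

/-- The symmetric boxes exhausting `ℤ²`. -/
def box (N : ℕ) : Finset (ℤ × ℤ) := Finset.Icc (-(N : ℤ), -(N : ℤ)) ((N : ℤ), (N : ℤ))

theorem mem_box {N : ℕ} {n : ℤ × ℤ} : n ∈ box N ↔ |n.1| ≤ N ∧ |n.2| ≤ N := by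
  rw [box, Finset.mem_Icc, Prod.le_def, Prod.le_def, abs_le, abs_le]
  tauto

theorem neg_mem_box {N : ℕ} : ∀ n ∈ box N, -n ∈ box N := by
  intro n hn
  rw [mem_box] at hn ⊢
  simpa using hn

theorem tendsto_box : Tendsto (fun N => box N ×ˢ box N) atTop atTop := by
  refine tendsto_atTop_finset_of_monotone (fun N M hNM => ?_) fun i => ?_
  · have : box N ⊆ box M := fun n hn => by
      rw [mem_box] at hn ⊢
      have : (N : ℤ) ≤ M := by exact_mod_cast hNM
      omega
    exact Finset.product_subset_product this this
  · refine ⟨i.1.1.natAbs + i.1.2.natAbs + i.2.1.natAbs + i.2.2.natAbs, ?_⟩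
    rw [Finset.mem_product, mem_box, mem_box]
    push_cast
    have h1 := abs_nonneg i.1.1
    have h2 := abs_nonneg i.1.2
    have h3 := abs_nonneg i.2.1
    have h4 := abs_nonneg i.2.2
    refine ⟨⟨?_, ?_⟩, ?_, ?_⟩ <;> linarith

/-- A quadratic trigonometric polynomial. -/
def trigChaos (b : ℤ × ℤ → ℂ) (S : Finset (ℤ × ℤ)) (D : ℤ × ℤ → ℤ × ℤ → ℝ) (a : ℤ × ℤ → ℂ)
    (x : ℝ × ℝ) : ℂ :=
  ∑ n ∈ S, ∑ m ∈ S, b (n + m) * D n m * bilinSymbol n m * chr (n + m) x * a n * a m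

theorem tendsto_trigChaos {b : ℤ × ℤ → ℂ} (hb : ∀ n, ‖b n‖ ≤ 1) {c c' : ℤ × ℤ → ℝ}
    (hc : RapidDecay fun n => (c n : ℂ)) (hc' : RapidDecay fun n => (c' n : ℂ)) {a : ℤ × ℤ → ℂ}
    (ha : PolyGrowth a) (x : ℝ × ℝ) :
    Tendsto (fun N => (trigChaos b (box N) (fun n m => c n * c m - c' n * c' m) a x).re) atTop
      (𝓝 (chaosPot b c a x - chaosPot b c' a x)) := by
  have hsum : ∀ {c : ℤ × ℤ → ℝ}, (RapidDecay fun n => (c n : ℂ)) →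
      HasSum (fun i : (ℤ × ℤ) × (ℤ × ℤ) => b (i.1 + i.2) * chaosCoeff c a i * chr (i.1 + i.2) x)
        (tser (fun i => b (i.1 + i.2) * chaosCoeff c a i) (fun i => i.1 + i.2) x) := by
    intro c hc
    refine (summable_tser (Summable.of_nonneg_of_le (fun i => norm_nonneg _) (fun i => ?_)
      (summable_chaosCoeff hc ha)) _ x).hasSum
    rw [norm_mul]
    exact mul_le_of_le_one_left (norm_nonneg _) (hb _)
  have h1 : Tendsto _ _ _ := ((hsum hc).sub (hsum hc'))
  have h2 := (Complex.continuous_re.tendsto _).comp (h1.comp tendsto_box)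
  rw [Complex.sub_re] at h2
  refine h2.congr fun N => ?_
  simp only [Function.comp_apply]
  congr 1
  rw [Finset.sum_product, trigChaos]
  refine Finset.sum_congr rfl fun n _ => Finset.sum_congr rfl fun m _ => ?_
  simp only [chaosCoeff]
  push_cast
  ring

/-- The Hölder seminorm of the truncated potential. -/
theorem holderSeminorm_trigChaos_le {γ P α : ℝ} (hP : 1 ≤ P) (hα : 0 < α) (hα1 : α ≤ 1)
    (h : α + 5 / (2 * P) < γ) : ∃ C : ℝ, 0 < C ∧ ∀ (b : ℤ × ℤ → ℂ) (S : Finset (ℤ × ℤ))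
      (D : ℤ × ℤ → ℤ × ℤ → ℝ) (a : ℤ × ℤ → ℂ),
      holderSeminorm α (fun x => (trigChaos b S D a x).re) ^ P ≤
        ENNReal.ofReal C * ∫⁻ x in cell, ‖trigChaos (fun n => b n / potMult γ n) S D a x‖ₑ ^ P := by
  obtain ⟨C, hC0, hC⟩ := holderSeminorm_pot_le hP hα hα1 h
  have hγ : 0 < γ := by
    have : 0 < 5 / (2 * P) := by positivity
    linarith
  refine ⟨C ^ P, by positivity, fun b S D a => ?_⟩
  -- Dividing the symbol by `potMult γ` exhibits the polynomial as a potential of order `γ` of a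
  -- rougher one.
  have h1 := hC ((ℤ × ℤ) × (ℤ × ℤ)) (S ×ˢ S) (fun i => b (i.1 + i.2) / potMult γ (i.1 + i.2) *
    D i.1 i.2 * bilinSymbol i.1 i.2 * a i.1 * a i.2) (fun i => i.1 + i.2)
  have e1 : ∀ x, ∑ i ∈ S ×ˢ S, potMult γ (i.1 + i.2) * (b (i.1 + i.2) / potMult γ (i.1 + i.2) *
      D i.1 i.2 * bilinSymbol i.1 i.2 * a i.1 * a i.2) * chr (i.1 + i.2) x = trigChaos b S D a x := by
    intro x
    rw [Finset.sum_product, trigChaos]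
    refine Finset.sum_congr rfl fun n _ => Finset.sum_congr rfl fun m _ => ?_
    have : (potMult γ (n + m) : ℂ) ≠ 0 := by exact_mod_cast (potMult_pos hγ _).ne'
    field_simp
  have e2 : ∀ x, ∑ i ∈ S ×ˢ S, (b (i.1 + i.2) / potMult γ (i.1 + i.2) *
      D i.1 i.2 * bilinSymbol i.1 i.2 * a i.1 * a i.2) * chr (i.1 + i.2) x =
      trigChaos (fun n => b n / potMult γ n) S D a x := by
    intro x
    rw [Finset.sum_product, trigChaos]
    refine Finset.sum_congr rfl fun n _ => Finset.sum_congr rfl fun m _ => ?_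
    ring
  simp only [e1, e2] at h1
  have hP0 : 0 < P := by linarith
  refine (ENNReal.rpow_le_rpow h1 hP0.le).trans (le_of_eq ?_)
  rw [ENNReal.mul_rpow_of_nonneg _ _ hP0.le, ENNReal.ofReal_rpow_of_pos hC0, ← ENNReal.rpow_mul,
    one_div_mul_cancel hP0.ne', ENNReal.rpow_one]

/-! ### Moments of truncated quadratic functionals -/

/-- Moments of quadratic trigonometric polynomials of white noise. -/
theorem lintegral_trigChaos_le {η δ K : ℝ} (hδ : 0 < δ) (hδη : δ < η) (hδ' : δ ≤ 1 / 2) (q : ℕ) :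
    ∃ C : ℝ, 0 < C ∧ ∀ {Ω : Type*} [MeasurableSpace Ω] {μ : Measure Ω}
      {ξ : Ω → PeriodicDistribution}, IsWhiteNoise μ ξ → ∀ {b : ℤ × ℤ → ℂ}, b 0 = 0 →
      (∀ n, ‖b n‖ ≤ K * rho n ^ (-(3 / 4 + η))) → ∀ {S : Finset (ℤ × ℤ)}, (∀ n ∈ S, -n ∈ S) →
      ∀ {D : ℤ × ℤ → ℤ × ℤ → ℝ} {M : ℝ}, 0 < M →
      (∀ n m, |D n m| ≤ M * (rho n ^ δ + rho m ^ δ)) → ∀ x,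
      ∫⁻ ω, ‖trigChaos b S D (fourierCoeff (ξ ω)) x‖ₑ ^ ((2 * q : ℕ) : ℝ) ∂μ ≤
        ENNReal.ofReal (C * M ^ ((2 * q : ℕ) : ℝ)) := by
  obtain ⟨C, hC0, hC⟩ := sum_norm_sq_bilin_le (K := K) hδ hδη hδ'
  refine ⟨chaosConst q * (√(C + 1)) ^ (2 * q), by have := chaosConst_pos q; positivity, ?_⟩
  intro Ω _ μ ξ hξ b hb0 hb S hS D M hM hD x
  have h1 := hC S b (fun n m => (D n m : ℂ)) M hM.le hb (fun n m => by
    rw [Complex.norm_real]; exact hD n m)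
  -- The condition on the pairs `(n, -n)` holds since `b 0 = 0`: this is where the projection
  -- replaces renormalization. At a fixed point `x` the character has modulus one and does not
  -- affect the Hilbert-Schmidt norm.
  have h2 := hξ.lintegral_quadratic_pow_le q hS
    (fun n m => b (n + m) * D n m * bilinSymbol n m * chr (n + m) x) (fun n => by simp [hb0])
    (σ := √(C + 1) * M) (by positivity) (by
      simp only [norm_mul _ (chr _ x), norm_chr, mul_one]
      rw [mul_pow, Real.sq_sqrt (by positivity)]
      refine h1.trans ?_
      gcongr
      linarith)
  simp only [ENNReal.rpow_natCast, Real.rpow_natCast]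
  refine h2.trans (le_of_eq ?_)
  rw [mul_pow, mul_assoc]

/-- Only finitely many Fourier coefficients enter, each almost everywhere measurable, so no
`σ`-algebra on distributions is needed. -/
theorem aemeasurable_trigChaos {Ω : Type*} [MeasurableSpace Ω] {μ : Measure Ω} [SFinite μ]
    {ξ : Ω → PeriodicDistribution} (hξ : IsWhiteNoise μ ξ) {X : Type*} [MeasurableSpace X]
    (ν : Measure X) [SFinite ν] (b : ℤ × ℤ → ℂ) (S : Finset (ℤ × ℤ)) {D : X → ℤ × ℤ → ℤ × ℤ → ℝ}
    (hD : ∀ n m, Measurable fun x => D x n m) {y : X → ℝ × ℝ} (hy : Measurable y) :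
    AEMeasurable (fun z : Ω × X => trigChaos b S (D z.2) (fourierCoeff (ξ z.1)) (y z.2))
      (μ.prod ν) := by
  have ha : ∀ n, AEMeasurable (fun z : Ω × X => fourierCoeff (ξ z.1) n) (μ.prod ν) := fun n =>
    (hξ.aemeasurable_fourierCoeff n).comp_quasiMeasurePreserving Measure.quasiMeasurePreserving_fst
  unfold trigChaos
  refine Finset.aemeasurable_fun_sum _ fun n _ => Finset.aemeasurable_fun_sum _ fun m _ => ?_
  refine AEMeasurable.mul (AEMeasurable.mul ?_ (ha n)) (ha m)
  have h1 := (hD n m).complex_ofReal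
  have h2 := (continuous_chr (n + m)).measurable.comp hy
  exact (((h1.const_mul _).mul_const _).mul h2 |>.comp measurable_snd).aemeasurable

/-- Weighted space-integrated moments of quadratic trigonometric polynomials of white noise. -/
theorem lintegral_lintegral_trigChaos_le {Ω : Type*} [MeasurableSpace Ω] {μ : Measure Ω}
    [IsProbabilityMeasure μ] {ξ : Ω → PeriodicDistribution} (hξ : IsWhiteNoise μ ξ)
    {X : Type*} [MeasurableSpace X] (ν : Measure X) [SFinite ν] (b : ℤ × ℤ → ℂ)
    (S : Finset (ℤ × ℤ)) {D : X → ℤ × ℤ → ℤ × ℤ → ℝ} (hD : ∀ n m, Measurable fun x => D x n m)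
    {y : X → ℝ × ℝ} (hy : Measurable y) {k B : X → ℝ≥0∞} (hk : Measurable k) (P : ℝ)
    (h : ∀ᵐ x ∂ν, ∫⁻ ω, ‖trigChaos b S (D x) (fourierCoeff (ξ ω)) (y x)‖ₑ ^ P ∂μ ≤ B x) :
    AEMeasurable (fun ω => ∫⁻ x, k x *
      ‖trigChaos b S (D x) (fourierCoeff (ξ ω)) (y x)‖ₑ ^ P ∂ν) μ ∧
    ∫⁻ ω, ∫⁻ x, k x * ‖trigChaos b S (D x) (fourierCoeff (ξ ω)) (y x)‖ₑ ^ P ∂ν ∂μ ≤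
      ∫⁻ x, k x * B x ∂ν := by
  have hm : AEMeasurable (fun z : Ω × X => k z.2 *
      ‖trigChaos b S (D z.2) (fourierCoeff (ξ z.1)) (y z.2)‖ₑ ^ P) (μ.prod ν) :=
    (hk.comp measurable_snd).aemeasurable.mul
      ((aemeasurable_trigChaos hξ ν b S hD hy).enorm.pow_const P)
  refine ⟨hm.lintegral_prod_right', ?_⟩
  rw [lintegral_lintegral_swap hm]
  have hm' : AEMeasurable (fun z : X × Ω => ‖trigChaos b S (D z.1) (fourierCoeff (ξ z.2)) (y z.1)‖ₑ ^ P)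
      (ν.prod μ) := (aemeasurable_trigChaos hξ ν b S hD hy).prod_swap.enorm.pow_const P
  refine lintegral_mono_ae ?_
  have hm2 : ∀ x, AEMeasurable (fun ω =>
      ‖trigChaos b S (D x) (fourierCoeff (ξ ω)) (y x)‖ₑ ^ P) μ := by
    intro x
    have ha := fun n => hξ.aemeasurable_fourierCoeff n
    refine AEMeasurable.pow_const (AEMeasurable.enorm ?_) P
    unfold trigChaos
    exact Finset.aemeasurable_fun_sum _ fun n _ => Finset.aemeasurable_fun_sum _ fun m _ =>
      ((ha n).const_mul _).mul (ha m)
  filter_upwards [h] with x hx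
  rw [lintegral_const_mul'' _ (hm2 x)]
  gcongr

/-! ### Potentials and moments of their differences -/

/-- The standing assumptions on the symbol of a potential of order `s`. -/
structure IsPotential (b : ℤ × ℤ → ℂ) (s : ℝ) : Prop where
  zero : b 0 = 0
  one_le : 1 ≤ s
  le : s ≤ 3 / 2
  bound : ∀ n, ‖b n‖ ≤ rho n ^ (-s)

theorem isPotential_potX : IsPotential potX 1 :=
  ⟨potX_fst_zero rfl, le_rfl, by norm_num, norm_potX_le⟩

theorem isPotential_potY : IsPotential potY (3 / 2) :=
  ⟨potY_fst_zero rfl, by norm_num, le_rfl, norm_potY_le⟩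

theorem IsPotential.norm_le_one {b : ℤ × ℤ → ℂ} {s : ℝ} (hb : IsPotential b s) (n : ℤ × ℤ) :
    ‖b n‖ ≤ 1 :=
  (hb.bound n).trans
    (Real.rpow_le_one_of_one_le_of_nonpos (one_le_rho n) (by linarith [hb.one_le]))

/-- The order `s` cancels: `-s + (s - 3/4 - η) = -(3/4 + η)`. So both potentials lead to the same
lattice sum. -/
theorem IsPotential.div_bound {b : ℤ × ℤ → ℂ} {s η : ℝ} (hb : IsPotential b s) (hη : η < 1 / 4)
    (hη0 : 0 < η) (n : ℤ × ℤ) :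
    ‖b n / potMult (s - 3 / 4 - η) n‖ ≤ 16 * rho n ^ (-(3 / 4 + η)) := by
  have hγ : 0 < s - 3 / 4 - η := by linarith [hb.one_le]
  have hr := rho_pos n
  rw [norm_div, Complex.norm_real, Real.norm_of_nonneg (potMult_pos hγ n).le, div_eq_mul_inv]
  have h4 : (4 : ℝ) ^ (s - 3 / 4 - η) ≤ 4 := by
    calc (4 : ℝ) ^ (s - 3 / 4 - η) ≤ 4 ^ (1 : ℝ) :=
          Real.rpow_le_rpow_of_exponent_le (by norm_num) (by linarith [hb.le])
      _ = 4 := Real.rpow_one 4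
  calc ‖b n‖ * (potMult (s - 3 / 4 - η) n)⁻¹
      ≤ rho n ^ (-s) * (4 * (4 : ℝ) ^ (s - 3 / 4 - η) * rho n ^ (s - 3 / 4 - η)) :=
        mul_le_mul (hb.bound n) (potMult_inv_le hγ n) (inv_nonneg.2 (potMult_pos hγ n).le)
          (by positivity)
    _ = (4 * (4 : ℝ) ^ (s - 3 / 4 - η)) * (rho n ^ (-s) * rho n ^ (s - 3 / 4 - η)) := by ring
    _ = (4 * (4 : ℝ) ^ (s - 3 / 4 - η)) * rho n ^ (-(3 / 4 + η)) := by
        rw [← Real.rpow_add hr]; ring_nf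
    _ ≤ 16 * rho n ^ (-(3 / 4 + η)) := by gcongr; linarith

theorem aemeasurable_liminf {Ω : Type*} [MeasurableSpace Ω] {μ : Measure Ω} {f : ℕ → Ω → ℝ≥0∞}
    (hf : ∀ N, AEMeasurable (f N) μ) : AEMeasurable (fun ω => liminf (fun N => f N ω) atTop) μ := by
  refine ⟨fun ω => liminf (fun N => (hf N).mk _ ω) atTop,
    Measurable.liminf fun N => (hf N).measurable_mk, ?_⟩
  filter_upwards [ae_all_iff.2 fun N => (hf N).ae_eq_mk] with ω h
  simp only [h]

/-- Moments of the difference of the potentials belonging to two multipliers. -/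
theorem IsPotential.exists_moment_diff {b : ℤ × ℤ → ℂ} {s ε : ℝ} (hb : IsPotential b s) (hε : 0 < ε)
    (hε' : ε < 1 / 4) {q : ℕ} (hq : 10 / ε < (2 * q : ℕ)) :
    ∃ C : ℝ, 0 < C ∧ ∀ {Ω : Type*} [MeasurableSpace Ω] {μ : Measure Ω} [IsProbabilityMeasure μ]
      {ξ : Ω → PeriodicDistribution}, IsWhiteNoise μ ξ → ∀ {c c' : ℤ × ℤ → ℝ},
      (RapidDecay fun n => (c n : ℂ)) → (RapidDecay fun n => (c' n : ℂ)) → ∀ {M : ℝ}, 0 < M →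
      (∀ n m, |c n * c m - c' n * c' m| ≤ M * (rho n ^ (ε / 2) + rho m ^ (ε / 2))) →
      ∃ Y : Ω → ℝ≥0∞, AEMeasurable Y μ ∧ (∀ ω, holderSeminorm (s - 3 / 4 - ε)
        (fun x => chaosPot b c (fourierCoeff (ξ ω)) x - chaosPot b c' (fourierCoeff (ξ ω)) x) ^
          ((2 * q : ℕ) : ℝ) ≤ Y ω) ∧
        ∫⁻ ω, Y ω ∂μ ≤ ENNReal.ofReal (C * M ^ ((2 * q : ℕ) : ℝ)) := by
  set P : ℝ := ((2 * q : ℕ) : ℝ) with hPdef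
  have hP1 : 1 ≤ P := by
    have : 1 ≤ 10 / ε := by rw [le_div_iff₀ hε]; linarith
    linarith
  have h1s := hb.one_le
  have hs2 := hb.le
  -- The gap between `γ` and the Hölder exponent is `ε/4`, and `P > 10/ε` makes the embedding loss
  -- `5/(2P)` smaller.
  obtain ⟨C₁, hC₁0, hC₁⟩ := holderSeminorm_trigChaos_le (γ := s - 3 / 4 - 3 / 4 * ε) (P := P)
    (α := s - 3 / 4 - ε) hP1 (by linarith) (by linarith) (by
      have h2 : 5 / (2 * P) < ε / 4 := by
        rw [div_lt_iff₀ (by positivity)]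
        rw [div_lt_iff₀ hε] at hq
        linarith
      linarith)
  -- `η = 3ε/4` is what `γ` leaves over, and `δ = ε/2 < η` is the part spent on the multiplier
  -- difference.
  obtain ⟨C₂, hC₂0, hC₂⟩ := lintegral_trigChaos_le (η := 3 / 4 * ε) (δ := ε / 2) (K := 16)
    (by linarith) (by linarith) (by linarith) q
  rw [← hPdef] at hC₂
  refine ⟨C₁ * C₂, by positivity, ?_⟩
  intro Ω _ μ _ ξ hξ c c' hc hc' M hM hD
  set β : ℤ × ℤ → ℂ := fun n => b n / potMult (s - 3 / 4 - 3 / 4 * ε) n with hβ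
  have hmom := fun N => lintegral_lintegral_trigChaos_le hξ (volume.restrict cell) β (box N)
    (D := fun _ n m => c n * c m - c' n * c' m) (fun n m => measurable_const) (y := id)
    measurable_id (k := fun _ => 1) (B := fun _ => ENNReal.ofReal (C₂ * M ^ P))
    measurable_const P (ae_of_all _ fun x => hC₂ hξ (by simp [hb.zero])
      (hb.div_bound (by linarith) (by linarith)) neg_mem_box hM hD x)
  simp only [one_mul, id_eq, lintegral_const, measure_univ, mul_one] at hmom
  -- The majorant is the lower limit over boxes of space-integrated moments. It is almost everywhere
  -- measurable and, by Fatou, has the uniform bound as its integral.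
  refine ⟨fun ω => liminf (fun N => ENNReal.ofReal C₁ * ∫⁻ x in cell, ‖trigChaos β (box N)
    (fun n m => c n * c m - c' n * c' m) (fourierCoeff (ξ ω)) x‖ₑ ^ P) atTop, ?_, fun ω => ?_, ?_⟩
  · exact aemeasurable_liminf fun N => (hmom N).1.const_mul _
  · exact holderSeminorm_rpow_le_liminf (by linarith)
      (fun x => tendsto_trigChaos hb.norm_le_one hc hc' (polyGrowth_fourierCoeff _) x)
      (fun N => hC₁ b (box N) _ _)
  · refine (lintegral_liminf_le' fun N => (hmom N).1.const_mul _).trans ?_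
    refine liminf_le_of_le (by isBoundedDefault) fun K hK => ?_
    obtain ⟨N, hN⟩ := hK.exists
    refine hN.trans ?_
    rw [lintegral_const_mul'' _ (hmom N).1, mul_assoc, ENNReal.ofReal_mul hC₁0.le]
    gcongr
    exact (hmom N).2

/-! ### Estimates for the mollification multipliers -/

/-- The homogeneous anisotropic modulus of a frequency. -/
def rhoZero (y : ℝ × ℝ) : ℝ := |y.1| + |y.2| ^ (2 / 3 : ℝ)

theorem rhoZero_nonneg (y : ℝ × ℝ) : 0 ≤ rhoZero y := by unfold rhoZero; positivity

/-- When `rhoZero y ≤ 1` also `|y.2| ≤ 1`, where `|y.2| ≤ |y.2|^(2/3)`. This passes from isotropic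
smoothness of the transform to anisotropic homogeneity. -/
theorem min_one_le_rhoZero_rpow {δ : ℝ} (hδ : 0 ≤ δ) (hδ1 : δ ≤ 1) (y : ℝ × ℝ) :
    min 1 (|y.1| + |y.2|) ≤ rhoZero y ^ δ := by
  refine le_trans ?_ (min_one_le_rpow (rhoZero_nonneg y) hδ hδ1)
  rcases le_total 1 (rhoZero y) with h | h
  · rw [min_eq_left h]; exact min_le_left _ _
  · rw [min_eq_right h]
    refine (min_le_right _ _).trans ?_
    have h2 : |y.2| ^ (2 / 3 : ℝ) ≤ 1 := by
      unfold rhoZero at h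
      linarith [abs_nonneg y.1]
    have h3 : |y.2| ≤ 1 := by
      by_contra hc
      push Not at hc
      have := Real.one_lt_rpow hc (by norm_num : (0 : ℝ) < 2 / 3)
      linarith
    have h4 : |y.2| ≤ |y.2| ^ (2 / 3 : ℝ) := by
      rcases (abs_nonneg y.2).eq_or_lt with h0 | h0
      · rw [← h0]; positivity
      · simpa using Real.rpow_le_rpow_of_exponent_ge h0 h3 (by norm_num : (2 / 3 : ℝ) ≤ 1)
    unfold rhoZero
    linarith

theorem abs_add_abs_le_two_mul_norm (y : ℝ × ℝ) : |y.1| + |y.2| ≤ 2 * ‖y‖ := by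
  have h1 := norm_fst_le y
  have h2 := norm_snd_le y
  rw [Real.norm_eq_abs] at h1 h2
  linarith

/-- Both quantities are bounded and vanish at least linearly at the origin, so they are dominated by
`min 1 (|y.1| + |y.2|)` and thus by every power `δ ∈ [0, 1]` of `rhoZero y`. -/
theorem exists_schwartz_bounds (Ψ : 𝓢(ℝ × ℝ, ℂ)) : ∃ C : ℝ, 1 ≤ C ∧ (∀ y, ‖Ψ y‖ ≤ C) ∧
    ∀ {δ : ℝ}, 0 ≤ δ → δ ≤ 1 →
      (∀ y, ‖fderiv ℝ Ψ y‖ * (|y.1| + |y.2|) ≤ C * rhoZero y ^ δ) ∧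
      (∀ y, ‖Ψ y - Ψ 0‖ ≤ C * rhoZero y ^ δ) := by
  obtain ⟨C₀, hC₀0, hC₀⟩ := schwartz_decay Ψ 0
  obtain ⟨C₁, hC₁0, hC₁⟩ := schwartz_decay (SchwartzMap.fderivCLM ℝ (ℝ × ℝ) ℂ Ψ) 1
  have hΨ : ∀ y, ‖Ψ y‖ ≤ C₀ := fun y => by simpa using hC₀ y
  have hΨ' : ∀ y, (1 + ‖y‖) * ‖fderiv ℝ Ψ y‖ ≤ C₁ := fun y => by simpa using hC₁ y
  refine ⟨1 + 2 * C₀ + 2 * C₁, by linarith, fun y => by linarith [hΨ y], fun {δ} hδ hδ1 => ⟨?_, ?_⟩⟩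
  · intro y
    have h1 := hΨ' y
    have h2 := abs_add_abs_le_two_mul_norm y
    have h3 := norm_nonneg (fderiv ℝ Ψ y)
    have h4 := norm_nonneg y
    have h5 : ‖fderiv ℝ Ψ y‖ * (|y.1| + |y.2|) ≤ 2 * C₁ * min 1 (|y.1| + |y.2|) := by
      rcases le_total 1 (|y.1| + |y.2|) with h | h
      · rw [min_eq_left h]
        nlinarith
      · rw [min_eq_right h]
        have h6 : ‖fderiv ℝ Ψ y‖ ≤ 2 * C₁ := by nlinarith
        exact mul_le_mul_of_nonneg_right h6 (by positivity)
    refine h5.trans (mul_le_mul (by linarith) (min_one_le_rhoZero_rpow hδ hδ1 y) ?_ (by linarith))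
    exact le_min zero_le_one (by positivity)
  · intro y
    have hlip : ‖Ψ y - Ψ 0‖ ≤ C₁ * ‖y - 0‖ :=
      convex_univ.norm_image_sub_le_of_norm_fderiv_le (𝕜 := ℝ) (f := Ψ)
        (fun x _ => Ψ.differentiableAt) (fun x _ => by
          have := hΨ' x
          nlinarith [norm_nonneg x, norm_nonneg (fderiv ℝ Ψ x)]) (mem_univ _) (mem_univ _)
    rw [sub_zero] at hlip
    have hb : ‖Ψ y - Ψ 0‖ ≤ 2 * C₀ := by
      have := norm_sub_le (Ψ y) (Ψ 0)
      linarith [hΨ y, hΨ 0]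
    have h4 : ‖y‖ ≤ |y.1| + |y.2| := by
      rw [Prod.norm_def, max_le_iff, Real.norm_eq_abs, Real.norm_eq_abs]
      constructor <;> linarith [abs_nonneg y.1, abs_nonneg y.2]
    have h5 : ‖Ψ y - Ψ 0‖ ≤ (1 + 2 * C₀ + 2 * C₁) * min 1 (|y.1| + |y.2|) := by
      rcases le_total 1 (|y.1| + |y.2|) with h | h
      · rw [min_eq_left h]; linarith
      · rw [min_eq_right h]
        have : 0 ≤ |y.1| + |y.2| := by positivity
        nlinarith
    exact h5.trans (mul_le_mul_of_nonneg_left (min_one_le_rhoZero_rpow hδ hδ1 y) (by linarith))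

theorem rhoZero_scale_le {ℓ : ℝ} (hℓ : 0 < ℓ) (n : ℤ × ℤ) :
    rhoZero (ℓ * n.1, ℓ ^ (3 / 2 : ℝ) * n.2) ≤ ℓ * rho n := by
  unfold rhoZero rho
  have h1 : |ℓ ^ (3 / 2 : ℝ) * (n.2 : ℝ)| ^ (2 / 3 : ℝ) = ℓ * |(n.2 : ℝ)| ^ (2 / 3 : ℝ) := by
    rw [abs_mul, abs_of_pos (Real.rpow_pos_of_pos hℓ _), Real.mul_rpow (by positivity) (abs_nonneg _),
      ← Real.rpow_mul hℓ.le]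
    norm_num
  simp only
  rw [h1, abs_mul, abs_of_pos hℓ]
  nlinarith

theorem rhoZero_scale_rpow_le {ℓ δ : ℝ} (hℓ : 0 < ℓ) (hδ : 0 ≤ δ) (n : ℤ × ℤ) :
    rhoZero (ℓ * n.1, ℓ ^ (3 / 2 : ℝ) * n.2) ^ δ ≤ ℓ ^ δ * rho n ^ δ := by
  rw [← Real.mul_rpow hℓ.le (rho_pos n).le]
  exact Real.rpow_le_rpow (rhoZero_nonneg _) (rhoZero_scale_le hℓ n) hδ

theorem hasDerivAt_mollMult (φ : 𝓢(ℝ × ℝ, ℝ)) {s : ℝ} (hs : 0 < s) (n : ℤ × ℤ) :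
    HasDerivAt (fun s => mollMult φ s n)
      (fderiv ℝ (kernelFourier φ) (s * n.1, s ^ (3 / 2 : ℝ) * n.2)
        ((n.1 : ℝ), 3 / 2 * s ^ (1 / 2 : ℝ) * n.2)).re s := by
  have h1 : HasDerivAt (fun s : ℝ => ((s * n.1, s ^ (3 / 2 : ℝ) * n.2) : ℝ × ℝ))
      ((n.1 : ℝ), 3 / 2 * s ^ (1 / 2 : ℝ) * n.2) s := by
    refine HasDerivAt.prodMk ?_ ?_
    · simpa using (hasDerivAt_id s).mul_const (n.1 : ℝ)
    · have := (Real.hasDerivAt_rpow_const (x := s) (p := 3 / 2) (Or.inl hs.ne')).mul_const (n.2 : ℝ)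
      norm_num at this ⊢
      exact this
  exact hasDerivAt_re (((kernelFourier φ).hasFDerivAt _).comp_hasDerivAt s h1)

theorem contDiffOn_mollMult (φ : 𝓢(ℝ × ℝ, ℝ)) (n : ℤ × ℤ) :
    ContDiffOn ℝ 1 (fun s => mollMult φ s n) (Ioi 0) := by
  intro s hs
  have hs' : s ≠ 0 := (mem_Ioi.1 hs).ne'
  have h1 : ContDiffAt ℝ 1 (fun s : ℝ => ((s * n.1, s ^ (3 / 2 : ℝ) * n.2) : ℝ × ℝ)) s :=
    (contDiffAt_id.mul contDiffAt_const).prodMk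
      ((Real.contDiffAt_rpow_const_of_ne hs').mul contDiffAt_const)
  have h2 : ContDiffAt ℝ 1 (kernelFourier φ) (s * n.1, s ^ (3 / 2 : ℝ) * n.2) :=
    ((kernelFourier φ).smooth 1).contDiffAt
  exact (Complex.reCLM.contDiff.contDiffAt.comp s (h2.comp s h1)).contDiffWithinAt

/-- The multiplier of the quadratic functional at scale `s`. -/
def mollProd (φ : 𝓢(ℝ × ℝ, ℝ)) (s : ℝ) (n m : ℤ × ℤ) : ℝ := mollMult φ s n * mollMult φ s m

theorem contDiffOn_mollProd (φ : 𝓢(ℝ × ℝ, ℝ)) (n m : ℤ × ℤ) :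
    ContDiffOn ℝ 1 (fun s => mollProd φ s n m) (Ioi 0) :=
  (contDiffOn_mollMult φ n).mul (contDiffOn_mollMult φ m)

/-- The multiplier is a Schwartz function of the scaled frequency, whose modulus is at most `s * rho
n`. Closeness to one uses the normalization `∫ φ = 1`. A scale derivative costs `1/s` but retains
the factor `(s * rho n) ^ δ`, whence `s ^ (δ - 1)`. -/
theorem exists_mollMult_bounds {φ : 𝓢(ℝ × ℝ, ℝ)} (hφ : IsKernel φ) : ∃ C : ℝ, 1 ≤ C ∧
    (∀ s n, |mollMult φ s n| ≤ C) ∧ ∀ {δ : ℝ}, 0 ≤ δ → δ ≤ 1 →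
      (∀ s, 0 < s → ∀ n, |mollMult φ s n - 1| ≤ C * s ^ δ * rho n ^ δ) ∧
      (∀ s, 0 < s → ∀ n m, |deriv (fun s => mollProd φ s n m) s| ≤
        C * s ^ (δ - 1) * (rho n ^ δ + rho m ^ δ)) := by
  obtain ⟨C, hC1, hC, hCδ⟩ := exists_schwartz_bounds (kernelFourier φ)
  have hb : ∀ s n, |mollMult φ s n| ≤ C := fun s n => (Complex.abs_re_le_norm _).trans (hC _)
  have hCC : C ≤ 2 * C ^ 2 := by nlinarith
  refine ⟨2 * C ^ 2, by nlinarith, fun s n => (hb s n).trans hCC, fun {δ} hδ hδ1 => ⟨?_, ?_⟩⟩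
  · intro s hs n
    have h1 := (hCδ hδ hδ1).2 (s * n.1, s ^ (3 / 2 : ℝ) * n.2)
    rw [hφ.fourier_zero] at h1
    have h2 : |mollMult φ s n - 1| ≤
        ‖kernelFourier φ (s * n.1, s ^ (3 / 2 : ℝ) * n.2) - 1‖ := by
      have := Complex.abs_re_le_norm (kernelFourier φ (s * n.1, s ^ (3 / 2 : ℝ) * n.2) - 1)
      simpa [mollMult] using this
    refine h2.trans (h1.trans ?_)
    rw [mul_assoc]
    exact mul_le_mul hCC (rhoZero_scale_rpow_le hs hδ n)
      (Real.rpow_nonneg (rhoZero_nonneg _) _) (by positivity)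
  · intro s hs n m
    have hder : ∀ k : ℤ × ℤ, ∃ d, HasDerivAt (fun s => mollMult φ s k) d s ∧
        |d| ≤ 3 / 2 * C * s ^ (δ - 1) * rho k ^ δ := by
      intro k
      refine ⟨_, hasDerivAt_mollMult φ hs k, (Complex.abs_re_le_norm _).trans
        ((ContinuousLinearMap.le_opNorm _ _).trans ?_)⟩
      have h1 := (hCδ hδ hδ1).1 (s * k.1, s ^ (3 / 2 : ℝ) * k.2)
      -- Up to the factor `3/2`, `s` times the velocity of the scaled frequency is that frequency
      -- itself.
      have h2 : s * ‖(((k.1 : ℝ), 3 / 2 * s ^ (1 / 2 : ℝ) * k.2) : ℝ × ℝ)‖ ≤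
          3 / 2 * (|s * k.1| + |s ^ (3 / 2 : ℝ) * k.2|) := by
        have hs32 : s ^ (3 / 2 : ℝ) = s * s ^ (1 / 2 : ℝ) := by
          rw [← Real.rpow_one_add' hs.le (by norm_num)]; norm_num
        have p1 : 0 ≤ s * |(k.1 : ℝ)| := by positivity
        have p2 : 0 ≤ s * s ^ (1 / 2 : ℝ) * |(k.2 : ℝ)| := by positivity
        have e1 : |s * (k.1 : ℝ)| = s * |(k.1 : ℝ)| := by rw [abs_mul, abs_of_pos hs]
        have e2 : |s ^ (3 / 2 : ℝ) * (k.2 : ℝ)| = s * s ^ (1 / 2 : ℝ) * |(k.2 : ℝ)| := by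
          rw [hs32, abs_mul, abs_of_nonneg (by positivity)]
        have e3 : |3 / 2 * s ^ (1 / 2 : ℝ) * (k.2 : ℝ)| = 3 / 2 * s ^ (1 / 2 : ℝ) * |(k.2 : ℝ)| := by
          rw [abs_mul, abs_of_nonneg (by positivity)]
        rw [Prod.norm_def, Real.norm_eq_abs, Real.norm_eq_abs, e1, e2, e3,
          mul_max_of_nonneg _ _ hs.le, max_le_iff]
        constructor <;> nlinarith
      set L := ‖fderiv ℝ (kernelFourier φ) (s * k.1, s ^ (3 / 2 : ℝ) * k.2)‖
      set w := ‖(((k.1 : ℝ), 3 / 2 * s ^ (1 / 2 : ℝ) * k.2) : ℝ × ℝ)‖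
      have hL : 0 ≤ L := norm_nonneg _
      have h3 : s * (L * w) ≤ 3 / 2 * (C * (s ^ δ * rho k ^ δ)) := by
        calc s * (L * w) = L * (s * w) := by ring
          _ ≤ L * (3 / 2 * (|s * k.1| + |s ^ (3 / 2 : ℝ) * k.2|)) := by gcongr
          _ = 3 / 2 * (L * (|s * k.1| + |s ^ (3 / 2 : ℝ) * k.2|)) := by ring
          _ ≤ 3 / 2 * (C * rhoZero (s * k.1, s ^ (3 / 2 : ℝ) * k.2) ^ δ) := by gcongr
          _ ≤ 3 / 2 * (C * (s ^ δ * rho k ^ δ)) := by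
              gcongr
              exact rhoZero_scale_rpow_le hs hδ k
      rw [Real.rpow_sub_one hs.ne']
      rw [show 3 / 2 * C * (s ^ δ / s) * rho k ^ δ = (3 / 2 * (C * (s ^ δ * rho k ^ δ))) / s by ring,
        le_div_iff₀ hs]
      linarith
    obtain ⟨d₁, h1, h1'⟩ := hder n
    obtain ⟨d₂, h2, h2'⟩ := hder m
    have hd : deriv (fun s => mollProd φ s n m) s = d₁ * mollMult φ s m + mollMult φ s n * d₂ :=
      (h1.mul h2).deriv
    rw [hd]
    have hp : 0 ≤ s ^ (δ - 1) := by positivity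
    have hn : 0 ≤ rho n ^ δ := Real.rpow_nonneg (rho_pos n).le _
    have hm : 0 ≤ rho m ^ δ := Real.rpow_nonneg (rho_pos m).le _
    calc |d₁ * mollMult φ s m + mollMult φ s n * d₂|
        ≤ |d₁| * |mollMult φ s m| + |mollMult φ s n| * |d₂| := by
          rw [← abs_mul, ← abs_mul]; exact abs_add_le _ _
      _ ≤ (3 / 2 * C * s ^ (δ - 1) * rho n ^ δ) * C + C * (3 / 2 * C * s ^ (δ - 1) * rho m ^ δ) :=
          add_le_add (mul_le_mul h1' (hb s m) (abs_nonneg _) (by positivity))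
            (mul_le_mul (hb s n) h2' (abs_nonneg _) (by positivity))
      _ = 3 / 2 * C ^ 2 * s ^ (δ - 1) * (rho n ^ δ + rho m ^ δ) := by ring
      _ ≤ 2 * C ^ 2 * s ^ (δ - 1) * (rho n ^ δ + rho m ^ δ) := by gcongr; norm_num

/-! ### The supremum over the mollification scales -/

theorem trigChaos_sub (b : ℤ × ℤ → ℂ) (S : Finset (ℤ × ℤ)) (D D' : ℤ × ℤ → ℤ × ℤ → ℝ)
    (a : ℤ × ℤ → ℂ) (x : ℝ × ℝ) : trigChaos b S (fun n m => D n m - D' n m) a x =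
      trigChaos b S D a x - trigChaos b S D' a x := by
  unfold trigChaos
  rw [← Finset.sum_sub_distrib]
  refine Finset.sum_congr rfl fun n _ => ?_
  rw [← Finset.sum_sub_distrib]
  refine Finset.sum_congr rfl fun m _ => ?_
  push_cast
  ring

theorem hasDerivAt_trigChaos (φ : 𝓢(ℝ × ℝ, ℝ)) (b : ℤ × ℤ → ℂ) (S : Finset (ℤ × ℤ))
    (a : ℤ × ℤ → ℂ) (x : ℝ × ℝ) {s : ℝ} (hs : 0 < s) :
    HasDerivAt (fun s => trigChaos b S (mollProd φ s) a x)
      (trigChaos b S (fun n m => deriv (fun s => mollProd φ s n m) s) a x) s := by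
  unfold trigChaos
  refine HasDerivAt.fun_sum fun n _ => HasDerivAt.fun_sum fun m _ => ?_
  have h : HasDerivAt (fun s => mollProd φ s n m) (deriv (fun s => mollProd φ s n m) s) s :=
    (((contDiffOn_mollProd φ n m).differentiableOn (by simp)).differentiableAt
      (Ioi_mem_nhds hs)).hasDerivAt
  exact ((((h.ofReal_comp.const_mul _).mul_const _).mul_const _).mul_const _).mul_const _

theorem continuousOn_trigChaos_deriv (φ : 𝓢(ℝ × ℝ, ℝ)) (b : ℤ × ℤ → ℂ) (S : Finset (ℤ × ℤ))
    (a : ℤ × ℤ → ℂ) (x : ℝ × ℝ) :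
    ContinuousOn (fun s => trigChaos b S (fun n m => deriv (fun s => mollProd φ s n m) s) a x)
      (Ioi 0) := by
  unfold trigChaos
  refine continuousOn_finsetSum _ fun n _ => continuousOn_finsetSum _ fun m _ => ?_
  have h := (contDiffOn_mollProd φ n m).continuousOn_deriv_of_isOpen isOpen_Ioi le_rfl
  exact ((((continuousOn_const.mul (Complex.continuous_ofReal.comp_continuousOn h)).mul
    continuousOn_const).mul continuousOn_const).mul continuousOn_const).mul continuousOn_const

/-- The fundamental theorem of calculus in the scale. The right side does not depend on the two
scales, so one random variable dominates an uncountable supremum. -/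
theorem enorm_trigChaos_sub_le (φ : 𝓢(ℝ × ℝ, ℝ)) (b : ℤ × ℤ → ℂ) (S : Finset (ℤ × ℤ))
    (a : ℤ × ℤ → ℂ) (x : ℝ × ℝ) {ℓ₀ ℓ ℓ' : ℝ} (hℓ : ℓ ∈ Ioc 0 ℓ₀) (hℓ' : ℓ' ∈ Ioc 0 ℓ₀) :
    ‖trigChaos b S (fun n m => mollProd φ ℓ n m - mollProd φ ℓ' n m) a x‖ₑ ≤
      ∫⁻ s in Ioc 0 ℓ₀,
        ‖trigChaos b S (fun n m => deriv (fun s => mollProd φ s n m) s) a x‖ₑ := by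
  have hsub : uIcc ℓ' ℓ ⊆ Ioi 0 := fun s hs => (lt_min hℓ'.1 hℓ.1).trans_le hs.1
  have h := intervalIntegral.integral_eq_sub_of_hasDerivAt
    (fun s hs => hasDerivAt_trigChaos φ b S a x (hsub hs))
    ((continuousOn_trigChaos_deriv φ b S a x).mono hsub).intervalIntegrable
  rw [trigChaos_sub]
  change ‖trigChaos b S (mollProd φ ℓ) a x - trigChaos b S (mollProd φ ℓ') a x‖ₑ ≤ _
  rw [← h, intervalIntegral.intervalIntegral_eq_integral_uIoc, enorm_smul]
  have h1 : ‖(if ℓ' ≤ ℓ then 1 else -1 : ℝ)‖ₑ = 1 := by split_ifs <;> simp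
  rw [h1, one_mul]
  refine (enorm_integral_le_lintegral_enorm _).trans (lintegral_mono_set fun s hs => ?_)
  exact ⟨(lt_min hℓ'.1 hℓ.1).trans hs.1, hs.2.trans (max_le hℓ'.2 hℓ.2)⟩

theorem lintegral_rpow_sub_one {δ ℓ₀ : ℝ} (hδ : 0 < δ) (hℓ₀ : 0 < ℓ₀) :
    ∫⁻ s in Ioc 0 ℓ₀, ENNReal.ofReal (s ^ (δ - 1)) = ENNReal.ofReal (ℓ₀ ^ δ / δ) := by
  have hi : IntervalIntegrable (fun s : ℝ => s ^ (δ - 1)) volume 0 ℓ₀ :=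
    intervalIntegral.intervalIntegrable_rpow' (by linarith)
  rw [← ofReal_integral_eq_lintegral_ofReal
    ((intervalIntegrable_iff_integrableOn_Ioc_of_le hℓ₀.le).1 hi)
    ((ae_restrict_iff' measurableSet_Ioc).2 (ae_of_all _ fun s hs => Real.rpow_nonneg hs.1.le _)),
    ← intervalIntegral.integral_of_le hℓ₀.le, integral_rpow (Or.inl (by linarith))]
  rw [sub_add_cancel, Real.zero_rpow hδ.ne', sub_zero]

theorem measurable_deriv_mollProd (φ : 𝓢(ℝ × ℝ, ℝ)) (n m : ℤ × ℤ) :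
    Measurable fun s : ℝ => deriv (fun s => mollProd φ s n m) s := measurable_deriv _

theorem measurable_trigChaos {X : Type*} [MeasurableSpace X] (b : ℤ × ℤ → ℂ) (S : Finset (ℤ × ℤ))
    {D : X → ℤ × ℤ → ℤ × ℤ → ℝ} (hD : ∀ n m, Measurable fun x => D x n m) {y : X → ℝ × ℝ}
    (hy : Measurable y) (a : ℤ × ℤ → ℂ) : Measurable fun z : X => trigChaos b S (D z) a (y z) := by
  unfold trigChaos
  refine Finset.measurable_fun_sum _ fun n _ => Finset.measurable_fun_sum _ fun m _ => ?_
  have h1 := (hD n m).complex_ofReal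
  have h2 := (continuous_chr (n + m)).measurable.comp hy
  exact ((((h1.const_mul _).mul_const _).mul h2).mul_const _).mul_const _

/-- Jensen in the scale with weight `s ^ (δ - 1)`, of total mass `ℓ₀ ^ δ / δ`. The integrand is
compensated by `s ^ (1 - δ)`, which after taking the power `P` leaves the exponent `(δ - 1)(1 - P)`.
-/
theorem lintegral_trigChaos_sub_le (φ : 𝓢(ℝ × ℝ, ℝ)) (b : ℤ × ℤ → ℂ) (S : Finset (ℤ × ℤ))
    (a : ℤ × ℤ → ℂ) {P δ : ℝ} (hP : 1 ≤ P) (hδ : 0 < δ) {ℓ₀ ℓ ℓ' : ℝ} (hℓ : ℓ ∈ Ioc 0 ℓ₀)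
    (hℓ' : ℓ' ∈ Ioc 0 ℓ₀) :
    ∫⁻ x in cell, ‖trigChaos b S (fun n m => mollProd φ ℓ n m - mollProd φ ℓ' n m) a x‖ₑ ^ P ≤
      ENNReal.ofReal (ℓ₀ ^ δ / δ) ^ (P - 1) *
      ∫⁻ z : (ℝ × ℝ) × ℝ, ENNReal.ofReal (z.2 ^ ((δ - 1) * (1 - P))) *
        ‖trigChaos b S (fun n m => deriv (fun s => mollProd φ s n m) z.2) a z.1‖ₑ ^ P
        ∂(volume.restrict cell).prod (volume.restrict (Ioc 0 ℓ₀)) := by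
  have hℓ₀ : 0 < ℓ₀ := hℓ.1.trans_le hℓ.2
  have hm := measurable_trigChaos b S (X := (ℝ × ℝ) × ℝ)
    (D := fun z n m => deriv (fun s => mollProd φ s n m) z.2)
    (fun n m => (measurable_deriv_mollProd φ n m).comp measurable_snd) (y := Prod.fst) measurable_fst a
  have hk : Measurable fun z : (ℝ × ℝ) × ℝ => ENNReal.ofReal (z.2 ^ ((δ - 1) * (1 - P))) :=
    (measurable_snd.pow_const _).ennreal_ofReal
  have hF : Measurable fun z : (ℝ × ℝ) × ℝ => ENNReal.ofReal (z.2 ^ ((δ - 1) * (1 - P))) *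
      ‖trigChaos b S (fun n m => deriv (fun s => mollProd φ s n m) z.2) a z.1‖ₑ ^ P :=
    hk.mul (hm.enorm.pow_const P)
  rw [lintegral_prod _ hF.aemeasurable, ← lintegral_const_mul _ hF.lintegral_prod_right']
  refine lintegral_mono fun x => ?_
  have hmx : Measurable fun s : ℝ =>
      trigChaos b S (fun n m => deriv (fun s => mollProd φ s n m) s) a x :=
    measurable_trigChaos b S (D := fun s n m => deriv (fun s => mollProd φ s n m) s)
      (measurable_deriv_mollProd φ) (y := fun _ => x) measurable_const a
  set g : ℝ → ℝ≥0∞ := fun s =>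
    ‖trigChaos b S (fun n m => deriv (fun s => mollProd φ s n m) s) a x‖ₑ with hg
  have h1 : ∫⁻ s in Ioc 0 ℓ₀, g s = ∫⁻ s in Ioc 0 ℓ₀, ENNReal.ofReal (s ^ (δ - 1)) *
      (ENNReal.ofReal (s ^ (1 - δ)) * g s) := by
    refine setLIntegral_congr_fun measurableSet_Ioc fun s hs => ?_
    rw [← mul_assoc, ← ENNReal.ofReal_mul (Real.rpow_nonneg hs.1.le _), ← Real.rpow_add hs.1]
    simp
  have hkm : ∀ r : ℝ, Measurable fun s : ℝ => ENNReal.ofReal (s ^ r) := fun r =>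
    (measurable_id.pow_const _).ennreal_ofReal
  have h2 := lintegral_mul_rpow_le (volume.restrict (Ioc 0 ℓ₀)) hP (hkm (δ - 1)).aemeasurable
    ((hkm (1 - δ)).mul hmx.enorm).aemeasurable
  have h0 := enorm_trigChaos_sub_le φ b S a x hℓ hℓ'
  refine (ENNReal.rpow_le_rpow h0 (by linarith)).trans ?_
  change (∫⁻ s in Ioc 0 ℓ₀, g s) ^ P ≤ _
  rw [h1]
  refine h2.trans (le_of_eq ?_)
  rw [lintegral_rpow_sub_one hδ hℓ₀]
  congr 1
  refine setLIntegral_congr_fun measurableSet_Ioc fun s hs => ?_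
  dsimp only
  rw [Pi.mul_apply, ENNReal.mul_rpow_of_nonneg _ _ (by linarith), ← mul_assoc,
    ENNReal.ofReal_rpow_of_nonneg (Real.rpow_nonneg hs.1.le _) (by linarith),
    ← ENNReal.ofReal_mul (Real.rpow_nonneg hs.1.le _), ← Real.rpow_mul hs.1.le, ← Real.rpow_add hs.1]
  congr 3
  ring

/-- Moments of the supremum over the mollification scales. -/
theorem IsPotential.exists_moment_sup {b : ℤ × ℤ → ℂ} {s ε : ℝ} (hb : IsPotential b s) (hε : 0 < ε)
    (hε' : ε < 1 / 4) {q : ℕ} (hq : 10 / ε < (2 * q : ℕ)) {φ : 𝓢(ℝ × ℝ, ℝ)} (hφ : IsKernel φ) :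
    ∃ C : ℝ, 0 < C ∧ ∀ {Ω : Type*} [MeasurableSpace Ω] {μ : Measure Ω} [IsProbabilityMeasure μ]
      {ξ : Ω → PeriodicDistribution}, IsWhiteNoise μ ξ → ∀ {ℓ₀ : ℝ}, 0 < ℓ₀ →
      ∃ Y : Ω → ℝ≥0∞, AEMeasurable Y μ ∧ (∀ ω, ∀ ℓ ∈ Ioc 0 ℓ₀, ∀ ℓ' ∈ Ioc 0 ℓ₀,
        holderSeminorm (s - 3 / 4 - ε) (fun x => chaosPot b (mollMult φ ℓ) (fourierCoeff (ξ ω)) x -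
          chaosPot b (mollMult φ ℓ') (fourierCoeff (ξ ω)) x) ^ ((2 * q : ℕ) : ℝ) ≤ Y ω) ∧
        ∫⁻ ω, Y ω ∂μ ≤ ENNReal.ofReal (C * (ℓ₀ ^ (ε / 2)) ^ ((2 * q : ℕ) : ℝ)) := by
  set P : ℝ := ((2 * q : ℕ) : ℝ) with hPdef
  have hP1 : 1 ≤ P := by
    have : 1 ≤ 10 / ε := by rw [le_div_iff₀ hε]; linarith
    linarith
  have h1s := hb.one_le
  have hs2 := hb.le
  obtain ⟨C₁, hC₁0, hC₁⟩ := holderSeminorm_trigChaos_le (γ := s - 3 / 4 - 3 / 4 * ε) (P := P)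
    (α := s - 3 / 4 - ε) hP1 (by linarith) (by linarith) (by
      have h2 : 5 / (2 * P) < ε / 4 := by
        rw [div_lt_iff₀ (by positivity)]
        rw [div_lt_iff₀ hε] at hq
        linarith
      linarith)
  obtain ⟨C₂, hC₂0, hC₂⟩ := lintegral_trigChaos_le (η := 3 / 4 * ε) (δ := ε / 2) (K := 16)
    (by linarith) (by linarith) (by linarith) q
  rw [← hPdef] at hC₂
  obtain ⟨C₃, hC₃1, -, hC₃⟩ := exists_mollMult_bounds hφ
  have hC₃' := (hC₃ (δ := ε / 2) (by linarith) (by linarith)).2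
  obtain ⟨δ, hδ⟩ : ∃ δ, δ = ε / 2 := ⟨_, rfl⟩
  rw [← hδ] at hC₃' hC₂ ⊢
  have hδ0 : 0 < δ := by linarith
  refine ⟨C₁ * (δ⁻¹ ^ P * (C₂ * C₃ ^ P)), by positivity, ?_⟩
  intro Ω _ μ _ ξ hξ ℓ₀ hℓ₀
  set β : ℤ × ℤ → ℂ := fun n => b n / potMult (s - 3 / 4 - 3 / 4 * ε) n with hβ
  set ν : Measure ((ℝ × ℝ) × ℝ) := (volume.restrict cell).prod (volume.restrict (Ioc 0 ℓ₀)) with hν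
  -- The derivative bound for the multiplier is available at positive scales only.
  have hν0 : ∀ᵐ z ∂ν, 0 < z.2 := by
    have h := (ae_restrict_iff' (μ := (volume : Measure ℝ)) (measurableSet_Ioc (a := 0) (b := ℓ₀))).2
      (ae_of_all _ fun s hs => hs.1 : ∀ᵐ s, s ∈ Ioc 0 ℓ₀ → 0 < s)
    exact Measure.quasiMeasurePreserving_snd.ae h
  have hmom := fun N => lintegral_lintegral_trigChaos_le hξ ν β (box N)
    (D := fun z n m => deriv (fun s => mollProd φ s n m) z.2)
    (fun n m => (measurable_deriv_mollProd φ n m).comp measurable_snd) (y := Prod.fst)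
    measurable_fst (k := fun z => ENNReal.ofReal (z.2 ^ ((δ - 1) * (1 - P))))
    (B := fun z => ENNReal.ofReal (C₂ * (C₃ * z.2 ^ (δ - 1)) ^ P))
    (measurable_snd.pow_const _).ennreal_ofReal P (hν0.mono fun z hz => hC₂ hξ (by simp [hb.zero])
      (hb.div_bound (by linarith) (by linarith)) neg_mem_box (by positivity)
      (hC₃' z.2 hz) z.1)
  -- The moment at scale `s` is of order `s ^ ((δ - 1) P)`. Multiplied by the Jensen weight it
  -- becomes `s ^ (δ - 1)`, integrable at zero.
  have hint : ∫⁻ z, ENNReal.ofReal (z.2 ^ ((δ - 1) * (1 - P))) *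
      ENNReal.ofReal (C₂ * (C₃ * z.2 ^ (δ - 1)) ^ P) ∂ν ≤
      ENNReal.ofReal (C₂ * C₃ ^ P * (ℓ₀ ^ δ / δ)) := by
    have e1 : ∫⁻ z, ENNReal.ofReal (z.2 ^ ((δ - 1) * (1 - P))) *
        ENNReal.ofReal (C₂ * (C₃ * z.2 ^ (δ - 1)) ^ P) ∂ν =
        ∫⁻ z, ENNReal.ofReal (C₂ * C₃ ^ P) * ENNReal.ofReal (z.2 ^ (δ - 1)) ∂ν := by
      refine lintegral_congr_ae (hν0.mono fun z hz => ?_)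
      dsimp only
      rw [← ENNReal.ofReal_mul (by positivity), ← ENNReal.ofReal_mul (by positivity),
        Real.mul_rpow (by positivity) (by positivity), ← Real.rpow_mul hz.le]
      congr 1
      have e2 : z.2 ^ ((δ - 1) * (1 - P)) * z.2 ^ ((δ - 1) * P) = z.2 ^ (δ - 1) := by
        rw [← Real.rpow_add hz]
        congr 1
        ring
      rw [← e2]
      ring
    have hmk : Measurable fun z : (ℝ × ℝ) × ℝ => ENNReal.ofReal (z.2 ^ (δ - 1)) :=
      (measurable_snd.pow_const _).ennreal_ofReal
    rw [e1, lintegral_const_mul _ hmk, hν, lintegral_prod _ hmk.aemeasurable]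
    simp only [lintegral_rpow_sub_one hδ0 hℓ₀, lintegral_const, measure_univ, mul_one]
    rw [← ENNReal.ofReal_mul (by positivity)]
  refine ⟨fun ω => liminf (fun N => ENNReal.ofReal C₁ * (ENNReal.ofReal (ℓ₀ ^ δ / δ) ^ (P - 1) *
    ∫⁻ z : (ℝ × ℝ) × ℝ, ENNReal.ofReal (z.2 ^ ((δ - 1) * (1 - P))) *
        ‖trigChaos β (box N) (fun n m => deriv (fun s => mollProd φ s n m) z.2)
          (fourierCoeff (ξ ω)) z.1‖ₑ ^ P ∂ν)) atTop, ?_, fun ω ℓ hℓ ℓ' hℓ' => ?_, ?_⟩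
  · exact aemeasurable_liminf fun N => ((hmom N).1.const_mul _).const_mul _
  · refine holderSeminorm_rpow_le_liminf (by linarith)
      (fun x => tendsto_trigChaos hb.norm_le_one (rapidDecay_mollMult φ hℓ.1)
        (rapidDecay_mollMult φ hℓ'.1) (polyGrowth_fourierCoeff _) x)
      (fun N => (hC₁ b (box N) _ _).trans ?_)
    gcongr
    exact lintegral_trigChaos_sub_le φ β (box N) _ hP1 hδ0 hℓ hℓ'
  · refine (lintegral_liminf_le' fun N => ((hmom N).1.const_mul _).const_mul _).trans ?_
    refine liminf_le_of_le (by isBoundedDefault) fun K hK => ?_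
    obtain ⟨N, hN⟩ := hK.exists
    refine hN.trans ?_
    rw [lintegral_const_mul'' _ ((hmom N).1.const_mul _), lintegral_const_mul'' _ (hmom N).1, mul_assoc,
      ENNReal.ofReal_mul hC₁0.le]
    gcongr
    refine (mul_le_mul_right ((hmom N).2.trans hint) _).trans (le_of_eq ?_)
    have hpos : 0 < ℓ₀ ^ δ / δ := by positivity
    rw [ENNReal.ofReal_rpow_of_pos hpos, ← ENNReal.ofReal_mul (by positivity)]
    congr 1
    have e3 : (ℓ₀ ^ δ / δ) ^ (P - 1) * (ℓ₀ ^ δ / δ) = (ℓ₀ ^ δ) ^ P * δ⁻¹ ^ P := by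
      rw [← Real.rpow_add_one hpos.ne', sub_add_cancel, div_eq_mul_inv,
        Real.mul_rpow (by positivity) (by positivity)]
    linear_combination (C₂ * C₃ ^ P) * e3

/-! ### Moment bounds -/

theorem negHolder_le {β : ℝ} {f : PeriodicDistribution} {g h : ℝ × ℝ → ℝ} (hg : IsPeriodic g)
    (hh : IsPeriodic h) (hf : IsDecomposition f 0 g h) :
    negHolder β f ≤ holderSeminorm (β + 1) g + holderSeminorm (β + 3 / 2) h := by
  unfold negHolder
  refine iInf_le_of_le 0 (iInf_le_of_le g (iInf_le_of_le h (iInf_le_of_le hg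
    (iInf_le_of_le hh (iInf_le_of_le hf (le_of_eq ?_))))))
  simp

theorem IsDecomposition.sub {f f' : PeriodicDistribution} {g h g' h' : ℝ × ℝ → ℝ}
    (hf : IsDecomposition f 0 g h) (hf' : IsDecomposition f' 0 g' h') (hg : Continuous g)
    (hh : Continuous h) (hg' : Continuous g') (hh' : Continuous h') :
    IsDecomposition (f - f') 0 (fun x => g x - g' x) (fun x => h x - h' x) := by
  intro ζ
  have c1 := continuous_pd₁_test ζ
  have c2 := continuous_pd₂_test ζ
  have e : pair (f - f') ζ = pair f ζ - pair f' ζ := rfl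
  rw [e, hf ζ, hf' ζ]
  simp only [sub_mul]
  rw [integral_sub (f := fun x => g x * pd₁ ζ x) (g := fun x => g' x * pd₁ ζ x) (integrableOn_cell (hg.mul c1))
      (integrableOn_cell (hg'.mul c1)),
    integral_sub (f := fun x => h x * pd₂ ζ x) (g := fun x => h' x * pd₂ ζ x) (integrableOn_cell (hh.mul c2))
      (integrableOn_cell (hh'.mul c2))]
  ring

theorem IsPeriodic.sub {g g' : ℝ × ℝ → ℝ} (hg : IsPeriodic g) (hg' : IsPeriodic g') :
    IsPeriodic fun x => g x - g' x := fun x => by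
  simp only [(hg x).1, (hg x).2, (hg' x).1, (hg' x).2, and_self]

theorem isPeriodic_chaosPot (b : ℤ × ℤ → ℂ) (c : ℤ × ℤ → ℝ) (a : ℤ × ℤ → ℂ) :
    IsPeriodic (chaosPot b c a) := isPeriodic_re_tser _ _

theorem IsPotential.continuous_chaosPot {b : ℤ × ℤ → ℂ} {s : ℝ} (hb : IsPotential b s)
    {c : ℤ × ℤ → ℝ} (hc : RapidDecay fun n => (c n : ℂ)) {a : ℤ × ℤ → ℂ} (ha : PolyGrowth a) :
    Continuous (chaosPot b c a) := by
  refine Complex.continuous_re.comp (continuous_tser ?_ _)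
  refine Summable.of_nonneg_of_le (fun i => norm_nonneg _) (fun i => ?_) (summable_chaosCoeff hc ha)
  rw [norm_mul]
  exact mul_le_of_le_one_left (norm_nonneg _) (hb.norm_le_one _)

theorem holderSeminorm_add_le (α : ℝ) (f g : ℝ × ℝ → ℝ) :
    holderSeminorm α (fun x => f x + g x) ≤ holderSeminorm α f + holderSeminorm α g := by
  refine holderSeminorm_le fun x y => ?_
  rw [add_sub_add_comm, mul_add]
  exact (enorm_add_le _ _).trans
    (add_le_add (enorm_sub_le_holderSeminorm f x y) (enorm_sub_le_holderSeminorm g x y))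

theorem chaosPot_zero (b : ℤ × ℤ → ℂ) (a : ℤ × ℤ → ℂ) (x : ℝ × ℝ) :
    chaosPot b (fun _ => 0) a x = 0 := by
  simp [chaosPot, tser, chaosCoeff]

theorem rapidDecay_zero : RapidDecay fun _ => (((0 : ℝ)) : ℂ) :=
  rapidDecay_of_finite (by simp [Function.support])

theorem add_rpow_le_of_rpow_le {P : ℝ} (hP : 0 < P) {a b A B : ℝ≥0∞} (ha : a ^ P ≤ A)
    (hb : b ^ P ≤ B) : (a + b) ^ P ≤ 2 ^ P * (A + B) := by
  have h1 : a + b ≤ 2 * max a b := by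
    rw [two_mul]
    exact add_le_add (le_max_left _ _) (le_max_right _ _)
  refine (ENNReal.rpow_le_rpow h1 hP.le).trans ?_
  rw [ENNReal.mul_rpow_of_nonneg _ _ hP.le]
  gcongr
  rcases le_total a b with h | h
  · rw [max_eq_right h]; exact hb.trans le_add_self
  · rw [max_eq_left h]; exact ha.trans le_self_add

/-! ### From pathwise majorants to upper expectations -/

theorem expectation_le_of_le {Ω : Type*} [MeasurableSpace Ω] {μ : Measure Ω} {f W : Ω → ℝ≥0∞}
    (hW : AEMeasurable W μ) (h : ∀ᵐ ω ∂μ, f ω ≤ W ω) : expectation μ f ≤ ∫⁻ ω, W ω ∂μ := by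
  unfold expectation
  refine iInf_le_of_le (hW.mk W) (iInf_le_of_le hW.measurable_mk (iInf_le_of_le ?_
    (lintegral_congr_ae hW.ae_eq_mk).symm.le))
  filter_upwards [h, hW.ae_eq_mk] with ω h1 h2
  rwa [← h2]

/-- On a probability space lower moments are controlled by higher ones, so all exponents `p` follow
from arbitrarily large even `P`. -/
theorem lintegral_rpow_div_le {Ω : Type*} [MeasurableSpace Ω] {μ : Measure Ω}
    [IsProbabilityMeasure μ] {W : Ω → ℝ≥0∞} (hW : AEMeasurable W μ) {p P : ℝ} (hp : 0 < p)
    (hpP : p ≤ P) {K M : ℝ} (hK : 0 ≤ K) (hM : 0 ≤ M)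
    (h : ∫⁻ ω, W ω ∂μ ≤ ENNReal.ofReal (K * M ^ P)) :
    ∫⁻ ω, W ω ^ (p / P) ∂μ ≤ ENNReal.ofReal (K ^ (1 / P) * M) ^ p := by
  have hP : 0 < P := hp.trans_le hpP
  have h1 := lintegral_rpow_le_measure μ (p := P / p) (by rw [le_div_iff₀ hp]; linarith)
    (hW.pow_const (p / P))
  rw [measure_univ, ENNReal.one_rpow, one_mul] at h1
  have e : ∀ ω, (W ω ^ (p / P)) ^ (P / p) = W ω := fun ω => by
    rw [← ENNReal.rpow_mul, div_mul_div_cancel₀ hP.ne', div_self hp.ne', ENNReal.rpow_one]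
  simp only [e] at h1
  have h2 := ENNReal.rpow_le_rpow (h1.trans h) (by positivity : 0 ≤ p / P)
  rw [← ENNReal.rpow_mul, div_mul_div_cancel₀ hp.ne', div_self hP.ne', ENNReal.rpow_one] at h2
  refine h2.trans (le_of_eq ?_)
  have hMP : 0 ≤ M ^ P := Real.rpow_nonneg hM _
  rw [ENNReal.ofReal_rpow_of_nonneg (mul_nonneg hK hMP) (by positivity),
    ENNReal.ofReal_rpow_of_nonneg (by positivity) hp.le]
  congr 1
  rw [Real.mul_rpow hK hMP, Real.mul_rpow (by positivity) hM, ← Real.rpow_mul hM, ← Real.rpow_mul hK]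
  congr 2
  · ring
  · field_simp

/-- Passing from the potentials to the distribution. -/
theorem expectation_iSup_negHolder_le {Ω : Type*} [MeasurableSpace Ω] {μ : Measure Ω}
    [IsProbabilityMeasure μ] {ι : Type*} {f : ι → Ω → PeriodicDistribution} {ε p P K M : ℝ}
    (hp : 0 < p) (hpP : p ≤ P) (hK : 0 ≤ K) (hM : 0 ≤ M) {g h : ι → Ω → ℝ × ℝ → ℝ} {Y Z : Ω → ℝ≥0∞}
    (hY : AEMeasurable Y μ) (hZ : AEMeasurable Z μ)
    (hgY : ∀ i ω, holderSeminorm (1 - 3 / 4 - ε) (g i ω) ^ P ≤ Y ω)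
    (hhZ : ∀ i ω, holderSeminorm (3 / 2 - 3 / 4 - ε) (h i ω) ^ P ≤ Z ω)
    (hYM : ∫⁻ ω, Y ω ∂μ ≤ ENNReal.ofReal (K * M ^ P))
    (hZM : ∫⁻ ω, Z ω ∂μ ≤ ENNReal.ofReal (K * M ^ P))
    (hf : ∀ᵐ ω ∂μ, ∀ i, negHolder (-(3 / 4) - ε) (f i ω) ≤
      holderSeminorm (1 - 3 / 4 - ε) (g i ω) + holderSeminorm (3 / 2 - 3 / 4 - ε) (h i ω)) :
    expectation μ (fun ω => ⨆ i, negHolder (-(3 / 4) - ε) (f i ω) ^ p) ≤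
      ENNReal.ofReal ((2 ^ P * (2 * K)) ^ (1 / P) * M) ^ p := by
  have hP : 0 < P := hp.trans_le hpP
  have hW : AEMeasurable (fun ω => 2 ^ P * (Y ω + Z ω)) μ := (hY.add hZ).const_mul _
  refine (expectation_le_of_le (hW.pow_const (p / P)) ?_).trans
    (lintegral_rpow_div_le hW hp hpP (by positivity) hM ?_)
  · filter_upwards [hf] with ω hω
    refine iSup_le fun i => ?_
    have h1 := add_rpow_le_of_rpow_le hP (hgY i ω) (hhZ i ω)
    have h2 := ENNReal.rpow_le_rpow ((ENNReal.rpow_le_rpow (hω i) hP.le).trans h1)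
      (by positivity : 0 ≤ p / P)
    rwa [← ENNReal.rpow_mul, mul_div_cancel₀ _ hP.ne'] at h2
  · rw [lintegral_const_mul'' (f := fun ω => Y ω + Z ω) _ (hY.add hZ), lintegral_add_left' hY]
    have hMP : 0 ≤ M ^ P := Real.rpow_nonneg hM _
    have e : ENNReal.ofReal (2 ^ P * (2 * K) * M ^ P) =
        2 ^ P * (ENNReal.ofReal (K * M ^ P) + ENNReal.ofReal (K * M ^ P)) := by
      have e2 : (2 : ℝ≥0∞) ^ P = ENNReal.ofReal (2 ^ P) := by
        rw [← ENNReal.ofReal_rpow_of_pos (by norm_num)]; simp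
      rw [e2, ← ENNReal.ofReal_add (by positivity) (by positivity), ← ENNReal.ofReal_mul (by positivity)]
      congr 1
      ring
    rw [e]
    gcongr

/-- All scales up to `1` are compared with scale `1` by the supremum bound. Scale `1` itself is the
difference from the multiplier that vanishes identically. -/
theorem IsPotential.exists_moment_mollMult {b : ℤ × ℤ → ℂ} {s ε : ℝ} (hb : IsPotential b s)
    (hε : 0 < ε) (hε' : ε < 1 / 4) {q : ℕ} (hq : 10 / ε < (2 * q : ℕ)) {φ : 𝓢(ℝ × ℝ, ℝ)}
    (hφ : IsKernel φ) :
    ∃ C : ℝ, 0 < C ∧ ∀ {Ω : Type*} [MeasurableSpace Ω] {μ : Measure Ω} [IsProbabilityMeasure μ]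
      {ξ : Ω → PeriodicDistribution}, IsWhiteNoise μ ξ →
      ∃ Y : Ω → ℝ≥0∞, AEMeasurable Y μ ∧ (∀ ω, ∀ ℓ ∈ Ioc (0 : ℝ) 1,
        holderSeminorm (s - 3 / 4 - ε) (chaosPot b (mollMult φ ℓ) (fourierCoeff (ξ ω))) ^
          ((2 * q : ℕ) : ℝ) ≤ Y ω) ∧ ∫⁻ ω, Y ω ∂μ ≤ ENNReal.ofReal C := by
  obtain ⟨C₁, hC₁0, hC₁⟩ := hb.exists_moment_sup hε hε' hq hφ
  obtain ⟨C₂, hC₂0, hC₂⟩ := hb.exists_moment_diff hε hε' hq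
  obtain ⟨C₃, hC₃1, hC₃, -⟩ := exists_mollMult_bounds hφ
  set P : ℝ := ((2 * q : ℕ) : ℝ) with hPdef
  have hP : 0 < P := lt_trans (by positivity) hq
  refine ⟨2 ^ P * (C₁ + C₂ * (C₃ ^ 2) ^ P), by positivity, ?_⟩
  intro Ω _ μ _ ξ hξ
  obtain ⟨Y, hYm, hY, hYi⟩ := hC₁ hξ one_pos
  obtain ⟨Z, hZm, hZ, hZi⟩ := hC₂ hξ (rapidDecay_mollMult φ one_pos) rapidDecay_zero
    (M := C₃ ^ 2) (by positivity) (fun n m => by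
      rw [mul_zero, sub_zero, abs_mul]
      have h1 := Real.one_le_rpow (one_le_rho n) (by linarith : 0 ≤ ε / 2)
      have h2 := Real.one_le_rpow (one_le_rho m) (by linarith : 0 ≤ ε / 2)
      have h3 : |mollMult φ 1 n| * |mollMult φ 1 m| ≤ C₃ * C₃ :=
        mul_le_mul (hC₃ 1 n) (hC₃ 1 m) (abs_nonneg _) (by linarith)
      nlinarith [sq_nonneg C₃])
  refine ⟨fun ω => 2 ^ P * (Y ω + Z ω), (hYm.add hZm).const_mul _, fun ω ℓ hℓ => ?_, ?_⟩
  · have h1 := add_rpow_le_of_rpow_le hP (hY ω ℓ hℓ 1 ⟨one_pos, le_rfl⟩) (hZ ω)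
    refine le_trans (ENNReal.rpow_le_rpow ?_ hP.le) h1
    refine le_trans (le_of_eq ?_) (holderSeminorm_add_le _ _ _)
    congr 1
    funext x
    rw [chaosPot_zero]
    ring
  · rw [lintegral_const_mul'' (f := fun ω => Y ω + Z ω) _ (hYm.add hZm), lintegral_add_left' hYm]
    have e2 : (2 : ℝ≥0∞) ^ P = ENNReal.ofReal (2 ^ P) := by
      rw [← ENNReal.ofReal_rpow_of_pos (by norm_num)]; simp
    rw [Real.one_rpow, Real.one_rpow, mul_one] at hYi
    rw [e2, ENNReal.ofReal_mul (by positivity), ENNReal.ofReal_add (by positivity) (by positivity)]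
    gcongr

theorem moment_bounds {φ : 𝓢(ℝ × ℝ, ℝ)} (hφ : IsKernel φ) {p ε : ℝ} (hp : 1 ≤ p) (hε : 0 < ε)
    (hε' : ε < 1 / 4) :
    ∃ C : ℝ≥0, ∀ (Ω : Type*) [MeasurableSpace Ω] (μ : Measure Ω) [IsProbabilityMeasure μ]
      (ξ v : Ω → PeriodicDistribution), IsWhiteNoise μ ξ →
      (∀ᵐ ω ∂μ, SolvesLinearized (v ω) (ξ ω)) →
      expectation μ (fun ω => ⨆ ℓ ∈ Ioc (0 : ℝ) 1,
          negHolder (-(3 / 4) - ε) (offline φ (v ω) ℓ) ^ p) ≤ C ∧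
      ∀ ℓ₀ ∈ Ioc (0 : ℝ) 1,
        expectation μ (fun ω => ⨆ ℓ ∈ Ioc (0 : ℝ) ℓ₀, ⨆ ℓ' ∈ Ioc (0 : ℝ) ℓ₀,
          negHolder (-(3 / 4) - ε) (offline φ (v ω) ℓ - offline φ (v ω) ℓ') ^ p) ^ (1 / p)
          ≤ C * ENNReal.ofReal (ℓ₀ ^ (ε / 2)) := by
  have hp0 : 0 < p := by linarith
  -- `P = 2q` must exceed `10/ε` for the embedding and `p` for the passage to lower moments.
  obtain ⟨q, hq⟩ := exists_nat_gt (10 / ε + p)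
  have hq' : (q : ℝ) ≤ (2 * q : ℕ) := by push_cast; linarith [(Nat.cast_nonneg q : (0 : ℝ) ≤ q)]
  have h10 : 0 < 10 / ε := by positivity
  have hq1 : 10 / ε < (2 * q : ℕ) := by linarith
  have hq2 : p ≤ (2 * q : ℕ) := by linarith
  obtain ⟨A₁, hA₁0, hA₁⟩ := isPotential_potX.exists_moment_mollMult hε hε' hq1 hφ
  obtain ⟨A₂, hA₂0, hA₂⟩ := isPotential_potY.exists_moment_mollMult hε hε' hq1 hφ
  obtain ⟨B₁, hB₁0, hB₁⟩ := isPotential_potX.exists_moment_sup hε hε' hq1 hφ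
  obtain ⟨B₂, hB₂0, hB₂⟩ := isPotential_potY.exists_moment_sup hε hε' hq1 hφ
  set P : ℝ := ((2 * q : ℕ) : ℝ) with hPdef
  have hP : 0 < P := h10.trans hq1
  set K := A₁ + A₂ + B₁ + B₂ with hK
  have hK0 : 0 < K := by positivity
  set L := (2 ^ P * (2 * K)) ^ (1 / P) with hL
  have hL0 : 0 ≤ L := by positivity
  have e1 : -(3 / 4) - ε + 1 = 1 - 3 / 4 - ε := by ring
  have e2 : -(3 / 4) - ε + 3 / 2 = 3 / 2 - 3 / 4 - ε := by ring
  -- The first bound is not rooted and needs `L ^ p`; the second is rooted and needs `L`.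
  refine ⟨Real.toNNReal (L ^ p + L), ?_⟩
  intro Ω _ μ _ ξ v hξ hv
  have hLp : ENNReal.ofReal (L ^ p) ≤ (Real.toNNReal (L ^ p + L) : ℝ≥0∞) :=
    ENNReal.ofReal_le_ofReal (by linarith)
  have hLL : ENNReal.ofReal L ≤ (Real.toNNReal (L ^ p + L) : ℝ≥0∞) :=
    ENNReal.ofReal_le_ofReal (by linarith [Real.rpow_nonneg hL0 p])
  constructor
  · obtain ⟨Y, hYm, hY, hYi⟩ := hA₁ hξ
    obtain ⟨Z, hZm, hZ, hZi⟩ := hA₂ hξ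
    have h := expectation_iSup_negHolder_le (μ := μ) (ι := Ioc (0 : ℝ) 1)
      (f := fun i ω => offline φ (v ω) i) (M := 1) hp0 hq2 hK0.le zero_le_one hYm hZm
      (fun i ω => hY ω i i.2) (fun i ω => hZ ω i i.2)
      (hYi.trans (ENNReal.ofReal_le_ofReal (by rw [Real.one_rpow]; linarith)))
      (hZi.trans (ENNReal.ofReal_le_ofReal (by rw [Real.one_rpow]; linarith))) (by
        filter_upwards [hv] with ω hω i
        have := negHolder_le (β := -(3 / 4) - ε) (isPeriodic_chaosPot _ _ _)
          (isPeriodic_chaosPot _ _ _) (hω.isDecomposition_offline hφ i.2.1)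
        rwa [e1, e2] at this)
    simp only [iSup_subtype] at h
    refine h.trans (le_trans (le_of_eq ?_) hLp)
    rw [mul_one, ENNReal.ofReal_rpow_of_nonneg hL0 hp0.le]
  · intro ℓ₀ hℓ₀
    obtain ⟨Y, hYm, hY, hYi⟩ := hB₁ hξ hℓ₀.1
    obtain ⟨Z, hZm, hZ, hZi⟩ := hB₂ hξ hℓ₀.1
    have hr : 0 ≤ ℓ₀ ^ (ε / 2) := Real.rpow_nonneg hℓ₀.1.le _
    have hrP : 0 ≤ (ℓ₀ ^ (ε / 2)) ^ P := Real.rpow_nonneg hr _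
    have h := expectation_iSup_negHolder_le (μ := μ) (ι := Ioc (0 : ℝ) ℓ₀ × Ioc (0 : ℝ) ℓ₀)
      (f := fun i ω => offline φ (v ω) i.1 - offline φ (v ω) i.2) (M := ℓ₀ ^ (ε / 2)) hp0 hq2 hK0.le
      hr hYm hZm
      (fun i ω => hY ω i.1 i.1.2 i.2 i.2.2) (fun i ω => hZ ω i.1 i.1.2 i.2 i.2.2)
      (hYi.trans (ENNReal.ofReal_le_ofReal (mul_le_mul_of_nonneg_right (by linarith) hrP)))
      (hZi.trans (ENNReal.ofReal_le_ofReal (mul_le_mul_of_nonneg_right (by linarith) hrP))) (by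
        filter_upwards [hv] with ω hω i
        have hc := fun ℓ : Ioc (0 : ℝ) ℓ₀ => isPotential_potX.continuous_chaosPot
          (rapidDecay_mollMult φ ℓ.2.1) (polyGrowth_fourierCoeff (ξ ω))
        have hc' := fun ℓ : Ioc (0 : ℝ) ℓ₀ => isPotential_potY.continuous_chaosPot
          (rapidDecay_mollMult φ ℓ.2.1) (polyGrowth_fourierCoeff (ξ ω))
        have := negHolder_le (β := -(3 / 4) - ε)
          ((isPeriodic_chaosPot _ _ _).sub (isPeriodic_chaosPot _ _ _))
          ((isPeriodic_chaosPot _ _ _).sub (isPeriodic_chaosPot _ _ _))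
          ((hω.isDecomposition_offline hφ i.1.2.1).sub (hω.isDecomposition_offline hφ i.2.2.1)
            (hc i.1) (hc' i.1) (hc i.2) (hc' i.2))
        rwa [e1, e2] at this)
    simp only [iSup_prod, iSup_subtype] at h
    refine (ENNReal.rpow_le_rpow h (by positivity)).trans ?_
    rw [← ENNReal.rpow_mul, mul_one_div_cancel hp0.ne', ENNReal.rpow_one, ENNReal.ofReal_mul hL0]
    gcongr

/-! ### Sharp frequency cutoffs -/

/-- The multiplier of the sharp frequency cutoff at the dyadic scale `2^N`. -/
def cutoff (N : ℕ) (n : ℤ × ℤ) : ℝ := if rho n ≤ 2 ^ N then 1 else 0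

theorem rapidDecay_cutoff (N : ℕ) : RapidDecay fun n => (cutoff N n : ℂ) := by
  refine rapidDecay_of_finite ((box (4 ^ N)).finite_toSet.subset fun n hn => ?_)
  have h : rho n ≤ 2 ^ N := by
    by_contra hc
    exact hn (by simp [cutoff, hc])
  have h1 : |(n.1 : ℝ)| ≤ 4 ^ N := by
    have := one_add_abs_fst_le_rho n
    have h2 : (2 : ℝ) ^ N ≤ 4 ^ N := pow_le_pow_left₀ (by norm_num) (by norm_num) N
    linarith
  have h2 : |(n.2 : ℝ)| ≤ 4 ^ N := by
    calc |(n.2 : ℝ)| ≤ rho n ^ (3 / 2 : ℝ) := abs_snd_le_rho n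
      _ ≤ rho n ^ (2 : ℝ) := Real.rpow_le_rpow_of_exponent_le (one_le_rho n) (by norm_num)
      _ = rho n ^ 2 := by norm_cast
      _ ≤ (2 ^ N) ^ 2 := by have := rho_pos n; gcongr
      _ = 4 ^ N := by rw [← pow_mul, mul_comm, pow_mul]; norm_num
  rw [Finset.mem_coe, mem_box]
  exact ⟨by exact_mod_cast h1, by exact_mod_cast h2⟩

theorem cutoff_nonneg (N : ℕ) (n : ℤ × ℤ) : 0 ≤ cutoff N n := by unfold cutoff; split_ifs <;> norm_num

theorem cutoff_le_one (N : ℕ) (n : ℤ × ℤ) : cutoff N n ≤ 1 := by unfold cutoff; split_ifs <;> norm_num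

/-- Beyond the cutoff frequency the error weight is at least one, so there any bounded difference of
multipliers is admissible. -/
theorem one_le_scale_rpow {δ : ℝ} (hδ : 0 ≤ δ) {N : ℕ} {n : ℤ × ℤ} (h : ¬ rho n ≤ 2 ^ N) :
    1 ≤ ((1 / 2 : ℝ) ^ N) ^ δ * rho n ^ δ := by
  rw [← Real.mul_rpow (by positivity) (rho_pos n).le]
  refine Real.one_le_rpow ?_ hδ
  rw [one_div, inv_pow, inv_mul_eq_div, le_div_iff₀ (by positivity), one_mul]
  exact (not_le.1 h).le

theorem abs_cutoff_succ_sub_le {δ : ℝ} (hδ : 0 ≤ δ) (N : ℕ) (n m : ℤ × ℤ) :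
    |cutoff (N + 1) n * cutoff (N + 1) m - cutoff N n * cutoff N m| ≤
      ((1 / 2 : ℝ) ^ N) ^ δ * (rho n ^ δ + rho m ^ δ) := by
  have hn : 0 ≤ rho n ^ δ := Real.rpow_nonneg (rho_pos n).le _
  have hm : 0 ≤ rho m ^ δ := Real.rpow_nonneg (rho_pos m).le _
  have hr : 0 ≤ ((1 / 2 : ℝ) ^ N) ^ δ := by positivity
  have hpow : (2 : ℝ) ^ N ≤ 2 ^ (N + 1) := pow_le_pow_right₀ (by norm_num) (Nat.le_succ N)
  have hle : |cutoff (N + 1) n * cutoff (N + 1) m - cutoff N n * cutoff N m| ≤ 1 := by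
    have b1 := mul_nonneg (cutoff_nonneg (N + 1) n) (cutoff_nonneg (N + 1) m)
    have b2 := mul_nonneg (cutoff_nonneg N n) (cutoff_nonneg N m)
    have b3 := mul_le_one₀ (cutoff_le_one (N + 1) n) (cutoff_nonneg (N + 1) m) (cutoff_le_one (N + 1) m)
    have b4 := mul_le_one₀ (cutoff_le_one N n) (cutoff_nonneg N m) (cutoff_le_one N m)
    rw [abs_le]
    constructor <;> linarith
  by_cases h1 : rho n ≤ 2 ^ N
  · by_cases h2 : rho m ≤ 2 ^ N
    · have e1 : rho n ≤ 2 ^ (N + 1) := h1.trans hpow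
      have e2 : rho m ≤ 2 ^ (N + 1) := h2.trans hpow
      simp only [cutoff, h1, h2, e1, e2, if_true, sub_self, abs_zero]
      positivity
    · have := one_le_scale_rpow hδ h2
      nlinarith [mul_nonneg hr hn]
  · have := one_le_scale_rpow hδ h1
    nlinarith [mul_nonneg hr hm]

/-- Below the cutoff both multipliers are close to or equal to one; above it boundedness suffices.
The product is handled by changing one factor at a time. -/
theorem exists_abs_mollMult_sub_cutoff_le {φ : 𝓢(ℝ × ℝ, ℝ)} (hφ : IsKernel φ) :
    ∃ C : ℝ, 0 < C ∧ ∀ {δ : ℝ}, 0 ≤ δ → δ ≤ 1 → ∀ (N : ℕ) (n m : ℤ × ℤ),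
      |mollMult φ ((1 / 2) ^ N) n * mollMult φ ((1 / 2) ^ N) m - cutoff N n * cutoff N m| ≤
        C * ((1 / 2 : ℝ) ^ N) ^ δ * (rho n ^ δ + rho m ^ δ) := by
  obtain ⟨C, hC1, hC, hCδ⟩ := exists_mollMult_bounds hφ
  refine ⟨C ^ 2, by positivity, fun {δ} hδ hδ1 N n m => ?_⟩
  have hs : (0 : ℝ) < (1 / 2) ^ N := by positivity
  have hdiff : ∀ k, |mollMult φ ((1 / 2) ^ N) k - cutoff N k| ≤
      C * ((1 / 2 : ℝ) ^ N) ^ δ * rho k ^ δ := by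
    intro k
    by_cases h : rho k ≤ 2 ^ N
    · rw [cutoff, if_pos h]
      exact (hCδ hδ hδ1).1 _ hs k
    · rw [cutoff, if_neg h, sub_zero, mul_assoc]
      have h1 := one_le_scale_rpow hδ h
      exact (hC _ k).trans (by nlinarith)
  have hn : 0 ≤ rho n ^ δ := Real.rpow_nonneg (rho_pos n).le _
  have hm : 0 ≤ rho m ^ δ := Real.rpow_nonneg (rho_pos m).le _
  have hr : 0 ≤ ((1 / 2 : ℝ) ^ N) ^ δ := by positivity
  set c := mollMult φ ((1 / 2) ^ N)
  calc |c n * c m - cutoff N n * cutoff N m|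
      = |(c n - cutoff N n) * c m + cutoff N n * (c m - cutoff N m)| := by ring_nf
    _ ≤ |c n - cutoff N n| * |c m| + |cutoff N n| * |c m - cutoff N m| := by
        rw [← abs_mul, ← abs_mul]; exact abs_add_le _ _
    _ ≤ (C * ((1 / 2 : ℝ) ^ N) ^ δ * rho n ^ δ) * C + C * (C * ((1 / 2 : ℝ) ^ N) ^ δ * rho m ^ δ) := by
        refine add_le_add (mul_le_mul (hdiff n) (hC _ m) (abs_nonneg _) (by positivity))
          (mul_le_mul ?_ (hdiff m) (abs_nonneg _) (by positivity))
        rw [abs_of_nonneg (cutoff_nonneg N n)]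
        exact (cutoff_le_one N n).trans hC1
    _ = C ^ 2 * ((1 / 2 : ℝ) ^ N) ^ δ * (rho n ^ δ + rho m ^ δ) := by ring

/-! ### Almost sure summability along dyadic scales -/

/-- Geometrically small moments are almost surely summable. -/
theorem ae_tsum_lt_top {Ω : Type*} [MeasurableSpace Ω] {μ : Measure Ω} [IsProbabilityMeasure μ]
    {T : ℕ → Ω → ℝ≥0∞} {P K r : ℝ} (hP : 1 ≤ P) (hK : 0 ≤ K) (hr : 0 ≤ r) (hr1 : r < 1)
    (h : ∀ N, ∃ Y : Ω → ℝ≥0∞, AEMeasurable Y μ ∧ (∀ ω, T N ω ^ P ≤ Y ω) ∧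
      ∫⁻ ω, Y ω ∂μ ≤ ENNReal.ofReal (K * (r ^ N) ^ P)) : ∀ᵐ ω ∂μ, ∑' N, T N ω < ∞ := by
  choose Y hYm hY hYi using h
  have hP0 : 0 < P := by linarith
  have h1 : ∀ N, ∫⁻ ω, Y N ω ^ (1 / P) ∂μ ≤ ENNReal.ofReal (K ^ (1 / P) * r ^ N) := fun N => by
    simpa using lintegral_rpow_div_le (hYm N) one_pos hP hK (pow_nonneg hr N) (hYi N)
  have h2 : ∫⁻ ω, ∑' N, Y N ω ^ (1 / P) ∂μ ≠ ∞ := by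
    rw [lintegral_tsum fun N => (hYm N).pow_const _]
    have hs : Summable fun N : ℕ => K ^ (1 / P) * r ^ N :=
      (summable_geometric_of_lt_one hr hr1).mul_left _
    refine ne_top_of_le_ne_top ?_ (ENNReal.tsum_le_tsum h1)
    rw [← ENNReal.ofReal_tsum_of_nonneg (fun N => by positivity) hs]
    exact ENNReal.ofReal_ne_top
  have h3 := ae_lt_top' (AEMeasurable.tsum fun N => (hYm N).pow_const _) h2
  filter_upwards [h3] with ω hω
  refine lt_of_le_of_lt (ENNReal.tsum_le_tsum fun N => ?_) hω
  have := ENNReal.rpow_le_rpow (hY N ω) (by positivity : 0 ≤ 1 / P)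
  rwa [← ENNReal.rpow_mul, mul_one_div_cancel hP0.ne', ENNReal.rpow_one] at this

theorem exists_exponent (ε : ℝ) : ∃ q : ℕ, 10 / ε < (2 * q : ℕ) := by
  obtain ⟨q, hq⟩ := exists_nat_gt (10 / ε)
  refine ⟨q, hq.trans_le ?_⟩
  push_cast
  linarith [(Nat.cast_nonneg q : (0 : ℝ) ≤ q)]

theorem half_pow_rpow (ε : ℝ) (N : ℕ) : ((1 / 2 : ℝ) ^ N) ^ (ε / 2) = ((1 / 2 : ℝ) ^ (ε / 2)) ^ N := by
  rw [← Real.rpow_natCast, ← Real.rpow_natCast, ← Real.rpow_mul (by norm_num),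
    ← Real.rpow_mul (by norm_num), mul_comm]

section AlmostSure

variable {Ω : Type*} [MeasurableSpace Ω] {μ : Measure Ω} [IsProbabilityMeasure μ]
  {ξ : Ω → PeriodicDistribution} {b : ℤ × ℤ → ℂ} {s ε : ℝ}

theorem IsPotential.ae_tsum_cutoff (hb : IsPotential b s) (hξ : IsWhiteNoise μ ξ) (hε : 0 < ε)
    (hε' : ε < 1 / 4) : ∀ᵐ ω ∂μ, ∑' N, holderSeminorm (s - 3 / 4 - ε)
      (fun x => chaosPot b (cutoff (N + 1)) (fourierCoeff (ξ ω)) x -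
        chaosPot b (cutoff N) (fourierCoeff (ξ ω)) x) < ∞ := by
  obtain ⟨q, hq⟩ := exists_exponent ε
  obtain ⟨C, hC0, hC⟩ := hb.exists_moment_diff hε hε' hq
  have hP : 1 ≤ ((2 * q : ℕ) : ℝ) := by
    have : 1 ≤ 10 / ε := by rw [le_div_iff₀ hε]; linarith
    linarith
  refine ae_tsum_lt_top (r := (1 / 2) ^ (ε / 2)) hP hC0.le (by positivity)
    (Real.rpow_lt_one (by norm_num) (by norm_num) (by linarith)) fun N => ?_
  rw [← half_pow_rpow]
  exact hC hξ (rapidDecay_cutoff _) (rapidDecay_cutoff _) (by positivity)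
    (abs_cutoff_succ_sub_le (by linarith) N)

/-- Every kernel is tied to the same kernel-free cutoffs. This is the source of the independence of
the limit from the kernel. -/
theorem IsPotential.ae_tsum_mollMult_sub_cutoff (hb : IsPotential b s) (hξ : IsWhiteNoise μ ξ)
    (hε : 0 < ε) (hε' : ε < 1 / 4) {φ : 𝓢(ℝ × ℝ, ℝ)} (hφ : IsKernel φ) :
    ∀ᵐ ω ∂μ, ∑' N, holderSeminorm (s - 3 / 4 - ε)
      (fun x => chaosPot b (mollMult φ ((1 / 2) ^ N)) (fourierCoeff (ξ ω)) x -
        chaosPot b (cutoff N) (fourierCoeff (ξ ω)) x) < ∞ := by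
  obtain ⟨q, hq⟩ := exists_exponent ε
  obtain ⟨C, hC0, hC⟩ := hb.exists_moment_diff hε hε' hq
  obtain ⟨A, hA0, hA⟩ := exists_abs_mollMult_sub_cutoff_le hφ
  have hP : 1 ≤ ((2 * q : ℕ) : ℝ) := by
    have : 1 ≤ 10 / ε := by rw [le_div_iff₀ hε]; linarith
    linarith
  refine ae_tsum_lt_top (r := (1 / 2) ^ (ε / 2)) (K := C * A ^ ((2 * q : ℕ) : ℝ)) hP (by positivity)
    (by positivity) (Real.rpow_lt_one (by norm_num) (by norm_num) (by linarith)) fun N => ?_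
  rw [← half_pow_rpow, mul_assoc, ← Real.mul_rpow hA0.le (by positivity)]
  exact hC hξ (rapidDecay_mollMult φ (by positivity)) (rapidDecay_cutoff _) (by positivity)
    (hA (by linarith) (by linarith) N)

theorem IsPotential.ae_tsum_iSup (hb : IsPotential b s) (hξ : IsWhiteNoise μ ξ)
    (hε : 0 < ε) (hε' : ε < 1 / 4) {φ : 𝓢(ℝ × ℝ, ℝ)} (hφ : IsKernel φ) :
    ∀ᵐ ω ∂μ, ∑' N : ℕ, (⨆ ℓ : Ioc (0 : ℝ) ((1 / 2) ^ N) × Ioc (0 : ℝ) ((1 / 2) ^ N),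
      holderSeminorm (s - 3 / 4 - ε)
      (fun x => chaosPot b (mollMult φ ℓ.1) (fourierCoeff (ξ ω)) x -
        chaosPot b (mollMult φ ℓ.2) (fourierCoeff (ξ ω)) x)) < ∞ := by
  obtain ⟨q, hq⟩ := exists_exponent ε
  obtain ⟨C, hC0, hC⟩ := hb.exists_moment_sup hε hε' hq hφ
  have hP : 1 ≤ ((2 * q : ℕ) : ℝ) := by
    have : 1 ≤ 10 / ε := by rw [le_div_iff₀ hε]; linarith
    linarith
  refine ae_tsum_lt_top (r := (1 / 2) ^ (ε / 2)) hP hC0.le (by positivity)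
    (Real.rpow_lt_one (by norm_num) (by norm_num) (by linarith)) fun N => ?_
  rw [← half_pow_rpow]
  obtain ⟨Y, hYm, hY, hYi⟩ := hC hξ (ℓ₀ := (1 / 2) ^ N) (by positivity)
  refine ⟨Y, hYm, fun ω => ?_, hYi⟩
  rw [← ENNReal.le_rpow_inv_iff (by linarith)]
  refine iSup_le fun ℓ => ?_
  rw [ENNReal.le_rpow_inv_iff (by linarith)]
  exact hY ω ℓ.1 ℓ.1.2 ℓ.2 ℓ.2.2

theorem IsPotential.ae_holderSeminorm_cutoff_zero (hb : IsPotential b s) (hξ : IsWhiteNoise μ ξ)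
    (hε : 0 < ε) (hε' : ε < 1 / 4) : ∀ᵐ ω ∂μ, holderSeminorm (s - 3 / 4 - ε)
      (chaosPot b (cutoff 0) (fourierCoeff (ξ ω))) < ∞ := by
  obtain ⟨q, hq⟩ := exists_exponent ε
  obtain ⟨C, hC0, hC⟩ := hb.exists_moment_diff hε hε' hq
  have hP : 0 < ((2 * q : ℕ) : ℝ) := lt_trans (by positivity) hq
  -- The difference bound is used with the zero multiplier as the second one.
  obtain ⟨Y, hYm, hY, hYi⟩ := hC hξ (rapidDecay_cutoff 0) rapidDecay_zero one_pos (fun n m => by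
    rw [mul_zero, sub_zero, one_mul, abs_of_nonneg (mul_nonneg (cutoff_nonneg _ _) (cutoff_nonneg _ _))]
    have h1 := Real.one_le_rpow (one_le_rho n) (by linarith : 0 ≤ ε / 2)
    have h2 := Real.one_le_rpow (one_le_rho m) (by linarith : 0 ≤ ε / 2)
    have h3 := mul_le_one₀ (cutoff_le_one 0 n) (cutoff_nonneg 0 m) (cutoff_le_one 0 m)
    linarith)
  filter_upwards [ae_lt_top' hYm (ne_top_of_le_ne_top ENNReal.ofReal_ne_top hYi)] with ω hω
  have h := (hY ω).trans_lt hω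
  simp only [chaosPot_zero, sub_zero] at h
  rwa [ENNReal.rpow_lt_top_iff_of_pos hP] at h

end AlmostSure

/-! ### The limiting potential -/

theorem holderSeminorm_sub_comm (α : ℝ) (f g : ℝ × ℝ → ℝ) :
    holderSeminorm α (fun x => f x - g x) = holderSeminorm α (fun x => g x - f x) := by
  unfold holderSeminorm
  refine iSup_congr fun x => iSup_congr fun y => iSup_congr fun _ => ?_
  rw [show f y - g y - (f x - g x) = -(g y - f y - (g x - f x)) by ring, abs_neg]

theorem holderSeminorm_sub_le (α : ℝ) (f g h : ℝ × ℝ → ℝ) :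
    holderSeminorm α (fun x => f x - h x) ≤
      holderSeminorm α (fun x => f x - g x) + holderSeminorm α (fun x => g x - h x) := by
  refine le_trans (le_of_eq ?_) (holderSeminorm_add_le _ _ _)
  congr 1
  funext x
  ring

theorem continuous_of_holderSeminorm {α : ℝ} (hα : 0 < α) {f : ℝ × ℝ → ℝ}
    (hf : holderSeminorm α f < ∞) : Continuous f := by
  refine continuous_iff_continuousAt.2 fun x => ?_
  rw [ContinuousAt, tendsto_iff_edist_tendsto_0]
  have h1 : Continuous fun y => ccDist y x ^ α := by
    unfold ccDist
    refine Continuous.rpow_const ?_ fun _ => Or.inr hα.le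
    refine Continuous.add (by fun_prop) (Continuous.rpow_const (by fun_prop) fun _ => Or.inr (by norm_num))
  have h2 : Tendsto (fun y => ENNReal.ofReal (ccDist y x ^ α) * holderSeminorm α f) (𝓝 x) (𝓝 0) := by
    have h3 := ENNReal.Tendsto.mul_const (b := holderSeminorm α f)
      (ENNReal.tendsto_ofReal (h1.tendsto x)) (Or.inr hf.ne)
    have h4 : ccDist x x ^ α = 0 := by
      unfold ccDist
      simp [hα.ne']
    simpa [h4] using h3
  refine tendsto_of_tendsto_of_tendsto_of_le_of_le tendsto_const_nhds h2 (fun y => zero_le) fun y => ?_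
  dsimp only
  rw [edist_eq_enorm_sub]
  exact enorm_sub_le_holderSeminorm f x y

/-- The pointwise limit of a sequence of functions, normalized to vanish at the origin. -/
def anchoredLim (G : ℕ → ℝ × ℝ → ℝ) (x : ℝ × ℝ) : ℝ := limUnder atTop fun N => G N x - G N 0

theorem isPeriodic_anchoredLim {G : ℕ → ℝ × ℝ → ℝ} (hG : ∀ N, IsPeriodic (G N)) :
    IsPeriodic (anchoredLim G) := fun x => by
  simp only [anchoredLim, fun N => (hG N x).1, fun N => (hG N x).2, and_self]

/-- The seminorm does not see additive constants, so only the increments from the origin are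
guaranteed to converge. -/
theorem tendsto_anchoredLim {α : ℝ} {G : ℕ → ℝ × ℝ → ℝ}
    (hG : ∑' N, holderSeminorm α (fun x => G (N + 1) x - G N x) < ∞) (x : ℝ × ℝ) :
    Tendsto (fun N => G N x - G N 0) atTop (𝓝 (anchoredLim G x)) := by
  refine tendsto_nhds_limUnder (cauchySeq_tendsto_of_complete ?_)
  refine cauchySeq_of_edist_le_of_tsum_ne_top
    (fun N => ENNReal.ofReal (ccDist x 0 ^ α) * holderSeminorm α (fun x => G (N + 1) x - G N x))
    (fun N => ?_) ?_
  · have h := enorm_sub_le_holderSeminorm (α := α) (fun x => G (N + 1) x - G N x) 0 x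
    rw [edist_comm, edist_eq_enorm_sub]
    refine le_trans (le_of_eq ?_) h
    congr 1
    ring
  · rw [ENNReal.tsum_mul_left]
    exact ENNReal.mul_ne_top ENNReal.ofReal_ne_top hG.ne

/-- Telescoping bounds the distance to later members by the tail, and lower semicontinuity transfers
the bound to the limit. -/
theorem holderSeminorm_sub_anchoredLim_le {α : ℝ} {G : ℕ → ℝ × ℝ → ℝ}
    (hG : ∑' N, holderSeminorm α (fun x => G (N + 1) x - G N x) < ∞) (N : ℕ) :
    holderSeminorm α (fun x => G N x - anchoredLim G x) ≤
      ∑' k, holderSeminorm α (fun x => G (k + N + 1) x - G (k + N) x) := by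
  set T := ∑' k, holderSeminorm α (fun x => G (k + N + 1) x - G (k + N) x) with hT
  have hpart : ∀ M, holderSeminorm α (fun x => G N x - G (M + N) x) ≤
      ∑ k ∈ Finset.range M, holderSeminorm α (fun x => G (k + N + 1) x - G (k + N) x) := by
    intro M
    induction M with
    | zero =>
      rw [Finset.sum_range_zero, zero_add]
      refine holderSeminorm_le fun x y => ?_
      simp
    | succ M ih =>
      rw [Finset.sum_range_succ]
      refine (holderSeminorm_sub_le α _ (G (M + N)) _).trans (add_le_add ih ?_)
      rw [holderSeminorm_sub_comm, add_right_comm]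
  have hlim : ∀ x, Tendsto (fun M => G N x - (G (M + N) x - G (M + N) 0)) atTop
      (𝓝 (G N x - anchoredLim G x)) := fun x =>
    ((tendsto_anchoredLim hG x).comp (tendsto_add_atTop_nat N)).const_sub _
  have h := holderSeminorm_rpow_le_liminf (α := α) (P := 1) one_pos hlim (L := fun _ => T) fun M => by
    rw [ENNReal.rpow_one]
    refine le_trans ?_ ((hpart M).trans (ENNReal.sum_le_tsum _))
    refine holderSeminorm_le fun x y => ?_
    have h := enorm_sub_le_holderSeminorm (α := α) (fun x => G N x - G (M + N) x) x y
    refine le_trans (le_of_eq ?_) h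
    congr 1
    ring
  simpa using h

/-! ### The limiting distribution -/

/-- The distribution `∂₁ g + ∂₂ h` exists for continuous `g` and `h`. -/
theorem exists_isDecomposition {g h : ℝ × ℝ → ℝ} (hg : Continuous g) (hh : Continuous h) :
    ∃ F : PeriodicDistribution, IsDecomposition F 0 g h := by
  have i1 : ∀ ζ : TorusTest, IntegrableOn (fun x => g x * pd₁ ζ x) cell := fun ζ =>
    integrableOn_cell (hg.mul (continuous_pd₁_test ζ))
  have i2 : ∀ ζ : TorusTest, IntegrableOn (fun x => h x * pd₂ ζ x) cell := fun ζ =>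
    integrableOn_cell (hh.mul (continuous_pd₂_test ζ))
  have a1 : ∀ (ζ η : TorusTest) x, pd₁ (ζ + η : TorusTest) x = pd₁ ζ x + pd₁ η x := fun ζ η x =>
    ((hasDerivAt_pd₁ ζ x.1 x.2).add (hasDerivAt_pd₁ η x.1 x.2)).deriv
  have a2 : ∀ (ζ η : TorusTest) x, pd₂ (ζ + η : TorusTest) x = pd₂ ζ x + pd₂ η x := fun ζ η x =>
    ((hasDerivAt_pd₂ ζ.2.1 x.1 x.2).add (hasDerivAt_pd₂ η.2.1 x.1 x.2)).deriv
  have s1 : ∀ (c : ℝ) (ζ : TorusTest) x, pd₁ (c • ζ : TorusTest) x = c * pd₁ ζ x := fun c ζ x =>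
    ((hasDerivAt_pd₁ ζ x.1 x.2).const_mul c).deriv
  have s2 : ∀ (c : ℝ) (ζ : TorusTest) x, pd₂ (c • ζ : TorusTest) x = c * pd₂ ζ x := fun c ζ x =>
    ((hasDerivAt_pd₂ ζ.2.1 x.1 x.2).const_mul c).deriv
  let L : TorusTest →ₗ[ℝ] ℝ :=
    { toFun := fun ζ => -(∫ x in cell, g x * pd₁ ζ x) - ∫ x in cell, h x * pd₂ ζ x
      map_add' := fun ζ η => by
        simp only [a1, a2, mul_add]
        rw [integral_add (i1 ζ) (i1 η), integral_add (i2 ζ) (i2 η)]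
        ring
      map_smul' := fun c ζ => by
        simp only [s1, s2, mul_left_comm _ c]
        rw [integral_const_mul, integral_const_mul, RingHom.id_apply, smul_eq_mul]
        ring }
  refine ⟨⟨L, 1, (∫ x in cell, ‖g x‖) + ∫ x in cell, ‖h x‖, fun ζ M hM => ?_⟩, fun ζ => ?_⟩
  · have b1 : ∀ x, |pd₁ ζ x| ≤ M := fun x => hM 1 le_rfl 0 (Nat.zero_le _) x
    have b2 : ∀ x, |pd₂ ζ x| ≤ M := fun x => hM 0 (Nat.zero_le _) 1 le_rfl x
    have c1 : ‖∫ x in cell, g x * pd₁ ζ x‖ ≤ (∫ x in cell, ‖g x‖) * M := by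
      rw [← integral_mul_const]
      refine (norm_integral_le_integral_norm _).trans (integral_mono (i1 ζ).norm
        ((integrableOn_cell hg).norm.mul_const M) fun x => ?_)
      simp only [norm_mul]
      exact mul_le_mul_of_nonneg_left (b1 x) (norm_nonneg _)
    have c2 : ‖∫ x in cell, h x * pd₂ ζ x‖ ≤ (∫ x in cell, ‖h x‖) * M := by
      rw [← integral_mul_const]
      refine (norm_integral_le_integral_norm _).trans (integral_mono (i2 ζ).norm
        ((integrableOn_cell hh).norm.mul_const M) fun x => ?_)
      simp only [norm_mul]
      exact mul_le_mul_of_nonneg_left (b2 x) (norm_nonneg _)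
    change ‖-(∫ x in cell, g x * pd₁ ζ x) - ∫ x in cell, h x * pd₂ ζ x‖ ≤ _
    refine (norm_sub_le _ _).trans ?_
    rw [norm_neg]
    linarith
  · change -(∫ x in cell, g x * pd₁ ζ x) - (∫ x in cell, h x * pd₂ ζ x) = _
    ring

/-- Derivatives of test functions have mean zero, so the normalization of the potentials at the
origin is invisible to the distribution. -/
theorem integral_pd₁_eq_zero (ζ : TorusTest) : ∫ x in cell, pd₁ ζ x = 0 := by
  have h := integral_chr_mul_pd₁ ζ 0
  simp only [chr_zero, one_mul, Prod.fst_zero, Int.cast_zero, mul_zero, zero_mul, neg_zero] at h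
  have h2 : ∫ x in cell, ((pd₁ ζ x : ℝ) : ℂ) = ((∫ x in cell, pd₁ ζ x : ℝ) : ℂ) :=
    integral_ofReal
  rw [h2] at h
  exact_mod_cast h

theorem integral_pd₂_eq_zero (ζ : TorusTest) : ∫ x in cell, pd₂ ζ x = 0 := by
  have h := integral_chr_mul_pd₂ ζ 0
  simp only [chr_zero, one_mul, Prod.snd_zero, Int.cast_zero, mul_zero, zero_mul, neg_zero] at h
  have h2 : ∫ x in cell, ((pd₂ ζ x : ℝ) : ℂ) = ((∫ x in cell, pd₂ ζ x : ℝ) : ℂ) :=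
    integral_ofReal
  rw [h2] at h
  exact_mod_cast h

/-- Since `u` has mean zero, `G N` may be replaced by `G N - G N 0`. This converges uniformly on the
cell, whose points have `ccDist` at most `2` from the origin. -/
theorem tendsto_integral_anchoredLim {α : ℝ} (hα : 0 < α) {G : ℕ → ℝ × ℝ → ℝ}
    (hG : ∑' N, holderSeminorm α (fun x => G (N + 1) x - G N x) < ∞) (hc : ∀ N, Continuous (G N))
    (hc' : Continuous (anchoredLim G)) {u : ℝ × ℝ → ℝ} (hu : Continuous u)
    (hu0 : ∫ x in cell, u x = 0) :
    Tendsto (fun N => ∫ x in cell, G N x * u x) atTop (𝓝 (∫ x in cell, anchoredLim G x * u x)) := by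
  obtain ⟨B, hB⟩ := isCompact_square.exists_bound_of_continuousOn hu.continuousOn
  set T : ℕ → ℝ≥0∞ := fun N => ∑' k, holderSeminorm α (fun x => G (k + N + 1) x - G (k + N) x) with hT
  have hT0 : Tendsto T atTop (𝓝 0) :=
    ENNReal.tendsto_sum_nat_add (fun N => holderSeminorm α (fun x => G (N + 1) x - G N x)) hG.ne
  have hTtop : ∀ N, T N ≠ ∞ := fun N => ne_top_of_le_ne_top hG.ne
    (ENNReal.tsum_comp_le_tsum_of_injective (add_left_injective N)
      fun N => holderSeminorm α (fun x => G (N + 1) x - G N x))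
  have hT0' : Tendsto (fun N => (T N).toReal) atTop (𝓝 0) :=
    (ENNReal.tendsto_toReal ENNReal.zero_ne_top).comp hT0
  have hzero : anchoredLim G 0 = 0 := by
    refine tendsto_nhds_unique (tendsto_anchoredLim hG 0) ?_
    simp
  have hpt : ∀ N, ∀ x ∈ cell, |G N x - G N 0 - anchoredLim G x| ≤ 2 ^ α * (T N).toReal := by
    intro N x hx
    have h1 := enorm_sub_le_holderSeminorm (α := α) (fun x => G N x - anchoredLim G x) 0 x
    have h2 := h1.trans (mul_le_mul_right (holderSeminorm_sub_anchoredLim_le hG N) _)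
    rw [hzero, sub_zero] at h2
    have h3 : ccDist x 0 ≤ 2 := by
      unfold ccDist
      have e1 : |x.1 - (0 : ℝ × ℝ).1| ≤ 1 := by
        rw [Prod.fst_zero, sub_zero, abs_of_nonneg hx.1.1]; exact hx.1.2.le
      have e2 : |x.2 - (0 : ℝ × ℝ).2| ≤ 1 := by
        rw [Prod.snd_zero, sub_zero, abs_of_nonneg hx.2.1]; exact hx.2.2.le
      have e3 := Real.rpow_le_one (abs_nonneg _) e2 (by norm_num : (0 : ℝ) ≤ 2 / 3)
      linarith
    have h4 : ccDist x 0 ^ α ≤ 2 ^ α := Real.rpow_le_rpow (ccDist_nonneg _ _) h3 hα.le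
    have h5 := ENNReal.toReal_mono (ENNReal.mul_ne_top ENNReal.ofReal_ne_top (hTtop N)) h2
    rw [ENNReal.toReal_mul, ENNReal.toReal_ofReal (Real.rpow_nonneg (ccDist_nonneg _ _) _),
      toReal_enorm, Real.norm_eq_abs] at h5
    have h6 : G N x - G N 0 - anchoredLim G x = G N x - anchoredLim G x - G N 0 := by ring
    rw [h6]
    exact h5.trans (mul_le_mul_of_nonneg_right h4 ENNReal.toReal_nonneg)
  rw [tendsto_iff_norm_sub_tendsto_zero]
  refine squeeze_zero (fun N => norm_nonneg _) (g := fun N => 2 ^ α * (T N).toReal * B)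
    (fun N => ?_) (by simpa using (hT0'.const_mul (2 ^ α)).mul_const B)
  have e : (∫ x in cell, G N x * u x) - ∫ x in cell, anchoredLim G x * u x =
      ∫ x in cell, (G N x - G N 0 - anchoredLim G x) * u x := by
    have i1 : IntegrableOn (fun x => G N x * u x) cell := integrableOn_cell ((hc N).mul hu)
    have i2 : IntegrableOn (fun x => G N 0 * u x) cell := integrableOn_cell (continuous_const.mul hu)
    have i3 : IntegrableOn (fun x => anchoredLim G x * u x) cell := integrableOn_cell (hc'.mul hu)
    have e0 : ∫ x in cell, G N 0 * u x = 0 := by rw [integral_const_mul, hu0, mul_zero]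
    have e1 := integral_sub i1 i2
    have e2 := integral_sub (i1.sub i2) i3
    simp only [sub_mul]
    simp only [Pi.sub_apply] at e2
    rw [e2, e1, e0, sub_zero]
  rw [e]
  refine (norm_setIntegral_le_of_norm_le_const (by rw [volume_cell]; exact ENNReal.one_lt_top)
    fun x hx => ?_).trans_eq (by rw [measureReal_def, volume_cell, ENNReal.toReal_one, mul_one])
  rw [norm_mul]
  exact mul_le_mul (hpt N x hx) (hB x (cell_subset_square hx)) (norm_nonneg _) (by positivity)

/-- The limit of the potentials of the quadratic term, as the frequency cutoff is removed. -/
def limitPot (b : ℤ × ℤ → ℂ) (ξ : PeriodicDistribution) : ℝ × ℝ → ℝ :=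
  anchoredLim fun N => chaosPot b (cutoff N) (fourierCoeff ξ)

theorem limitPot_eq (b : ℤ × ℤ → ℂ) (ξ : PeriodicDistribution) :
    limitPot b ξ = anchoredLim fun N => chaosPot b (cutoff N) (fourierCoeff ξ) := rfl

theorem isPeriodic_limitPot (b : ℤ × ℤ → ℂ) (ξ : PeriodicDistribution) :
    IsPeriodic (limitPot b ξ) :=
  isPeriodic_anchoredLim fun _ => isPeriodic_chaosPot _ _ _

open Classical in
/-- The renormalized quadratic term `∂₁ g + ∂₂ h`, with `g`, `h` the limits of the potentials. -/
def limitDist (ξ : PeriodicDistribution) : PeriodicDistribution :=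
  -- The decomposition determines the distribution, so the choice is immaterial. The value `0`
  -- occurs only when no such distribution exists, hence almost surely not for white noise.
  if H : ∃ F : PeriodicDistribution, IsDecomposition F 0 (limitPot potX ξ) (limitPot potY ξ) then
    H.choose else 0

theorem isDecomposition_limitDist {ξ : PeriodicDistribution} (hX : Continuous (limitPot potX ξ))
    (hY : Continuous (limitPot potY ξ)) :
    IsDecomposition (limitDist ξ) 0 (limitPot potX ξ) (limitPot potY ξ) := by
  have H := exists_isDecomposition hX hY
  rw [limitDist, dif_pos H]
  exact H.choose_spec

theorem projTest_projTest (ζ : TorusTest) : projTest (projTest ζ) = projTest ζ := by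
  apply Subtype.ext
  funext x
  have h : avg₁ (projTest ζ : ℝ × ℝ → ℝ) x = 0 := by
    have hc := ζ.2.1.continuous
    have hi : IntervalIntegrable (fun s => (ζ : ℝ × ℝ → ℝ) (s, x.2)) volume 0 1 :=
      (by fun_prop : Continuous fun s => (ζ : ℝ × ℝ → ℝ) (s, x.2)).intervalIntegrable _ _
    simp only [avg₁, projTest_apply]
    rw [intervalIntegral.integral_sub hi intervalIntegrable_const,
      intervalIntegral.integral_const]
    simp
  rw [projTest_apply, h, sub_zero]

theorem proj_proj (f : PeriodicDistribution) : proj (proj f) = proj f := by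
  apply Subtype.ext
  refine LinearMap.ext fun ζ => ?_
  change pair (proj (proj f)) ζ = pair (proj f) ζ
  rw [pair_proj, pair_proj, pair_proj, projTest_projTest]

theorem eq_proj_of_tendsto {f : ℕ → PeriodicDistribution} {F : PeriodicDistribution}
    (hf : ∀ N, f N = proj (f N)) (h : ∀ ζ, Tendsto (fun N => pair (f N) ζ) atTop (𝓝 (pair F ζ))) :
    F = proj F := by
  apply Subtype.ext
  refine LinearMap.ext fun ζ => ?_
  change pair F ζ = pair (proj F) ζ
  refine tendsto_nhds_unique (h ζ) ?_
  rw [pair_proj]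
  refine (h (projTest ζ)).congr fun N => ?_
  rw [← pair_proj, ← hf N]

/-- The distributions of the cutoff series lie in the range of the projection and converge to the
limit on each test function. Being fixed by the projection survives such limits by duality. -/
theorem limitDist_eq_proj {ξ : PeriodicDistribution} {α β : ℝ} (hα : 0 < α) (hβ : 0 < β)
    (hX : ∑' N, holderSeminorm α (fun x => chaosPot potX (cutoff (N + 1)) (fourierCoeff ξ) x -
        chaosPot potX (cutoff N) (fourierCoeff ξ) x) < ∞)
    (hY : ∑' N, holderSeminorm β (fun x => chaosPot potY (cutoff (N + 1)) (fourierCoeff ξ) x -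
        chaosPot potY (cutoff N) (fourierCoeff ξ) x) < ∞)
    (hX' : Continuous (limitPot potX ξ)) (hY' : Continuous (limitPot potY ξ)) :
    limitDist ξ = proj (limitDist ξ) := by
  have ha := polyGrowth_fourierCoeff ξ
  refine eq_proj_of_tendsto (f := fun N => proj (ofFun fun x =>
    (tser (chaosCoeff (cutoff N) (fourierCoeff ξ)) (fun i => i.1 + i.2) x).re))
    (fun N => (proj_proj _).symm) fun ζ => ?_
  rw [isDecomposition_limitDist hX' hY' ζ]
  simp only [fun N => isDecomposition_chaosPot (rapidDecay_cutoff N) ha ζ]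
  rw [limitPot_eq] at hX' hY' ⊢
  rw [limitPot_eq]
  exact (tendsto_const_nhds.sub (tendsto_integral_anchoredLim
      (G := fun N => chaosPot potX (cutoff N) (fourierCoeff ξ)) hα hX
      (fun N => isPotential_potX.continuous_chaosPot (rapidDecay_cutoff N) ha) hX'
      (continuous_pd₁_test ζ) (integral_pd₁_eq_zero ζ))).sub
    (tendsto_integral_anchoredLim (G := fun N => chaosPot potY (cutoff N) (fourierCoeff ξ)) hβ hY
      (fun N => isPotential_potY.continuous_chaosPot (rapidDecay_cutoff N) ha) hY'
      (continuous_pd₂_test ζ) (integral_pd₂_eq_zero ζ))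

/-! ### Almost sure convergence of the mollified nonlinearity -/

section AlmostSure

variable {Ω : Type*} [MeasurableSpace Ω] {μ : Measure Ω} [IsProbabilityMeasure μ]
  {ξ v : Ω → PeriodicDistribution} {b : ℤ × ℤ → ℂ} {s ε : ℝ}

/-- The limit is the zeroth cutoff plus a correction bounded by the summable increments. -/
theorem IsPotential.ae_holderSeminorm_limitPot (hb : IsPotential b s) (hξ : IsWhiteNoise μ ξ)
    (hε : 0 < ε) (hε' : ε < 1 / 4) :
    ∀ᵐ ω ∂μ, holderSeminorm (s - 3 / 4 - ε) (limitPot b (ξ ω)) < ∞ := by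
  filter_upwards [hb.ae_tsum_cutoff hξ hε hε', hb.ae_holderSeminorm_cutoff_zero hξ hε hε']
    with ω h1 h2
  have h3 := holderSeminorm_sub_anchoredLim_le
    (G := fun N => chaosPot b (cutoff N) (fourierCoeff (ξ ω))) h1 0
  rw [← limitPot_eq, holderSeminorm_sub_comm] at h3
  have h4 := holderSeminorm_add_le (s - 3 / 4 - ε)
    (fun x => limitPot b (ξ ω) x - chaosPot b (cutoff 0) (fourierCoeff (ξ ω)) x)
    (chaosPot b (cutoff 0) (fourierCoeff (ξ ω)))
  simp only [sub_add_cancel] at h4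
  refine h4.trans_lt (ENNReal.add_lt_top.2 ⟨h3.trans_lt ?_, h2⟩)
  simpa only [add_zero] using h1

/-- Almost sure convergence of the potentials of the mollified quadratic term. -/
theorem IsPotential.ae_exists_rate (hb : IsPotential b s) (hξ : IsWhiteNoise μ ξ)
    (hε : 0 < ε) (hε' : ε < 1 / 4) {φ : 𝓢(ℝ × ℝ, ℝ)} (hφ : IsKernel φ) :
    ∀ᵐ ω ∂μ, ∃ E : ℕ → ℝ≥0∞, Tendsto E atTop (𝓝 0) ∧ ∀ N, ∀ ℓ ∈ Ioc (0 : ℝ) ((1 / 2) ^ N),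
      (∀ ℓ' ∈ Ioc (0 : ℝ) ((1 / 2) ^ N), holderSeminorm (s - 3 / 4 - ε)
        (fun x => chaosPot b (mollMult φ ℓ) (fourierCoeff (ξ ω)) x -
          chaosPot b (mollMult φ ℓ') (fourierCoeff (ξ ω)) x) ≤ E N) ∧
      holderSeminorm (s - 3 / 4 - ε)
        (fun x => chaosPot b (mollMult φ ℓ) (fourierCoeff (ξ ω)) x - limitPot b (ξ ω) x) ≤ E N := by
  filter_upwards [hb.ae_tsum_cutoff hξ hε hε', hb.ae_tsum_mollMult_sub_cutoff hξ hε hε' hφ,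
    hb.ae_tsum_iSup hξ hε hε' hφ] with ω h1 h2 h3
  have t1 := ENNReal.tendsto_sum_nat_add (fun N => holderSeminorm (s - 3 / 4 - ε)
    (fun x => chaosPot b (cutoff (N + 1)) (fourierCoeff (ξ ω)) x -
      chaosPot b (cutoff N) (fourierCoeff (ξ ω)) x)) h1.ne
  have t2 := ENNReal.tendsto_atTop_zero_of_tsum_ne_top h2.ne
  have t3 := ENNReal.tendsto_atTop_zero_of_tsum_ne_top h3.ne
  -- Three errors: between two scales below `2^(-N)`, between mollification at scale `2^(-N)` and
  -- cutoff `N`, and between cutoff `N` and the limit.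
  have t := (t3.add t2).add t1
  rw [add_zero, add_zero] at t
  have hsup : ∀ N : ℕ, ∀ ℓ ∈ Ioc (0 : ℝ) ((1 / 2) ^ N), ∀ ℓ' ∈ Ioc (0 : ℝ) ((1 / 2) ^ N),
      holderSeminorm (s - 3 / 4 - ε)
        (fun x => chaosPot b (mollMult φ ℓ) (fourierCoeff (ξ ω)) x -
          chaosPot b (mollMult φ ℓ') (fourierCoeff (ξ ω)) x) ≤
      ⨆ ℓ : Ioc (0 : ℝ) ((1 / 2) ^ N) × Ioc (0 : ℝ) ((1 / 2) ^ N), holderSeminorm (s - 3 / 4 - ε)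
        (fun x => chaosPot b (mollMult φ ℓ.1) (fourierCoeff (ξ ω)) x -
          chaosPot b (mollMult φ ℓ.2) (fourierCoeff (ξ ω)) x) := fun N ℓ hℓ ℓ' hℓ' =>
    le_iSup (fun ℓ : Ioc (0 : ℝ) ((1 / 2) ^ N) × Ioc (0 : ℝ) ((1 / 2) ^ N) =>
      holderSeminorm (s - 3 / 4 - ε)
        (fun x => chaosPot b (mollMult φ ℓ.1) (fourierCoeff (ξ ω)) x -
          chaosPot b (mollMult φ ℓ.2) (fourierCoeff (ξ ω)) x)) (⟨ℓ, hℓ⟩, ⟨ℓ', hℓ'⟩)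
  refine ⟨_, t, fun N ℓ hℓ => ⟨fun ℓ' hℓ' => ?_, ?_⟩⟩
  · exact (hsup N ℓ hℓ ℓ' hℓ').trans (le_self_add.trans le_self_add)
  · refine (holderSeminorm_sub_le _ _ (chaosPot b (cutoff N) (fourierCoeff (ξ ω))) _).trans
      (add_le_add ?_ (holderSeminorm_sub_anchoredLim_le
        (G := fun N => chaosPot b (cutoff N) (fourierCoeff (ξ ω))) h1 N))
    exact (holderSeminorm_sub_le _ _
      (chaosPot b (mollMult φ ((1 / 2) ^ N)) (fourierCoeff (ξ ω))) _).trans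
      (add_le_add (hsup N ℓ hℓ _ ⟨by positivity, le_rfl⟩) le_rfl)

theorem ae_limitDist_eq_proj (hξ : IsWhiteNoise μ ξ) :
    ∀ᵐ ω ∂μ, limitDist (ξ ω) = proj (limitDist (ξ ω)) := by
  -- Any admissible `ε` would do, since `limitDist` does not depend on it.
  have h0 : (0 : ℝ) < 1 / 8 := by norm_num
  have h1 : (1 / 8 : ℝ) < 1 / 4 := by norm_num
  filter_upwards [isPotential_potX.ae_tsum_cutoff hξ h0 h1, isPotential_potY.ae_tsum_cutoff hξ h0 h1,
    isPotential_potX.ae_holderSeminorm_limitPot hξ h0 h1,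
    isPotential_potY.ae_holderSeminorm_limitPot hξ h0 h1] with ω hX hY hX' hY'
  exact limitDist_eq_proj (by norm_num) (by norm_num) hX hY
    (continuous_of_holderSeminorm (by norm_num) hX') (continuous_of_holderSeminorm (by norm_num) hY')

/-- Almost sure convergence of the mollified quadratic term. -/
theorem ae_tendsto_offline (hξ : IsWhiteNoise μ ξ) (hv : ∀ᵐ ω ∂μ, SolvesLinearized (v ω) (ξ ω))
    (hε : 0 < ε) (hε' : ε < 1 / 4) {φ : 𝓢(ℝ × ℝ, ℝ)} (hφ : IsKernel φ) : ∀ᵐ ω ∂μ,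
      (∀ δ : ℝ≥0∞, 0 < δ → ∃ ℓ₀ : ℝ, 0 < ℓ₀ ∧ ∀ ℓ ∈ Ioc (0 : ℝ) ℓ₀, ∀ ℓ' ∈ Ioc (0 : ℝ) ℓ₀,
        negHolder (-(3 / 4) - ε) (offline φ (v ω) ℓ - offline φ (v ω) ℓ') ≤ δ) ∧
      negHolder (-(3 / 4) - ε) (limitDist (ξ ω)) < ∞ ∧
      Tendsto (fun ℓ => negHolder (-(3 / 4) - ε) (offline φ (v ω) ℓ - limitDist (ξ ω)))
        (𝓝[>] 0) (𝓝 0) := by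
  have e1 : -(3 / 4) - ε + 1 = 1 - 3 / 4 - ε := by ring
  have e2 : -(3 / 4) - ε + 3 / 2 = 3 / 2 - 3 / 4 - ε := by ring
  filter_upwards [hv, isPotential_potX.ae_holderSeminorm_limitPot hξ hε hε',
    isPotential_potY.ae_holderSeminorm_limitPot hξ hε hε',
    isPotential_potX.ae_exists_rate hξ hε hε' hφ, isPotential_potY.ae_exists_rate hξ hε hε' hφ]
    with ω hω hX hY ⟨E₁, hE₁, hX'⟩ ⟨E₂, hE₂, hY'⟩
  have cX := continuous_of_holderSeminorm (by linarith) hX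
  have cY := continuous_of_holderSeminorm (by linarith) hY
  have hF := isDecomposition_limitDist cX cY
  have ha := polyGrowth_fourierCoeff (ξ ω)
  have dX : ∀ {ℓ : ℝ}, 0 < ℓ → Continuous (chaosPot potX (mollMult φ ℓ) (fourierCoeff (ξ ω))) :=
    fun hℓ => isPotential_potX.continuous_chaosPot (rapidDecay_mollMult φ hℓ) ha
  have dY : ∀ {ℓ : ℝ}, 0 < ℓ → Continuous (chaosPot potY (mollMult φ ℓ) (fourierCoeff (ξ ω))) :=
    fun hℓ => isPotential_potY.continuous_chaosPot (rapidDecay_mollMult φ hℓ) ha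
  have hE : Tendsto (fun N => E₁ N + E₂ N) atTop (𝓝 0) := by simpa using hE₁.add hE₂
  have hsmall : ∀ δ : ℝ≥0∞, 0 < δ → ∃ N, E₁ N + E₂ N ≤ δ := fun δ hδ =>
    ((ENNReal.tendsto_nhds_zero.1 hE) δ hδ).exists
  refine ⟨fun δ hδ => ?_, ?_, ?_⟩
  · obtain ⟨N, hN⟩ := hsmall δ hδ
    refine ⟨(1 / 2) ^ N, by positivity, fun ℓ hℓ ℓ' hℓ' => ?_⟩
    have h := negHolder_le (β := -(3 / 4) - ε)
      ((isPeriodic_chaosPot _ _ _).sub (isPeriodic_chaosPot _ _ _))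
      ((isPeriodic_chaosPot _ _ _).sub (isPeriodic_chaosPot _ _ _))
      ((hω.isDecomposition_offline hφ hℓ.1).sub (hω.isDecomposition_offline hφ hℓ'.1)
        (dX hℓ.1) (dY hℓ.1) (dX hℓ'.1) (dY hℓ'.1))
    rw [e1, e2] at h
    exact (h.trans (add_le_add ((hX' N ℓ hℓ).1 ℓ' hℓ') ((hY' N ℓ hℓ).1 ℓ' hℓ'))).trans hN
  · have h := negHolder_le (β := -(3 / 4) - ε) (isPeriodic_limitPot _ _) (isPeriodic_limitPot _ _) hF
    rw [e1, e2] at h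
    exact h.trans_lt (ENNReal.add_lt_top.2 ⟨hX, hY⟩)
  · refine ENNReal.tendsto_nhds_zero.2 fun δ hδ => ?_
    obtain ⟨N, hN⟩ := hsmall δ hδ
    filter_upwards [Ioc_mem_nhdsGT (show (0 : ℝ) < (1 / 2) ^ N by positivity)] with ℓ hℓ
    have h := negHolder_le (β := -(3 / 4) - ε)
      ((isPeriodic_chaosPot _ _ _).sub (isPeriodic_limitPot _ _))
      ((isPeriodic_chaosPot _ _ _).sub (isPeriodic_limitPot _ _))
      ((hω.isDecomposition_offline hφ hℓ.1).sub hF (dX hℓ.1) (dY hℓ.1) cX cY)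
    rw [e1, e2] at h
    exact (h.trans (add_le_add (hX' N ℓ hℓ).2 (hY' N ℓ hℓ).2)).trans hN

end AlmostSure

end Ripple

end

open MeasureTheory Set Filter Topology
open scoped NNReal ENNReal SchwartzMap

theorem lemma5 :
    -- moment bounds, with a constant depending only on the kernel and on the exponents `p`, `ε`
    (∀ φ : 𝓢(ℝ × ℝ, ℝ), Ripple.IsKernel φ →
      ∀ p ε : ℝ, 1 ≤ p → 0 < ε → ε < 1 / 4 →
      ∃ C : ℝ≥0, ∀ (Ω : Type*) [MeasurableSpace Ω] (μ : Measure Ω) [IsProbabilityMeasure μ]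
        (ξ v : Ω → Ripple.PeriodicDistribution), Ripple.IsWhiteNoise μ ξ →
        (∀ᵐ ω ∂μ, Ripple.SolvesLinearized (v ω) (ξ ω)) →
        Ripple.expectation μ (fun ω => ⨆ ℓ ∈ Ioc (0 : ℝ) 1,
            Ripple.negHolder (-(3 / 4) - ε) (Ripple.offline φ (v ω) ℓ) ^ p) ≤ C ∧
        ∀ ℓ₀ ∈ Ioc (0 : ℝ) 1,
          Ripple.expectation μ (fun ω => ⨆ ℓ ∈ Ioc (0 : ℝ) ℓ₀, ⨆ ℓ' ∈ Ioc (0 : ℝ) ℓ₀,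
            Ripple.negHolder (-(3 / 4) - ε)
              (Ripple.offline φ (v ω) ℓ - Ripple.offline φ (v ω) ℓ') ^ p) ^ (1 / p)
            ≤ C * ENNReal.ofReal (ℓ₀ ^ (ε / 2))) ∧
    -- almost sure convergence, to one and the same limit for all kernels
    (∀ (Ω : Type*) [MeasurableSpace Ω] (μ : Measure Ω) [IsProbabilityMeasure μ]
      (ξ v : Ω → Ripple.PeriodicDistribution), Ripple.IsWhiteNoise μ ξ →
      (∀ᵐ ω ∂μ, Ripple.SolvesLinearized (v ω) (ξ ω)) →
      ∃ F : Ω → Ripple.PeriodicDistribution,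
        (∀ᵐ ω ∂μ, F ω = Ripple.proj (F ω)) ∧
        ∀ φ : 𝓢(ℝ × ℝ, ℝ), Ripple.IsKernel φ → ∀ ε : ℝ, 0 < ε → ε < 1 / 4 → ∀ᵐ ω ∂μ,
          (∀ δ : ℝ≥0∞, 0 < δ → ∃ ℓ₀ : ℝ, 0 < ℓ₀ ∧ ∀ ℓ ∈ Ioc (0 : ℝ) ℓ₀, ∀ ℓ' ∈ Ioc (0 : ℝ) ℓ₀,
            Ripple.negHolder (-(3 / 4) - ε)
              (Ripple.offline φ (v ω) ℓ - Ripple.offline φ (v ω) ℓ') ≤ δ) ∧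
          Ripple.negHolder (-(3 / 4) - ε) (F ω) < ∞ ∧
          Tendsto (fun ℓ => Ripple.negHolder (-(3 / 4) - ε) (Ripple.offline φ (v ω) ℓ - F ω))
            (𝓝[>] 0) (𝓝 0)) :=
  ⟨fun _ hφ _ _ hp hε hε' => Ripple.moment_bounds hφ hp hε hε',
    fun _ _ _ _ ξ _ hξ hv => ⟨fun ω => Ripple.limitDist (ξ ω), Ripple.ae_limitDist_eq_proj hξ,
      fun _ hφ _ hε hε' => Ripple.ae_tendsto_offline hξ hv hε hε' hφ⟩⟩
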